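/- **Setting.** Let $T>0$, $x>0$, $0<\alpha\le 1/2$, and let $W$ be a standard $d$-dimensional Brownian motion on a probability space $(\Omega,\mathcal F,\mathbf P)$ with its augmented filtration $(\mathcal F_t)$. The interest rate $r_t\in\mathbb R$, the stock-appreciation rates $\mu_t\in\mathbb R^d$ and the volatility matrix $\sigma_t\in\mathbb R^{d\times d}$ are deterministic càdlàg functions on $[0,T]$, $\sigma_t$ is non-singular for a.e. $t$, and $\theta_t=\sigma_t^{-1}(\mu_t-r_t\mathbf 1)$ satisfies $\int_0^T|\theta_t|^2dt<\infty$. Put $R_t=\int_0^t r_u\,du$ and $\|\theta\|_t=(\int_0^t|\theta_u|^2du)^{1/2}$. A control $\varsigma=(y,c)$ (where $y_t=\sigma_t'\pi_t$ for the portfolio process $\pi$, and $c\ge 0$ is the consumption rate) governs the wealth process $$dX^\varsigma_t=X^\varsigma_t(r_t+y_t'\theta_t)\,dt-c_t\,dt+X^\varsigma_t y_t'\,dW_t,\qquad X^\varsigma_0=x .$$ $\mathcal V$ is the class of progressively measurable $(y,c)$, with values in $\mathbb R^d\times[0,\infty)$, for which this equation (with a.s. integrable drift and square integrable diffusion coefficient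 along the solution) has a unique strong a.s. positive continuous solution on $[0,T]$. $\mathcal U$ is the class of controls $(y,vX^\varsigma)$ with deterministic $y$, $\int_0^T|y_t|^2dt<\infty$, and deterministic $v\ge0$, $\int_0^Tv_t\,dt<\infty$. For $\gamma\in(0,1)$ let $$J(x,\varsigma)=\mathbf E\Big(\int_0^T c_t^{\gamma}\,dt+(X^\varsigma_T)^\gamma\Big).$$ For $\varsigma\in\mathcal U$ let $\lambda_t=\inf\{\lambda\ge0:\mathbf P(X^\varsigma_t\le\lambda)\ge\alpha\}$ and $\mathrm{VaR}_t(x,\varsigma,\alpha)=xe^{R_t}-\lambda_t$. The VaR-constrained problem with level $\zeta$ is $$\max_{\varsigma\in\mathcal U}J(x,\varsigma)\quad\text{subject to}\quad \sup_{0\le t\le T}\frac{\mathrm{VaR}_t(x,\varsigma,\alpha)}{\zeta xe^{R_t}}\le1,$$ and the unconstrained problem is $\max_{\varsigma\in\mathcal V}J(x,\varsigma)$. Let $q=1/(1-\gamma)$, $\widetilde g_\gamma(t)=\exp\big(\gamma R_t+\frac{q-1}2\|\theta\|_t^2\big)$, $\|f\|_{q,T}=(\int_0^T|f_t|^qdt)^{1/q}$,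 let $z_\alpha$ be the standard normal $\alpha$-quantile, and $$\widetilde\kappa(\gamma)=\frac{\|\widetilde g_\gamma\|_{q,T}^q}{\|\widetilde g_\gamma\|_{q,T}^q+\widetilde g_\gamma^{\,q}(T)},\qquad \widetilde l(\gamma)=\ln(1-\widetilde\kappa(\gamma)),$$ $$l_*(\gamma)=\begin{cases}-q\|\theta\|_T|z_\alpha|+\widetilde l(\gamma), & 0<\gamma\le\frac12,\\[1mm] -q\|\theta\|_T|z_\alpha|+\widetilde l(\gamma)-\frac{q(q-2)}2\|\theta\|_T^2, & \frac12<\gamma<1.\end{cases}$$ **Theorem 3.9.** Let $\gamma\in(0,1)$, assume $r_t\ge0$ for all $t\in[0,T]$ and $$1-e^{l_*(\gamma)}\le\zeta<1 .$$ Then an optimal solution of the VaR-constrained problem is the control $\varsigma^*=(y^*,v^*X^*)$ with $$y^*_t=\frac{\theta_t}{1-\gamma}\quad\Big(y^*_t=\sigma_t'\pi^*_t\ \text{ for a.e. } t,\ \ \pi^*_t=\frac{(\sigma_t\sigma_t')^{-1}(\mu_t-r_t\mathbf 1)}{1-\gamma}\Big),\qquad v^*_t=\frac{\widetilde g_\gamma^{\,q}(t)}{\widetilde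 g_\gamma^{\,q}(T)+\int_t^T\widetilde g_\gamma^{\,q}(s)\,ds},$$ where the optimal wealth process $X^*$ is the solution of $$dX^*_t=X^*_t\Big(r_t-v^*_t+\frac{|\theta_t|^2}{1-\gamma}\Big)dt+X^*_t\frac{\theta_t'}{1-\gamma}\,dW_t,\qquad X^*_0=x .$$ That is, $\varsigma^*\in\mathcal U$, it satisfies the VaR constraint, and it maximises $J(x,\cdot)$ over all controls in $\mathcal U$ satisfying the constraint. Moreover it coincides with the solution of the unconstrained problem: $\varsigma^*\in\mathcal V$, it maximises $J(x,\cdot)$ over $\mathcal V$, and $J(x,\varsigma^*)=x^\gamma\big(\|\widetilde g_\gamma\|_{q,T}^q+\widetilde g_\gamma^{\,q}(T)\big)^{1/q}$. -/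

import Mathlib

open MeasureTheory ProbabilityTheory Filter Topology Set
open scoped NNReal ENNReal Matrix

noncomputable section

namespace VaRConsumption

/-! ### The market -/

/-- Right continuous with left limits on `[0,T]`. -/
def IsCadlagOn {β : Type*} [TopologicalSpace β] (T : ℝ) (f : ℝ → β) : Prop :=
  (∀ t ∈ Ico 0 T, ContinuousWithinAt f (Ioi t) t) ∧
    ∀ t ∈ Ioc 0 T, ∃ l, Tendsto f (𝓝[<] t) (𝓝 l)

/-- The deterministic coefficients of a Black-Scholes market with one bond and `d` stocks:
interest rate `r`, stock-appreciation rates `μ`, volatility matrix `σ`. -/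
structure Market (d : ℕ) where
  r : ℝ → ℝ
  μ : ℝ → EuclideanSpace ℝ (Fin d)
  σ : ℝ → Matrix (Fin d) (Fin d) ℝ

namespace Market

variable {d : ℕ} (m : Market d)

/-- The vector `μ_t - r_t 𝟏`. -/
def excess (t : ℝ) : Fin d → ℝ := fun i => m.μ t i - m.r t

/-- `θ_t = σ_t⁻¹ (μ_t - r_t 𝟏)`. -/
def θ (t : ℝ) : EuclideanSpace ℝ (Fin d) := WithLp.toLp 2 ((m.σ t)⁻¹ *ᵥ m.excess t)

/-- `R_t = ∫₀ᵗ r_u du`. -/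
def R (t : ℝ) : ℝ := ∫ u in (0 : ℝ)..t, m.r u

/-- `‖θ‖_t = (∫₀ᵗ |θ_u|² du)^{1/2}`. -/
def θnorm (t : ℝ) : ℝ := √(∫ u in (0 : ℝ)..t, ‖m.θ u‖ ^ 2)

/-- Standing assumptions on the coefficients over the horizon `[0,T]`: càdlàg coefficients,
volatility matrix non-singular almost everywhere, `θ` square integrable. -/
structure Standing (T : ℝ) : Prop where
  cadlag_r : IsCadlagOn T m.r
  cadlag_μ : IsCadlagOn T m.μ
  cadlag_σ : IsCadlagOn T m.σ
  nonsing : ∀ᵐ t ∂volume.restrict (Icc 0 T), IsUnit (m.σ t).det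
  θ_sq : MemLp m.θ 2 (volume.restrict (Icc 0 T))

end Market

/-! ### Brownian motion, its filtration, and the Itô integral -/

variable {Ω : Type*} [MeasurableSpace Ω] {d : ℕ}

/-- Standard `d`-dimensional Brownian motion: independent real Brownian motions. -/
structure IsBrownianMotion (W : Fin d → ℝ≥0 → Ω → ℝ) (P : Measure Ω) : Prop where
  measurable : ∀ i t, Measurable (W i t)
  brownian : ∀ i, IsBrownianReal (W i) P
  indep : iIndepFun (fun i ω (t : ℝ≥0) => W i t ω) P

/-- The Brownian filtration augmented by the null sets. -/
@[reducible] def brownianFiltration (W : Fin d → ℝ≥0 → Ω → ℝ) (P : Measure Ω) (t : ℝ) : MeasurableSpace Ω :=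
  (⨆ (i : Fin d) (s : ℝ≥0) (_ : (s : ℝ) ≤ t), MeasurableSpace.comap (W i s) inferInstance) ⊔
    MeasurableSpace.generateFrom {A : Set Ω | MeasurableSet A ∧ P A = 0}

/-- Progressive measurability on `[0,T]`: on each `[0,t] × Ω` with `t ≤ T`, the process is
measurable for the product of the Borel sets and `F t`. -/
def IsProgressiveOn {β : Type*} [MeasurableSpace β] (F : ℝ → MeasurableSpace Ω) (T : ℝ)
    (u : ℝ → Ω → β) : Prop :=
  ∀ t ∈ Icc 0 T, Measurable[Subtype.instMeasurableSpace.prod (F t)]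
    fun p : Icc (0 : ℝ) t × Ω => u p.1 p.2

/-- Bounded simple (elementary) `ℝᵈ`-valued integrands on `[0,T]`: on `(t_k, t_{k+1}]`, `k < n`,
the value is the bounded `F t_k`-measurable vector `coef k`. -/
structure SimpleIntegrand (F : ℝ → MeasurableSpace Ω) (T : ℝ) (d : ℕ) where
  n : ℕ
  time : ℕ → ℝ
  time_mono : Monotone time
  time_mem : ∀ k, time k ∈ Icc 0 T
  coef : ℕ → Ω → EuclideanSpace ℝ (Fin d)
  coef_meas : ∀ k, Measurable[F (time k)] (coef k)
  coef_bdd : ∃ C : ℝ, ∀ k ω, ‖coef k ω‖ ≤ C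

namespace SimpleIntegrand

variable {F : ℝ → MeasurableSpace Ω} {T : ℝ}

/-- The value of the simple integrand at time `s`. -/
def eval (S : SimpleIntegrand F T d) (s : ℝ) (ω : Ω) : EuclideanSpace ℝ (Fin d) :=
  ∑ k ∈ Finset.range S.n,
    (Ioc (S.time k) (S.time (k + 1))).indicator (fun _ => S.coef k ω) s

/-- The stochastic integral `∫₀ᵗ S' dW` of a simple integrand. -/
def integral (S : SimpleIntegrand F T d) (W : Fin d → ℝ≥0 → Ω → ℝ) (t : ℝ) (ω : Ω) : ℝ :=
  ∑ k ∈ Finset.range S.n, ∑ i, S.coef k ω i *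
    (W i (min (S.time (k + 1)) t).toNNReal ω - W i (min (S.time k) t).toNNReal ω)

end SimpleIntegrand

/-- `I` is (a version of) the Itô integral process `I_t = ∫₀ᵗ H_s' dW_s`, `0 ≤ t ≤ T`: there are
bounded simple integrands `S n` with `∫₀ᵀ |S n - H|² ds → 0` in probability, whose integrals
converge to `I` uniformly on `[0,T]` in probability. -/
def IsItoIntegral (W : Fin d → ℝ≥0 → Ω → ℝ) (P : Measure Ω) (T : ℝ)
    (H : ℝ → Ω → EuclideanSpace ℝ (Fin d)) (I : ℝ → Ω → ℝ) : Prop :=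
  ∃ S : ℕ → SimpleIntegrand (brownianFiltration W P) T d,
    (∀ ε : ℝ≥0∞, 0 < ε → Tendsto
      (fun n => P {ω | ε ≤ ∫⁻ s in Icc 0 T, ‖(S n).eval s ω - H s ω‖ₑ ^ 2}) atTop (𝓝 0)) ∧
    (∀ ε : ℝ, 0 < ε → Tendsto
      (fun n => P {ω | ∃ t ∈ Icc 0 T, ε ≤ |(S n).integral W t ω - I t ω|}) atTop (𝓝 0))

/-! ### Controlled wealth, control classes, cost -/

/-- An investment control `y` (that is, `y_t = σ_t' π_t` for a portfolio process `π`),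
a consumption rate `c`, and a candidate wealth process `X`. -/
structure Strategy (Ω : Type*) (d : ℕ) where
  y : ℝ → Ω → EuclideanSpace ℝ (Fin d)
  c : ℝ → Ω → ℝ
  X : ℝ → Ω → ℝ

/-- `X` is a strong, a.s. positive and continuous solution on `[0,T]` of
`dX_t = X_t (r_t + y_t' θ_t) dt - c_t dt + X_t y_t' dW_t`, `X_0 = x`. -/
structure IsWealth (m : Market d) (W : Fin d → ℝ≥0 → Ω → ℝ) (P : Measure Ω) (T x : ℝ)
    (y : ℝ → Ω → EuclideanSpace ℝ (Fin d)) (c X : ℝ → Ω → ℝ) : Prop where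
  adapted : ∀ t ∈ Icc 0 T, Measurable[brownianFiltration W P t] (X t)
  cont : ∀ᵐ ω ∂P, ContinuousOn (fun t => X t ω) (Icc 0 T)
  pos : ∀ᵐ ω ∂P, ∀ t ∈ Icc 0 T, 0 < X t ω
  drift_integrable : ∀ᵐ ω ∂P,
    IntegrableOn (fun u => X u ω * (m.r u + inner ℝ (y u ω) (m.θ u)) - c u ω) (Icc 0 T)
  diffusion_sq : ∀ᵐ ω ∂P, MemLp (fun u => X u ω • y u ω) 2 (volume.restrict (Icc 0 T))
  sde : ∃ I : ℝ → Ω → ℝ, IsItoIntegral W P T (fun u ω => X u ω • y u ω) I ∧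
    ∀ᵐ ω ∂P, ∀ t ∈ Icc 0 T,
      X t ω = x + (∫ u in (0 : ℝ)..t,
        (X u ω * (m.r u + inner ℝ (y u ω) (m.θ u)) - c u ω)) + I t ω

/-- The class `𝒰`: `y` is a deterministic square integrable function and `c_t = v_t X_t` with a
deterministic nonnegative integrable function `v`, where `X` is the wealth process. -/
def classU (m : Market d) (W : Fin d → ℝ≥0 → Ω → ℝ) (P : Measure Ω) (T x : ℝ) :
    Set (Strategy Ω d) :=
  {s | ∃ (y : ℝ → EuclideanSpace ℝ (Fin d)) (v : ℝ → ℝ),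
    MemLp y 2 (volume.restrict (Icc 0 T)) ∧
    (∀ t ∈ Icc 0 T, 0 ≤ v t) ∧ IntegrableOn v (Icc 0 T) ∧
    s.y = (fun t _ => y t) ∧ s.c = (fun t ω => v t * s.X t ω) ∧
    IsWealth m W P T x s.y s.c s.X}

/-- The class `𝒱` of admissible controls: progressively measurable `(y,c)` with `c ≥ 0` for which
the wealth equation has a unique strong a.s. positive continuous solution, namely `X`. -/
def classV (m : Market d) (W : Fin d → ℝ≥0 → Ω → ℝ) (P : Measure Ω) (T x : ℝ) :
    Set (Strategy Ω d) :=
  {s | IsProgressiveOn (brownianFiltration W P) T s.y ∧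
    IsProgressiveOn (brownianFiltration W P) T s.c ∧
    (∀ᵐ ω ∂P, ∀ t ∈ Icc 0 T, 0 ≤ s.c t ω) ∧
    IsWealth m W P T x s.y s.c s.X ∧
    ∀ X', IsWealth m W P T x s.y s.c X' → ∀ᵐ ω ∂P, ∀ t ∈ Icc 0 T, X' t ω = s.X t ω}

/-- The cost function `E (∫₀ᵀ c_t^γ₁ dt + X_T^γ₂)`, the expectation of a nonnegative quantity. -/
def cost (P : Measure Ω) (T γ₁ γ₂ : ℝ) (s : Strategy Ω d) : ℝ≥0∞ :=
  ∫⁻ ω, ((∫⁻ t in Icc 0 T, ENNReal.ofReal (s.c t ω ^ γ₁)) + ENNReal.ofReal (s.X T ω ^ γ₂)) ∂P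

/-! ### Value-at-Risk -/

/-- `inf {l ≥ 0 : P(Y ≤ l) ≥ α}`. -/
def quantile (P : Measure Ω) (Y : Ω → ℝ) (α : ℝ) : ℝ :=
  sInf {l : ℝ | 0 ≤ l ∧ α ≤ P.real {ω | Y ω ≤ l}}

/-- `VaR_t = x e^{R_t} - λ_t`, with `λ_t` the `α`-quantile of the wealth at time `t`. -/
def VaR (m : Market d) (P : Measure Ω) (x α : ℝ) (s : Strategy Ω d) (t : ℝ) : ℝ :=
  x * Real.exp (m.R t) - quantile P (s.X t) α

/-- The risk constraint `sup_{0 ≤ t ≤ T} VaR_t / (ζ x e^{R_t}) ≤ 1`. -/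
def VaRBounded (m : Market d) (P : Measure Ω) (T x α ζ : ℝ) (s : Strategy Ω d) : Prop :=
  ∀ t ∈ Icc 0 T, VaR m P x α s t / (ζ * x * Real.exp (m.R t)) ≤ 1

/-- The `α`-quantile `z_α` of the standard normal distribution. -/
def normalQuantile (α : ℝ) : ℝ := sInf {z : ℝ | α ≤ cdf (gaussianReal 0 1) z}

/-! ### The candidate optimal strategy and the bound on the risk level -/

/-- `q = 1/(1-γ)`. -/
def qexp (γ : ℝ) : ℝ := 1 / (1 - γ)

/-- `g̃_γ(t) = exp (γ R_t + (q-1)/2 ‖θ‖_t²)`. -/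
def gTilde (m : Market d) (γ t : ℝ) : ℝ :=
  Real.exp (γ * m.R t + (qexp γ - 1) / 2 * m.θnorm t ^ 2)

/-- `‖f‖_{q,T} = (∫₀ᵀ |f_t|^q dt)^{1/q}`. -/
def qNorm (q T : ℝ) (f : ℝ → ℝ) : ℝ := (∫ t in (0 : ℝ)..T, |f t| ^ q) ^ (1 / q)

/-- `y*_t = θ_t / (1-γ)`. -/
def yStar (m : Market d) (γ t : ℝ) : EuclideanSpace ℝ (Fin d) := (1 / (1 - γ)) • m.θ t

/-- `π*_t = (σ_t σ_t')⁻¹ (μ_t - r_t 𝟏) / (1-γ)`. -/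
def piStar (m : Market d) (γ t : ℝ) : Fin d → ℝ :=
  (1 / (1 - γ)) • ((m.σ t * (m.σ t)ᵀ)⁻¹ *ᵥ m.excess t)

/-- `v*_t = g̃_γ(t)^q / (g̃_γ(T)^q + ∫_t^T g̃_γ(s)^q ds)`. -/
def vStar (m : Market d) (T γ t : ℝ) : ℝ :=
  gTilde m γ t ^ qexp γ /
    (gTilde m γ T ^ qexp γ + ∫ s in t..T, gTilde m γ s ^ qexp γ)

/-- `κ̃(γ) = ‖g̃_γ‖_{q,T}^q / (‖g̃_γ‖_{q,T}^q + g̃_γ(T)^q)`. -/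
def kappaTilde (m : Market d) (T γ : ℝ) : ℝ :=
  qNorm (qexp γ) T (gTilde m γ) ^ qexp γ /
    (qNorm (qexp γ) T (gTilde m γ) ^ qexp γ + gTilde m γ T ^ qexp γ)

/-- The function `l_*(γ)`, where `l̃(γ) = ln (1 - κ̃(γ))`. -/
def lStar (m : Market d) (T α γ : ℝ) : ℝ :=
  if γ ≤ 1 / 2 then
    -(qexp γ) * m.θnorm T * |normalQuantile α| + Real.log (1 - kappaTilde m T γ)
  else
    -(qexp γ) * m.θnorm T * |normalQuantile α| + Real.log (1 - kappaTilde m T γ)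
      - qexp γ * (qexp γ - 2) / 2 * m.θnorm T ^ 2

end VaRConsumption

end

open MeasureTheory ProbabilityTheory Filter Topology Set
open scoped NNReal ENNReal Matrix

set_option linter.unusedSectionVars false

noncomputable section

namespace VaRConsumption

variable {Ω : Type*} [mΩ : MeasurableSpace Ω] {d : ℕ}

/-! The optimality is convex duality and does not see the risk constraint. Let `H_t = e^{-R_t} Z_t`
be the state price density, with `Z_t = exp(-∫₀ᵗ θ'dW - ½‖θ‖_t²)`. Under the measure with density
`Z_T`, the process `W + ∫θ` is a Brownian motion, and discounted wealth plus accumulated discounted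
consumption is a nonnegative local martingale, hence a supermartingale. This is the budget
inequality `E(∫ H_t c_t dt + H_T X_T) ≤ x` (`isLevy_girsanovMeasure`, `lintegral_discount_le`,
`IsWealth.budget`, `IsWealth.lintegral_statePrice_le`). Young's inequality `c^γ ≤ γ(l H c) + (1-γ)(l
H)^{-γ/(1-γ)}`, together with the lognormal moment `E H_t^{-γ/(1-γ)} = g̃(t)^q` and the best
constant `l`, bounds the cost of every admissible control by `x^γ G^{1-γ}`, where `G = g̃(T)^q + ∫₀ᵀ
g̃^q` (`cost_le`).

The candidate attains this bound. Its wealth is lognormal, and `v*` is minus the logarithmic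
derivative of `g̃(T)^q + ∫_t^T g̃^q`, so all moments are explicit (`cost_wealthStar`). For the
constrained problem only feasibility remains: `ln(X*_t / (x e^{R_t}))` is Gaussian with mean `-∫₀ᵗ
v* - q(q-2)/2 ‖θ‖_t²` and standard deviation `q‖θ‖_t`, and the worst case over `t` of its
`α`-quantile is at least `l_*(γ)` (`Market.Standing.lStar_sub_le`, `vaRBounded_wealthStar`).

The stochastic calculus is needed mostly for deterministic integrands, where everything is Gaussian.
Wiener integrals are limits of grid sums, made uniform in time by Doob's inequality and
Borel-Cantelli (`exists_isWiener`). Itô's formula for the wealth is replaced by an exact isometry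
for the stochastic exponential (`integral_densityProc_sub_sint_sq`) and a pathwise integration by
parts (`discount`). General portfolios enter only through their approximating simple integrands;
truncating the quadratic variation of these (`SimpleIntegrand.stopped`) plays the role of stopping
times, both for the supermartingale property and for pathwise uniqueness (`ae_eq_zero_of_linear`).
-/

/-! ### The augmented Brownian filtration -/

section Filtration

variable {W : Fin d → ℝ≥0 → Ω → ℝ} {P : Measure Ω}

/-- The σ-algebra generated by a Brownian motion up to time `t`, before augmentation. -/
@[reducible] def rawFiltration (W : Fin d → ℝ≥0 → Ω → ℝ) (t : ℝ) : MeasurableSpace Ω :=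
  ⨆ (i : Fin d) (s : ℝ≥0) (_ : (s : ℝ) ≤ t), MeasurableSpace.comap (W i s) inferInstance

lemma IsBrownianMotion.brownianFiltration_le (hW : IsBrownianMotion W P) (t : ℝ) :
    brownianFiltration W P t ≤ mΩ := by
  refine sup_le (iSup_le fun i => iSup_le fun s => iSup_le fun _ => (hW.measurable i s).comap_le) ?_
  exact MeasurableSpace.generateFrom_le fun A hA => hA.1

lemma brownianFiltration_mono : Monotone (brownianFiltration W P) := by
  intro s t hst
  refine sup_le_sup_right ?_ _
  exact iSup_mono fun i => iSup_mono fun u => iSup_le fun hu => le_iSup_of_le (hu.trans hst) le_rfl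

lemma measurableSet_brownianFiltration_of_null {A : Set Ω} (hA : MeasurableSet A) (h0 : P A = 0)
    (t : ℝ) : MeasurableSet[brownianFiltration W P t] A :=
  (le_sup_right : MeasurableSpace.generateFrom _ ≤ brownianFiltration W P t) _
    (MeasurableSpace.measurableSet_generateFrom ⟨hA, h0⟩)

lemma measurableSet_brownianFiltration_of_full {A : Set Ω} (hA : MeasurableSet A) (h0 : P Aᶜ = 0)
    (t : ℝ) : MeasurableSet[brownianFiltration W P t] A := by
  have := (measurableSet_brownianFiltration_of_null (W := W) hA.compl h0 t).compl
  rwa [compl_compl] at this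

lemma measurable_brownianFiltration (i : Fin d) {s : ℝ≥0} {t : ℝ} (h : (s : ℝ) ≤ t) :
    Measurable[brownianFiltration W P t] (W i s) := by
  have : MeasurableSpace.comap (W i s) inferInstance ≤ brownianFiltration W P t :=
    by
    refine le_trans ?_ le_sup_left
    refine le_iSup_of_le i (le_iSup_of_le s ?_)
    exact le_iSup (fun _ : (s : ℝ) ≤ t => MeasurableSpace.comap (W i s) inferInstance) h
  exact fun A hA => this _ ⟨A, hA, rfl⟩

/-- An augmented event agrees almost surely with a raw event. -/
lemma exists_ae_eq_of_measurableSet_brownianFiltration {t : ℝ} {A : Set Ω}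
    (hA : MeasurableSet[brownianFiltration W P t] A) :
    ∃ B, MeasurableSet[rawFiltration W t] B ∧ A =ᵐ[P] B := by
  -- The sets that agree a.e. with a raw event form a σ-algebra. It contains the raw events and the
  -- null sets, hence their join.
  have : brownianFiltration W P t ≤ eventuallyMeasurableSpace (rawFiltration W t) (ae P) := by
    refine sup_le le_eventuallyMeasurableSpace (MeasurableSpace.generateFrom_le ?_)
    intro N hN
    refine ⟨∅, @MeasurableSet.empty _ (rawFiltration W t), ?_⟩
    exact ae_eq_empty.2 hN.2
  exact this _ hA

/-- This lifts the independence of past and increment from single coordinates to the whole vector.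
Each join is generated by the π-system of intersections `⋂ i, f i`; on two such sets the probability
factors over `i` by `hm`, and then inside each `i` by `hab`. -/
lemma indep_iSup_iSup {ι : Type*} [Fintype ι] {m a b : ι → MeasurableSpace Ω} {P : Measure Ω}
    [IsProbabilityMeasure P]
    (hle : ∀ i, m i ≤ mΩ) (hm : iIndep m P) (ha : ∀ i, a i ≤ m i) (hb : ∀ i, b i ≤ m i)
    (hab : ∀ i, Indep (a i) (b i) P) : Indep (⨆ i, a i) (⨆ i, b i) P := by
  classical
  have key : ∀ (c : ι → MeasurableSpace Ω) (s : Set Ω),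
      s ∈ piiUnionInter (fun i => {s | MeasurableSet[c i] s}) univ →
      ∃ f : ι → Set Ω, (∀ i, MeasurableSet[c i] (f i)) ∧ s = ⋂ i, f i := by
    rintro c s ⟨t, -, f, hf, rfl⟩
    refine ⟨fun i => if i ∈ t then f i else univ, fun i => ?_, ?_⟩
    · by_cases hi : i ∈ t
      · simpa [hi] using hf i hi
      · simp [hi]
    · ext ω
      simp only [mem_iInter]
      refine forall_congr' fun i => ?_
      by_cases hi : i ∈ t <;> simp [hi]
  have hA : (⨆ i, a i) = MeasurableSpace.generateFrom
      (piiUnionInter (fun i => {s | MeasurableSet[a i] s}) univ) := by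
    have := (generateFrom_piiUnionInter_measurableSet a univ).symm
    simpa using this
  have hB : (⨆ i, b i) = MeasurableSpace.generateFrom
      (piiUnionInter (fun i => {s | MeasurableSet[b i] s}) univ) := by
    have := (generateFrom_piiUnionInter_measurableSet b univ).symm
    simpa using this
  refine IndepSets.indep (iSup_le fun i => (ha i).trans (hle i))
    (iSup_le fun i => (hb i).trans (hle i))
    (isPiSystem_piiUnionInter _ (fun n => @MeasurableSpace.isPiSystem_measurableSet Ω (a n)) _)
    (isPiSystem_piiUnionInter _ (fun n => @MeasurableSpace.isPiSystem_measurableSet Ω (b n)) _)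
    hA hB ?_
  rw [IndepSets_iff]
  intro s t hs ht
  obtain ⟨f, hf, rfl⟩ := key a s hs
  obtain ⟨g, hg, rfl⟩ := key b t ht
  rw [← iInter_inter_distrib]
  have h1 := hm.meas_iInter (s := fun i => f i ∩ g i)
    (fun i => (ha i _ (hf i)).inter (hb i _ (hg i)))
  have h2 := hm.meas_iInter (s := f) (fun i => ha i _ (hf i))
  have h3 := hm.meas_iInter (s := g) (fun i => hb i _ (hg i))
  rw [h1, h2, h3, ← Finset.prod_mul_distrib]
  exact Finset.prod_congr rfl fun i _ => (Indep_iff _ _ _).1 (hab i) _ _ (hf i) (hg i)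

/-- The value of the `d`-dimensional Brownian motion at a real time. -/
def vecBM (W : Fin d → ℝ≥0 → Ω → ℝ) (t : ℝ) (ω : Ω) : EuclideanSpace ℝ (Fin d) :=
  WithLp.toLp 2 fun i => W i t.toNNReal ω

lemma measurable_vecBM {s t : ℝ} (h : s ≤ t) (ht : 0 ≤ t) :
    Measurable[brownianFiltration W P t] (vecBM W s) := by
  refine (MeasurableEquiv.toLp 2 (Fin d → ℝ)).measurable.comp ?_
  refine @measurable_pi_lambda _ _ _ (brownianFiltration W P t) _ _ fun i => ?_
  refine measurable_brownianFiltration i ?_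
  simp [Real.coe_toNNReal', h, ht]

/-- The future increments of Brownian motion are independent of the raw past. -/
lemma IsBrownianMotion.indep_raw [IsProbabilityMeasure P] (hW : IsBrownianMotion W P) {s t : ℝ}
    (hs : 0 ≤ s) (hst : s ≤ t) :
    Indep (rawFiltration W s) (⨆ i, MeasurableSpace.comap
      (fun ω => W i t.toNNReal ω - W i s.toNNReal ω) inferInstance) P := by
  have hmeas : ∀ i, Measurable (fun ω (t : ℝ≥0) => W i t ω) := fun i =>
    measurable_pi_lambda _ fun t => hW.measurable i t
  refine indep_iSup_iSup (m := fun i => MeasurableSpace.comap (fun ω (t : ℝ≥0) => W i t ω)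
    inferInstance) (fun i => (hmeas i).comap_le) hW.indep.iIndep ?_ ?_ ?_
  · intro i
    refine iSup_le fun u => iSup_le fun _ => ?_
    rintro _ ⟨B, hB, rfl⟩
    exact ⟨(fun f : ℝ≥0 → ℝ => f u) ⁻¹' B, measurable_pi_apply u hB, rfl⟩
  · rintro i _ ⟨B, hB, rfl⟩
    have h : Measurable fun f : ℝ≥0 → ℝ => f t.toNNReal - f s.toNNReal := by fun_prop
    exact ⟨_, h hB, rfl⟩
  · intro i
    -- Markov property of one coordinate: the path of `W i (s + ·) - W i s` is independent of the
    -- path up to `s`. Only its value at `t - s` is used.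
    have h := ((hW.brownian i).toIsPreBrownianReal.indepFun_shift s.toNNReal).symm
    rw [IndepFun_iff_Indep] at h
    refine indep_of_indep_of_le_left (indep_of_indep_of_le_right h ?_) ?_
    · rintro _ ⟨B, hB, rfl⟩
      refine ⟨(fun f : ℝ≥0 → ℝ => f (t.toNNReal - s.toNNReal)) ⁻¹' B,
        measurable_pi_apply _ hB, ?_⟩
      ext ω
      simp only [mem_preimage]
      rw [add_tsub_cancel_of_le (Real.toNNReal_le_toNNReal hst)]
    · refine iSup_le fun u => iSup_le fun hu => ?_
      have hu' : u ≤ s.toNNReal := by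
        rw [← NNReal.coe_le_coe, Real.coe_toNNReal _ hs]; exact hu
      rintro _ ⟨B, hB, rfl⟩
      exact ⟨(fun f : Iic s.toNNReal → ℝ => f ⟨u, hu'⟩) ⁻¹' B, measurable_pi_apply _ hB, rfl⟩

/-- The future increments of Brownian motion are independent of the augmented past. -/
lemma IsBrownianMotion.indep_increment [IsProbabilityMeasure P] (hW : IsBrownianMotion W P)
    {s t : ℝ} (hs : 0 ≤ s) (hst : s ≤ t) :
    Indep (brownianFiltration W P s) (⨆ i, MeasurableSpace.comap
      (fun ω => W i t.toNNReal ω - W i s.toNNReal ω) inferInstance) P := by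
  rw [Indep_iff]
  intro A B hA hB
  obtain ⟨A', hA', hAA'⟩ := exists_ae_eq_of_measurableSet_brownianFiltration hA
  have h := (Indep_iff _ _ _).1 (hW.indep_raw hs hst) A' B hA' hB
  rw [measure_congr hAA', measure_congr (hAA'.inter (ae_eq_refl B)), h]

end Filtration

/-! ### Gaussian increments with respect to a filtration -/

/-- `N` is known at time `t`, independent of the past at time `s`, and centred Gaussian with
variance `v`. -/
structure IsGaussInc (F : ℝ → MeasurableSpace Ω) (P : Measure Ω) (s t : ℝ) (N : Ω → ℝ) (v : ℝ) :
    Prop where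
  meas : Measurable[F t] N
  indep : Indep (F s) (MeasurableSpace.comap N inferInstance) P
  law : P.map N = gaussianReal 0 v.toNNReal

section GaussInc

variable {F : ℝ → MeasurableSpace Ω} {P : Measure Ω} [IsProbabilityMeasure P]

/-- The hypothesis says that the unnormalised law of `N` on each past event is the same Gaussian up
to mass. It encodes the law (take the whole space) and the independence at once, as an equality of
finite measures, which transforms can decide. -/
lemma isGaussInc_of_map_restrict (hF : ∀ t, F t ≤ mΩ) {s t v : ℝ} {N : Ω → ℝ}
    (hN : Measurable[F t] N)
    (h : ∀ A, MeasurableSet[F s] A → (P.restrict A).map N = P A • gaussianReal 0 v.toNNReal) :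
    IsGaussInc F P s t N v := by
  have hN' : Measurable N := hN.mono (hF t) le_rfl
  have hlaw : P.map N = gaussianReal 0 v.toNNReal := by
    simpa using h univ (@MeasurableSet.univ _ (F s))
  refine ⟨hN, ?_, hlaw⟩
  rw [Indep_iff]
  rintro A _ hA ⟨B, hB, rfl⟩
  have h1 := congrArg (fun μ => μ B) (h A hA)
  simp only [Measure.smul_apply, smul_eq_mul] at h1
  rw [Measure.map_apply hN' hB, Measure.restrict_apply (hN' hB), inter_comm, ← hlaw,
    Measure.map_apply hN' hB] at h1
  exact h1

/-- Characteristic functions determine finite measures, so the criterion above may be tested on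
Fourier transforms over each past event. -/
lemma isGaussInc_of_charFun (hF : ∀ t, F t ≤ mΩ) {s t v : ℝ} (hv : 0 ≤ v) {N : Ω → ℝ}
    (hN : Measurable[F t] N)
    (h : ∀ A, MeasurableSet[F s] A → ∀ l : ℝ, ∫ ω in A, Complex.exp (l * N ω * Complex.I) ∂P =
      P.real A • Complex.exp (-(v * l ^ 2 / 2))) :
    IsGaussInc F P s t N v := by
  have hN' : Measurable N := hN.mono (hF t) le_rfl
  refine isGaussInc_of_map_restrict hF hN fun A hA => ?_
  have hfin : IsFiniteMeasure (P A • gaussianReal 0 v.toNNReal) :=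
    Measure.smul_finite _ (measure_ne_top P A)
  refine Measure.ext_of_charFun ?_
  funext l
  rw [charFun_apply_real, integral_map hN'.aemeasurable (by fun_prop)]
  rw [h A hA l]
  rw [charFun_apply_real, integral_smul_measure, ← charFun_apply_real, charFun_gaussianReal]
  simp [Real.coe_toNNReal _ hv, Measure.real]

namespace IsGaussInc

variable {s t r v v' : ℝ} {N N' : Ω → ℝ}

lemma measurable (h : IsGaussInc F P s t N v) (hF : ∀ t, F t ≤ mΩ) : Measurable N :=
  h.meas.mono (hF t) le_rfl

lemma setIntegral_charFun (h : IsGaussInc F P s t N v) (hF : ∀ t, F t ≤ mΩ) (hv : 0 ≤ v)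
    {A : Set Ω} (hA : MeasurableSet[F s] A) (l : ℝ) :
    ∫ ω in A, Complex.exp (l * N ω * Complex.I) ∂P =
      P.real A • Complex.exp (-(v * l ^ 2 / 2)) := by
  rw [Indep.setIntegral_eq_smul (f := fun x : ℝ => Complex.exp (l * x * Complex.I)) (hF s) h.indep
    (h.measurable hF).aemeasurable hA (by fun_prop)]
  congr 1
  rw [← integral_map (f := fun x : ℝ => Complex.exp (l * x * Complex.I))
    (h.measurable hF).aemeasurable (by fun_prop), h.law, ← charFun_apply_real, charFun_gaussianReal]
  simp [Real.coe_toNNReal _ hv]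

/-- Functions of the past and of a Gaussian increment integrate independently. -/
lemma integral_mul (h : IsGaussInc F P s t N v) (hF : ∀ t, F t ≤ mΩ) {𝕜 : Type*} [RCLike 𝕜]
    {f : Ω → 𝕜} (hf : Measurable[F s] f) {g : ℝ → 𝕜} (hg : Measurable g) :
    ∫ ω, f ω * g (N ω) ∂P = (∫ ω, f ω ∂P) * ∫ x, g x ∂(gaussianReal 0 v.toNNReal) := by
  have hN := h.measurable hF
  have hf' : Measurable f := hf.mono (hF s) le_rfl
  have hi : IndepFun f (fun ω => g (N ω)) P := by
    rw [IndepFun_iff_Indep]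
    refine indep_of_indep_of_le_left (indep_of_indep_of_le_right h.indep ?_) hf.comap_le
    rintro _ ⟨B, hB, rfl⟩
    exact ⟨g ⁻¹' B, hg hB, rfl⟩
  rw [hi.integral_fun_mul_eq_mul_integral hf'.aestronglyMeasurable
    (hg.comp hN).aestronglyMeasurable, ← h.law,
    integral_map hN.aemeasurable hg.aestronglyMeasurable]

lemma lintegral_mul (h : IsGaussInc F P s t N v) (hF : ∀ t, F t ≤ mΩ)
    {f : Ω → ℝ≥0∞} (hf : Measurable[F s] f) {g : ℝ → ℝ≥0∞} (hg : Measurable g) :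
    ∫⁻ ω, f ω * g (N ω) ∂P = (∫⁻ ω, f ω ∂P) * ∫⁻ x, g x ∂(gaussianReal 0 v.toNNReal) := by
  have hN := h.measurable hF
  rw [lintegral_mul_eq_lintegral_mul_lintegral_of_independent_measurableSpace (hF s) hN.comap_le
    h.indep hf, ← h.law, lintegral_map hg hN]
  exact hg.comp (Measurable.of_comap_le le_rfl)

/-- On a past event `A`, the factor `1_A exp(i l N)` is known at time `t` and `N'` is independent of
`F t`; the two Gaussian transforms multiply and the variances add. -/
lemma add (h : IsGaussInc F P s t N v) (h' : IsGaussInc F P t r N' v')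
    (hF : ∀ t, F t ≤ mΩ) (hmono : Monotone F) (hst : s ≤ t) (htr : t ≤ r)
    (hv : 0 ≤ v) (hv' : 0 ≤ v') :
    IsGaussInc F P s r (fun ω => N ω + N' ω) (v + v') := by
  refine isGaussInc_of_charFun hF (add_nonneg hv hv')
    ((h.meas.mono (hmono htr) le_rfl).add h'.meas) fun A hA l => ?_
  have hA' := hF s A hA
  have h1 := h'.integral_mul hF (𝕜 := ℂ)
    (f := A.indicator fun ω => Complex.exp (l * N ω * Complex.I))
    (g := fun x => Complex.exp (l * x * Complex.I)) ?_ (by fun_prop)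
  · have h2 := h'.setIntegral_charFun hF hv' (@MeasurableSet.univ _ (F t)) l
    rw [setIntegral_univ, ← integral_map (f := fun x : ℝ => Complex.exp (l * x * Complex.I))
      (h'.measurable hF).aemeasurable (by fun_prop), h'.law] at h2
    rw [h2, integral_indicator hA', h.setIntegral_charFun hF hv hA] at h1
    have h3 : ∀ ω, A.indicator (fun ω => Complex.exp (l * N ω * Complex.I)) ω *
        Complex.exp (l * N' ω * Complex.I) =
        A.indicator (fun ω => Complex.exp (l * (N ω + N' ω : ℝ) * Complex.I)) ω := by
      intro ω
      by_cases hω : ω ∈ A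
      · simp only [indicator_of_mem hω]
        rw [← Complex.exp_add]; push_cast; ring_nf
      · simp [hω]
    simp_rw [h3] at h1
    rw [integral_indicator hA'] at h1
    rw [h1]
    simp only [probReal_univ, one_smul, Complex.real_smul]
    rw [mul_assoc, ← Complex.exp_add]
    push_cast; ring_nf
  · refine Measurable.indicator ?_ (hmono hst _ hA)
    have hN : Measurable[F t] N := h.meas
    have : Measurable (fun x : ℝ => Complex.exp (l * x * Complex.I)) := by fun_prop
    exact this.comp hN

/-- Characteristic functions have modulus one, so dominated convergence carries the criterion to
a.s. limits. This transfers the joint law from grid sums to Wiener integrals. -/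
lemma of_tendsto (hF : ∀ t, F t ≤ mΩ) {Nn : ℕ → Ω → ℝ} {vn : ℕ → ℝ}
    (h : ∀ n, IsGaussInc F P s t (Nn n) (vn n)) (hvn : ∀ n, 0 ≤ vn n) (hN : Measurable[F t] N)
    (hlim : ∀ᵐ ω ∂P, Tendsto (fun n => Nn n ω) atTop (𝓝 (N ω)))
    (hv : Tendsto vn atTop (𝓝 v)) : IsGaussInc F P s t N v := by
  have hv0 : 0 ≤ v := ge_of_tendsto' hv hvn
  refine isGaussInc_of_charFun hF hv0 hN fun A hA l => ?_
  have hN' : Measurable N := hN.mono (hF t) le_rfl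
  have h1 : Tendsto (fun n => ∫ ω in A, Complex.exp (l * Nn n ω * Complex.I) ∂P) atTop
      (𝓝 (∫ ω in A, Complex.exp (l * N ω * Complex.I) ∂P)) := by
    refine tendsto_integral_of_dominated_convergence (fun _ => 1) (fun n => ?_)
      (integrable_const _) (fun n => ?_) ?_
    · have : Measurable (Nn n) := (h n).measurable hF
      have h2 : Measurable fun ω => Complex.exp (l * Nn n ω * Complex.I) := by fun_prop
      exact h2.aestronglyMeasurable
    · refine Eventually.of_forall fun ω => ?_
      have := Complex.norm_exp_ofReal_mul_I (l * Nn n ω)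
      push_cast at this
      exact this.le
    · refine ae_restrict_of_ae ?_
      filter_upwards [hlim] with ω hω
      have hc : Continuous fun x : ℝ => Complex.exp (l * x * Complex.I) := by fun_prop
      exact (hc.tendsto _).comp hω
  refine tendsto_nhds_unique h1 ?_
  simp_rw [fun n => (h n).setIntegral_charFun hF (hvn n) hA l]
  refine Tendsto.const_smul ?_ _
  have hc : Continuous fun x : ℝ => Complex.exp (-(x * l ^ 2 / 2)) := by fun_prop
  exact (hc.tendsto _).comp hv

lemma mgf (h : IsGaussInc F P s t N v) (hF : ∀ t, F t ≤ mΩ) (hv : 0 ≤ v) {f : Ω → ℝ}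
    (hf : Measurable[F s] f) :
    ∫ ω, f ω * Real.exp (N ω) ∂P = (∫ ω, f ω ∂P) * Real.exp (v / 2) := by
  rw [h.integral_mul hF hf Real.measurable_exp]
  congr 1
  have h1 := mgf_gaussianReal (p := gaussianReal 0 v.toNNReal) (X := id) (Measure.map_id) 1
  simpa [ProbabilityTheory.mgf, Real.coe_toNNReal _ hv] using h1

lemma memLp (h : IsGaussInc F P s t N v) (hF : ∀ t, F t ≤ mΩ) (p : ℝ≥0) : MemLp N p P := by
  have := memLp_id_gaussianReal (μ := 0) (v := v.toNNReal) p
  rw [← h.law, memLp_map_measure_iff aestronglyMeasurable_id (h.measurable hF).aemeasurable] at this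
  exact this

end IsGaussInc

end GaussInc

/-! ### Càdlàg coefficients -/

namespace IsCadlagOn

variable {β : Type*} [TopologicalSpace β] {T : ℝ} {f : ℝ → β}

lemma comp (hf : IsCadlagOn T f) {β' : Type*} [TopologicalSpace β'] {g : β → β'}
    (hg : Continuous g) : IsCadlagOn T (fun t => g (f t)) := by
  refine ⟨fun t ht => ?_, fun t ht => ?_⟩
  · exact (hg.continuousAt).comp_continuousWithinAt (hf.1 t ht)
  · obtain ⟨l, hl⟩ := hf.2 t ht
    exact ⟨g l, (hg.tendsto l).comp hl⟩

/-- The point `τ n t` is the first multiple of `1/(n+1)` strictly above `t`, clipped at `T`. Thus `f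
∘ τ n` takes countably many values and converges by right continuity; at `t = T` the clip returns
`T` itself, where right continuity is not assumed. -/
lemma measurable [MeasurableSpace β] [BorelSpace β] [TopologicalSpace.PseudoMetrizableSpace β]
    (hf : IsCadlagOn T f) : Measurable (fun t : Icc 0 T => f t) := by
  let τ : ℕ → ℝ → ℝ := fun n t => min T ((⌊(n + 1 : ℝ) * t⌋₊ + 1) / (n + 1))
  have hlow : ∀ (n : ℕ) (t : ℝ), t < ((⌊(n + 1 : ℝ) * t⌋₊ : ℝ) + 1) / (n + 1) := fun n t => by
    rw [lt_div_iff₀ (by positivity)]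
    have := Nat.lt_floor_add_one ((n + 1 : ℝ) * t)
    linarith
  have hup : ∀ (n : ℕ) (t : ℝ), 0 ≤ t → ((⌊(n + 1 : ℝ) * t⌋₊ : ℝ) + 1) / (n + 1) ≤ t + 1 / ((n : ℝ) + 1) :=
    fun n t ht => by
      have := Nat.floor_le (a := (n + 1 : ℝ) * t) (by positivity)
      rw [add_div]
      gcongr
      rw [div_le_iff₀ (by positivity)]
      linarith
  refine measurable_of_tendsto_metrizable (f := fun n (t : Icc 0 T) => f (τ n t)) (fun n => ?_) ?_
  · have h1 : Measurable fun t : Icc 0 T => ⌊(n + 1 : ℝ) * t⌋₊ :=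
      Nat.measurable_floor.comp (measurable_const.mul measurable_subtype_coe)
    exact (measurable_from_top (f := fun k : ℕ => f (min T ((k + 1) / (n + 1))))).comp h1
  · rw [tendsto_pi_nhds]
    rintro ⟨t, ht0, htT⟩
    rcases htT.lt_or_eq with h | h
    · have h1 : Tendsto (fun n => τ n t) atTop (𝓝 t) := by
        have h2 : Tendsto (fun n : ℕ => t + 1 / ((n : ℝ) + 1)) atTop (𝓝 t) := by
          simpa using tendsto_const_nhds.add (tendsto_one_div_add_atTop_nhds_zero_nat (𝕜 := ℝ))
        exact tendsto_of_tendsto_of_tendsto_of_le_of_le tendsto_const_nhds h2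
          (fun n => le_min htT (hlow n t).le) (fun n => (min_le_right _ _).trans (hup n t ht0))
      refine (hf.1 t ⟨ht0, h⟩).tendsto.comp ?_
      exact tendsto_nhdsWithin_iff.2 ⟨h1, Eventually.of_forall fun n => lt_min h (hlow n t)⟩
    · subst h
      have : ∀ n, τ n t = t := fun n => min_eq_left (hlow n t).le
      simp only [this]; exact tendsto_const_nhds

/-- One-sided limits bound `f` near every point, and compactness makes the local bounds global. -/
lemma bounded {f : ℝ → ℝ} (hf : IsCadlagOn T f) : ∃ C, ∀ t ∈ Icc 0 T, |f t| ≤ C := by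
  refine isCompact_Icc.induction_on (p := fun s => ∃ C, ∀ t ∈ s, |f t| ≤ C) ⟨0, by simp⟩ ?_ ?_ ?_
  · rintro s t hst ⟨C, hC⟩
    exact ⟨C, fun x hx => hC x (hst hx)⟩
  · rintro s t ⟨C, hC⟩ ⟨C', hC'⟩
    exact ⟨max C C', fun x hx => hx.elim (fun h => (hC x h).trans (le_max_left _ _))
      (fun h => (hC' x h).trans (le_max_right _ _))⟩
  · intro x hx
    have hl : ∃ C, ∀ᶠ t in 𝓝[<] x, t ∈ Icc 0 T → |f t| ≤ C := by
      rcases hx.1.eq_or_lt with h | h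
      · refine ⟨0, ?_⟩
        filter_upwards [self_mem_nhdsWithin] with t ht ht'
        exact absurd ht'.1 (not_le.2 (h ▸ ht))
      · obtain ⟨l, hl⟩ := hf.2 x ⟨h, hx.2⟩
        refine ⟨|l| + 1, ?_⟩
        filter_upwards [hl.abs.eventually_le_const (lt_add_one |l|)] with t ht _ using ht
    have hr : ∃ C, ∀ᶠ t in 𝓝[>] x, t ∈ Icc 0 T → |f t| ≤ C := by
      rcases hx.2.eq_or_lt with h | h
      · refine ⟨0, ?_⟩
        filter_upwards [self_mem_nhdsWithin] with t ht ht'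
        exact absurd ht'.2 (not_le.2 (h ▸ ht))
      · refine ⟨|f x| + 1, ?_⟩
        filter_upwards [(hf.1 x ⟨hx.1, h⟩).tendsto.abs.eventually_le_const (lt_add_one |f x|)]
          with t ht _ using ht
    obtain ⟨C₁, h₁⟩ := hl
    obtain ⟨C₂, h₂⟩ := hr
    refine ⟨{t | t ∈ Icc 0 T ∧ |f t| ≤ max (max C₁ C₂) |f x|}, ?_, _, fun t ht => ht.2⟩
    rw [mem_nhdsWithin_iff_eventually]
    have : ∀ᶠ t in 𝓝 x, t ∈ Icc 0 T → |f t| ≤ max (max C₁ C₂) |f x| := by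
      rw [← nhdsNE_sup_pure, ← nhdsLT_sup_nhdsGT]
      refine eventually_sup.2 ⟨eventually_sup.2 ⟨?_, ?_⟩, ?_⟩
      · filter_upwards [h₁] with t ht ht' using (ht ht').trans (by simp)
      · filter_upwards [h₂] with t ht ht' using (ht ht').trans (by simp)
      · rw [eventually_pure]; intro _; simp
    filter_upwards [this] with t ht ht'
    exact ⟨ht', ht ht'⟩

lemma integrableOn {f : ℝ → ℝ} (hf : IsCadlagOn T f) : IntegrableOn f (Icc 0 T) := by
  obtain ⟨C, hC⟩ := hf.bounded
  have hm : AEStronglyMeasurable f (volume.restrict (Icc 0 T)) :=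
    (aemeasurable_restrict_of_measurable_subtype measurableSet_Icc hf.measurable).aestronglyMeasurable
  exact ⟨hm, HasFiniteIntegral.of_bounded (C := C)
    ((ae_restrict_iff' measurableSet_Icc).2 (Eventually.of_forall hC))⟩

end IsCadlagOn

/-! ### Brownian motion relative to a filtration -/

/-- `B` is a Brownian motion on `[0,T]` relative to the filtration `F`: it is adapted and its
increments are Gaussian and independent of the past. -/
structure IsLevy (F : ℝ → MeasurableSpace Ω) (P : Measure Ω) (T : ℝ)
    (B : ℝ → Ω → EuclideanSpace ℝ (Fin d)) : Prop where
  adapted : ∀ t ∈ Icc 0 T, Measurable[F t] (B t)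
  incr : ∀ ⦃s t : ℝ⦄, 0 ≤ s → s ≤ t → t ≤ T → ∀ u : EuclideanSpace ℝ (Fin d),
    IsGaussInc F P s t (fun ω => inner ℝ u (B t ω - B s ω)) (‖u‖ ^ 2 * (t - s))

section Brownian

variable {W : Fin d → ℝ≥0 → Ω → ℝ} {P : Measure Ω} [IsProbabilityMeasure P]

lemma inner_eq_sum (u v : EuclideanSpace ℝ (Fin d)) : inner ℝ u v = ∑ i, u i * v i := by
  simp [PiLp.inner_apply, mul_comm]

lemma IsBrownianMotion.isGaussInc (hW : IsBrownianMotion W P) {s t : ℝ} (hs : 0 ≤ s)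
    (hst : s ≤ t) (u : EuclideanSpace ℝ (Fin d)) :
    IsGaussInc (brownianFiltration W P) P s t
      (fun ω => inner ℝ u (vecBM W t ω - vecBM W s ω)) (‖u‖ ^ 2 * (t - s)) := by
  have hF := hW.brownianFiltration_le
  have ht := hs.trans hst
  have hN : Measurable[brownianFiltration W P t]
      (fun ω => inner ℝ u (vecBM W t ω - vecBM W s ω)) :=
    (innerSL ℝ u).continuous.measurable.comp
      ((measurable_vecBM le_rfl ht).sub (measurable_vecBM hst ht))
  refine ⟨hN, ?_, ?_⟩
  · refine indep_of_indep_of_le_right (hW.indep_increment hs hst) ?_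
    refine Measurable.comap_le ?_
    simp only [inner_eq_sum]
    refine Finset.measurable_sum _ fun i _ => Measurable.const_mul ?_ _
    have : Measurable[MeasurableSpace.comap
        (fun ω => W i t.toNNReal ω - W i s.toNNReal ω) inferInstance]
        (fun ω => W i t.toNNReal ω - W i s.toNNReal ω) := Measurable.of_comap_le le_rfl
    exact this.mono (le_iSup (fun i => MeasurableSpace.comap
        (fun ω => W i t.toNNReal ω - W i s.toNNReal ω) inferInstance) i) le_rfl
  · refine Measure.ext_of_charFun ?_
    funext l
    have hN' : Measurable (fun ω => inner ℝ u (vecBM W t ω - vecBM W s ω)) := hN.mono (hF t) le_rfl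
    rw [charFun_apply_real, integral_map hN'.aemeasurable (by fun_prop), charFun_gaussianReal]
    -- Independence of the coordinates splits the characteristic function into one-dimensional ones
    -- at frequencies `l * u i`; the exponents recombine to `‖u‖ ^ 2`.
    have h1 : ∀ ω, Complex.exp (l * (inner ℝ u (vecBM W t ω - vecBM W s ω) : ℝ) * Complex.I) =
        ∏ i, (fun x : ℝ => Complex.exp ((l * u i : ℝ) * x * Complex.I))
          (W i t.toNNReal ω - W i s.toNNReal ω) := by
      intro ω
      rw [← Complex.exp_sum, inner_eq_sum]
      congr 1
      push_cast
      rw [Finset.mul_sum, Finset.sum_mul]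
      refine Finset.sum_congr rfl fun i _ => ?_
      simp [vecBM]; ring
    simp_rw [h1]
    have hind : iIndepFun (fun i ω => W i t.toNNReal ω - W i s.toNNReal ω) P :=
      hW.indep.comp (fun i (f : ℝ≥0 → ℝ) => f t.toNNReal - f s.toNNReal) (fun i => by fun_prop)
    rw [hind.integral_fun_prod_comp (X := fun i ω => W i t.toNNReal ω - W i s.toNNReal ω)
      (f := fun i (x : ℝ) => Complex.exp ((l * u i : ℝ) * x * Complex.I))
      (fun i => ((hW.measurable i _).sub (hW.measurable i _)).aemeasurable)
      (fun i => by fun_prop)]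
    have h2 : ∀ i, ∫ ω, Complex.exp ((l * u i : ℝ) * (W i t.toNNReal ω - W i s.toNNReal ω : ℝ)
        * Complex.I) ∂P = Complex.exp (-((t - s) * (l * u i) ^ 2 / 2)) := by
      intro i
      have hl := ((hW.brownian i).toIsPreBrownianReal.hasLaw_sub t.toNNReal s.toNNReal)
      have h3 : Measurable (W i t.toNNReal - W i s.toNNReal) :=
        (hW.measurable i _).sub (hW.measurable i _)
      have h4 := integral_map (μ := P) h3.aemeasurable
        (f := fun x : ℝ => Complex.exp ((l * u i : ℝ) * x * Complex.I)) (by fun_prop)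
      simp only [Pi.sub_apply] at h4
      rw [← h4, hl.map_eq, ← charFun_apply_real, charFun_gaussianReal]
      have h5 : ((nndist (t.toNNReal : ℝ) (s.toNNReal : ℝ) : ℝ≥0) : ℂ) = t - s := by
        have : ((nndist (t.toNNReal : ℝ) (s.toNNReal : ℝ) : ℝ≥0) : ℝ) = t - s := by
          rw [coe_nndist, Real.coe_toNNReal _ hs, Real.coe_toNNReal _ ht, Real.dist_eq,
            abs_of_nonneg (by linarith)]
        rw [← Complex.ofReal_sub, ← this]
      erw [h5]
      congr 1
      push_cast
      ring
    rw [Finset.prod_congr rfl fun i _ => h2 i, ← Complex.exp_sum]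
    congr 1
    have h6 : (0:ℝ) ≤ ‖u‖ ^ 2 * (t - s) := mul_nonneg (by positivity) (by linarith)
    have h7 : ((Real.toNNReal (‖u‖ ^ 2 * (t - s)) : ℝ≥0) : ℂ) = ((‖u‖ ^ 2 * (t - s) : ℝ) : ℂ) :=
      congrArg (fun x : ℝ => (x : ℂ)) (Real.coe_toNNReal _ h6)
    rw [h7, EuclideanSpace.norm_sq_eq]
    push_cast
    simp only [Real.norm_eq_abs, ← Complex.ofReal_pow, sq_abs]
    rw [Finset.sum_mul, Finset.sum_mul, Finset.sum_div]
    rw [mul_zero, zero_mul, zero_sub, ← Finset.sum_neg_distrib]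
    refine Finset.sum_congr rfl fun i _ => ?_
    push_cast; ring

lemma IsBrownianMotion.isLevy (hW : IsBrownianMotion W P) (T : ℝ) :
    IsLevy (brownianFiltration W P) P T (vecBM W) :=
  ⟨fun _ ht => measurable_vecBM le_rfl ht.1, fun _ _ hs hst _ u => hW.isGaussInc hs hst u⟩

lemma IsBrownianMotion.ae_continuous (hW : IsBrownianMotion W P) :
    ∀ᵐ ω ∂P, Continuous fun t => vecBM W t ω := by
  have : ∀ᵐ ω ∂P, ∀ i, Continuous (W i · ω) := ae_all_iff.2 fun i => (hW.brownian i).cont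
  filter_upwards [this] with ω hω
  refine (PiLp.continuous_toLp 2 _).comp (continuous_pi fun i => ?_)
  exact (hω i).comp continuous_real_toNNReal

lemma SimpleIntegrand.integral_eq {F : ℝ → MeasurableSpace Ω} {T : ℝ}
    (S : SimpleIntegrand F T d) (t : ℝ) (ω : Ω) :
    S.integral W t ω = ∑ k ∈ Finset.range S.n,
      inner ℝ (S.coef k ω) (vecBM W (min (S.time (k + 1)) t) ω - vecBM W (min (S.time k) t) ω) := by
  simp [SimpleIntegrand.integral, inner_eq_sum, vecBM]

end Brownian

/-! ### Orthogonal increments and elementary stochastic integrals -/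

section Orthogonal

variable {F : ℝ → MeasurableSpace Ω} {P : Measure Ω} [IsProbabilityMeasure P]

/-- The hypothesis on `D` says that its conditional expectation given `m` vanishes, and the
`m`-measurable factor `N` can be pulled out. -/
lemma integral_mul_eq_zero_of_setIntegral {m : MeasurableSpace Ω} (hm : m ≤ mΩ) {N D : Ω → ℝ}
    (hN : Measurable[m] N) (hN2 : MemLp N 2 P) (hD2 : MemLp D 2 P)
    (hD : ∀ A, MeasurableSet[m] A → ∫ ω in A, D ω ∂P = 0) : ∫ ω, N ω * D ω ∂P = 0 := by
  have hDi : Integrable D P := hD2.integrable (by norm_num)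
  have h1 : (0 : Ω → ℝ) =ᵐ[P] P[D | m] := by
    refine ae_eq_condExp_of_forall_setIntegral_eq hm hDi (fun _ _ _ => integrableOn_zero) ?_
      aestronglyMeasurable_zero
    intro A hA _
    simp [hD A hA]
  have hN' : StronglyMeasurable[m] N := hN.stronglyMeasurable
  have h2 := condExp_mul_of_stronglyMeasurable_left (μ := P) (m := m)
    (f := N) (g := D) hN'
    (hN2.integrable_mul hD2) hDi
  have h3 : ∫ ω, (N * D) ω ∂P = ∫ ω, (P[N * D | m]) ω ∂P := (integral_condExp hm).symm
  have h4 : P[N * D | m] =ᵐ[P] 0 := by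
    filter_upwards [h1, h2] with ω h1 h2
    rw [h2]
    simp [← h1]
  rw [integral_congr_ae h4] at h3
  simpa using h3

/-- Pythagoras for martingale differences: in the induction the cross term pairs the sum so far,
known at `τ n`, with a difference centred given that time. -/
lemma integral_sum_sq_of_orthogonal (hF : ∀ t, F t ≤ mΩ) (hmono : Monotone F) {τ : ℕ → ℝ}
    (hτ : Monotone τ) {D : ℕ → Ω → ℝ} (n : ℕ)
    (hmeas : ∀ k < n, Measurable[F (τ (k + 1))] (D k)) (h2 : ∀ k < n, MemLp (D k) 2 P)
    (h0 : ∀ k < n, ∀ A, MeasurableSet[F (τ k)] A → ∫ ω in A, D k ω ∂P = 0) :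
    ∫ ω, (∑ k ∈ Finset.range n, D k ω) ^ 2 ∂P = ∑ k ∈ Finset.range n, ∫ ω, D k ω ^ 2 ∂P := by
  induction n with
  | zero => simp
  | succ n ih =>
    have hm : Measurable[F (τ n)] fun ω => ∑ k ∈ Finset.range n, D k ω := by
      refine Finset.measurable_sum _ fun k hk => ?_
      have hk := Finset.mem_range.1 hk
      exact (hmeas k (by omega)).mono (hmono (hτ (by omega))) le_rfl
    have hL : MemLp (fun ω => ∑ k ∈ Finset.range n, D k ω) 2 P := by
      refine memLp_finsetSum _ fun k hk => h2 k ?_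
      have := Finset.mem_range.1 hk; omega
    have hcross := integral_mul_eq_zero_of_setIntegral (hF _) hm hL (h2 n (by omega))
      (h0 n (by omega))
    rw [Finset.sum_range_succ, ← ih (fun k hk => hmeas k (by omega)) (fun k hk => h2 k (by omega))
      (fun k hk => h0 k (by omega))]
    have : ∀ ω, (∑ k ∈ Finset.range (n + 1), D k ω) ^ 2 =
        (∑ k ∈ Finset.range n, D k ω) ^ 2 + 2 * ((∑ k ∈ Finset.range n, D k ω) * D n ω) +
          D n ω ^ 2 := by
      intro ω; rw [Finset.sum_range_succ]; ring
    simp_rw [this]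
    have hi := (hL.integrable_mul (h2 n (by omega))).const_mul 2
    simp only [Pi.mul_apply] at hi
    have hi' : Integrable (fun ω => (∑ k ∈ Finset.range n, D k ω) ^ 2 +
        2 * ((∑ k ∈ Finset.range n, D k ω) * D n ω)) P := hL.integrable_sq.add hi
    rw [integral_add hi' (h2 n (by omega)).integrable_sq,
      integral_add hL.integrable_sq hi, integral_const_mul, hcross]
    ring

end Orthogonal

namespace IsLevy

variable {F : ℝ → MeasurableSpace Ω} {P : Measure Ω} [IsProbabilityMeasure P] {T : ℝ}
  {B : ℝ → Ω → EuclideanSpace ℝ (Fin d)} {s t C : ℝ} {ξ : Ω → EuclideanSpace ℝ (Fin d)}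

lemma measurable_inner (hB : IsLevy F P T B) (hmono : Monotone F) (hs : 0 ≤ s)
    (hst : s ≤ t) (ht : t ≤ T) (hξ : Measurable[F s] ξ) :
    Measurable[F t] fun ω => inner ℝ (ξ ω) (B t ω - B s ω) := by
  have h1 := hB.adapted t ⟨hs.trans hst, ht⟩
  have h2 := (hB.adapted s ⟨hs, hst.trans ht⟩).mono (hmono hst) le_rfl
  have h3 := hξ.mono (hmono hst) le_rfl
  have hc : Measurable fun p : EuclideanSpace ℝ (Fin d) × EuclideanSpace ℝ (Fin d) =>
    (inner ℝ p.1 p.2 : ℝ) := (continuous_fst.inner continuous_snd).measurable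
  exact hc.comp (h3.prodMk (h1.sub h2))

lemma memLp_coord (hB : IsLevy F P T B) (hF : ∀ t, F t ≤ mΩ) (hs : 0 ≤ s)
    (hst : s ≤ t) (ht : t ≤ T) (i : Fin d) : MemLp (fun ω => (B t ω - B s ω) i) 2 P := by
  have := (hB.incr hs hst ht (EuclideanSpace.single i 1)).memLp hF 2
  simpa [EuclideanSpace.inner_single_left] using this

lemma norm_coord_le (ξ : EuclideanSpace ℝ (Fin d)) (i : Fin d) : ‖ξ i‖ ≤ ‖ξ‖ :=
  PiLp.norm_apply_le ξ i

lemma measurable_coord {m : MeasurableSpace Ω} {ξ : Ω → EuclideanSpace ℝ (Fin d)}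
    (hξ : Measurable[m] ξ) (i : Fin d) : Measurable[m] fun ω => ξ ω i := by
  have : Measurable fun v : EuclideanSpace ℝ (Fin d) => v i := by fun_prop
  exact this.comp hξ

lemma memLp_inner (hB : IsLevy F P T B) (hF : ∀ t, F t ≤ mΩ) (hs : 0 ≤ s)
    (hst : s ≤ t) (ht : t ≤ T) (hξ : Measurable[F s] ξ) (hC : ∀ ω, ‖ξ ω‖ ≤ C) :
    MemLp (fun ω => inner ℝ (ξ ω) (B t ω - B s ω)) 2 P := by
  simp only [inner_eq_sum]
  refine memLp_finsetSum _ fun i _ => ?_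
  refine (hB.memLp_coord hF hs hst ht i).mul' (p := ⊤) (q := 2) ?_
  exact memLp_top_of_bound ((measurable_coord hξ i).mono (hF s) le_rfl).aestronglyMeasurable C
    (Eventually.of_forall fun ω => (norm_coord_le _ i).trans (hC ω))

lemma setIntegral_inner (hB : IsLevy F P T B) (hF : ∀ t, F t ≤ mΩ) (hs : 0 ≤ s)
    (hst : s ≤ t) (ht : t ≤ T) (hξ : Measurable[F s] ξ) (hC : ∀ ω, ‖ξ ω‖ ≤ C) {A : Set Ω}
    (hA : MeasurableSet[F s] A) :
    ∫ ω in A, inner ℝ (ξ ω) (B t ω - B s ω) ∂P = 0 := by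
  rw [← integral_indicator (hF s A hA)]
  have h1 : ∀ ω, A.indicator (fun ω => inner ℝ (ξ ω) (B t ω - B s ω)) ω =
      ∑ i, A.indicator (fun ω => ξ ω i) ω *
        id (inner ℝ (EuclideanSpace.single i 1) (B t ω - B s ω)) := by
    intro ω
    by_cases h : ω ∈ A
    · simp [h, inner_eq_sum (ξ ω), EuclideanSpace.inner_single_left]
    · simp [h]
  simp_rw [h1]
  have hm : ∀ i, Measurable[F s] (A.indicator fun ω => ξ ω i) := fun i =>
    (measurable_coord hξ i).indicator hA
  rw [integral_finsetSum]
  · refine Finset.sum_eq_zero fun i _ => ?_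
    rw [(hB.incr hs hst ht (EuclideanSpace.single i 1)).integral_mul hF (hm i) measurable_id]
    have : ∫ x, id x ∂(gaussianReal 0
        (‖(EuclideanSpace.single i 1 : EuclideanSpace ℝ (Fin d))‖ ^ 2 * (t - s)).toNNReal) = 0 := by
      simp only [id]; exact integral_id_gaussianReal
    rw [this, mul_zero]
  · intro i _
    have h2 := (hB.incr hs hst ht (EuclideanSpace.single i 1)).memLp hF 2
    refine (h2.mul' (p := ⊤) (q := 2) (r := 2) (φ := A.indicator fun ω => ξ ω i) ?_).integrable
      (by norm_num)
    refine memLp_top_of_bound ((hm i).mono (hF s) le_rfl).aestronglyMeasurable C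
      (Eventually.of_forall fun ω => ?_)
    refine (norm_indicator_le_norm_self _ _).trans ((norm_coord_le _ i).trans (hC ω))

lemma integral_sq_gaussianReal (v : ℝ≥0) : ∫ x, x ^ 2 ∂(gaussianReal 0 v) = v := by
  have h := variance_fun_id_gaussianReal (μ := 0) (v := v)
  rw [variance_eq_integral (by fun_prop)] at h
  simpa using h

/-- `IsLevy` only describes the increments along fixed vectors, while `ξ` is random. Polarisation
writes each product of two coordinates through squares along `e i`, `e j` and `e i + e j`, to which
independence from the past applies. -/
lemma integral_inner_sq (hB : IsLevy F P T B) (hF : ∀ t, F t ≤ mΩ) (hs : 0 ≤ s)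
    (hst : s ≤ t) (ht : t ≤ T) (hξ : Measurable[F s] ξ) (hC : ∀ ω, ‖ξ ω‖ ≤ C) :
    ∫ ω, (inner ℝ (ξ ω) (B t ω - B s ω)) ^ 2 ∂P = (∫ ω, ‖ξ ω‖ ^ 2 ∂P) * (t - s) := by
  have hsq : ∀ (u : EuclideanSpace ℝ (Fin d)) (f : Ω → ℝ), Measurable[F s] f →
      ∫ ω, f ω * (inner ℝ u (B t ω - B s ω)) ^ 2 ∂P = (∫ ω, f ω ∂P) * (‖u‖ ^ 2 * (t - s)) := by
    intro u f hf
    rw [(hB.incr hs hst ht u).integral_mul hF hf (g := fun x : ℝ => x ^ 2) (by fun_prop),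
      integral_sq_gaussianReal, Real.coe_toNNReal]
    exact mul_nonneg (by positivity) (by linarith)
  let e : Fin d → EuclideanSpace ℝ (Fin d) := fun i => EuclideanSpace.single i 1
  have hmem : ∀ u, MemLp (fun ω => inner ℝ u (B t ω - B s ω)) 2 P := fun u =>
    (hB.incr hs hst ht u).memLp hF 2
  have hfb : ∀ i j, MemLp (fun ω => ξ ω i * ξ ω j) ⊤ P := fun i j => by
    have h1 : ∀ i, MemLp (fun ω => ξ ω i) ⊤ P := fun i =>
      memLp_top_of_bound ((measurable_coord hξ i).mono (hF s) le_rfl).aestronglyMeasurable C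
        (Eventually.of_forall fun ω => (norm_coord_le _ i).trans (hC ω))
    exact (h1 j).mul' (h1 i)
  have hint : ∀ i j u, Integrable
      (fun ω => (ξ ω i * ξ ω j) * (inner ℝ u (B t ω - B s ω)) ^ 2) P := fun i j u => by
    have := memLp_one_iff_integrable.2 (hmem u).integrable_sq
    exact memLp_one_iff_integrable.1 (this.mul' (p := ⊤) (q := 1) (hfb i j))
  have hexp : ∀ ω, (inner ℝ (ξ ω) (B t ω - B s ω)) ^ 2 = ∑ i, ∑ j,
      (((ξ ω i * ξ ω j) * (inner ℝ (e i + e j) (B t ω - B s ω)) ^ 2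
        - (ξ ω i * ξ ω j) * (inner ℝ (e i) (B t ω - B s ω)) ^ 2)
        - (ξ ω i * ξ ω j) * (inner ℝ (e j) (B t ω - B s ω)) ^ 2) / 2 := by
    intro ω
    rw [inner_eq_sum, sq, Finset.sum_mul_sum]
    refine Finset.sum_congr rfl fun i _ => Finset.sum_congr rfl fun j _ => ?_
    simp only [e, inner_add_left, EuclideanSpace.inner_single_left]
    simp; ring
  simp_rw [hexp]
  have hi0 : ∀ i j, Integrable (fun ω =>
      (ξ ω i * ξ ω j) * (inner ℝ (e i + e j) (B t ω - B s ω)) ^ 2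
        - (ξ ω i * ξ ω j) * (inner ℝ (e i) (B t ω - B s ω)) ^ 2) P := fun i j =>
    (hint i j (e i + e j)).sub (hint i j (e i))
  have hi1 : ∀ i j, Integrable (fun ω =>
      ((ξ ω i * ξ ω j) * (inner ℝ (e i + e j) (B t ω - B s ω)) ^ 2
        - (ξ ω i * ξ ω j) * (inner ℝ (e i) (B t ω - B s ω)) ^ 2)
        - (ξ ω i * ξ ω j) * (inner ℝ (e j) (B t ω - B s ω)) ^ 2) P := fun i j =>
    (hi0 i j).sub (hint i j (e j))
  rw [integral_finsetSum _ fun i _ => integrable_finsetSum _ fun j _ => (hi1 i j).div_const 2]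
  have hval : ∀ i j, ∫ ω, (((ξ ω i * ξ ω j) * (inner ℝ (e i + e j) (B t ω - B s ω)) ^ 2
        - (ξ ω i * ξ ω j) * (inner ℝ (e i) (B t ω - B s ω)) ^ 2)
        - (ξ ω i * ξ ω j) * (inner ℝ (e j) (B t ω - B s ω)) ^ 2) / 2 ∂P =
      if i = j then (∫ ω, ξ ω i * ξ ω i ∂P) * (t - s) else 0 := by
    intro i j
    have hm : Measurable[F s] fun ω => ξ ω i * ξ ω j :=
      (measurable_coord hξ i).mul (measurable_coord hξ j)
    rw [integral_div, integral_sub (hi0 i j) (hint i j (e j)),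
      integral_sub (hint i j (e i + e j)) (hint i j (e i)), hsq _ _ hm, hsq _ _ hm, hsq _ _ hm]
    -- The combination `‖e i + e j‖² - ‖e i‖² - ‖e j‖²` is `2` on the diagonal and `0` off it, so
    -- distinct coordinates do not interact.
    have hn : ‖e i + e j‖ ^ 2 = if i = j then 4 else 2 := by
      rw [@norm_add_sq_real]
      simp only [e, EuclideanSpace.inner_single_left, PiLp.norm_single]
      by_cases h : i = j
      · simp [h]; norm_num
      · simp [h]; norm_num
    have hn1 : ∀ i, ‖e i‖ = 1 := fun i => by simp [e]
    rw [hn, hn1, hn1]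
    by_cases h : i = j
    · subst h; simp; ring
    · simp [h]; ring
  have h3 : ∀ i, ∫ ω, ∑ j, (((ξ ω i * ξ ω j) * (inner ℝ (e i + e j) (B t ω - B s ω)) ^ 2
        - (ξ ω i * ξ ω j) * (inner ℝ (e i) (B t ω - B s ω)) ^ 2)
        - (ξ ω i * ξ ω j) * (inner ℝ (e j) (B t ω - B s ω)) ^ 2) / 2 ∂P =
      (∫ ω, ξ ω i * ξ ω i ∂P) * (t - s) := by
    intro i
    rw [integral_finsetSum _ fun j _ => (hi1 i j).div_const 2]
    simp [hval]
  rw [Finset.sum_congr rfl fun i _ => h3 i, ← Finset.sum_mul, ← integral_finsetSum]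
  · congr 2
    funext ω
    rw [EuclideanSpace.norm_sq_eq]
    simp [sq]
  · intro i _
    exact (hfb i i).integrable le_top

end IsLevy

/-- The elementary stochastic integral up to time `t` of the integrand with value `ξ k` on
`(τ k, τ (k+1)]`, `k < n`. -/
def stochSum (B : ℝ → Ω → EuclideanSpace ℝ (Fin d)) (τ : ℕ → ℝ)
    (ξ : ℕ → Ω → EuclideanSpace ℝ (Fin d)) (n : ℕ) (t : ℝ) (ω : Ω) : ℝ :=
  ∑ k ∈ Finset.range n, inner ℝ (ξ k ω) (B (min (τ (k + 1)) t) ω - B (min (τ k) t) ω)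

section StochSum

variable {F : ℝ → MeasurableSpace Ω} {P : Measure Ω} [IsProbabilityMeasure P] {T : ℝ}
  {B : ℝ → Ω → EuclideanSpace ℝ (Fin d)} {s t C : ℝ} {ξ : ℕ → Ω → EuclideanSpace ℝ (Fin d)}
  {τ : ℕ → ℝ} {n : ℕ}

/-- The coefficient `ξ k`, made known at time `min (τ k) t`. -/
def clipCoef (τ : ℕ → ℝ) (ξ : ℕ → Ω → EuclideanSpace ℝ (Fin d)) (t : ℝ) (k : ℕ) (ω : Ω) :
    EuclideanSpace ℝ (Fin d) := if τ k ≤ t then ξ k ω else 0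

/-- A cell that starts after `t` has zero increment, so its coefficient may be set to zero. The
remaining coefficients are known at `min (τ k) t`, and the orthogonality lemma applies along the
clipped partition. -/
lemma stochSum_eq_clip (hτ : Monotone τ) :
    stochSum B τ ξ n t = fun ω => ∑ k ∈ Finset.range n,
      inner ℝ (clipCoef τ ξ t k ω) (B (min (τ (k + 1)) t) ω - B (min (τ k) t) ω) := by
  funext ω
  refine Finset.sum_congr rfl fun k _ => ?_
  by_cases h : τ k ≤ t
  · simp [clipCoef, h]
  · have h' := (not_le.1 h).le
    simp [clipCoef, h, min_eq_right h', min_eq_right (h'.trans (hτ k.le_succ))]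

lemma measurable_clipCoef (hξ : ∀ k, Measurable[F (τ k)] (ξ k)) (k : ℕ) :
    Measurable[F (min (τ k) t)] (clipCoef τ ξ t k) := by
  unfold clipCoef
  by_cases h : τ k ≤ t
  · rw [min_eq_left h]; simpa [h] using hξ k
  · simp [h]

lemma norm_clipCoef_le (hC : ∀ k ω, ‖ξ k ω‖ ≤ C) (k : ℕ) (ω : Ω) :
    ‖clipCoef τ ξ t k ω‖ ≤ C := by
  unfold clipCoef
  split_ifs
  · exact hC k ω
  · simpa using (norm_nonneg _).trans (hC k ω)

variable (hB : IsLevy F P T B) (hF : ∀ t, F t ≤ mΩ) (hmono : Monotone F) (hτ : Monotone τ)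
  (hτT : ∀ k, τ k ∈ Icc 0 T) (hξ : ∀ k, Measurable[F (τ k)] (ξ k)) (hC : ∀ k ω, ‖ξ k ω‖ ≤ C)

include hB hmono hτ hτT hξ in
lemma measurable_stochSum (ht : t ∈ Icc 0 T) : Measurable[F t] (stochSum B τ ξ n t) := by
  rw [stochSum_eq_clip hτ]
  refine Finset.measurable_sum _ fun k _ => ?_
  refine (hB.measurable_inner hmono (le_min (hτT k).1 ht.1) (min_le_min_right _ (hτ k.le_succ))
    (min_le_of_right_le ht.2) (measurable_clipCoef hξ k)).mono (hmono (min_le_right _ _)) le_rfl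

include hB hF hτ hτT hξ hC in
lemma memLp_stochSum (ht : t ∈ Icc 0 T) : MemLp (stochSum B τ ξ n t) 2 P := by
  rw [stochSum_eq_clip hτ]
  refine memLp_finsetSum _ fun k _ => ?_
  exact hB.memLp_inner hF (le_min (hτT k).1 ht.1) (min_le_min_right _ (hτ k.le_succ))
    (min_le_of_right_le ht.2) (measurable_clipCoef hξ k) (norm_clipCoef_le hC k)

include hB hF hmono hτ hτT hξ hC in
/-- The Itô isometry for elementary integrals. -/
lemma integral_stochSum_sq (ht : t ∈ Icc 0 T) :
    ∫ ω, (stochSum B τ ξ n t ω) ^ 2 ∂P =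
      ∑ k ∈ Finset.range n, (∫ ω, ‖ξ k ω‖ ^ 2 ∂P) * (min (τ (k + 1)) t - min (τ k) t) := by
  have h0 := fun k => le_min (hτT k).1 ht.1
  have h1 : ∀ k, min (τ k) t ≤ min (τ (k + 1)) t := fun k => min_le_min_right _ (hτ k.le_succ)
  have h2 : ∀ k, min (τ k) t ≤ T := fun k => min_le_of_right_le ht.2
  rw [stochSum_eq_clip hτ]
  rw [integral_sum_sq_of_orthogonal hF hmono (τ := fun k => min (τ k) t)
    (D := fun k ω => inner ℝ (clipCoef τ ξ t k ω) (B (min (τ (k + 1)) t) ω - B (min (τ k) t) ω))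
    (fun i j hij => min_le_min_right _ (hτ hij)) n
    (fun k _ => hB.measurable_inner hmono (h0 k) (h1 k) (h2 _) (measurable_clipCoef hξ k))
    (fun k _ => hB.memLp_inner hF (h0 k) (h1 k) (h2 _) (measurable_clipCoef hξ k)
      (norm_clipCoef_le hC k))
    (fun k _ A hA => hB.setIntegral_inner hF (h0 k) (h1 k) (h2 _) (measurable_clipCoef hξ k)
      (norm_clipCoef_le hC k) hA)]
  refine Finset.sum_congr rfl fun k _ => ?_
  rw [hB.integral_inner_sq hF (h0 k) (h1 k) (h2 _) (measurable_clipCoef hξ k)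
      (norm_clipCoef_le hC k)]
  by_cases h : τ k ≤ t
  · simp [clipCoef, h]
  · have h' := (not_le.1 h).le
    simp [min_eq_right h', min_eq_right (h'.trans (hτ k.le_succ))]

include hB hF hmono hτ hτT hξ hC in
/-- Elementary stochastic integrals are martingales. -/
lemma setIntegral_stochSum (hs : 0 ≤ s) (hst : s ≤ t) (ht : t ≤ T) {A : Set Ω}
    (hA : MeasurableSet[F s] A) :
    ∫ ω in A, stochSum B τ ξ n t ω ∂P = ∫ ω in A, stochSum B τ ξ n s ω ∂P := by
  have hi : ∀ {t}, t ∈ Icc 0 T → ∀ k, Integrable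
      (fun ω => inner ℝ (ξ k ω) (B (min (τ (k + 1)) t) ω - B (min (τ k) t) ω)) P := by
    intro t ht k
    -- A single term is an elementary integral with one cell, along the partition shifted to start
    -- at `τ k`.
    have h := memLp_stochSum (n := 1) (ξ := fun _ => ξ k) (τ := fun j => τ (k + j)) (C := C) hB hF
      (fun i j hij => hτ (by omega)) (fun j => hτT _)
      (fun j => (hξ k).mono (hmono (hτ (by omega))) le_rfl) (fun _ ω => hC k ω) ht
    have := h.integrable (by norm_num)
    unfold stochSum at this
    simpa using this
  have htT : t ∈ Icc 0 T := ⟨hs.trans hst, ht⟩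
  have hsT : s ∈ Icc 0 T := ⟨hs, hst.trans ht⟩
  unfold stochSum
  rw [integral_finsetSum _ fun k _ => (hi htT k).integrableOn,
    integral_finsetSum _ fun k _ => (hi hsT k).integrableOn]
  refine Finset.sum_congr rfl fun k _ => ?_
  rw [← sub_eq_zero, ← integral_sub (hi htT k).integrableOn (hi hsT k).integrableOn]
  have hk : τ k ≤ τ (k + 1) := hτ k.le_succ
  -- A cell may end before `s` (its term is frozen), straddle `s` (only the increment after `s`
  -- remains, with a coefficient known at `s`), or start after `s`, in which case `A` is also an
  -- event of the past at `τ k`.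
  rcases le_or_gt (τ k) s with h | h
  · rcases le_or_gt (τ (k + 1)) s with h' | h'
    · simp [min_eq_left h', min_eq_left h, min_eq_left (h'.trans hst), min_eq_left (h.trans hst)]
    · have := hB.setIntegral_inner (s := s) (t := min (τ (k + 1)) t) (ξ := ξ k) hF hs
        (le_min h'.le hst) (min_le_of_right_le ht) ((hξ k).mono (hmono h) le_rfl) (hC k) hA
      rw [← this]
      congr 1
      funext ω
      rw [min_eq_left h, min_eq_left (h.trans hst), min_eq_right h'.le, ← inner_sub_right]
      congr 1
      abel
  · have e1 : min (τ k) s = s := min_eq_right h.le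
    have e2 : min (τ (k + 1)) s = s := min_eq_right (h.le.trans hk)
    rcases le_or_gt t (τ k) with h' | h'
    · simp [e1, e2, min_eq_right h', min_eq_right (h'.trans hk)]
    · have := hB.setIntegral_inner (s := τ k) (t := min (τ (k + 1)) t) (ξ := ξ k) hF (hτT k).1
        (le_min hk h'.le) (min_le_of_right_le ht) (hξ k) (hC k) (hmono h.le _ hA)
      rw [← this]
      congr 1
      funext ω
      rw [e1, e2, min_eq_left h'.le]
      simp

end StochSum

/-! ### Simple integrands -/

lemma sum_indicator_of_mem {E : Type*} [AddCommMonoid E] {τ : ℕ → ℝ} (hτ : Monotone τ)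
    (a : ℕ → E) {n k : ℕ} (hk : k < n) {s : ℝ} (hs : s ∈ Ioc (τ k) (τ (k + 1))) :
    ∑ j ∈ Finset.range n, (Ioc (τ j) (τ (j + 1))).indicator (fun _ => a j) s = a k := by
  rw [Finset.sum_eq_single k]
  · simp [hs]
  · intro j _ hj
    refine indicator_of_notMem (fun h => ?_) _
    rcases lt_or_gt_of_ne hj with h' | h'
    · exact absurd (h.2.trans (hτ h')) (not_le.2 hs.1)
    · exact absurd (hs.2.trans (hτ h')) (not_le.2 h.1)
  · intro h; exact absurd (Finset.mem_range.2 hk) h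

namespace SimpleIntegrand

variable {F : ℝ → MeasurableSpace Ω} {T : ℝ} {P : Measure Ω} [IsProbabilityMeasure P]
  {B : ℝ → Ω → EuclideanSpace ℝ (Fin d)}

/-- The integral of a simple integrand with respect to a vector valued process. -/
def sint (S : SimpleIntegrand F T d) (B : ℝ → Ω → EuclideanSpace ℝ (Fin d)) (t : ℝ) (ω : Ω) : ℝ :=
  stochSum B S.time S.coef S.n t ω

lemma integral_eq_sint {W : Fin d → ℝ≥0 → Ω → ℝ} (S : SimpleIntegrand F T d) (t : ℝ) (ω : Ω) :
    S.integral W t ω = S.sint (vecBM W) t ω := S.integral_eq t ω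

lemma eval_of_mem (S : SimpleIntegrand F T d) {k : ℕ} (hk : k < S.n) {s : ℝ}
    (hs : s ∈ Ioc (S.time k) (S.time (k + 1))) (ω : Ω) : S.eval s ω = S.coef k ω :=
  sum_indicator_of_mem S.time_mono _ hk hs

lemma eval_of_forall_notMem (S : SimpleIntegrand F T d) {s : ℝ}
    (hs : ∀ k < S.n, s ∉ Ioc (S.time k) (S.time (k + 1))) (ω : Ω) : S.eval s ω = 0 :=
  Finset.sum_eq_zero fun k hk => indicator_of_notMem (hs k (Finset.mem_range.1 hk)) _

lemma enorm_eval_sq (S : SimpleIntegrand F T d) (s : ℝ) (ω : Ω) :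
    ‖S.eval s ω‖ₑ ^ 2 = ∑ k ∈ Finset.range S.n,
      (Ioc (S.time k) (S.time (k + 1))).indicator (fun _ => ‖S.coef k ω‖ₑ ^ 2) s := by
  by_cases h : ∃ k < S.n, s ∈ Ioc (S.time k) (S.time (k + 1))
  · obtain ⟨k, hk, hs⟩ := h
    rw [S.eval_of_mem hk hs,
      sum_indicator_of_mem S.time_mono (fun k => ‖S.coef k ω‖ₑ ^ 2) hk hs]
  · push Not at h
    rw [S.eval_of_forall_notMem h, Finset.sum_eq_zero]
    · simp
    · exact fun k hk => indicator_of_notMem (h k (Finset.mem_range.1 hk)) _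

/-- The quadratic variation `∑ |coef k|² (t_{k+1} ∧ t - t_k ∧ t)`. -/
def qv (S : SimpleIntegrand F T d) (t : ℝ) (ω : Ω) : ℝ :=
  ∑ k ∈ Finset.range S.n, ‖S.coef k ω‖ ^ 2 * (min (S.time (k + 1)) t - min (S.time k) t)

lemma qv_term_nonneg (S : SimpleIntegrand F T d) (t : ℝ) (ω : Ω) (k : ℕ) :
    0 ≤ ‖S.coef k ω‖ ^ 2 * (min (S.time (k + 1)) t - min (S.time k) t) :=
  mul_nonneg (by positivity) (sub_nonneg.2 (min_le_min_right _ (S.time_mono k.le_succ)))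

lemma qv_nonneg (S : SimpleIntegrand F T d) (t : ℝ) (ω : Ω) : 0 ≤ S.qv t ω :=
  Finset.sum_nonneg fun k _ => S.qv_term_nonneg t ω k

/-- This pathwise identity lets `qv` be controlled by the distance between integrands in `L²(dt)`.
It is exact because the cells are disjoint and lie to the right of `0`. -/
lemma lintegral_eval_sq (S : SimpleIntegrand F T d) (t : ℝ) (ω : Ω) :
    ∫⁻ s in Icc 0 t, ‖S.eval s ω‖ₑ ^ 2 = ENNReal.ofReal (S.qv t ω) := by
  simp_rw [enorm_eval_sq]
  rw [lintegral_finsetSum _ fun k _ => measurable_const.indicator measurableSet_Ioc]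
  rw [qv, ENNReal.ofReal_sum_of_nonneg fun k _ => S.qv_term_nonneg t ω k]
  refine Finset.sum_congr rfl fun k _ => ?_
  rw [lintegral_indicator measurableSet_Ioc, setLIntegral_const,
    Measure.restrict_apply measurableSet_Ioc, ENNReal.ofReal_mul (by positivity)]
  have h1 : Ioc (S.time k) (S.time (k + 1)) ∩ Icc 0 t =
      Ioc (min (S.time k) t) (min (S.time (k + 1)) t) := by
    ext s
    simp only [mem_inter_iff, mem_Ioc, mem_Icc, min_lt_iff, le_min_iff]
    constructor
    · rintro ⟨⟨h1, h2⟩, h3, h4⟩; exact ⟨Or.inl h1, h2, h4⟩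
    · rintro ⟨h1, h2, h3⟩
      have h5 : S.time k < s := h1.elim id fun h => absurd h3 (not_le.2 h)
      exact ⟨⟨h5, h2⟩, (S.time_mem k).1.trans h5.le, h3⟩
  rw [h1, Real.volume_Ioc]
  congr 1
  rw [ENNReal.ofReal_pow (norm_nonneg _), ofReal_norm]

lemma measurable_coef (S : SimpleIntegrand F T d) (hF : ∀ t, F t ≤ mΩ) (k : ℕ) :
    Measurable (S.coef k) := (S.coef_meas k).mono (hF _) le_rfl

lemma measurable_eval (S : SimpleIntegrand F T d) (hF : ∀ t, F t ≤ mΩ) :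
    Measurable (fun p : ℝ × Ω => S.eval p.1 p.2) := by
  unfold eval
  refine Finset.measurable_sum _ fun k _ => ?_
  have : (fun p : ℝ × Ω => (Ioc (S.time k) (S.time (k + 1))).indicator
      (fun _ => S.coef k p.2) p.1) =
      (Ioc (S.time k) (S.time (k + 1)) ×ˢ univ).indicator fun p => S.coef k p.2 := by
    funext p
    by_cases h : p.1 ∈ Ioc (S.time k) (S.time (k + 1))
    · rw [indicator_of_mem h, indicator_of_mem (by exact ⟨h, mem_univ _⟩)]
    · rw [indicator_of_notMem h, indicator_of_notMem (by exact fun h' => h h'.1)]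
  rw [this]
  exact ((S.measurable_coef hF k).comp measurable_snd).indicator
    (measurableSet_Ioc.prod MeasurableSet.univ)

lemma measurable_qv (S : SimpleIntegrand F T d) (hF : ∀ t, F t ≤ mΩ) (t : ℝ) :
    Measurable (S.qv t) :=
  Finset.measurable_sum _ fun k _ => (((S.measurable_coef hF k).norm.pow_const 2).mul_const _)

lemma integral_sint_sq (S : SimpleIntegrand F T d) (hB : IsLevy F P T B) (hF : ∀ t, F t ≤ mΩ)
    (hmono : Monotone F) {t : ℝ} (ht : t ∈ Icc 0 T) :
    ∫ ω, (S.sint B t ω) ^ 2 ∂P = ∫ ω, S.qv t ω ∂P := by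
  obtain ⟨C, hC⟩ := S.coef_bdd
  simp only [sint]
  rw [integral_stochSum_sq hB hF hmono S.time_mono S.time_mem S.coef_meas hC ht]
  unfold qv
  rw [integral_finsetSum]
  · exact Finset.sum_congr rfl fun k _ => (integral_mul_const _ _).symm
  · intro k _
    refine Integrable.mul_const ?_ _
    refine Integrable.of_bound ((S.measurable_coef hF k).norm.pow_const 2).aestronglyMeasurable
      (C ^ 2) (Eventually.of_forall fun ω => ?_)
    rw [norm_pow, norm_norm]
    exact pow_le_pow_left₀ (norm_nonneg _) (hC k ω) 2

lemma memLp_sint (S : SimpleIntegrand F T d) (hB : IsLevy F P T B) (hF : ∀ t, F t ≤ mΩ)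
    {t : ℝ} (ht : t ∈ Icc 0 T) : MemLp (S.sint B t) 2 P := by
  obtain ⟨C, hC⟩ := S.coef_bdd
  exact memLp_stochSum hB hF S.time_mono S.time_mem S.coef_meas hC ht

lemma measurable_sint (S : SimpleIntegrand F T d) (hB : IsLevy F P T B) (hmono : Monotone F)
    {t : ℝ} (ht : t ∈ Icc 0 T) : Measurable[F t] (S.sint B t) :=
  measurable_stochSum hB hmono S.time_mono S.time_mem S.coef_meas ht

lemma setIntegral_sint (S : SimpleIntegrand F T d) (hB : IsLevy F P T B) (hF : ∀ t, F t ≤ mΩ)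
    (hmono : Monotone F) {s t : ℝ} (hs : 0 ≤ s) (hst : s ≤ t) (ht : t ≤ T) {A : Set Ω}
    (hA : MeasurableSet[F s] A) : ∫ ω in A, S.sint B t ω ∂P = ∫ ω in A, S.sint B s ω ∂P := by
  obtain ⟨C, hC⟩ := S.coef_bdd
  exact setIntegral_stochSum hB hF hmono S.time_mono S.time_mem S.coef_meas hC hs hst ht hA

lemma sint_zero (S : SimpleIntegrand F T d) (ω : Ω) : S.sint B 0 ω = 0 := by
  unfold sint stochSum
  refine Finset.sum_eq_zero fun k _ => ?_
  simp [min_eq_right (S.time_mem k).1, min_eq_right (S.time_mem (k + 1)).1]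

lemma integral_sint (S : SimpleIntegrand F T d) (hB : IsLevy F P T B) (hF : ∀ t, F t ≤ mΩ)
    (hmono : Monotone F) {t : ℝ} (ht : t ∈ Icc 0 T) : ∫ ω, S.sint B t ω ∂P = 0 := by
  have := S.setIntegral_sint hB hF hmono le_rfl ht.1 ht.2 (@MeasurableSet.univ _ (F 0))
  simpa [sint_zero] using this

lemma continuous_sint (S : SimpleIntegrand F T d) {ω : Ω} (h : ContinuousOn (B · ω) (Icc 0 T)) :
    ContinuousOn (fun t => S.sint B t ω) (Icc 0 T) := by
  unfold sint stochSum
  refine continuousOn_finsetSum _ fun k _ => ?_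
  refine ContinuousOn.inner (𝕜 := ℝ) continuousOn_const ?_
  have h1 : ∀ k, ContinuousOn (fun t => B (min (S.time k) t) ω) (Icc 0 T) := fun k =>
    h.comp (by fun_prop) fun t ht => ⟨le_min (S.time_mem k).1 ht.1, min_le_of_right_le ht.2⟩
  exact (h1 _).sub (h1 _)

/-! #### Common refinement -/

/-- The times of two simple integrands. -/
def times (S S' : SimpleIntegrand F T d) : Finset ℝ :=
  (Finset.range (S.n + 1)).image S.time ∪ (Finset.range (S'.n + 1)).image S'.time

lemma times_card_pos (S S' : SimpleIntegrand F T d) : 0 < (times S S').card :=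
  Finset.card_pos.2 ⟨S.time 0, Finset.mem_union_left _ (Finset.mem_image_of_mem _ (by simp))⟩

/-- The increasing enumeration of the times of two simple integrands. -/
def mergeTime (S S' : SimpleIntegrand F T d) (k : ℕ) : ℝ :=
  -- Clipping the index makes the finite list of times an eventually constant sequence; `card`
  -- points bound `card - 1` cells.
  (times S S').orderEmbOfFin rfl
    ⟨min k ((times S S').card - 1), by have := times_card_pos S S'; omega⟩

lemma mergeTime_mono (S S' : SimpleIntegrand F T d) : Monotone (mergeTime S S') := fun i j hij => by
  refine ((times S S').orderEmbOfFin rfl).monotone ?_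
  simp only [Fin.mk_le_mk]
  omega

lemma mergeTime_mem_times (S S' : SimpleIntegrand F T d) (k : ℕ) :
    mergeTime S S' k ∈ times S S' := Finset.orderEmbOfFin_mem _ _ _

lemma mergeTime_mem (S S' : SimpleIntegrand F T d) (k : ℕ) : mergeTime S S' k ∈ Icc 0 T := by
  have := mergeTime_mem_times S S' k
  simp only [times, Finset.mem_union, Finset.mem_image] at this
  rcases this with ⟨j, -, h⟩ | ⟨j, -, h⟩
  · exact h ▸ S.time_mem j
  · exact h ▸ S'.time_mem j

lemma exists_mergeTime_eq {S S' : SimpleIntegrand F T d} {x : ℝ} (hx : x ∈ times S S') :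
    ∃ q ≤ (times S S').card - 1, mergeTime S S' q = x := by
  have : x ∈ Set.range ((times S S').orderEmbOfFin rfl) := by
    rw [Finset.range_orderEmbOfFin]; exact hx
  obtain ⟨i, hi⟩ := this
  have hi' := i.2
  refine ⟨i, by omega, ?_⟩
  rw [mergeTime, ← hi]
  congr 1
  ext
  simp only []
  omega

lemma le_mergeTime {S S' : SimpleIntegrand F T d} {x : ℝ} (hx : x ∈ times S S') {k : ℕ}
    (h : x < mergeTime S S' (k + 1)) : x ≤ mergeTime S S' k := by
  obtain ⟨q, -, rfl⟩ := exists_mergeTime_eq hx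
  refine mergeTime_mono S S' ?_
  by_contra hq
  exact absurd (mergeTime_mono S S' (show k + 1 ≤ q by omega)) (not_le.2 h)

/-- If `b` is the `q`-th merged time, the cells counted are exactly those with index below `q`, and
the sum telescopes. -/
lemma sum_mergeTime_le {S S' : SimpleIntegrand F T d} {b : ℝ} (hb : b ∈ times S S')
    {G : Type*} [AddCommGroup G] (g : ℝ → G) :
    ∑ k ∈ Finset.range ((times S S').card - 1), (if mergeTime S S' (k + 1) ≤ b then
      g (mergeTime S S' (k + 1)) - g (mergeTime S S' k) else 0) = g b - g (mergeTime S S' 0) := by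
  obtain ⟨q, hq, rfl⟩ := exists_mergeTime_eq hb
  have hcond : ∀ k ∈ Finset.range ((times S S').card - 1),
      (mergeTime S S' (k + 1) ≤ mergeTime S S' q ↔ k < q) := by
    intro k hk
    have hk := Finset.mem_range.1 hk
    rw [mergeTime, mergeTime, OrderEmbedding.le_iff_le, Fin.mk_le_mk]
    omega
  rw [Finset.sum_congr rfl fun k hk => by rw [if_congr (hcond k hk) rfl rfl]]
  rw [← Finset.sum_filter]
  have : (Finset.range ((times S S').card - 1)).filter (fun k => k < q) = Finset.range q := by
    ext k; simp only [Finset.mem_filter, Finset.mem_range]; omega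
  rw [this, Finset.sum_range_sub (fun k => g (mergeTime S S' k))]

lemma sum_mergeTime {S S' : SimpleIntegrand F T d} {a b : ℝ} (ha : a ∈ times S S')
    (hb : b ∈ times S S') (hab : a ≤ b) {G : Type*} [AddCommGroup G] (g : ℝ → G) :
    ∑ k ∈ Finset.range ((times S S').card - 1), (if mergeTime S S' (k + 1) ∈ Ioc a b then
      g (mergeTime S S' (k + 1)) - g (mergeTime S S' k) else 0) = g b - g a := by
  have h := congrArg₂ (· - ·) (sum_mergeTime_le hb g) (sum_mergeTime_le ha g)
  simp only [sub_sub_sub_cancel_right] at h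
  rw [← h, ← Finset.sum_sub_distrib]
  refine Finset.sum_congr rfl fun k _ => ?_
  by_cases h1 : mergeTime S S' (k + 1) ≤ a
  · simp [h1, h1.trans hab, not_lt.2 h1]
  · simp [h1, not_le.1 h1]

/-- The times of `U` are merged times, so a merged cell whose right end lies in a cell of `U` cannot
begin before that cell. Its coefficient is therefore known at the left end. -/
lemma measurable_eval_mergeTime {S S' : SimpleIntegrand F T d} (hmono : Monotone F)
    (U : SimpleIntegrand F T d) (hU : ∀ j ≤ U.n, U.time j ∈ times S S') (k : ℕ) :
    Measurable[F (mergeTime S S' k)] (U.eval (mergeTime S S' (k + 1))) := by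
  unfold eval
  refine Finset.measurable_sum _ fun j hj => ?_
  by_cases h : mergeTime S S' (k + 1) ∈ Ioc (U.time j) (U.time (j + 1))
  · simp only [indicator_of_mem h]
    exact (U.coef_meas j).mono
      (hmono (le_mergeTime (hU j (Finset.mem_range.1 hj).le) h.1)) le_rfl
  · simp only [indicator_of_notMem h]
    exact measurable_const

lemma left_mem_times (S S' : SimpleIntegrand F T d) : ∀ j ≤ S.n, S.time j ∈ times S S' :=
  fun _ hj => Finset.mem_union_left _
    (Finset.mem_image_of_mem _ (Finset.mem_range.2 (Nat.lt_succ_of_le hj)))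

lemma right_mem_times (S S' : SimpleIntegrand F T d) : ∀ j ≤ S'.n, S'.time j ∈ times S S' :=
  fun _ hj => Finset.mem_union_right _
    (Finset.mem_image_of_mem _ (Finset.mem_range.2 (Nat.lt_succ_of_le hj)))

lemma norm_eval_le (S : SimpleIntegrand F T d) {C : ℝ} (hC : ∀ k ω, ‖S.coef k ω‖ ≤ C) (s : ℝ)
    (ω : Ω) : ‖S.eval s ω‖ ≤ C := by
  by_cases h : ∃ k < S.n, s ∈ Ioc (S.time k) (S.time (k + 1))
  · obtain ⟨k, hk, hs⟩ := h
    rw [S.eval_of_mem hk hs]; exact hC k ω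
  · push Not at h
    rw [S.eval_of_forall_notMem h, norm_zero]
    exact (norm_nonneg _).trans (hC 0 ω)

/-- The difference of two simple integrands, on the common refinement of their partitions. -/
def sub (S S' : SimpleIntegrand F T d) (hmono : Monotone F) : SimpleIntegrand F T d where
  n := (times S S').card - 1
  time := mergeTime S S'
  time_mono := mergeTime_mono S S'
  time_mem := mergeTime_mem S S'
  coef k ω := S.eval (mergeTime S S' (k + 1)) ω - S'.eval (mergeTime S S' (k + 1)) ω
  coef_meas k := (measurable_eval_mergeTime hmono S (left_mem_times S S') k).sub
    (measurable_eval_mergeTime hmono S' (right_mem_times S S') k)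
  coef_bdd := by
    obtain ⟨C, hC⟩ := S.coef_bdd
    obtain ⟨C', hC'⟩ := S'.coef_bdd
    exact ⟨C + C', fun k ω => (norm_sub_le _ _).trans
      (add_le_add (S.norm_eval_le hC _ _) (S'.norm_eval_le hC' _ _))⟩

/-- Passing to the refinement leaves sums of coefficients against increments unchanged. The general
`g` and biadditive `L` serve two purposes: stochastic integrals, with `g` the stopped path of `B`,
and pointwise values, with `g` a step function. -/
lemma sum_mergeTime_eval {S S' U : SimpleIntegrand F T d} (hU : ∀ j ≤ U.n, U.time j ∈ times S S')
    {G : Type*} [AddCommGroup G] (g : ℝ → G) (L : EuclideanSpace ℝ (Fin d) →+ G →+ ℝ) (ω : Ω) :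
    ∑ k ∈ Finset.range ((times S S').card - 1), L (U.eval (mergeTime S S' (k + 1)) ω)
      (g (mergeTime S S' (k + 1)) - g (mergeTime S S' k)) =
    ∑ j ∈ Finset.range U.n, L (U.coef j ω) (g (U.time (j + 1)) - g (U.time j)) := by
  have h1 : ∀ k, L (U.eval (mergeTime S S' (k + 1)) ω)
      (g (mergeTime S S' (k + 1)) - g (mergeTime S S' k)) =
      ∑ j ∈ Finset.range U.n, L (U.coef j ω) (if mergeTime S S' (k + 1) ∈
        Ioc (U.time j) (U.time (j + 1)) then
        g (mergeTime S S' (k + 1)) - g (mergeTime S S' k) else 0) := by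
    intro k
    rw [eval, map_sum, AddMonoidHom.finsetSum_apply]
    refine Finset.sum_congr rfl fun j _ => ?_
    by_cases h : mergeTime S S' (k + 1) ∈ Ioc (U.time j) (U.time (j + 1))
    · rw [indicator_of_mem h, if_pos h]
    · rw [indicator_of_notMem h, if_neg h]; simp
  simp_rw [h1]
  rw [Finset.sum_comm]
  refine Finset.sum_congr rfl fun j hj => ?_
  have hj := Finset.mem_range.1 hj
  rw [← map_sum, sum_mergeTime (hU j hj.le) (hU (j + 1) hj) (U.time_mono j.le_succ)]

lemma sub_sint (S S' : SimpleIntegrand F T d) (hmono : Monotone F) (t : ℝ) (ω : Ω) :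
    (S.sub S' hmono).sint B t ω = S.sint B t ω - S'.sint B t ω := by
  let L : EuclideanSpace ℝ (Fin d) →+ EuclideanSpace ℝ (Fin d) →+ ℝ :=
    AddMonoidHom.mk' (fun u => AddMonoidHom.mk' (fun v => (inner ℝ u v : ℝ))
      (fun a b => inner_add_right u a b)) (fun a b => by ext v; exact inner_add_left a b v)
  have h1 := sum_mergeTime_eval (left_mem_times S S') (fun x => B (min x t) ω) L ω
  have h2 := sum_mergeTime_eval (right_mem_times S S') (fun x => B (min x t) ω) L ω
  simp only [L, AddMonoidHom.mk'_apply] at h1 h2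
  unfold sint stochSum
  rw [← h1, ← h2, ← Finset.sum_sub_distrib]
  refine Finset.sum_congr rfl fun k _ => ?_
  simp only [sub]
  rw [inner_sub_left]

lemma sub_eval (S S' : SimpleIntegrand F T d) (hmono : Monotone F) (s : ℝ) (ω : Ω) :
    (S.sub S' hmono).eval s ω = S.eval s ω - S'.eval s ω := by
  -- The indicator of `(a, b]` at `s` is the increment from `a` to `b` of the step function `x ↦
  -- 1_{s ≤ x}`, so the value at `s` is itself a sum of coefficients against increments.
  have key : ∀ U : SimpleIntegrand F T d, ∀ i : Fin d, ∀ j,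
      ((Ioc (U.time j) (U.time (j + 1))).indicator (fun _ => U.coef j ω) s) i =
      U.coef j ω i * ((if s ≤ U.time (j + 1) then 1 else 0) - (if s ≤ U.time j then 1 else 0)) := by
    intro U i j
    by_cases h1 : s ≤ U.time j
    · have : s ∉ Ioc (U.time j) (U.time (j + 1)) := fun h => absurd h.1 (not_lt.2 h1)
      simp [this, h1, h1.trans (U.time_mono j.le_succ)]
    · by_cases h2 : s ≤ U.time (j + 1)
      · have : s ∈ Ioc (U.time j) (U.time (j + 1)) := ⟨not_le.1 h1, h2⟩
        rw [indicator_of_mem this]; simp [h1, h2]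
      · have : s ∉ Ioc (U.time j) (U.time (j + 1)) := fun h => h2 h.2
        simp [this, h1, h2]
  have key2 : ∀ U : SimpleIntegrand F T d, ∀ i : Fin d, (U.eval s ω) i = ∑ j ∈ Finset.range U.n,
      U.coef j ω i * ((if s ≤ U.time (j + 1) then 1 else 0) - (if s ≤ U.time j then 1 else 0)) := by
    intro U i
    rw [eval, WithLp.ofLp_sum, Finset.sum_apply]
    exact Finset.sum_congr rfl fun j _ => key U i j
  ext i
  let L : EuclideanSpace ℝ (Fin d) →+ ℝ →+ ℝ :=
    AddMonoidHom.mk' (fun u => AddMonoidHom.mk' (fun v => u i * v)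
      (fun a b => mul_add _ _ _)) (fun a b => by ext; simp [add_mul])
  have h1 := sum_mergeTime_eval (left_mem_times S S') (fun x => if s ≤ x then (1 : ℝ) else 0) L ω
  have h2 := sum_mergeTime_eval (right_mem_times S S') (fun x => if s ≤ x then (1 : ℝ) else 0) L ω
  simp only [L, AddMonoidHom.mk'_apply] at h1 h2
  rw [PiLp.sub_apply, key2, key2, key2, ← h1, ← h2, ← Finset.sum_sub_distrib]
  refine Finset.sum_congr rfl fun k _ => ?_
  simp only [sub, PiLp.sub_apply]
  rw [sub_mul]
  rfl

end SimpleIntegrand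

/-! ### Maximal inequality for continuous martingales -/

section Maximal

variable {F : ℝ → MeasurableSpace Ω} {P : Measure Ω} [IsProbabilityMeasure P] {T : ℝ}

/-- The dyadic points just below `t` stay in `[0, T]` and converge to `t`, and `a < g` is an open
condition. -/
lemma exists_dyadic_lt {g : ℝ → ℝ} {T a t : ℝ} (hT : 0 < T) (hg : ContinuousOn g (Icc 0 T))
    (ht : t ∈ Icc 0 T) (ha : a < g t) :
    ∃ m k : ℕ, k ≤ 2 ^ m ∧ a < g (k * (T / 2 ^ m)) := by
  have h2 : Tendsto (fun m : ℕ => T / (2 : ℝ) ^ m) atTop (𝓝 0) :=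
    tendsto_const_nhds.div_atTop (tendsto_pow_atTop_atTop_of_one_lt one_lt_two)
  let k : ℕ → ℕ := fun m => ⌊t / (T / 2 ^ m)⌋₊
  have hpos : ∀ m : ℕ, 0 < T / (2 : ℝ) ^ m := fun m => by positivity
  have hle : ∀ m, (k m : ℝ) * (T / 2 ^ m) ≤ t := fun m => by
    rw [← le_div_iff₀ (hpos m)]
    exact Nat.floor_le (div_nonneg ht.1 (hpos m).le)
  have hge : ∀ m, t - T / 2 ^ m ≤ (k m : ℝ) * (T / 2 ^ m) := fun m => by
    have := (Nat.lt_floor_add_one (t / (T / 2 ^ m))).le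
    rw [div_le_iff₀ (hpos m)] at this
    have h3 : (k m : ℝ) = (⌊t / (T / 2 ^ m)⌋₊ : ℝ) := rfl
    rw [h3]; linarith
  have hlim : Tendsto (fun m => (k m : ℝ) * (T / 2 ^ m)) atTop (𝓝 t) := by
    refine tendsto_of_tendsto_of_tendsto_of_le_of_le ?_ tendsto_const_nhds hge hle
    simpa using tendsto_const_nhds.sub h2
  have hmem : ∀ m, (k m : ℝ) * (T / 2 ^ m) ∈ Icc 0 T := fun m =>
    ⟨mul_nonneg (Nat.cast_nonneg _) (hpos m).le, (hle m).trans ht.2⟩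
  have hlim' := (hg t ht).tendsto.comp
    (tendsto_nhdsWithin_iff.2 ⟨hlim, Eventually.of_forall hmem⟩)
  obtain ⟨m, hm⟩ := (hlim'.eventually_const_lt ha).exists
  refine ⟨m, k m, ?_, hm⟩
  have h5 : (k m : ℝ) ≤ 2 ^ m := by
    have := (hmem m).2
    rw [← le_div_iff₀ (hpos m)] at this
    rwa [div_div_cancel₀ hT.ne'] at this
  exact_mod_cast h5

/-- Sampled on the grid, `N` is a discrete martingale and `|N| = max(N, -N)` a submartingale, so
Doob's discrete inequality applies. -/
lemma discrete_maximal {T : ℝ} (hT : 0 < T) (hF : ∀ t, F t ≤ mΩ) (hmono : Monotone F)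
    {N : ℝ → Ω → ℝ}
    (hN : ∀ t ∈ Icc 0 T, Measurable[F t] (N t)) (hint : ∀ t ∈ Icc 0 T, Integrable (N t) P)
    (hmart : ∀ s t, 0 ≤ s → s ≤ t → t ≤ T → ∀ A, MeasurableSet[F s] A →
      ∫ ω in A, N t ω ∂P = ∫ ω in A, N s ω ∂P) {ε : ℝ} (hε : 0 < ε) (n : ℕ) (hn : n ≠ 0) :
    P {ω | ∃ k ≤ n, ε ≤ |N (k * (T / n)) ω|} ≤ ENNReal.ofReal ((∫ ω, |N T ω| ∂P) / ε) := by
  have hnpos : (0 : ℝ) < n := by exact_mod_cast Nat.pos_of_ne_zero hn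
  let τ : ℕ → ℝ := fun k => min (k * (T / n)) T
  have hτ : Monotone τ := fun i j hij => min_le_min_right _ (by gcongr)
  have hτT : ∀ k, τ k ∈ Icc 0 T := fun k => ⟨le_min (by positivity) hT.le, min_le_right _ _⟩
  have hτk : ∀ k ≤ n, τ k = k * (T / n) := fun k hk => by
    refine min_eq_left ?_
    rw [mul_div_assoc', div_le_iff₀ hnpos, mul_comm]
    have : (k : ℝ) ≤ n := by exact_mod_cast hk
    gcongr
  let 𝒢 : Filtration ℕ mΩ := ⟨fun k => F (τ k), fun i j hij => hmono (hτ hij), fun k => hF _⟩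
  have hM : Martingale (fun k => N (τ k)) 𝒢 P := by
    refine martingale_of_setIntegral_eq_succ (fun k => ?_) (fun k => hint _ (hτT k)) ?_
    · exact (hN _ (hτT k)).stronglyMeasurable
    · intro k A hA
      exact (hmart _ _ (hτT k).1 (hτ k.le_succ) (hτT _).2 A hA).symm
  have hsub : Submartingale (fun k ω => |N (τ k) ω|) 𝒢 P := by
    have := hM.submartingale.sup hM.neg.submartingale
    exact this
  have hmax := maximal_ineq hsub (fun k ω => abs_nonneg _) (ε := ε.toNNReal) n
  have hset : {ω | ∃ k ≤ n, ε ≤ |N (k * (T / n)) ω|} = {ω | ((ε.toNNReal : ℝ≥0) : ℝ) ≤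
      (Finset.range (n + 1)).sup' Finset.nonempty_range_add_one fun k => |N (τ k) ω|} := by
    ext ω
    simp only [Set.mem_ofPred_eq, Real.coe_toNNReal _ hε.le, Finset.le_sup'_iff, Finset.mem_range]
    constructor
    · rintro ⟨k, hk, h⟩
      exact ⟨k, by omega, by rwa [hτk k hk]⟩
    · rintro ⟨k, hk, h⟩
      refine ⟨k, by omega, ?_⟩
      rwa [hτk k (by omega)] at h
  rw [hset]
  set G := {ω | ((ε.toNNReal : ℝ≥0) : ℝ) ≤
      (Finset.range (n + 1)).sup' Finset.nonempty_range_add_one fun k => |N (τ k) ω|}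
  have hTn : τ n = T := by
    rw [hτk n le_rfl]; field_simp
  rw [hTn] at hmax
  have h1 : ENNReal.ofReal (∫ ω in G, |N T ω| ∂P) ≤ ENNReal.ofReal (∫ ω, |N T ω| ∂P) :=
    ENNReal.ofReal_le_ofReal (setIntegral_le_integral (hint T ⟨hT.le, le_rfl⟩).abs
      (Eventually.of_forall fun ω => abs_nonneg _))
  change ENNReal.ofReal ε * P G ≤ _ at hmax
  rw [ENNReal.ofReal_div_of_pos hε, ENNReal.le_div_iff_mul_le
    (Or.inl (ENNReal.ofReal_pos.2 hε).ne') (Or.inl ENNReal.ofReal_ne_top), mul_comm]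
  exact hmax.trans h1

/-- Doob's maximal inequality for a martingale on `[0,T]` with continuous paths. -/
lemma continuous_maximal (hT : 0 < T) (hF : ∀ t, F t ≤ mΩ) (hmono : Monotone F) {N : ℝ → Ω → ℝ}
    (hN : ∀ t ∈ Icc 0 T, Measurable[F t] (N t)) (hint : ∀ t ∈ Icc 0 T, Integrable (N t) P)
    (hmart : ∀ s t, 0 ≤ s → s ≤ t → t ≤ T → ∀ A, MeasurableSet[F s] A →
      ∫ ω in A, N t ω ∂P = ∫ ω in A, N s ω ∂P)
    (hc : ∀ᵐ ω ∂P, ContinuousOn (fun t => N t ω) (Icc 0 T)) {ε : ℝ} (hε : 0 < ε) :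
    P {ω | ∃ t ∈ Icc 0 T, ε ≤ |N t ω|} ≤ ENNReal.ofReal (2 * (∫ ω, |N T ω| ∂P) / ε) := by
  -- The dyadic grids are nested, so these events increase. Lowering the level to `ε / 2` turns `ε ≤
  -- |N t|` into a strict inequality that survives at nearby dyadic times; this costs the factor `2`
  -- in the bound.
  let G : ℕ → Set Ω := fun m => {ω | ∃ k : ℕ, k ≤ 2 ^ m ∧ ε / 2 ≤ |N (k * (T / 2 ^ m)) ω|}
  have hG : Monotone G := by
    refine monotone_nat_of_le_succ fun m ω => ?_
    rintro ⟨k, hk, h⟩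
    refine ⟨2 * k, by rw [pow_succ]; omega, ?_⟩
    convert h using 3
    push_cast; rw [pow_succ]; field_simp
  have hsub : {ω | ∃ t ∈ Icc 0 T, ε ≤ |N t ω|} ≤ᵐ[P] ⋃ m, G m := by
    filter_upwards [hc] with ω hω
    rintro ⟨t, ht, h⟩
    obtain ⟨m, k, hk, h'⟩ := exists_dyadic_lt hT hω.abs ht
      (show ε / 2 < |N t ω| by linarith)
    exact mem_iUnion.2 ⟨m, k, hk, h'.le⟩
  refine (measure_mono_ae hsub).trans ?_
  rw [hG.measure_iUnion]
  refine iSup_le fun m => ?_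
  have := discrete_maximal hT hF hmono hN hint hmart (half_pos hε) (2 ^ m) (by positivity)
  push_cast at this
  refine this.trans (le_of_eq ?_)
  congr 1
  field_simp

end Maximal

/-! ### Mean square convergence -/

section MeanSquare

variable {α E : Type*} [MeasurableSpace α] [NormedAddCommGroup E] {μ : Measure α}

lemma lintegral_enorm_sq_eq (f : α → E) : ∫⁻ a, ‖f a‖ₑ ^ 2 ∂μ = eLpNorm f 2 μ ^ 2 := by
  rw [eLpNorm_eq_lintegral_rpow_enorm_toReal (by norm_num) (by norm_num)]
  simp only [ENNReal.toReal_ofNat, ENNReal.rpow_ofNat]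
  rw [← ENNReal.rpow_ofNat, ← ENNReal.rpow_mul]
  norm_num

/-- Continuity of the `L²` norm, from the triangle inequality in both directions. -/
lemma tendsto_lintegral_enorm_sq {f : ℕ → α → E} {g : α → E}
    (hf : ∀ n, AEStronglyMeasurable (f n) μ) (hg : AEStronglyMeasurable g μ)
    (h : Tendsto (fun n => ∫⁻ a, ‖f n a - g a‖ₑ ^ 2 ∂μ) atTop (𝓝 0)) :
    Tendsto (fun n => ∫⁻ a, ‖f n a‖ₑ ^ 2 ∂μ) atTop (𝓝 (∫⁻ a, ‖g a‖ₑ ^ 2 ∂μ)) := by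
  have h0 : Tendsto (fun n => eLpNorm (f n - g) 2 μ) atTop (𝓝 0) := by
    have h1 : ∀ n, eLpNorm (f n - g) 2 μ = (∫⁻ a, ‖f n a - g a‖ₑ ^ 2 ∂μ) ^ (1 / 2 : ℝ) := by
      intro n
      have := lintegral_enorm_sq_eq (μ := μ) (f n - g)
      simp only [Pi.sub_apply] at this
      rw [this, ← ENNReal.rpow_ofNat, ← ENNReal.rpow_mul]
      norm_num
    simp_rw [h1]
    have := (ENNReal.continuous_rpow_const (y := (1 / 2 : ℝ))).tendsto 0
    rw [ENNReal.zero_rpow_of_pos (by norm_num)] at this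
    exact this.comp h
  have h1 : Tendsto (fun n => eLpNorm (f n) 2 μ) atTop (𝓝 (eLpNorm g 2 μ)) := by
    refine tendsto_of_tendsto_of_tendsto_of_le_of_le
      (g := fun n => eLpNorm g 2 μ - eLpNorm (f n - g) 2 μ)
      (h := fun n => eLpNorm g 2 μ + eLpNorm (f n - g) 2 μ) ?_ ?_ ?_ ?_
    · simpa using ENNReal.Tendsto.sub tendsto_const_nhds h0 (Or.inr ENNReal.zero_ne_top)
    · simpa using tendsto_const_nhds.add h0
    · intro n
      have := eLpNorm_sub_le (p := 2) (hf n) ((hf n).sub hg) (by norm_num)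
      simp only [sub_sub_cancel] at this
      exact tsub_le_iff_right.2 this
    · intro n
      have := eLpNorm_add_le (p := 2) hg ((hf n).sub hg) (by norm_num)
      simpa using this
  simp_rw [lintegral_enorm_sq_eq]
  exact ((ENNReal.continuous_pow 2).tendsto _).comp h1

lemma integral_norm_sq_eq_toReal {g : α → E} (hg : AEStronglyMeasurable g μ) :
    ∫ a, ‖g a‖ ^ 2 ∂μ = (∫⁻ a, ‖g a‖ₑ ^ 2 ∂μ).toReal := by
  rw [integral_eq_lintegral_of_nonneg_ae (Eventually.of_forall fun a => by positivity)
    (by exact hg.norm.pow 2)]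
  congr 1
  refine lintegral_congr fun a => ?_
  rw [ENNReal.ofReal_pow (norm_nonneg _), ofReal_norm]

lemma lintegral_enorm_sq_ne_top {g : α → E} (hg : MemLp g 2 μ) :
    ∫⁻ a, ‖g a‖ₑ ^ 2 ∂μ ≠ ⊤ := by
  rw [lintegral_enorm_sq_eq]
  exact ENNReal.pow_ne_top hg.2.ne

end MeanSquare

/-! ### Approximation of deterministic integrands by step functions -/

/-- The uniform grid of step `T / N` on `[0,T]`. -/
def gridTime (T : ℝ) (N k : ℕ) : ℝ := min (k * (T / N)) T

section Grid

variable {T : ℝ} {N : ℕ}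

lemma gridTime_mono (hT : 0 ≤ T) : Monotone (gridTime T N) := fun i j hij =>
  min_le_min_right _ (by gcongr)

lemma gridTime_mem (hT : 0 ≤ T) (k : ℕ) : gridTime T N k ∈ Icc 0 T :=
  ⟨le_min (by positivity) hT, min_le_right _ _⟩

lemma gridTime_zero (hT : 0 ≤ T) : gridTime T N 0 = 0 := by simp [gridTime, hT]

lemma gridTime_last (hN : N ≠ 0) : gridTime T N N = T := by
  have : (N : ℝ) ≠ 0 := by exact_mod_cast hN
  rw [gridTime, mul_div_cancel₀ _ this, min_self]

lemma gridTime_succ_sub_le (hT : 0 ≤ T) (k : ℕ) :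
    gridTime T N (k + 1) - gridTime T N k ≤ T / N := by
  have h0 : 0 ≤ T / N := by positivity
  unfold gridTime
  push_cast
  rcases le_total ((k : ℝ) * (T / N)) T with h | h
  · rw [min_eq_left h]
    have := min_le_left ((k + 1 : ℝ) * (T / N)) T
    linarith
  · rw [min_eq_right h]
    have := min_le_right ((k + 1 : ℝ) * (T / N)) T
    linarith

lemma exists_mem_gridCell (hT : 0 ≤ T) (hN : N ≠ 0) {s : ℝ} (hs : s ∈ Ioc 0 T) :
    ∃ k < N, s ∈ Ioc (gridTime T N k) (gridTime T N (k + 1)) := by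
  by_contra! h
  have : ∀ k ≤ N, gridTime T N k < s := by
    intro k
    induction k with
    | zero => intro _; rw [gridTime_zero hT]; exact hs.1
    | succ k ih =>
      intro hk
      have h1 := ih (by omega)
      by_contra h2
      exact h k (by omega) ⟨h1, not_lt.1 h2⟩
  have := this N le_rfl
  rw [gridTime_last hN] at this
  exact absurd hs.2 (not_le.2 this)

end Grid

/-- The simple integrand with deterministic values `G (t_k)` on the uniform grid. -/
def gridIntegrand (F : ℝ → MeasurableSpace Ω) (T : ℝ) (hT : 0 ≤ T)
    (G : ℝ → EuclideanSpace ℝ (Fin d)) (hG : ∃ C, ∀ t, ‖G t‖ ≤ C) (N : ℕ) :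
    SimpleIntegrand F T d where
  n := N
  time := gridTime T N
  time_mono := gridTime_mono hT
  time_mem := gridTime_mem hT
  coef k _ := G (gridTime T N k)
  coef_meas _ := measurable_const
  coef_bdd := by
    obtain ⟨C, hC⟩ := hG
    exact ⟨C, fun _ _ => hC _⟩

/-- The step function with values `G (t_k)` on the uniform grid. -/
def gridStep (T : ℝ) (N : ℕ) (G : ℝ → EuclideanSpace ℝ (Fin d)) (s : ℝ) :
    EuclideanSpace ℝ (Fin d) :=
  ∑ k ∈ Finset.range N, (Ioc (gridTime T N k)
    (gridTime T N (k + 1))).indicator (fun _ => G (gridTime T N k)) s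

lemma gridStep_of_mem {T : ℝ} (hT : 0 ≤ T) {N : ℕ} {G : ℝ → EuclideanSpace ℝ (Fin d)} {k : ℕ}
    (hk : k < N) {s : ℝ} (hs : s ∈ Ioc (gridTime T N k) (gridTime T N (k + 1))) :
    gridStep T N G s = G (gridTime T N k) :=
  sum_indicator_of_mem (gridTime_mono hT) _ hk hs

lemma measurable_gridStep (T : ℝ) (N : ℕ) (G : ℝ → EuclideanSpace ℝ (Fin d)) :
    Measurable (gridStep T N G) :=
  Finset.measurable_fun_sum _ fun _ _ => measurable_const.indicator measurableSet_Ioc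

/-- Grid discretizations of a bounded continuous function approximate a given square integrable
function. -/
lemma exists_grid_approx {T : ℝ} (hT : 0 < T) {ψ : ℝ → EuclideanSpace ℝ (Fin d)}
    (hψ : MemLp ψ 2 (volume.restrict (Icc 0 T))) {ε : ℝ} (hε : 0 < ε) :
    ∃ (G : ℝ → EuclideanSpace ℝ (Fin d)) (_ : ∃ C, ∀ t, ‖G t‖ ≤ C) (N₀ : ℕ), ∀ N ≥ N₀,
      ∫⁻ s in Icc 0 T, ‖gridStep T N G s - ψ s‖ₑ ^ 2 ≤ ENNReal.ofReal (ε ^ 2) := by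
  -- Half of `ε` pays for the `L²` approximation by a continuous `G`. The other half pays for the
  -- discretisation of `G`: oscillation at most `ε / 2 / √T` on cells has `L²` norm at most `ε / 2`
  -- on `[0, T]`.
  obtain ⟨G, hG, -⟩ := hψ.exists_boundedContinuous_eLpNorm_sub_le (by norm_num)
    (ε := ENNReal.ofReal (ε / 2)) (ENNReal.ofReal_pos.2 (half_pos hε)).ne'
  have huc := isCompact_Icc.uniformContinuousOn_of_continuous
    (G.continuous.continuousOn (s := Icc 0 T))
  rw [Metric.uniformContinuousOn_iff] at huc
  have hsT : 0 < √T := Real.sqrt_pos.2 hT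
  obtain ⟨η, hη, hη'⟩ := huc (ε / 2 / √T) (by positivity)
  obtain ⟨N₀, hN₀⟩ := exists_nat_gt (T / η)
  refine ⟨G, ⟨‖G‖, G.norm_coe_le_norm⟩, N₀, fun N hN => ?_⟩
  have hNpos : (0 : ℝ) < N := (div_pos hT hη).trans (hN₀.trans_le (by exact_mod_cast hN))
  have hN0 : N ≠ 0 := by rintro rfl; simp at hNpos
  have hstep : T / N < η := by
    rw [div_lt_iff₀ hNpos, mul_comm, ← div_lt_iff₀ hη]
    exact hN₀.trans_le (by exact_mod_cast hN)
  have hae : ∀ᵐ s ∂volume.restrict (Icc 0 T), ‖gridStep T N G s - G s‖ ≤ ε / 2 / √T := by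
    -- The cells are open on the left, so the origin belongs to none of them.
    have h0 : ∀ᵐ s ∂volume.restrict (Icc (0 : ℝ) T), s ≠ 0 :=
      ae_restrict_of_ae (Measure.ae_ne volume 0)
    filter_upwards [h0, ae_restrict_mem measurableSet_Icc] with s hs0 hs
    obtain ⟨k, hk, hks⟩ := exists_mem_gridCell hT.le hN0 ⟨lt_of_le_of_ne hs.1 hs0.symm, hs.2⟩
    rw [gridStep_of_mem hT.le hk hks, ← dist_eq_norm]
    refine (hη' _ (gridTime_mem hT.le k) _ hs ?_).le
    rw [dist_comm, Real.dist_eq, abs_of_nonneg (by linarith [hks.1])]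
    have := gridTime_succ_sub_le (N := N) hT.le k
    linarith [hks.2]
  have h1 : eLpNorm (gridStep T N G - ⇑G) 2 (volume.restrict (Icc 0 T)) ≤
      ENNReal.ofReal (ε / 2) := by
    refine (eLpNorm_le_of_ae_bound (C := ε / 2 / √T) hae).trans ?_
    rw [Measure.restrict_apply_univ, Real.volume_Icc, sub_zero, ENNReal.toReal_ofNat,
      ENNReal.ofReal_rpow_of_pos hT, ← ENNReal.ofReal_mul (by positivity)]
    refine ENNReal.ofReal_le_ofReal (le_of_eq ?_)
    rw [← one_div, ← Real.sqrt_eq_rpow]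
    field_simp
  have hGm : AEStronglyMeasurable G (volume.restrict (Icc 0 T)) :=
    G.continuous.aestronglyMeasurable
  have h2 : eLpNorm (gridStep T N G - ψ) 2 (volume.restrict (Icc 0 T)) ≤ ENNReal.ofReal ε := by
    have := eLpNorm_add_le (p := 2)
      (((measurable_gridStep T N G).aestronglyMeasurable).sub hGm) (hGm.sub hψ.1) (by norm_num)
    rw [sub_add_sub_cancel] at this
    refine this.trans ?_
    rw [eLpNorm_sub_comm ⇑G ψ]
    refine (add_le_add h1 hG).trans ?_
    rw [← ENNReal.ofReal_add (by positivity) (by positivity), add_halves]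
  have h3 := lintegral_enorm_sq_eq (μ := volume.restrict (Icc 0 T)) (gridStep T N G - ψ)
  simp only [Pi.sub_apply] at h3
  rw [h3, ENNReal.ofReal_pow hε.le]
  gcongr

/-! ### Wiener integrals of deterministic functions -/

section Wiener

variable {F : ℝ → MeasurableSpace Ω} {P : Measure Ω} [IsProbabilityMeasure P] {T : ℝ}
  {B : ℝ → Ω → EuclideanSpace ℝ (Fin d)}

lemma SimpleIntegrand.sint_sub_of_mem (S : SimpleIntegrand F T d) {k : ℕ} (hk : k < S.n) {s t : ℝ}
    (hs : S.time k ≤ s) (hst : s ≤ t) (ht : t ≤ S.time (k + 1)) (ω : Ω) :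
    S.sint B t ω - S.sint B s ω = inner ℝ (S.coef k ω) (B t ω - B s ω) := by
  unfold sint stochSum
  rw [← Finset.sum_sub_distrib, Finset.sum_eq_single k]
  · rw [min_eq_right ht, min_eq_right (hst.trans ht), min_eq_left hs, min_eq_left (hs.trans hst),
      ← inner_sub_right, sub_sub_sub_cancel_right]
  · intro j _ hj
    rcases lt_or_gt_of_ne hj with h' | h'
    · have h1 := S.time_mono (show j + 1 ≤ k from h')
      have h2 := S.time_mono (show j ≤ k from h'.le)
      rw [min_eq_left (h1.trans hs), min_eq_left (h1.trans (hs.trans hst)),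
        min_eq_left (h2.trans hs), min_eq_left (h2.trans (hs.trans hst)), sub_self]
    · have h1 := S.time_mono (show k + 1 ≤ j + 1 by omega)
      have h2 := S.time_mono (show k + 1 ≤ j from h')
      rw [min_eq_right (ht.trans h1), min_eq_right (ht.trans h2),
        min_eq_right ((hst.trans ht).trans h1), min_eq_right ((hst.trans ht).trans h2)]
      simp
  · intro h; exact absurd (Finset.mem_range.2 hk) h

lemma intervalIntegrable_gridStep_sq {G : ℝ → EuclideanSpace ℝ (Fin d)} (hG : ∃ C, ∀ t, ‖G t‖ ≤ C)
    (hT : 0 ≤ T) (N : ℕ) (a : ℝ) (u : EuclideanSpace ℝ (Fin d)) (s t : ℝ) :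
    IntervalIntegrable (fun r => ‖a • gridStep T N G r + u‖ ^ 2) volume s t := by
  obtain ⟨C, hC⟩ := hG
  have : IsFiniteMeasure (volume.restrict (uIoc s t)) := ⟨by
    rw [Measure.restrict_apply_univ, uIoc, Real.volume_Ioc]; exact ENNReal.ofReal_lt_top⟩
  refine intervalIntegrable_iff.2 ⟨?_, HasFiniteIntegral.of_bounded (C := (|a| * C + ‖u‖) ^ 2)
    (Eventually.of_forall fun r => ?_)⟩
  · exact ((((measurable_gridStep T N G).const_smul a).add_const u).norm.pow_const
      2).aestronglyMeasurable
  · rw [Real.norm_of_nonneg (by positivity)]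
    have h1 : ‖gridStep T N G r‖ ≤ C :=
      SimpleIntegrand.norm_eval_le (gridIntegrand (Ω := Unit) (fun _ => ⊤) T hT G ⟨C, hC⟩ N)
        (fun _ _ => hC _) r ()
    have h2 : ‖a • gridStep T N G r + u‖ ≤ |a| * C + ‖u‖ := by
      refine (norm_add_le _ _).trans ?_
      rw [norm_smul, Real.norm_eq_abs]
      gcongr
    gcongr

/-- Induction on the number of cells. Inside a cell the combination is one scalar increment of `B`
along `a • G + u`; across a grid point independent increments add. The term in `u` is carried along
because Girsanov's theorem needs the joint law with `B`. -/
lemma isGaussInc_gridIntegrand (hB : IsLevy F P T B) (hF : ∀ t, F t ≤ mΩ) (hmono : Monotone F)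
    (hT : 0 ≤ T) {G : ℝ → EuclideanSpace ℝ (Fin d)} (hG : ∃ C, ∀ t, ‖G t‖ ≤ C) (N : ℕ)
    (a : ℝ) (u : EuclideanSpace ℝ (Fin d)) (k : ℕ) (hk : k ≤ N) {s t : ℝ} (hs : 0 ≤ s)
    (hst : s ≤ t) (ht : t ≤ gridTime T N k) :
    IsGaussInc F P s t (fun ω => a * ((gridIntegrand F T hT G hG N).sint B t ω -
      (gridIntegrand F T hT G hG N).sint B s ω) + inner ℝ u (B t ω - B s ω))
      (∫ r in s..t, ‖a • gridStep T N G r + u‖ ^ 2) := by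
  induction k generalizing s t with
  | zero =>
    rw [gridTime_zero hT] at ht
    obtain rfl : s = 0 := le_antisymm (hst.trans ht) hs
    obtain rfl : t = 0 := le_antisymm ht hst
    simpa using hB.incr le_rfl le_rfl hT 0
  | succ k ih =>
    have hcell : ∀ s, gridTime T N k ≤ s → s ≤ t →
        IsGaussInc F P s t (fun ω => a * ((gridIntegrand F T hT G hG N).sint B t ω -
        (gridIntegrand F T hT G hG N).sint B s ω) + inner ℝ u (B t ω - B s ω))
        (∫ r in s..t, ‖a • gridStep T N G r + u‖ ^ 2) := by
      intro s hks hst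
      have h1 := hB.incr ((gridTime_mem hT k).1.trans hks) hst
        (ht.trans (gridTime_mem hT (k + 1)).2) (a • G (gridTime T N k) + u)
      have h2 : ∫ r in s..t, ‖a • gridStep T N G r + u‖ ^ 2 =
          ‖a • G (gridTime T N k) + u‖ ^ 2 * (t - s) := by
        rw [intervalIntegral.integral_congr_ae
          (g := fun _ => ‖a • G (gridTime T N k) + u‖ ^ 2)]
        · rw [intervalIntegral.integral_const, smul_eq_mul, mul_comm]
        · refine Eventually.of_forall fun r hr => ?_
          rw [uIoc_of_le hst] at hr
          rw [gridStep_of_mem hT hk ⟨hks.trans_lt hr.1, hr.2.trans ht⟩]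
      rw [h2]
      convert h1 using 2 with ω
      rw [SimpleIntegrand.sint_sub_of_mem (k := k) _ (by exact hk) hks hst ht, inner_add_left,
        inner_smul_left]
      rfl
    by_cases h1 : t ≤ gridTime T N k
    · exact ih (by omega) hs hst h1
    · push Not at h1
      by_cases h2 : gridTime T N k ≤ s
      · exact hcell s h2 hst
      · push Not at h2
        have h3 := (ih (by omega) hs h2.le le_rfl).add (hcell _ le_rfl h1.le) hF hmono h2.le h1.le
          (intervalIntegral.integral_nonneg h2.le fun _ _ => by positivity)
          (intervalIntegral.integral_nonneg h1.le fun _ _ => by positivity)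
        rw [intervalIntegral.integral_add_adjacent_intervals
          (intervalIntegrable_gridStep_sq hG hT _ _ _ _ _)
          (intervalIntegrable_gridStep_sq hG hT _ _ _ _ _)] at h3
        convert h3 using 2 with ω
        rw [inner_sub_right, inner_sub_right, inner_sub_right]
        ring

lemma tendstoUniformlyOn_of_geometric {f : ℕ → ℝ → ℝ} {g : ℝ → ℝ} {s : Set ℝ}
    (h : ∀ᶠ n in atTop, ∀ t ∈ s, |f (n + 1) t - f n t| < (1 / 2) ^ n)
    (hg : ∀ t ∈ s, g t = limUnder atTop fun n => f n t) :
    TendstoUniformlyOn f g atTop s := by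
  obtain ⟨n₀, hn₀⟩ := eventually_atTop.1 h
  have hd : ∀ t ∈ s, ∀ n, dist (f (n + n₀) t) (f (n + 1 + n₀) t) ≤ (1 / 2) ^ n₀ * (1 / 2) ^ n := by
    intro t ht n
    rw [dist_comm, Real.dist_eq, ← pow_add, show n + 1 + n₀ = n + n₀ + 1 by ring, add_comm n₀ n]
    exact (hn₀ (n + n₀) (by omega) t ht).le
  have hlim : ∀ t ∈ s, Tendsto (fun n => f (n + n₀) t) atTop (𝓝 (g t)) := by
    intro t ht
    have hc := cauchySeq_of_le_geometric (1 / 2) _ (by norm_num) (hd t ht)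
    obtain ⟨l, hl⟩ := cauchySeq_tendsto_of_complete hc
    have h1 : Tendsto (fun n => f n t) atTop (𝓝 l) := (tendsto_add_atTop_iff_nat n₀).1 hl
    rw [hg t ht, h1.limUnder_eq]
    exact hl
  rw [Metric.tendstoUniformlyOn_iff]
  intro ε hε
  have hz : Tendsto (fun n : ℕ => (1 / 2 : ℝ) ^ n₀ * (1 / 2) ^ n / (1 - 1 / 2)) atTop (𝓝 0) := by
    have := (tendsto_pow_atTop_nhds_zero_of_lt_one (r := (1 / 2 : ℝ)) (by norm_num)
      (by norm_num)).const_mul ((1 / 2 : ℝ) ^ n₀)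
    simpa using this.div_const (1 - 1 / 2 : ℝ)
  obtain ⟨n₁, hn₁⟩ := eventually_atTop.1 (hz.eventually_lt_const hε)
  filter_upwards [eventually_ge_atTop (n₁ + n₀)] with n hn t ht
  obtain ⟨j, rfl⟩ : ∃ j, n = j + n₀ := ⟨n - n₀, by omega⟩
  rw [dist_comm]
  exact (dist_le_of_le_geometric_of_tendsto (1 / 2) _ (by norm_num) (hd t ht) (hlim t ht) j).trans_lt
    (hn₁ j (by omega))

/-- Uniform limits of adapted continuous processes whose successive differences are
summably small in probability. -/
lemma exists_uniform_limit
    (hfull : ∀ A, MeasurableSet A → P Aᶜ = 0 → ∀ t, MeasurableSet[F t] A)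
    {N : ℕ → ℝ → Ω → ℝ} (hN : ∀ n, ∀ t ∈ Icc 0 T, Measurable[F t] (N n t))
    (hc : ∀ᵐ ω ∂P, ∀ n, ContinuousOn (fun t => N n t ω) (Icc 0 T)) (h0 : ∀ n ω, N n 0 ω = 0)
    (hsum : ∑' n, P {ω | ∃ t ∈ Icc 0 T, (1 / 2) ^ n ≤ |N (n + 1) t ω - N n t ω|} ≠ ⊤) :
    ∃ M : ℝ → Ω → ℝ, (∀ t ∈ Icc 0 T, Measurable[F t] (M t)) ∧
      (∀ ω, ContinuousOn (fun t => M t ω) (Icc 0 T)) ∧ (∀ ω, M 0 ω = 0) ∧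
      ∀ᵐ ω ∂P, TendstoUniformlyOn (fun n t => N n t ω) (fun t => M t ω) atTop (Icc 0 T) := by
  classical
  have hgood : ∀ᵐ ω ∂P, (∀ n, ContinuousOn (fun t => N n t ω) (Icc 0 T)) ∧
      ∀ᶠ n in atTop, ∀ t ∈ Icc 0 T, |N (n + 1) t ω - N n t ω| < (1 / 2) ^ n := by
    filter_upwards [hc, ae_eventually_notMem hsum] with ω h1 h2
    refine ⟨h1, h2.mono fun n hn t ht => ?_⟩
    by_contra h
    exact hn ⟨t, ht, not_lt.1 h⟩
  -- The good event is shrunk to a measurable one of full measure. The augmented filtration contains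
  -- it at every time, so setting the limit to zero outside keeps adaptedness and makes every path
  -- continuous.
  obtain ⟨Ω₀, hΩ₀, hmeas, hnull⟩ : ∃ Ω₀ : Set Ω, (∀ ω ∈ Ω₀,
      (∀ n, ContinuousOn (fun t => N n t ω) (Icc 0 T)) ∧
      ∀ᶠ n in atTop, ∀ t ∈ Icc 0 T, |N (n + 1) t ω - N n t ω| < (1 / 2) ^ n) ∧
      MeasurableSet Ω₀ ∧ P Ω₀ᶜ = 0 := by
    obtain ⟨s, hs, hsm, hs0⟩ := exists_measurable_superset_of_null (ae_iff.1 hgood)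
    refine ⟨sᶜ, fun ω hω => ?_, hsm.compl, by rwa [compl_compl]⟩
    by_contra h
    exact hω (hs h)
  have hΩ₀t := hfull Ω₀ hmeas hnull
  let M : ℝ → Ω → ℝ := fun t ω => if ω ∈ Ω₀ then limUnder atTop (fun n => N n t ω) else 0
  have hunif : ∀ ω ∈ Ω₀, TendstoUniformlyOn (fun n t => N n t ω) (fun t => M t ω) atTop (Icc 0 T) :=
    fun ω hω => tendstoUniformlyOn_of_geometric (hΩ₀ ω hω).2 fun t _ => by simp [M, hω]
  refine ⟨M, fun t ht => ?_, fun ω => ?_, fun ω => ?_, ?_⟩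
  · refine @measurable_of_tendsto_metrizable _ _ (F t) _ _ _ _
      (fun n ω => if ω ∈ Ω₀ then N n t ω else 0) _
      (fun n => Measurable.ite (hΩ₀t t) (hN n t ht) measurable_const) ?_
    rw [tendsto_pi_nhds]
    intro ω
    by_cases h : ω ∈ Ω₀
    · simpa only [if_pos h] using (hunif ω h).tendsto_at ht
    · simp [M, h]
  · by_cases h : ω ∈ Ω₀
    · exact (hunif ω h).continuousOn (Eventually.of_forall (hΩ₀ ω h).1).frequently
    · simpa [M, h] using continuousOn_const
  · by_cases h : ω ∈ Ω₀
    · simp only [M, if_pos h, h0]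
      exact tendsto_const_nhds.limUnder_eq
    · simp [M, h]
  · have : ∀ᵐ ω ∂P, ω ∈ Ω₀ := mem_ae_iff.2 hnull
    filter_upwards [this] with ω hω using hunif ω hω

/-- Integrate `|D| ≤ D²/(2δ) + δ/2`. -/
lemma integral_abs_le_of_sq_le {D : Ω → ℝ} (hD : MemLp D 2 P) {δ : ℝ} (hδ : 0 < δ)
    (h : ∫ ω, D ω ^ 2 ∂P ≤ δ ^ 2) : ∫ ω, |D ω| ∂P ≤ δ := by
  have h2 : Integrable (fun ω => D ω ^ 2) P := hD.integrable_sq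
  have h1 : ∫ ω, |D ω| ∂P ≤ ∫ ω, (D ω ^ 2 * (1 / (2 * δ)) + δ / 2) ∂P := by
    refine integral_mono (hD.integrable (by norm_num)).abs
      ((h2.mul_const _).add (integrable_const _)) fun ω => ?_
    have : |D ω| ^ 2 = D ω ^ 2 := sq_abs _
    simp only
    rw [← this, mul_one_div, div_add_div _ _ (by positivity) (by positivity),
      le_div_iff₀ (by positivity)]
    nlinarith [sq_nonneg (|D ω| - δ)]
  rw [integral_add (h2.mul_const _) (integrable_const _), integral_mul_const, integral_const,
    probReal_univ, one_smul] at h1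
  refine h1.trans ?_
  have : (∫ ω, D ω ^ 2 ∂P) * (1 / (2 * δ)) ≤ δ ^ 2 * (1 / (2 * δ)) := by gcongr
  have h3 : δ ^ 2 * (1 / (2 * δ)) = δ / 2 := by field_simp
  linarith

/-- `M` is a version of the Wiener integral `∫ ψ' dB` of the deterministic function `ψ`. -/
structure IsWiener (F : ℝ → MeasurableSpace Ω) (P : Measure Ω) (T : ℝ)
    (B : ℝ → Ω → EuclideanSpace ℝ (Fin d)) (ψ : ℝ → EuclideanSpace ℝ (Fin d))
    (M : ℝ → Ω → ℝ) : Prop where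
  adapted : ∀ t ∈ Icc 0 T, Measurable[F t] (M t)
  cont : ∀ ω, ContinuousOn (fun t => M t ω) (Icc 0 T)
  zero : ∀ ω, M 0 ω = 0
  -- The joint Gaussian law of the increments of `M` and `B`: its variance also records their
  -- covariance, from which the drift in Girsanov's theorem arises.
  incr : ∀ ⦃s t : ℝ⦄, 0 ≤ s → s ≤ t → t ≤ T → ∀ (a : ℝ) (u : EuclideanSpace ℝ (Fin d)),
    IsGaussInc F P s t (fun ω => a * (M t ω - M s ω) + inner ℝ u (B t ω - B s ω))
      (∫ r in s..t, ‖a • ψ r + u‖ ^ 2)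

lemma lintegral_enorm_sub_sq_le {α E : Type*} [MeasurableSpace α] [NormedAddCommGroup E]
    {μ : Measure α} {f g h : α → E} (hf : AEStronglyMeasurable f μ) (hg : AEStronglyMeasurable g μ)
    (hh : AEStronglyMeasurable h μ) :
    ∫⁻ a, ‖f a - g a‖ₑ ^ 2 ∂μ ≤
      2 * (∫⁻ a, ‖f a - h a‖ₑ ^ 2 ∂μ) + 2 * ∫⁻ a, ‖g a - h a‖ₑ ^ 2 ∂μ := by
  have hpt : ∀ a, ‖f a - g a‖ₑ ^ 2 ≤ 2 * ‖f a - h a‖ₑ ^ 2 + 2 * ‖g a - h a‖ₑ ^ 2 := by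
    intro a
    have h1 : ‖f a - g a‖ ^ 2 ≤ 2 * ‖f a - h a‖ ^ 2 + 2 * ‖g a - h a‖ ^ 2 := by
      have h2 : ‖f a - g a‖ ≤ ‖f a - h a‖ + ‖g a - h a‖ := by
        have := norm_sub_le (f a - h a) (g a - h a)
        simpa using this
      nlinarith [norm_nonneg (f a - g a), sq_nonneg (‖f a - h a‖ - ‖g a - h a‖)]
    have h3 := ENNReal.ofReal_le_ofReal h1
    rwa [ENNReal.ofReal_add (by positivity) (by positivity),
      ENNReal.ofReal_mul (by norm_num), ENNReal.ofReal_mul (by norm_num),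
      ENNReal.ofReal_pow (norm_nonneg _), ENNReal.ofReal_pow (norm_nonneg _),
      ENNReal.ofReal_pow (norm_nonneg _), ofReal_norm, ofReal_norm, ofReal_norm,
      ENNReal.ofReal_ofNat] at h3
  refine (lintegral_mono hpt).trans (le_of_eq ?_)
  have h1 : AEMeasurable (fun a => ‖f a - h a‖ₑ ^ 2) μ := (hf.sub hh).enorm.pow_const 2
  have h2 : AEMeasurable (fun a => ‖g a - h a‖ₑ ^ 2) μ := (hg.sub hh).enorm.pow_const 2
  rw [lintegral_add_left' (h1.const_mul 2),
    lintegral_const_mul'' _ h1,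
    lintegral_const_mul'' _ h2]

/-- Grid functions at `L²` distance `4^{-n}` from `ψ` have integrals whose successive differences
have first moment at most `2·4^{-n}`. By Doob's inequality these exceed `2^{-n}` somewhere with
probability at most `4·2^{-n}`, which is summable, so the paths converge uniformly a.s.; the
Gaussian law of the increments passes to the limit. -/
theorem exists_isWiener (hT : 0 < T) (hF : ∀ t, F t ≤ mΩ) (hmono : Monotone F)
    (hfull : ∀ A, MeasurableSet A → P Aᶜ = 0 → ∀ t, MeasurableSet[F t] A)
    (hB : IsLevy F P T B) (hBc : ∀ᵐ ω ∂P, ContinuousOn (B · ω) (Icc 0 T))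
    {ψ : ℝ → EuclideanSpace ℝ (Fin d)} (hψ : MemLp ψ 2 (volume.restrict (Icc 0 T))) :
    ∃ M, IsWiener F P T B ψ M := by
  have happ := fun n : ℕ => exists_grid_approx hT hψ (ε := (1 / 4) ^ n) (by positivity)
  choose G hG N₀ hN₀ using happ
  let n₁ : ℕ → ℕ := fun n => N₀ n + 1
  let S : ℕ → SimpleIntegrand F T d := fun n => gridIntegrand F T hT.le (G n) (hG n) (n₁ n)
  let g : ℕ → ℝ → EuclideanSpace ℝ (Fin d) := fun n => gridStep T (n₁ n) (G n)
  have hg : ∀ n, ∫⁻ s in Icc 0 T, ‖g n s - ψ s‖ₑ ^ 2 ≤ ENNReal.ofReal (((1 / 4) ^ n) ^ 2) :=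
    fun n => hN₀ n _ (by simp [n₁])
  have hgm : ∀ n, AEStronglyMeasurable (g n) (volume.restrict (Icc 0 T)) := fun n =>
    (measurable_gridStep _ _ _).aestronglyMeasurable
  have hTm : T ∈ Icc 0 T := ⟨hT.le, le_rfl⟩
  have hdiff : ∀ n, P {ω | ∃ t ∈ Icc 0 T, (1 / 2) ^ n ≤
      |(S (n + 1)).sint B t ω - (S n).sint B t ω|} ≤ ENNReal.ofReal (4 * (1 / 2) ^ n) := by
    intro n
    let U := (S (n + 1)).sub (S n) hmono
    have hU : ∀ t ω, U.sint B t ω = (S (n + 1)).sint B t ω - (S n).sint B t ω :=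
      fun t ω => SimpleIntegrand.sub_sint _ _ _ _ _
    simp_rw [← hU]
    refine (continuous_maximal hT hF hmono (N := U.sint B)
      (fun t ht => U.measurable_sint hB hmono ht)
      (fun t ht => (U.memLp_sint hB hF ht).integrable (by norm_num))
      (fun s t hs hst ht A hA => U.setIntegral_sint hB hF hmono hs hst ht hA)
      (by filter_upwards [hBc] with ω hω using U.continuous_sint hω) (by positivity)).trans ?_
    refine ENNReal.ofReal_le_ofReal ?_
    have hqv : ∀ ω, U.qv T ω ≤ (2 * (1 / 4) ^ n) ^ 2 := by
      intro ω
      have h1 := U.lintegral_eval_sq T ω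
      have h2 : ∀ s, U.eval s ω = g (n + 1) s - g n s := fun s => SimpleIntegrand.sub_eval _ _ _ _ _
      simp_rw [h2] at h1
      have h3 := lintegral_enorm_sub_sq_le (hgm (n + 1)) (hgm n) hψ.1
      rw [h1] at h3
      have h4 := h3.trans (add_le_add (mul_le_mul_right (hg (n + 1)) 2)
        (mul_le_mul_right (hg n) 2))
      rw [← ENNReal.ofReal_ofNat, ← ENNReal.ofReal_mul (by norm_num),
        ← ENNReal.ofReal_mul (by norm_num), ← ENNReal.ofReal_add (by positivity) (by positivity),
        ENNReal.ofReal_le_ofReal_iff (by positivity)] at h4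
      refine h4.trans ?_
      have : (0 : ℝ) < (1 / 4) ^ n := by positivity
      rw [pow_succ (1 / 4 : ℝ) n]
      nlinarith
    have h5 : ∫ ω, |U.sint B T ω| ∂P ≤ 2 * (1 / 4) ^ n := by
      refine integral_abs_le_of_sq_le (U.memLp_sint hB hF hTm) (by positivity) ?_
      rw [U.integral_sint_sq hB hF hmono hTm]
      refine (integral_mono_of_nonneg (Eventually.of_forall fun ω => U.qv_nonneg T ω)
        (integrable_const _) (Eventually.of_forall hqv)).trans ?_
      simp
    rw [div_le_iff₀ (by positivity)]
    have : (1 / 4 : ℝ) ^ n = (1 / 2) ^ n * (1 / 2) ^ n := by rw [← mul_pow]; norm_num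
    rw [mul_assoc, ← this]
    linarith
  obtain ⟨M, hM1, hM2, hM3, hM4⟩ := exists_uniform_limit (P := P) (F := F) (T := T) hfull
    (N := fun n => (S n).sint B) (fun n t ht => (S n).measurable_sint hB hmono ht)
    (by filter_upwards [hBc] with ω hω n using (S n).continuous_sint hω)
    (fun n ω => (S n).sint_zero ω) (by
      refine ne_top_of_le_ne_top ?_ (ENNReal.tsum_le_tsum hdiff)
      rw [← ENNReal.ofReal_tsum_of_nonneg (fun n => by positivity)
        ((summable_geometric_of_lt_one (by norm_num) (by norm_num)).mul_left 4)]
      exact ENNReal.ofReal_ne_top)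
  refine ⟨M, hM1, hM2, hM3, fun s t hs hst ht a u => ?_⟩
  have htm : t ∈ Icc 0 T := ⟨hs.trans hst, ht⟩
  have hsm : s ∈ Icc 0 T := ⟨hs, hst.trans ht⟩
  refine IsGaussInc.of_tendsto hF (fun n => isGaussInc_gridIntegrand hB hF hmono hT.le (hG n) (n₁ n)
    a u (n₁ n) le_rfl hs hst (by rw [gridTime_last (by simp [n₁])]; exact ht))
    (fun n => intervalIntegral.integral_nonneg hst fun _ _ => by positivity) ?_ ?_ ?_
  · refine (((hM1 t htm).sub ((hM1 s hsm).mono (hmono hst) le_rfl)).const_mul a).add ?_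
    exact ((hB.adapted t htm).sub ((hB.adapted s hsm).mono (hmono hst) le_rfl)).const_inner
  · filter_upwards [hM4] with ω hω
    exact (((hω.tendsto_at htm).sub (hω.tendsto_at hsm)).const_mul a).add_const _
  · have hsub : Ioc s t ⊆ Icc 0 T := fun r hr => ⟨hs.trans hr.1.le, hr.2.trans ht⟩
    have hle : volume.restrict (Ioc s t) ≤ volume.restrict (Icc 0 T) :=
      Measure.restrict_mono hsub le_rfl
    have hψm := hψ.1.mono_measure hle
    have h6 : Tendsto (fun n => ∫⁻ r in Ioc s t, ‖(a • g n r + u) - (a • ψ r + u)‖ₑ ^ 2) atTop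
        (𝓝 0) := by
      refine tendsto_of_tendsto_of_tendsto_of_le_of_le tendsto_const_nhds
        (h := fun n => ‖a‖ₑ ^ 2 * ENNReal.ofReal (((1 / 4) ^ n) ^ 2)) ?_ (fun _ => zero_le) ?_
      · have h7 : Tendsto (fun n : ℕ => (((1 / 4 : ℝ)) ^ n) ^ 2) atTop (𝓝 0) := by
          simpa using (tendsto_pow_atTop_nhds_zero_of_lt_one (r := (1 / 4 : ℝ)) (by norm_num)
            (by norm_num)).pow 2
        have h8 := ENNReal.Tendsto.const_mul (a := ‖a‖ₑ ^ 2) (ENNReal.tendsto_ofReal h7)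
          (Or.inr (by simp))
        simpa using h8
      · intro n
        simp only [add_sub_add_right_eq_sub, ← smul_sub, enorm_smul, mul_pow]
        rw [lintegral_const_mul' _ _ (by simp)]
        gcongr
        exact (lintegral_mono' hle le_rfl).trans (hg n)
    have hmf : ∀ n, AEStronglyMeasurable (fun r => a • g n r + u) (volume.restrict (Ioc s t)) :=
      fun n => (((hgm n).mono_measure hle).const_smul a).add aestronglyMeasurable_const
    have hmψ : AEStronglyMeasurable (fun r => a • ψ r + u) (volume.restrict (Ioc s t)) :=
      (hψm.const_smul a).add aestronglyMeasurable_const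
    have h9 := tendsto_lintegral_enorm_sq hmf hmψ h6
    have hfin : ∫⁻ r in Ioc s t, ‖a • ψ r + u‖ₑ ^ 2 ≠ ⊤ :=
      lintegral_enorm_sq_ne_top (g := fun r => a • ψ r + u)
        (((hψ.mono_measure hle).const_smul a).add (memLp_const u))
    simp_rw [intervalIntegral.integral_of_le hst]
    rw [integral_norm_sq_eq_toReal hmψ]
    have h10 : ∀ n, ∫ r in Ioc s t, ‖a • g n r + u‖ ^ 2 =
        (∫⁻ r in Ioc s t, ‖a • g n r + u‖ₑ ^ 2).toReal := fun n => integral_norm_sq_eq_toReal (hmf n)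
    exact ((ENNReal.tendsto_toReal hfin).comp h9).congr fun n => (h10 n).symm

end Wiener

/-! ### Change of measure -/

section Girsanov

lemma intervalIntegrable_of_integrableOn_Icc {E : Type*} [NormedAddCommGroup E] {f : ℝ → E}
    {T s t : ℝ} (h : IntegrableOn f (Icc 0 T)) (hs : s ∈ Icc 0 T) (ht : t ∈ Icc 0 T) :
    IntervalIntegrable f volume s t := by
  refine (h.mono_set ?_).intervalIntegrable
  exact uIcc_subset_Icc hs ht

lemma ofReal_exp_add (a b : ℝ) : ENNReal.ofReal (Real.exp (a + b)) =
    ENNReal.ofReal (Real.exp a) * ENNReal.ofReal (Real.exp b) := by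
  rw [Real.exp_add, ENNReal.ofReal_mul (Real.exp_pos _).le]

lemma lintegral_exp_gaussianReal {v : ℝ} (hv : 0 ≤ v) (l : ℝ) :
    ∫⁻ x, ENNReal.ofReal (Real.exp (l * x)) ∂(gaussianReal 0 v.toNNReal) =
      ENNReal.ofReal (Real.exp (v * l ^ 2 / 2)) := by
  rw [← ofReal_integral_eq_lintegral_ofReal (integrable_exp_mul_gaussianReal l)
    (Eventually.of_forall fun _ => (Real.exp_pos _).le)]
  have h1 := mgf_gaussianReal (p := gaussianReal 0 v.toNNReal) (X := id) (Measure.map_id) l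
  simp only [ProbabilityTheory.mgf, id, Real.coe_toNNReal _ hv, zero_mul, zero_add] at h1
  rw [h1]

/-- A Laplace transform finite on the whole line extends to an entire function and determines the
measure. Real exponentials suit Girsanov's theorem because the density is one as well, and
nonnegative integrals need no integrability checks. -/
lemma measure_ext_of_lintegral_exp {μ μ' : Measure ℝ} [IsFiniteMeasure μ] [IsFiniteMeasure μ']
    (h : ∀ l : ℝ, ∫⁻ x, ENNReal.ofReal (Real.exp (l * x)) ∂μ =
      ∫⁻ x, ENNReal.ofReal (Real.exp (l * x)) ∂μ')
    (hfin : ∀ l : ℝ, ∫⁻ x, ENNReal.ofReal (Real.exp (l * x)) ∂μ ≠ ⊤) : μ = μ' := by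
  have hset : integrableExpSet id μ = univ := by
    ext l
    simp only [integrableExpSet, mem_univ, iff_true]
    refine ⟨by fun_prop, ?_⟩
    rw [hasFiniteIntegral_iff_ofReal (Eventually.of_forall fun _ => (Real.exp_pos _).le)]
    exact (hfin l).lt_top
  have hmgf : ProbabilityTheory.mgf id μ = ProbabilityTheory.mgf id μ' := by
    funext l
    simp only [ProbabilityTheory.mgf, id]
    rw [integral_eq_lintegral_of_nonneg_ae (Eventually.of_forall fun _ => (Real.exp_pos _).le)
      (by fun_prop), integral_eq_lintegral_of_nonneg_ae
      (Eventually.of_forall fun _ => (Real.exp_pos _).le) (by fun_prop), h]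
  have h0 : μ = 0 ↔ μ' = 0 := by
    have := h 0
    simp only [zero_mul, Real.exp_zero, ENNReal.ofReal_one, lintegral_const, one_mul] at this
    rw [← Measure.measure_univ_eq_zero, ← Measure.measure_univ_eq_zero, this]
  refine Measure.ext_of_complexMGF_id_eq ?_
  funext z
  exact eqOn_complexMGF_of_mgf' hmgf h0 (by simp [hset])

variable {F : ℝ → MeasurableSpace Ω} {P : Measure Ω} [IsProbabilityMeasure P] {T : ℝ}
  {B : ℝ → Ω → EuclideanSpace ℝ (Fin d)} {ψ : ℝ → EuclideanSpace ℝ (Fin d)} {M : ℝ → Ω → ℝ}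

lemma IsGaussInc.lintegral_mul_exp {s t v : ℝ} {N : Ω → ℝ} (h : IsGaussInc F P s t N v)
    (hF : ∀ t, F t ≤ mΩ) (hv : 0 ≤ v) {f : Ω → ℝ≥0∞} (hf : Measurable[F s] f) :
    ∫⁻ ω, f ω * ENNReal.ofReal (Real.exp (N ω)) ∂P =
      (∫⁻ ω, f ω ∂P) * ENNReal.ofReal (Real.exp (v / 2)) := by
  rw [h.lintegral_mul hF hf (g := fun x => ENNReal.ofReal (Real.exp x)) (by fun_prop)]
  have := lintegral_exp_gaussianReal hv 1
  simp only [one_mul, one_pow, mul_one] at this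
  rw [this]

lemma intervalIntegrable_norm_sq (hψ : MemLp ψ 2 (volume.restrict (Icc 0 T))) {s t : ℝ}
    (hs : s ∈ Icc 0 T) (ht : t ∈ Icc 0 T) :
    IntervalIntegrable (fun r => ‖ψ r‖ ^ 2) volume s t :=
  intervalIntegrable_of_integrableOn_Icc (f := fun r => ‖ψ r‖ ^ 2)
    ((memLp_two_iff_integrable_sq_norm hψ.1).1 hψ) hs ht

lemma IsWiener.incr_smul (hM : IsWiener F P T B ψ M) {s t : ℝ} (hs : 0 ≤ s) (hst : s ≤ t)
    (ht : t ≤ T) (a : ℝ) :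
    IsGaussInc F P s t (fun ω => a * (M t ω - M s ω)) (a ^ 2 * ∫ r in s..t, ‖ψ r‖ ^ 2) := by
  have := hM.incr hs hst ht a 0
  simpa [norm_smul, mul_pow, intervalIntegral.integral_const_mul] using this

/-- The density process `exp (-∫ψ' dB - ½ ∫ |ψ|²)`. -/
def densityProc (ψ : ℝ → EuclideanSpace ℝ (Fin d)) (M : ℝ → Ω → ℝ) (t : ℝ) (ω : Ω) : ℝ :=
  Real.exp (-M t ω - (∫ r in (0 : ℝ)..t, ‖ψ r‖ ^ 2) / 2)

/-- The probability measure under which `B + ∫ ψ` is a Brownian motion. -/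
def girsanovMeasure (P : Measure Ω) (T : ℝ) (ψ : ℝ → EuclideanSpace ℝ (Fin d))
    (M : ℝ → Ω → ℝ) : Measure Ω :=
  P.withDensity fun ω => ENNReal.ofReal (densityProc ψ M T ω)

lemma measurable_densityProc (hM : IsWiener F P T B ψ M) {t : ℝ} (ht : t ∈ Icc 0 T) :
    Measurable[F t] (densityProc ψ M t) :=
  Real.measurable_exp.comp ((hM.adapted t ht).neg.sub_const _)

lemma densityProc_pos (t : ℝ) (ω : Ω) : 0 < densityProc ψ M t ω := Real.exp_pos _

lemma measurable_ofReal_densityProc (hF : ∀ t, F t ≤ mΩ) (hM : IsWiener F P T B ψ M) {t : ℝ}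
    (ht : t ∈ Icc 0 T) : Measurable (fun ω => ENNReal.ofReal (densityProc ψ M t ω)) :=
  ((measurable_densityProc hM ht).mono (hF _) le_rfl).ennreal_ofReal

lemma lintegral_girsanovMeasure (hT : 0 ≤ T) (hF : ∀ t, F t ≤ mΩ) (hM : IsWiener F P T B ψ M)
    (f : Ω → ℝ≥0∞) :
    ∫⁻ ω, f ω ∂(girsanovMeasure P T ψ M) = ∫⁻ ω, ENNReal.ofReal (densityProc ψ M T ω) * f ω ∂P := by
  rw [girsanovMeasure, lintegral_withDensity_eq_lintegral_mul_non_measurable _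
    (measurable_ofReal_densityProc hF hM ⟨hT, le_rfl⟩)
    (Eventually.of_forall fun _ => ENNReal.ofReal_lt_top)]
  rfl

/-- The martingale property of the density: the factor accrued on `[t, T]` is independent of `F t`,
and its Gaussian exponential moment is exactly compensated by `-½ ∫ |ψ|²`. -/
lemma lintegral_girsanovMeasure_of_measurable (hF : ∀ t, F t ≤ mΩ)
    (hψ : MemLp ψ 2 (volume.restrict (Icc 0 T))) (hM : IsWiener F P T B ψ M) {t : ℝ}
    (ht : t ∈ Icc 0 T) {f : Ω → ℝ≥0∞} (hf : Measurable[F t] f) :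
    ∫⁻ ω, f ω ∂(girsanovMeasure P T ψ M) = ∫⁻ ω, ENNReal.ofReal (densityProc ψ M t ω) * f ω ∂P := by
  have hT : (0 : ℝ) ≤ T := ht.1.trans ht.2
  rw [lintegral_girsanovMeasure hT hF hM]
  have h0 : (0 : ℝ) ∈ Icc 0 T := ⟨le_rfl, hT⟩
  have hTT : T ∈ Icc 0 T := ⟨hT, le_rfl⟩
  have hadd := intervalIntegral.integral_add_adjacent_intervals
    (intervalIntegrable_norm_sq hψ h0 ht) (intervalIntegrable_norm_sq hψ ht hTT)
  have h1 : ∀ ω, ENNReal.ofReal (densityProc ψ M T ω) * f ω =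
      ENNReal.ofReal (Real.exp (-(∫ r in t..T, ‖ψ r‖ ^ 2) / 2)) *
      ((ENNReal.ofReal (densityProc ψ M t ω) * f ω) *
        ENNReal.ofReal (Real.exp (-1 * (M T ω - M t ω)))) := by
    intro ω
    have h2 : ENNReal.ofReal (densityProc ψ M T ω) =
        ENNReal.ofReal (Real.exp (-(∫ r in t..T, ‖ψ r‖ ^ 2) / 2)) *
        (ENNReal.ofReal (densityProc ψ M t ω) *
          ENNReal.ofReal (Real.exp (-1 * (M T ω - M t ω)))) := by
      unfold densityProc
      rw [← ofReal_exp_add, ← ofReal_exp_add, ← hadd]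
      congr 2
      ring
    rw [h2]; ring
  simp_rw [h1]
  rw [lintegral_const_mul' _ _ ENNReal.ofReal_ne_top,
    (hM.incr_smul ht.1 ht.2 le_rfl (-1)).lintegral_mul_exp hF
      (f := fun ω => ENNReal.ofReal (densityProc ψ M t ω) * f ω)
      (mul_nonneg (by norm_num) (intervalIntegral.integral_nonneg ht.2 fun _ _ => by positivity))
      ((measurable_densityProc hM ht).ennreal_ofReal.mul hf), mul_left_comm, ← ofReal_exp_add]
  have : -(∫ r in t..T, ‖ψ r‖ ^ 2) / 2 + (-1) ^ 2 * (∫ r in t..T, ‖ψ r‖ ^ 2) / 2 = 0 := by ring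
  rw [this, Real.exp_zero, ENNReal.ofReal_one, mul_one]

lemma isProbabilityMeasure_girsanovMeasure (hT : 0 ≤ T) (hF : ∀ t, F t ≤ mΩ)
    (hψ : MemLp ψ 2 (volume.restrict (Icc 0 T))) (hM : IsWiener F P T B ψ M) :
    IsProbabilityMeasure (girsanovMeasure P T ψ M) := by
  constructor
  have := lintegral_girsanovMeasure_of_measurable hF hψ hM (t := 0) ⟨le_rfl, hT⟩
    (f := fun _ => 1) (@measurable_const _ _ _ (F 0) _)
  simpa [densityProc, hM.zero] using this

/-- Girsanov's theorem for a deterministic drift. -/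
theorem isLevy_girsanovMeasure (hT : 0 ≤ T) (hF : ∀ t, F t ≤ mΩ) (hmono : Monotone F)
    (hψ : MemLp ψ 2 (volume.restrict (Icc 0 T))) (hB : IsLevy F P T B)
    (hM : IsWiener F P T B ψ M) :
    IsLevy F (girsanovMeasure P T ψ M) T (fun t ω => B t ω + ∫ r in (0 : ℝ)..t, ψ r) := by
  have := isProbabilityMeasure_girsanovMeasure hT hF hψ hM
  set Q := girsanovMeasure P T ψ M
  refine ⟨fun t ht => (hB.adapted t ht).add_const _, fun s t hs hst ht u => ?_⟩
  have hsm : s ∈ Icc 0 T := ⟨hs, hst.trans ht⟩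
  have htm : t ∈ Icc 0 T := ⟨hs.trans hst, ht⟩
  have h0m : (0 : ℝ) ∈ Icc 0 T := ⟨le_rfl, hT⟩
  have hψi : IntegrableOn ψ (Icc 0 T) := hψ.integrable (by norm_num)
  have hst0 : 0 ≤ t - s := sub_nonneg.2 hst
  have hv : 0 ≤ ‖u‖ ^ 2 * (t - s) := by positivity
  have hshift : ∀ ω, inner ℝ u ((B t ω + ∫ r in (0 : ℝ)..t, ψ r) - (B s ω + ∫ r in (0 : ℝ)..s, ψ r)) =
      inner ℝ u (B t ω - B s ω) + ∫ r in s..t, inner ℝ u (ψ r) := by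
    intro ω
    have h1 : ∫ r in s..t, inner ℝ u (ψ r) = inner ℝ u (∫ r in s..t, ψ r) :=
      (innerSL ℝ u).intervalIntegral_comp_comm (intervalIntegrable_of_integrableOn_Icc hψi hsm htm)
    rw [h1, ← intervalIntegral.integral_interval_sub_left
      (intervalIntegrable_of_integrableOn_Icc hψi h0m htm)
      (intervalIntegrable_of_integrableOn_Icc hψi h0m hsm), ← inner_add_right]
    congr 1
    abel
  have hmeas : Measurable[F t] fun ω => inner ℝ u ((B t ω + ∫ r in (0 : ℝ)..t, ψ r) -
      (B s ω + ∫ r in (0 : ℝ)..s, ψ r)) :=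
    (((hB.adapted t htm).add_const _).sub
      (((hB.adapted s hsm).mono (hmono hst) le_rfl).add_const _)).const_inner
  refine isGaussInc_of_map_restrict hF hmeas fun A hA => ?_
  have hA' := hF s A hA
  have hmeas' := hmeas.mono (hF t) le_rfl
  have hfin : IsFiniteMeasure (Q A • gaussianReal 0 (‖u‖ ^ 2 * (t - s)).toNNReal) :=
    Measure.smul_finite _ (measure_ne_top _ _)
  have hright : ∀ l : ℝ, ∫⁻ x, ENNReal.ofReal (Real.exp (l * x))
      ∂(Q A • gaussianReal 0 (‖u‖ ^ 2 * (t - s)).toNNReal) =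
      Q A * ENNReal.ofReal (Real.exp (‖u‖ ^ 2 * (t - s) * l ^ 2 / 2)) := by
    intro l
    rw [lintegral_smul_measure, lintegral_exp_gaussianReal hv, smul_eq_mul]
  symm
  refine measure_ext_of_lintegral_exp (fun l => ?_) (fun l => ?_)
  swap
  · rw [hright]; exact ENNReal.mul_ne_top (measure_ne_top _ _) ENNReal.ofReal_ne_top
  rw [hright, lintegral_map (by fun_prop) hmeas', ← lintegral_indicator hA']
  have hind : ∀ ω, A.indicator (fun ω => ENNReal.ofReal (Real.exp (l *
      inner ℝ u ((B t ω + ∫ r in (0 : ℝ)..t, ψ r) - (B s ω + ∫ r in (0 : ℝ)..s, ψ r))))) ω =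
      A.indicator (fun _ => (1 : ℝ≥0∞)) ω * ENNReal.ofReal (Real.exp (l *
      inner ℝ u ((B t ω + ∫ r in (0 : ℝ)..t, ψ r) - (B s ω + ∫ r in (0 : ℝ)..s, ψ r)))) := by
    intro ω
    by_cases h : ω ∈ A <;> simp [h]
  have h1A : Measurable[F s] (A.indicator fun _ => (1 : ℝ≥0∞)) := by
    exact (@measurable_const _ _ _ (F s) _).indicator hA
  simp_rw [hind]
  rw [lintegral_girsanovMeasure_of_measurable hF hψ hM htm (f := fun ω =>
    A.indicator (fun _ => (1 : ℝ≥0∞)) ω * ENNReal.ofReal (Real.exp (l * inner ℝ u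
      ((B t ω + ∫ r in (0 : ℝ)..t, ψ r) - (B s ω + ∫ r in (0 : ℝ)..s, ψ r))))) ((h1A.mono (hmono hst) le_rfl).mul
    (Real.measurable_exp.comp (hmeas.const_mul l)).ennreal_ofReal)]
  have hadd := intervalIntegral.integral_add_adjacent_intervals
    (intervalIntegrable_norm_sq hψ h0m hsm) (intervalIntegrable_norm_sq hψ hsm htm)
  -- Isolate a constant, a factor known at `s`, and the exponential of the joint increment of `M`
  -- and `B`, whose variance is available from `incr` with `a = -1` and vector `l • u`.
  have hsplit : ∀ ω, ENNReal.ofReal (densityProc ψ M t ω) * (A.indicator (fun _ => (1 : ℝ≥0∞)) ω *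
      ENNReal.ofReal (Real.exp (l * inner ℝ u ((B t ω + ∫ r in (0 : ℝ)..t, ψ r) -
        (B s ω + ∫ r in (0 : ℝ)..s, ψ r))))) =
      ENNReal.ofReal (Real.exp (l * (∫ r in s..t, inner ℝ u (ψ r)) -
        (∫ r in s..t, ‖ψ r‖ ^ 2) / 2)) *
      ((ENNReal.ofReal (densityProc ψ M s ω) * A.indicator (fun _ => (1 : ℝ≥0∞)) ω) *
      ENNReal.ofReal (Real.exp (-1 * (M t ω - M s ω) + inner ℝ (l • u) (B t ω - B s ω)))) := by
    intro ω
    have h2 : ENNReal.ofReal (densityProc ψ M t ω) * ENNReal.ofReal (Real.exp (l *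
        inner ℝ u ((B t ω + ∫ r in (0 : ℝ)..t, ψ r) - (B s ω + ∫ r in (0 : ℝ)..s, ψ r)))) =
        ENNReal.ofReal (Real.exp (l * (∫ r in s..t, inner ℝ u (ψ r)) -
        (∫ r in s..t, ‖ψ r‖ ^ 2) / 2)) * (ENNReal.ofReal (densityProc ψ M s ω) *
        ENNReal.ofReal (Real.exp (-1 * (M t ω - M s ω) + inner ℝ (l • u) (B t ω - B s ω)))) := by
      unfold densityProc
      rw [← ofReal_exp_add, ← ofReal_exp_add, ← ofReal_exp_add, ← hadd, hshift, real_inner_smul_left]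
      congr 2
      ring
    rw [mul_left_comm, h2]; ring
  -- Half of this variance cancels both terms of the constant isolated above and leaves `l² ‖u‖² (t
  -- - s) / 2`, the exponent of a Brownian increment.
  have hvar : ∫ r in s..t, ‖(-1 : ℝ) • ψ r + l • u‖ ^ 2 = (∫ r in s..t, ‖ψ r‖ ^ 2) -
      2 * l * (∫ r in s..t, inner ℝ u (ψ r)) + l ^ 2 * ‖u‖ ^ 2 * (t - s) := by
    have hinner : IntervalIntegrable (fun r => inner ℝ u (ψ r)) volume s t :=
      intervalIntegrable_of_integrableOn_Icc (f := fun r => inner ℝ u (ψ r))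
        (hψi.const_inner u) hsm htm
    have h3 : ∀ r, ‖(-1 : ℝ) • ψ r + l • u‖ ^ 2 =
        ‖ψ r‖ ^ 2 - 2 * l * inner ℝ u (ψ r) + l ^ 2 * ‖u‖ ^ 2 := by
      intro r
      rw [norm_add_sq_real, norm_smul, norm_smul, real_inner_smul_left, real_inner_smul_right,
        real_inner_comm, mul_pow, mul_pow, Real.norm_eq_abs, Real.norm_eq_abs, sq_abs, sq_abs]
      ring
    simp_rw [h3]
    rw [intervalIntegral.integral_add ((intervalIntegrable_norm_sq hψ hsm htm).sub
      (hinner.const_mul _)) intervalIntegrable_const, intervalIntegral.integral_sub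
      (intervalIntegrable_norm_sq hψ hsm htm) (hinner.const_mul _),
      intervalIntegral.integral_const_mul, intervalIntegral.integral_const, smul_eq_mul]
    ring
  simp_rw [hsplit]
  rw [lintegral_const_mul' _ _ ENNReal.ofReal_ne_top,
    (hM.incr hs hst ht (-1) (l • u)).lintegral_mul_exp hF
      (f := fun ω => ENNReal.ofReal (densityProc ψ M s ω) * A.indicator (fun _ => (1 : ℝ≥0∞)) ω)
      (intervalIntegral.integral_nonneg hst fun _ _ => by positivity)
      ((measurable_densityProc hM hsm).ennreal_ofReal.mul h1A), mul_left_comm, ← ofReal_exp_add,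
    ← lintegral_girsanovMeasure_of_measurable hF hψ hM hsm h1A, lintegral_indicator hA',
    setLIntegral_one, hvar]
  congr 3
  ring

end Girsanov

/-! ### Stopping simple integrands -/

namespace SimpleIntegrand

variable {F : ℝ → MeasurableSpace Ω} {T : ℝ} {P : Measure Ω} [IsProbabilityMeasure P]
  {B : ℝ → Ω → EuclideanSpace ℝ (Fin d)}

/-- The quadratic variation on `[0,t]` through the cell of index `j`. -/
def prefixQv (S : SimpleIntegrand F T d) (t : ℝ) (j : ℕ) (ω : Ω) : ℝ :=
  ∑ i ∈ Finset.range (j + 1), ‖S.coef i ω‖ ^ 2 * (min (S.time (i + 1)) t - min (S.time i) t)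

lemma prefixQv_mono (S : SimpleIntegrand F T d) (t : ℝ) (ω : Ω) :
    Monotone fun j => S.prefixQv t j ω := by
  refine monotone_nat_of_le_succ fun j => ?_
  unfold prefixQv
  rw [Finset.sum_range_succ _ (j + 1)]
  linarith [S.qv_term_nonneg t ω (j + 1)]

lemma prefixQv_le_qv (S : SimpleIntegrand F T d) (t : ℝ) (ω : Ω) {j : ℕ} (hj : j < S.n) :
    S.prefixQv t j ω ≤ S.qv t ω :=
  Finset.sum_le_sum_of_subset_of_nonneg (Finset.range_subset_range.2 hj)
    fun i _ _ => S.qv_term_nonneg t ω i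

/-- The simple integrand set to zero as soon as its quadratic variation on `[0,t]` would
exceed `a`. -/
def stopped (S : SimpleIntegrand F T d) (hmono : Monotone F) (t a : ℝ) : SimpleIntegrand F T d where
  n := S.n
  time := S.time
  time_mono := S.time_mono
  time_mem := S.time_mem
  -- The sum tested includes cell `j` itself, yet involves only coefficients known at `time j`. The
  -- decision is thus adapted and the level is never overshot.
  coef j ω := if S.prefixQv t j ω ≤ a then S.coef j ω else 0
  coef_meas j := by
    have : Measurable[F (S.time j)] (S.prefixQv t j) := by
      refine Finset.measurable_fun_sum _ fun i hi => ?_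
      have hi' : i ≤ j := by have := Finset.mem_range.1 hi; omega
      have h1 : Measurable fun v : EuclideanSpace ℝ (Fin d) =>
          ‖v‖ ^ 2 * (min (S.time (i + 1)) t - min (S.time i) t) := by fun_prop
      exact h1.comp ((S.coef_meas i).mono (hmono (S.time_mono hi')) le_rfl)
    exact Measurable.ite (this measurableSet_Iic) (S.coef_meas j) measurable_const
  coef_bdd := by
    obtain ⟨C, hC⟩ := S.coef_bdd
    refine ⟨C, fun j ω => ?_⟩
    split_ifs
    · exact hC j ω
    · rw [norm_zero]; exact (norm_nonneg _).trans (hC j ω)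

/-- If cell `n` is kept, the sum through `n` is at most `prefixQv t n ω ≤ a`; otherwise its term is
zero and the previous bound stands. -/
lemma qv_stop_le (S : SimpleIntegrand F T d) (hmono : Monotone F) (t : ℝ) {a : ℝ} (ha : 0 ≤ a)
    (ω : Ω) : (S.stopped hmono t a).qv t ω ≤ a := by
  have hterm : ∀ j, ‖if S.prefixQv t j ω ≤ a then S.coef j ω else 0‖ ^ 2 *
      (min (S.time (j + 1)) t - min (S.time j) t) ≤
      ‖S.coef j ω‖ ^ 2 * (min (S.time (j + 1)) t - min (S.time j) t) := by
    intro j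
    split_ifs
    · exact le_rfl
    · simpa using S.qv_term_nonneg t ω j
  have key : ∀ n : ℕ, ∑ j ∈ Finset.range n, ‖if S.prefixQv t j ω ≤ a then S.coef j ω else 0‖ ^ 2 *
      (min (S.time (j + 1)) t - min (S.time j) t) ≤ a := by
    intro n
    induction n with
    | zero => simpa using ha
    | succ n ih =>
      by_cases h : S.prefixQv t n ω ≤ a
      · exact (Finset.sum_le_sum fun j _ => hterm j).trans h
      · rw [Finset.sum_range_succ, if_neg h]
        simpa using ih
  exact key S.n

lemma qv_stop_le_qv (S : SimpleIntegrand F T d) (hmono : Monotone F) (t a : ℝ) (ω : Ω) :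
    (S.stopped hmono t a).qv t ω ≤ S.qv t ω := by
  refine Finset.sum_le_sum fun j _ => ?_
  change ‖if S.prefixQv t j ω ≤ a then S.coef j ω else 0‖ ^ 2 * _ ≤ _
  split_ifs
  · exact le_rfl
  · simpa [stopped] using S.qv_term_nonneg t ω j

lemma stop_sint_of_le (S : SimpleIntegrand F T d) (hmono : Monotone F) {t a : ℝ} {ω : Ω}
    (h : S.qv t ω ≤ a) (s : ℝ) : (S.stopped hmono t a).sint B s ω = S.sint B s ω := by
  unfold sint stochSum
  refine Finset.sum_congr rfl fun j hj => ?_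
  have : (S.stopped hmono t a).coef j ω = S.coef j ω :=
    if_pos ((S.prefixQv_le_qv t ω (Finset.mem_range.1 hj)).trans h)
  rw [this]
  rfl

/-- The integral of the stopped integrand is the integral frozen at some time. -/
lemma exists_stop_sint_eq (S : SimpleIntegrand F T d) (hmono : Monotone F) (t a : ℝ) (ω : Ω) :
    ∃ ρ ∈ Icc 0 T, ∀ s, (S.stopped hmono t a).sint B s ω = S.sint B (min s ρ) ω := by
  classical
  have hex : ∃ j, j = S.n ∨ ¬ S.prefixQv t j ω ≤ a := ⟨S.n, Or.inl rfl⟩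
  -- The first cell that is switched off, or the end of the partition. Prefix sums increase, so
  -- every later cell is off too and the integral freezes at `time J`.
  let J := Nat.find hex
  have hlt : ∀ j < J, S.prefixQv t j ω ≤ a := fun j hj => by
    have := Nat.find_min hex hj
    push Not at this
    exact this.2
  have hge : ∀ j < S.n, J ≤ j → ¬ S.prefixQv t j ω ≤ a := fun j hj hJ => by
    rcases Nat.find_spec hex with h | h
    · exact absurd (h ▸ hJ : S.n ≤ j) (by omega)
    · exact fun h' => h ((S.prefixQv_mono t ω hJ).trans h')
  refine ⟨S.time J, S.time_mem J, fun s => ?_⟩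
  unfold sint stochSum
  refine Finset.sum_congr rfl fun j hj => ?_
  rcases lt_or_ge j J with h | h
  · have h1 : (S.stopped hmono t a).coef j ω = S.coef j ω := if_pos (hlt j h)
    rw [h1]
    have h2 := S.time_mono (show j + 1 ≤ J from h)
    have h3 := S.time_mono (show j ≤ J from h.le)
    have h4 : ∀ x, x ≤ S.time J → min x (min s (S.time J)) = min x s := fun x hx => by
      rw [min_comm s, ← min_assoc, min_eq_left hx]
    rw [h4 _ h2, h4 _ h3]
    rfl
  · have h1 : (S.stopped hmono t a).coef j ω = 0 := if_neg (hge j (Finset.mem_range.1 hj) h)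
    have h2 := S.time_mono (show J ≤ j + 1 by omega)
    have h3 := S.time_mono h
    rw [h1, min_eq_right (min_le_of_right_le h2), min_eq_right (min_le_of_right_le h3)]
    simp

/-- The localized Itô isometry. -/
lemma lintegral_sint_sq_le (S : SimpleIntegrand F T d) (hB : IsLevy F P T B)
    (hF : ∀ t, F t ≤ mΩ) (hmono : Monotone F) {t a : ℝ} (ht : t ∈ Icc 0 T) (ha : 0 ≤ a) :
    ∫⁻ ω in {ω | S.qv t ω ≤ a}, ENNReal.ofReal ((S.sint B t ω) ^ 2) ∂P ≤
      ∫⁻ ω, ENNReal.ofReal (min (S.qv t ω) a) ∂P := by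
  have hmeas : MeasurableSet {ω | S.qv t ω ≤ a} :=
    measurableSet_le (S.measurable_qv hF t) measurable_const
  have h1 : ∫⁻ ω in {ω | S.qv t ω ≤ a}, ENNReal.ofReal ((S.sint B t ω) ^ 2) ∂P ≤
      ∫⁻ ω, ENNReal.ofReal (((S.stopped hmono t a).sint B t ω) ^ 2) ∂P := by
    refine le_trans (le_of_eq ?_) (setLIntegral_le_lintegral {ω | S.qv t ω ≤ a} _)
    refine setLIntegral_congr_fun hmeas fun ω hω => ?_
    rw [S.stop_sint_of_le hmono hω]
  refine h1.trans ?_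
  have h2 := (memLp_sint (S.stopped hmono t a) hB hF ht).integrable_sq
  have h3 : Integrable (fun ω => min (S.qv t ω) a) P := by
    refine Integrable.of_bound (C := a) ((S.measurable_qv hF t).min
      measurable_const).aestronglyMeasurable (Eventually.of_forall fun ω => ?_)
    rw [Real.norm_of_nonneg (le_min (S.qv_nonneg t ω) ha)]
    exact min_le_right _ _
  rw [← ofReal_integral_eq_lintegral_ofReal h2 (Eventually.of_forall fun ω => sq_nonneg _),
    ← ofReal_integral_eq_lintegral_ofReal h3
      (Eventually.of_forall fun ω => le_min (S.qv_nonneg t ω) ha),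
    integral_sint_sq _ hB hF hmono ht]
  refine ENNReal.ofReal_le_ofReal (integral_mono_of_nonneg
    (Eventually.of_forall fun ω => qv_nonneg _ t ω) h3 (Eventually.of_forall fun ω => ?_))
  exact le_min (S.qv_stop_le_qv hmono t a ω) (S.qv_stop_le hmono t ha ω)

end SimpleIntegrand

/-! ### Almost sure approximation of Itô integrals -/

section AlmostSure

variable {W : Fin d → ℝ≥0 → Ω → ℝ} {P : Measure Ω} {T : ℝ}

/-- Pick indices along which both bad events have probability at most `2^{-k}`; Borel-Cantelli
upgrades convergence in probability to a.s. convergence. -/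
lemma IsItoIntegral.exists_ae_approx {H : ℝ → Ω → EuclideanSpace ℝ (Fin d)} {I : ℝ → Ω → ℝ}
    (h : IsItoIntegral W P T H I) :
    ∃ S : ℕ → SimpleIntegrand (brownianFiltration W P) T d,
      ∀ᵐ ω ∂P, Tendsto (fun n => ∫⁻ s in Icc 0 T, ‖(S n).eval s ω - H s ω‖ₑ ^ 2) atTop (𝓝 0) ∧
        TendstoUniformlyOn (fun n t => (S n).sint (vecBM W) t ω) (fun t => I t ω) atTop
          (Icc 0 T) := by
  obtain ⟨S, h1, h2⟩ := h
  have hpos : ∀ k : ℕ, (0 : ℝ≥0∞) < (1 / 2) ^ k := fun k =>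
    ENNReal.pow_pos (by norm_num) k
  have hex : ∀ k : ℕ, ∃ n, P {ω | ENNReal.ofReal ((1 / 2) ^ k) ≤
      ∫⁻ s in Icc 0 T, ‖(S n).eval s ω - H s ω‖ₑ ^ 2} ≤ (1 / 2) ^ k ∧
      P {ω | ∃ t ∈ Icc 0 T, (1 / 2) ^ k ≤ |(S n).integral W t ω - I t ω|} ≤ (1 / 2) ^ k := by
    intro k
    exact (((h1 _ (ENNReal.ofReal_pos.2 (by positivity))).eventually_le_const (hpos k)).and
      ((h2 ((1 / 2) ^ k) (by positivity)).eventually_le_const (hpos k))).exists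
  choose n hn using hex
  have hgeo : ∑' k : ℕ, ((1 / 2 : ℝ≥0∞)) ^ k ≠ ⊤ := by
    rw [ENNReal.tsum_geometric]
    simp
  have e1 := ae_eventually_notMem (ne_top_of_le_ne_top hgeo
    (ENNReal.tsum_le_tsum fun k => (hn k).1))
  have e2 := ae_eventually_notMem (ne_top_of_le_ne_top hgeo
    (ENNReal.tsum_le_tsum fun k => (hn k).2))
  have hz : Tendsto (fun k : ℕ => (1 / 2 : ℝ) ^ k) atTop (𝓝 0) :=
    tendsto_pow_atTop_nhds_zero_of_lt_one (by norm_num) (by norm_num)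
  refine ⟨fun k => S (n k), ?_⟩
  filter_upwards [e1, e2] with ω h3 h4
  constructor
  · refine tendsto_of_tendsto_of_tendsto_of_le_of_le' tendsto_const_nhds
      (h := fun k : ℕ => ENNReal.ofReal ((1 / 2) ^ k)) ?_ (Eventually.of_forall fun _ => zero_le) ?_
    · simpa using ENNReal.tendsto_ofReal hz
    · exact h3.mono fun k hk => (not_le.1 hk).le
  · rw [Metric.tendstoUniformlyOn_iff]
    intro ε hε
    filter_upwards [h4, hz.eventually_lt_const hε] with k hk hkε t ht
    rw [dist_comm, Real.dist_eq, ← SimpleIntegrand.integral_eq_sint]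
    refine lt_trans ?_ hkε
    by_contra hcon
    exact hk ⟨t, ht, not_lt.1 hcon⟩

/-- A jointly measurable version with continuous paths of a process which is a.s. continuous
on `[0,T]`. -/
lemma exists_continuous_version [IsProbabilityMeasure P] (hT : 0 ≤ T) {X : ℝ → Ω → ℝ}
    (hX : ∀ t ∈ Icc 0 T, Measurable (X t))
    (hc : ∀ᵐ ω ∂P, ContinuousOn (fun t => X t ω) (Icc 0 T)) :
    ∃ Y : ℝ → Ω → ℝ, Measurable (fun p : ℝ × Ω => Y p.1 p.2) ∧ (∀ ω, Continuous (Y · ω)) ∧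
      ∀ᵐ ω ∂P, ∀ t ∈ Icc 0 T, Y t ω = X t ω := by
  classical
  obtain ⟨s, hs, hsm, hs0⟩ := exists_measurable_superset_of_null (ae_iff.1 hc)
  have hgood : ∀ ω ∉ s, ContinuousOn (fun t => X t ω) (Icc 0 T) := fun ω hω => by
    by_contra h
    exact hω (hs h)
  let Y : ℝ → Ω → ℝ := fun t ω => if ω ∈ s then 0 else X (projIcc 0 T hT t) ω
  have hYc : ∀ ω, Continuous (Y · ω) := by
    intro ω
    by_cases h : ω ∈ s
    · simpa [Y, h] using continuous_const
    · simp only [Y, if_neg h]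
      exact (hgood ω h).comp_continuous (continuous_subtype_val.comp continuous_projIcc)
        fun t => (projIcc 0 T hT t).2
  have hYm : ∀ t, Measurable (Y t) := fun t =>
    Measurable.ite hsm measurable_const (hX _ (projIcc 0 T hT t).2)
  refine ⟨Y, measurable_uncurry_of_continuous_of_measurable (u := Y) hYc hYm, hYc, ?_⟩
  have : ∀ᵐ ω ∂P, ω ∉ s := measure_eq_zero_iff_ae_notMem.1 hs0
  filter_upwards [this] with ω hω t ht
  simp [Y, hω, projIcc_of_mem hT ht]

end AlmostSure

/-! ### Calculus of absolutely continuous functions -/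

section AbsolutelyContinuous

lemma AbsolutelyContinuousOnInterval_exp {f : ℝ → ℝ} {a b : ℝ}
    (hf : AbsolutelyContinuousOnInterval f a b) :
    AbsolutelyContinuousOnInterval (fun t => Real.exp (f t)) a b := by
  obtain ⟨C, hC⟩ := hf.exists_bound
  rw [absolutelyContinuousOnInterval_iff] at hf ⊢
  intro ε hε
  have hC0 : 0 < Real.exp C := Real.exp_pos C
  obtain ⟨δ, hδ, h⟩ := hf (ε / Real.exp C) (by positivity)
  refine ⟨δ, hδ, fun E hE hsum => ?_⟩
  have h1 := h E hE hsum
  rw [lt_div_iff₀ hC0, mul_comm, Finset.mul_sum] at h1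
  refine lt_of_le_of_lt (Finset.sum_le_sum fun i hi => ?_) h1
  have hlip : ∀ u v : ℝ, u ≤ C → v ≤ C → |Real.exp u - Real.exp v| ≤ Real.exp C * |u - v| := by
    intro u v hu hv
    have := Convex.norm_image_sub_le_of_norm_deriv_le (f := Real.exp) (s := Iic C) (C := Real.exp C)
      (fun x _ => Real.differentiableAt_exp) (fun x hx => by
        rw [Real.deriv_exp, Real.norm_of_nonneg (Real.exp_pos x).le]
        exact Real.exp_le_exp.2 hx) (convex_Iic C) hv hu
    simpa using this
  have hmem := hE.1 i hi
  rw [Real.dist_eq, Real.dist_eq]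
  exact hlip _ _ ((le_abs_self _).trans (hC _ hmem.1)) ((le_abs_self _).trans (hC _ hmem.2))

lemma AbsolutelyContinuousOnInterval_integral_eq {f f' : ℝ → ℝ} {a b : ℝ}
    (hf : AbsolutelyContinuousOnInterval f a b)
    (h : ∀ᵐ x, x ∈ uIcc a b → HasDerivAt f (f' x) x) : ∫ x in a..b, f' x = f b - f a := by
  rw [← hf.integral_deriv_eq_sub]
  refine intervalIntegral.integral_congr_ae ?_
  filter_upwards [h] with x hx hx'
  exact (hx (uIoc_subset_uIcc hx')).deriv.symm

/-- Product rule for `exp (∫ b) * ∫ g`. -/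
lemma integral_exp_mul_primitive {b g : ℝ → ℝ} {s t : ℝ} (hb : IntervalIntegrable b volume s t)
    (hg : IntervalIntegrable g volume s t) (c : ℝ) :
    ∫ u in s..t, (b u * Real.exp (∫ v in s..u, b v) * (c + ∫ v in s..u, g v) +
      Real.exp (∫ v in s..u, b v) * g u) =
      Real.exp (∫ v in s..t, b v) * (c + ∫ v in s..t, g v) - c := by
  have hb' := hb.absolutelyContinuousOnInterval_intervalIntegral (c := s) left_mem_uIcc
  have hg' := hg.absolutelyContinuousOnInterval_intervalIntegral (c := s) left_mem_uIcc
  have hc : AbsolutelyContinuousOnInterval (fun _ : ℝ => c) s t :=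
    (contDiffOn_const (n := 1)).absolutelyContinuousOnInterval
  have h := (AbsolutelyContinuousOnInterval_exp hb').fun_mul (hc.add hg')
  have := AbsolutelyContinuousOnInterval_integral_eq (f' := fun u =>
    b u * Real.exp (∫ v in s..u, b v) * (c + ∫ v in s..u, g v) +
      Real.exp (∫ v in s..u, b v) * g u) h (by
    filter_upwards [hb.ae_hasDerivAt_integral, hg.ae_hasDerivAt_integral] with x h1 h2 hx
    have h3 := (h1 hx s left_mem_uIcc).exp.mul ((h2 hx s left_mem_uIcc).const_add c)
    exact h3.congr_deriv (by ring))
  rw [this]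
  simp

end AbsolutelyContinuous

/-! ### Uniqueness for linear stochastic equations -/

section Uniqueness

lemma lintegral_mul_sq_le {α : Type*} [MeasurableSpace α] {μ : Measure α} {f g : α → ℝ≥0∞}
    (hf : AEMeasurable f μ) (hg : AEMeasurable g μ) :
    (∫⁻ a, f a * g a ∂μ) ^ 2 ≤ (∫⁻ a, f a ^ 2 ∂μ) * ∫⁻ a, g a ^ 2 ∂μ := by
  have h := ENNReal.lintegral_mul_le_Lp_mul_Lq μ Real.HolderConjugate.two_two hf hg
  simp only [Pi.mul_apply, ENNReal.rpow_ofNat] at h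
  calc (∫⁻ a, f a * g a ∂μ) ^ 2 ≤ ((∫⁻ a, f a ^ 2 ∂μ) ^ (1 / 2 : ℝ) *
      (∫⁻ a, g a ^ 2 ∂μ) ^ (1 / 2 : ℝ)) ^ 2 := by gcongr
    _ = _ := by
      rw [mul_pow, ← ENNReal.rpow_ofNat, ← ENNReal.rpow_ofNat, ← ENNReal.rpow_mul,
        ← ENNReal.rpow_mul]
      norm_num

/-- Cauchy-Schwarz after splitting `|b|` into two square roots. It asks only integrability of the
weight `b`, and the bound is useful although `b` need not be square integrable. -/
lemma enorm_integral_mul_sq_le {t : ℝ} (ht : 0 ≤ t) {D b : ℝ → ℝ}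
    (hD : AEStronglyMeasurable D (volume.restrict (Icc 0 t)))
    (hb : AEStronglyMeasurable b (volume.restrict (Icc 0 t))) :
    ‖∫ u in (0 : ℝ)..t, D u * b u‖ₑ ^ 2 ≤
      (∫⁻ s in Icc 0 t, ‖b s‖ₑ) * ∫⁻ s in Icc 0 t, ‖D s‖ₑ ^ 2 * ‖b s‖ₑ := by
  have hbm := hb.enorm
  have h1 : ‖∫ u in (0 : ℝ)..t, D u * b u‖ₑ ≤
      ∫⁻ s in Icc 0 t, (‖D s‖ₑ * ‖b s‖ₑ ^ (1 / 2 : ℝ)) * ‖b s‖ₑ ^ (1 / 2 : ℝ) := by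
    rw [intervalIntegral.integral_of_le ht, ← integral_Icc_eq_integral_Ioc]
    refine (enorm_integral_le_lintegral_enorm _).trans (le_of_eq (lintegral_congr fun s => ?_))
    rw [enorm_mul, mul_assoc, ← ENNReal.rpow_add_of_nonneg _ _ (by norm_num) (by norm_num)]
    norm_num
  have h2 := lintegral_mul_sq_le (hD.enorm.mul (hbm.pow_const (1 / 2 : ℝ)))
    (hbm.pow_const (1 / 2 : ℝ))
  have h3 : ∀ s, (‖b s‖ₑ ^ (1 / 2 : ℝ)) ^ 2 = ‖b s‖ₑ := fun s => by
    rw [← ENNReal.rpow_ofNat, ← ENNReal.rpow_mul]; norm_num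
  simp only [Pi.mul_apply, mul_pow, h3] at h2
  refine (pow_le_pow_left₀ zero_le h1 2).trans (h2.trans ?_)
  rw [mul_comm]

/-- Gronwall's lemma without measurability of `u`. By absolute continuity of `∫ k`, an interval of
length `η` carries mass below `1/2`; if `u` vanishes up to `n η`, its supremum `S` up to `(n+1) η`
satisfies `S ≤ S/2`, and `S` is finite. -/
lemma eq_zero_of_le_lintegral {T : ℝ} {u k : ℝ → ℝ≥0∞} {K : ℝ≥0∞}
    (hk : ∫⁻ s in Icc 0 T, k s ≠ ⊤) (hK : K ≠ ⊤) (hu : ∀ t ∈ Icc 0 T, u t ≤ K)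
    (h : ∀ t ∈ Icc 0 T, u t ≤ ∫⁻ s in Icc 0 t, u s * k s) : ∀ t ∈ Icc 0 T, u t = 0 := by
  obtain ⟨δ, hδ, hδ'⟩ := exists_pos_setLIntegral_lt_of_measure_lt hk
    (show (1 / 2 : ℝ≥0∞) ≠ 0 by norm_num)
  obtain ⟨η, hη, hηδ⟩ : ∃ η : ℝ, 0 < η ∧ ENNReal.ofReal η < δ := by
    by_cases hδt : δ = ⊤
    · exact ⟨1, one_pos, by simp [hδt]⟩
    · refine ⟨δ.toReal / 2, half_pos (ENNReal.toReal_pos hδ.ne' hδt), ?_⟩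
      rw [ENNReal.ofReal_lt_iff_lt_toReal (by positivity) hδt]
      exact half_lt_self (ENNReal.toReal_pos hδ.ne' hδt)
  have key : ∀ n : ℕ, ∀ t ∈ Icc 0 T, t ≤ n * η → u t = 0 := by
    intro n
    induction n with
    | zero =>
      intro t ht hle
      have ht0 : t = 0 := le_antisymm (by simpa using hle) ht.1
      have := h t ht
      rw [ht0, Icc_self, Measure.restrict_singleton] at this
      rw [ht0]
      simpa using this
    | succ n ih =>
      set S := ⨆ t : {t : ℝ // t ∈ Icc 0 T ∧ t ≤ (n + 1 : ℕ) * η}, u t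
      have hS : ∀ t ∈ Icc 0 T, t ≤ (n + 1 : ℕ) * η → u t ≤ S := fun t ht hle =>
        le_iSup (fun t : {t : ℝ // t ∈ Icc 0 T ∧ t ≤ (n + 1 : ℕ) * η} => u t) ⟨t, ht, hle⟩
      have hSK : S ≤ K := iSup_le fun t => hu t t.2.1
      have hhalf : S ≤ S * (1 / 2) := by
        refine iSup_le fun ⟨t, ht, hle⟩ => ?_
        have h1 : ∫⁻ s in Icc 0 t, u s * k s ≤
            ∫⁻ s in Icc 0 t, (Ioi (n * η)).indicator (fun s => S * k s) s := by
          refine setLIntegral_mono' measurableSet_Icc fun s hs => ?_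
          have hsm : s ∈ Icc 0 T := ⟨hs.1, hs.2.trans ht.2⟩
          by_cases hsn : s ≤ n * η
          · simp [ih s hsm hsn]
          · rw [indicator_of_mem (by exact not_le.1 hsn)]
            gcongr
            exact hS s hsm (hs.2.trans hle)
        refine (h t ht).trans (h1.trans ?_)
        rw [lintegral_indicator measurableSet_Ioi, lintegral_const_mul' _ _
          (ne_top_of_le_ne_top hK hSK), Measure.restrict_restrict measurableSet_Ioi]
        gcongr
        have hsub : Ioi (n * η) ∩ Icc 0 t ⊆ Icc 0 T := fun s hs => ⟨hs.2.1, hs.2.2.trans ht.2⟩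
        have h2 := hδ' (Ioi (n * η) ∩ Icc 0 t) (by
          rw [Measure.restrict_apply (measurableSet_Ioi.inter measurableSet_Icc),
            inter_eq_left.2 hsub]
          refine lt_of_le_of_lt ?_ hηδ
          have : Ioi (n * η) ∩ Icc 0 t ⊆ Ioc (n * η) (n * η + η) := fun s hs =>
            ⟨hs.1, hs.2.2.trans (hle.trans (by push_cast; linarith))⟩
          refine (measure_mono this).trans ?_
          rw [Real.volume_Ioc, add_sub_cancel_left])
        rw [Measure.restrict_restrict (measurableSet_Ioi.inter measurableSet_Icc),
          inter_eq_left.2 hsub] at h2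
        exact h2.le
      have hS0 : S = 0 := by
        by_contra hS0
        have hSt : S ≠ ⊤ := ne_top_of_le_ne_top hK hSK
        have h3 : S * (1 / 2) < S := by
          rw [one_div, ← div_eq_mul_inv]; exact ENNReal.half_lt_self hS0 hSt
        exact absurd hhalf (not_le.2 h3)
      intro t ht hle
      exact le_antisymm ((hS t ht hle).trans hS0.le) zero_le
  intro t ht
  obtain ⟨n, hn⟩ := exists_nat_ge (t / η)
  exact key n t ht (by rwa [div_le_iff₀ hη] at hn)

/-- Let `A` be the running integral. While `A < a` everything is counted, and by continuity `A`
reaches every level below `a`. Stopping at level `a` is thus expressed by the indicator of `A < a`,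
without a stopping time. -/
lemma min_lintegral_le {T a : ℝ} {g : ℝ → ℝ≥0∞} (hg : Measurable g)
    (hfin : ∫⁻ s in Icc 0 T, g s ≠ ⊤) {t : ℝ} (ht : t ∈ Icc 0 T) :
    min (∫⁻ s in Icc 0 t, g s) (ENNReal.ofReal a) ≤
      ∫⁻ s in Icc 0 t, (if ∫⁻ r in Icc 0 s, g r < ENNReal.ofReal a then g s else 0) := by
  set A : ℝ → ℝ≥0∞ := fun s => ∫⁻ r in Icc 0 s, g r
  have hA : Monotone A := fun s r hsr => lintegral_mono_set (Icc_subset_Icc_right hsr)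
  have hle : ∀ r ∈ Icc 0 t, A r < ENNReal.ofReal a →
      A r ≤ ∫⁻ s in Icc 0 t, (if A s < ENNReal.ofReal a then g s else 0) := by
    intro r hr hlt
    refine le_trans (le_of_eq ?_) (lintegral_mono_set (Icc_subset_Icc_right hr.2))
    refine setLIntegral_congr_fun measurableSet_Icc fun s hs => ?_
    rw [if_pos ((hA hs.2).trans_lt hlt)]
  rcases lt_or_ge (A t) (ENNReal.ofReal a) with h | h
  · exact (min_le_left _ _).trans (hle t ⟨ht.1, le_rfl⟩ h)
  · refine (min_le_right _ _).trans ?_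
    have hfin' : ∫⁻ s in Icc 0 t, g s ≠ ⊤ := ne_top_of_le_ne_top hfin (hA ht.2)
    have hcont : ContinuousOn A (Icc 0 t) := by
      have hint : IntegrableOn (fun s => (g s).toReal) (Icc 0 t) :=
        integrable_toReal_of_lintegral_ne_top hg.aemeasurable hfin'
      have h1 := ENNReal.continuous_ofReal.comp_continuousOn
        (intervalIntegral.continuousOn_primitive_Icc hint)
      refine h1.congr fun s hs => ?_
      have hs' : ∫⁻ r in Icc 0 s, g r ≠ ⊤ := ne_top_of_le_ne_top hfin' (hA hs.2)
      simp only [Function.comp]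
      rw [integral_toReal hg.aemeasurable (ae_lt_top hg hs'), ENNReal.ofReal_toReal hs']
    have hA0 : A 0 = 0 := by simp [A]
    refine le_of_forall_lt fun c hc => ?_
    obtain ⟨c', hc1, hc2⟩ := exists_between hc
    obtain ⟨r, hr, hrA⟩ := intermediate_value_Icc ht.1 hcont
      ⟨by rw [hA0]; exact zero_le, hc2.le.trans h⟩
    exact (hc1.trans_le (hrA ▸ le_rfl)).trans_le (hle r hr (hrA ▸ hc2))

variable {F : ℝ → MeasurableSpace Ω} {P : Measure Ω} [IsProbabilityMeasure P] {T : ℝ}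
  {B : ℝ → Ω → EuclideanSpace ℝ (Fin d)}

lemma tendsto_qv {S : ℕ → SimpleIntegrand F T d} (hF : ∀ t, F t ≤ mΩ)
    {H : ℝ → EuclideanSpace ℝ (Fin d)}
    {ω : Ω} (hH : AEStronglyMeasurable H (volume.restrict (Icc 0 T)))
    (h : Tendsto (fun n => ∫⁻ s in Icc 0 T, ‖(S n).eval s ω - H s‖ₑ ^ 2) atTop (𝓝 0)) {t : ℝ}
    (ht : t ∈ Icc 0 T) :
    Tendsto (fun n => ENNReal.ofReal ((S n).qv t ω)) atTop (𝓝 (∫⁻ s in Icc 0 t, ‖H s‖ₑ ^ 2)) := by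
  have hle : volume.restrict (Icc 0 t) ≤ volume.restrict (Icc 0 T) :=
    Measure.restrict_mono (Icc_subset_Icc_right ht.2) le_rfl
  simp_rw [← SimpleIntegrand.lintegral_eval_sq]
  refine tendsto_lintegral_enorm_sq (fun n => ?_) (hH.mono_measure hle) ?_
  · have h1 := ((S n).measurable_eval hF).comp (measurable_prodMk_right (y := ω))
    exact h1.aestronglyMeasurable
  · exact tendsto_of_tendsto_of_tendsto_of_le_of_le tendsto_const_nhds h (fun _ => zero_le)
      fun n => lintegral_mono' hle le_rfl

lemma enorm_sq_eq_ofReal (x : ℝ) : ‖x‖ₑ ^ 2 = ENNReal.ofReal (x ^ 2) := by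
  rw [← ofReal_norm, ← ENNReal.ofReal_pow (norm_nonneg _), Real.norm_eq_abs, sq_abs]

lemma enorm_add_sq_le (x y : ℝ) : ‖x + y‖ₑ ^ 2 ≤ 2 * ‖x‖ₑ ^ 2 + 2 * ‖y‖ₑ ^ 2 := by
  simp_rw [enorm_sq_eq_ofReal]
  rw [← ENNReal.ofReal_ofNat, ← ENNReal.ofReal_mul (by norm_num), ← ENNReal.ofReal_mul (by norm_num),
    ← ENNReal.ofReal_add (by positivity) (by positivity)]
  exact ENNReal.ofReal_le_ofReal (by nlinarith [sq_nonneg (x - y)])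

/-- The homogeneous linear equation `dD = D b dt + D y' dB`, `D_0 = 0`, has only the zero
solution. -/
theorem ae_eq_zero_of_linear (hB : IsLevy F P T B) (hF : ∀ t, F t ≤ mΩ) (hmono : Monotone F)
    (hT : 0 ≤ T) {D : ℝ → Ω → ℝ} (hDm : Measurable fun p : ℝ × Ω => D p.1 p.2)
    (hDc : ∀ ω, Continuous (D · ω)) {y : ℝ → EuclideanSpace ℝ (Fin d)}
    (hy : MemLp y 2 (volume.restrict (Icc 0 T))) {b : ℝ → ℝ} (hb : IntegrableOn b (Icc 0 T))
    {S : ℕ → SimpleIntegrand F T d}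
    (hS : ∀ᵐ ω ∂P,
      Tendsto (fun n => ∫⁻ s in Icc 0 T, ‖(S n).eval s ω - D s ω • y s‖ₑ ^ 2) atTop (𝓝 0) ∧
      ∀ t ∈ Icc 0 T, Tendsto (fun n => (S n).sint B t ω) atTop
        (𝓝 (D t ω - ∫ u in (0 : ℝ)..t, D u ω * b u))) :
    ∀ᵐ ω ∂P, ∀ t ∈ Icc 0 T, D t ω = 0 := by
  set μ := volume.restrict (Icc (0 : ℝ) T)
  -- The weight dominates both `‖y‖²` and `|b|`, so the energy `∫ |D|² k` controls the quadratic
  -- variation and the drift together. A measurable version is taken for Tonelli's theorem.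
  obtain ⟨k, hkm, hkeq⟩ : ∃ k : ℝ → ℝ≥0∞, Measurable k ∧
      (fun s => ‖y s‖ₑ ^ 2 + ‖b s‖ₑ) =ᵐ[μ] k := by
    have : AEMeasurable (fun s => ‖y s‖ₑ ^ 2 + ‖b s‖ₑ) μ :=
      (hy.1.enorm.pow_const 2).add hb.1.enorm
    exact ⟨_, this.measurable_mk, this.ae_eq_mk⟩
  have hkfin : ∫⁻ s in Icc 0 T, k s ≠ ⊤ := by
    rw [← lintegral_congr_ae hkeq, lintegral_add_left' (hy.1.enorm.pow_const 2)]
    exact ENNReal.add_ne_top.2 ⟨lintegral_enorm_sq_ne_top hy, hb.2.ne⟩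
  have hle : ∀ {t}, t ∈ Icc 0 T → volume.restrict (Icc 0 t) ≤ μ := fun {t} ht =>
    Measure.restrict_mono (Icc_subset_Icc_right ht.2) le_rfl
  set A : ℝ → Ω → ℝ≥0∞ := fun t ω => ∫⁻ s in Icc 0 t, ‖D s ω‖ₑ ^ 2 * k s
  have hDk : Measurable fun p : Ω × ℝ => ‖D p.2 p.1‖ₑ ^ 2 * k p.2 :=
    ((hDm.comp measurable_swap).enorm.pow_const 2).mul (hkm.comp measurable_snd)
  have hDkω : ∀ ω, Measurable fun s => ‖D s ω‖ₑ ^ 2 * k s := fun ω =>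
    hDk.comp measurable_prodMk_left
  have hAm : Measurable fun p : Ω × ℝ => A p.2 p.1 := by
    have h1 : ∀ p : Ω × ℝ, A p.2 p.1 =
        ∫⁻ s, (Icc 0 p.2).indicator (fun s => ‖D s p.1‖ₑ ^ 2 * k s) s := fun p =>
      (lintegral_indicator measurableSet_Icc _).symm
    simp_rw [h1]
    refine Measurable.lintegral_prod_right' (f := fun q : (Ω × ℝ) × ℝ =>
      (Icc 0 q.1.2).indicator (fun s => ‖D s q.1.1‖ₑ ^ 2 * k s) q.2) ?_
    have hset : MeasurableSet {q : (Ω × ℝ) × ℝ | 0 ≤ q.2 ∧ q.2 ≤ q.1.2} :=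
      (measurableSet_le measurable_const measurable_snd).inter
        (measurableSet_le measurable_snd (measurable_snd.comp measurable_fst))
    have h2 : (fun q : (Ω × ℝ) × ℝ => (Icc 0 q.1.2).indicator
        (fun s => ‖D s q.1.1‖ₑ ^ 2 * k s) q.2) =
        {q : (Ω × ℝ) × ℝ | 0 ≤ q.2 ∧ q.2 ≤ q.1.2}.indicator
          fun q => ‖D q.2 q.1.1‖ₑ ^ 2 * k q.2 := by
      funext q
      simp only [indicator, mem_Icc, Set.mem_ofPred_eq]
    rw [h2]
    exact (hDk.comp ((measurable_fst.comp measurable_fst).prodMk measurable_snd)).indicator hset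
  have hAfin : ∀ ω, A T ω ≠ ⊤ := by
    intro ω
    obtain ⟨C, hC⟩ := isCompact_Icc.exists_bound_of_continuousOn ((hDc ω).continuousOn (s := Icc 0 T))
    have h1 : A T ω ≤ ∫⁻ s in Icc 0 T, ENNReal.ofReal C ^ 2 * k s := by
      refine setLIntegral_mono' measurableSet_Icc fun s hs => ?_
      gcongr
      rw [← ofReal_norm]
      exact ENNReal.ofReal_le_ofReal (hC s hs)
    refine ne_top_of_le_ne_top ?_ h1
    rw [lintegral_const_mul _ hkm]
    exact ENNReal.mul_ne_top (by simp) hkfin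
  have hAmono : ∀ ω, Monotone (A · ω) := fun ω s t hst => lintegral_mono_set (Icc_subset_Icc_right hst)
  have hHA : ∀ ω, ∀ t ∈ Icc 0 T, ∫⁻ s in Icc 0 t, ‖D s ω • y s‖ₑ ^ 2 ≤ A t ω := by
    intro ω t ht
    refine lintegral_mono_ae (ae_mono (hle ht) ?_)
    filter_upwards [hkeq] with s hs
    rw [enorm_smul, mul_pow]
    gcongr
    exact hs ▸ le_self_add
  have hbA : ∀ ω, ∀ t ∈ Icc 0 T, ‖∫ u in (0 : ℝ)..t, D u ω * b u‖ₑ ^ 2 ≤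
      (∫⁻ s in Icc 0 T, k s) * A t ω := by
    intro ω t ht
    refine (enorm_integral_mul_sq_le ht.1 (hDc ω).aestronglyMeasurable
      (hb.mono_set (Icc_subset_Icc_right ht.2)).1).trans ?_
    have hbk : ∀ᵐ s ∂μ, ‖b s‖ₑ ≤ k s := by
      filter_upwards [hkeq] with s hs
      exact hs ▸ le_add_self
    refine mul_le_mul' ((lintegral_mono' (hle ht) le_rfl).trans (lintegral_mono_ae hbk)) ?_
    refine lintegral_mono_ae (ae_mono (hle ht) ?_)
    filter_upwards [hbk] with s hs
    gcongr
  set C : ℝ≥0∞ := 2 + 2 * ∫⁻ s in Icc 0 T, k s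
  have hC : C ≠ ⊤ := ENNReal.add_ne_top.2 ⟨by simp, ENNReal.mul_ne_top (by simp) hkfin⟩
  have hDt : ∀ t, Measurable (D t) := fun t => hDm.comp measurable_prodMk_left
  have hAt : ∀ t, Measurable (A t) := fun t => hAm.comp measurable_prodMk_right
  have main : ∀ a : ℝ, 0 < a → ∀ t ∈ Icc 0 T,
      ∫⁻ ω, (if A t ω < ENNReal.ofReal a then ‖D t ω‖ₑ ^ 2 else 0) ∂P = 0 := by
    intro a ha
    -- The second moment localised to small energy. It is bounded although `D` itself may have no
    -- moments.
    set u : ℝ → ℝ≥0∞ := fun t => ∫⁻ ω, (if A t ω < ENNReal.ofReal a then ‖D t ω‖ₑ ^ 2 else 0) ∂P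
    have hJ : ∀ t ∈ Icc 0 T, ∫⁻ ω, (if A t ω < ENNReal.ofReal a then
        ‖D t ω - ∫ u in (0 : ℝ)..t, D u ω * b u‖ₑ ^ 2 else 0) ∂P ≤
        ∫⁻ ω, min (A t ω) (ENNReal.ofReal a) ∂P := by
      intro t ht
      set f : ℕ → Ω → ℝ≥0∞ := fun n => {ω | (S n).qv t ω ≤ a}.indicator
        fun ω => ENNReal.ofReal (((S n).sint B t ω) ^ 2)
      have hqm : ∀ n, MeasurableSet {ω | (S n).qv t ω ≤ a} := fun n =>
        measurableSet_le ((S n).measurable_qv hF t) measurable_const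
      have hfm : ∀ n, Measurable (f n) := fun n =>
        ((((S n).measurable_sint hB hmono ht).mono (hF t) le_rfl).pow_const 2).ennreal_ofReal.indicator
          (hqm n)
      have hHm : ∀ ω, AEStronglyMeasurable (fun s => D s ω • y s) μ := fun ω =>
        (hDc ω).aestronglyMeasurable.smul hy.1
      -- On `A < a` the quadratic variations of the approximants are eventually below `a`, so the
      -- localised isometry applies to them and Fatou's lemma passes to the limit.
      have h1 : ∀ᵐ ω ∂P, (if A t ω < ENNReal.ofReal a then
          ‖D t ω - ∫ u in (0 : ℝ)..t, D u ω * b u‖ₑ ^ 2 else 0) ≤ liminf (fun n => f n ω) atTop := by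
        filter_upwards [hS] with ω hω
        split_ifs with hlt
        · have hq := tendsto_qv hF (hHm ω) hω.1 ht
          have hev := hq.eventually_lt_const ((hHA ω t ht).trans_lt hlt)
          have hlim : Tendsto (fun n => f n ω) atTop
              (𝓝 (‖D t ω - ∫ u in (0 : ℝ)..t, D u ω * b u‖ₑ ^ 2)) := by
            rw [enorm_sq_eq_ofReal]
            refine (ENNReal.tendsto_ofReal ((hω.2 t ht).pow 2)).congr' ?_
            filter_upwards [hev] with n hn
            rw [ENNReal.ofReal_lt_ofReal_iff ha] at hn
            simp only [f]
            rw [indicator_of_mem (by exact hn.le)]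
          exact hlim.liminf_eq.ge
        · exact zero_le
      refine (lintegral_mono_ae h1).trans ((lintegral_liminf_le hfm).trans ?_)
      have h2 : ∀ n, ∫⁻ ω, f n ω ∂P ≤
          ∫⁻ ω, min (ENNReal.ofReal ((S n).qv t ω)) (ENNReal.ofReal a) ∂P := by
        intro n
        simp only [f]
        rw [lintegral_indicator (hqm n)]
        refine ((S n).lintegral_sint_sq_le hB hF hmono ht ha.le).trans (le_of_eq ?_)
        simp_rw [ENNReal.ofReal_min]
      have h3 : Tendsto (fun n => ∫⁻ ω, min (ENNReal.ofReal ((S n).qv t ω)) (ENNReal.ofReal a) ∂P)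
          atTop (𝓝 (∫⁻ ω, min (∫⁻ s in Icc 0 t, ‖D s ω • y s‖ₑ ^ 2) (ENNReal.ofReal a) ∂P)) := by
        refine tendsto_lintegral_of_dominated_convergence (fun _ => ENNReal.ofReal a)
          (fun n => ((S n).measurable_qv hF t).ennreal_ofReal.min measurable_const)
          (fun n => Eventually.of_forall fun ω => min_le_right _ _) (by simp) ?_
        filter_upwards [hS] with ω hω
        exact (tendsto_qv hF (hHm ω) hω.1 ht).min tendsto_const_nhds
      refine (liminf_le_liminf (Eventually.of_forall h2)).trans (h3.liminf_eq.le.trans ?_)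
      exact lintegral_mono fun ω => min_le_min_right _ (hHA ω t ht)
    have hu1 : ∀ t ∈ Icc 0 T, u t ≤ C * ∫⁻ ω, min (A t ω) (ENNReal.ofReal a) ∂P := by
      intro t ht
      have hpt : ∀ ω, (if A t ω < ENNReal.ofReal a then ‖D t ω‖ₑ ^ 2 else 0) ≤
          2 * (if A t ω < ENNReal.ofReal a then
            ‖D t ω - ∫ u in (0 : ℝ)..t, D u ω * b u‖ₑ ^ 2 else 0) +
          2 * (∫⁻ s in Icc 0 T, k s) * min (A t ω) (ENNReal.ofReal a) := by
        intro ω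
        split_ifs with hlt
        · rw [min_eq_left hlt.le, mul_assoc]
          have h1 := enorm_add_sq_le (D t ω - ∫ u in (0 : ℝ)..t, D u ω * b u)
            (∫ u in (0 : ℝ)..t, D u ω * b u)
          rw [sub_add_cancel] at h1
          refine h1.trans ?_
          gcongr
          exact hbA ω t ht
        · exact zero_le
      refine (lintegral_mono hpt).trans ?_
      rw [lintegral_add_right _ (((hAt t).min measurable_const).const_mul _),
        lintegral_const_mul' _ _ (by simp), lintegral_const_mul' _ _
        (ENNReal.mul_ne_top (by simp) hkfin), add_mul]
      exact add_le_add (mul_le_mul_right (hJ t ht) 2) le_rfl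
    refine eq_zero_of_le_lintegral (k := fun s => C * k s) (K := C * ENNReal.ofReal a) ?_
      (ENNReal.mul_ne_top hC ENNReal.ofReal_ne_top) (fun t ht => ?_) (fun t ht => ?_)
    · rw [lintegral_const_mul _ hkm]
      exact ENNReal.mul_ne_top hC hkfin
    · refine (hu1 t ht).trans ?_
      gcongr
      refine (lintegral_mono fun ω => min_le_right _ _).trans ?_
      simp
    · refine (hu1 t ht).trans ?_
      -- The truncated energy is at most the energy gathered while `A s < a`; exchanging the
      -- integrals turns the estimate into Gronwall's inequality for `u` with kernel `C * k`.
      have h4 : ∫⁻ ω, min (A t ω) (ENNReal.ofReal a) ∂P ≤ ∫⁻ ω, (∫⁻ s in Icc 0 t,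
          (if A s ω < ENNReal.ofReal a then ‖D s ω‖ₑ ^ 2 * k s else 0)) ∂P :=
        lintegral_mono fun ω => min_lintegral_le (hDkω ω) (hAfin ω) ht
      have h5 : ∫⁻ ω, (∫⁻ s in Icc 0 t,
          (if A s ω < ENNReal.ofReal a then ‖D s ω‖ₑ ^ 2 * k s else 0)) ∂P =
          ∫⁻ s in Icc 0 t, u s * k s := by
        rw [lintegral_lintegral_swap]
        · refine lintegral_congr fun s => ?_
          rw [← lintegral_mul_const _ (Measurable.ite (measurableSet_lt (hAt s) measurable_const)
            ((hDt s).enorm.pow_const 2) measurable_const)]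
          refine lintegral_congr fun ω => ?_
          rw [ite_mul, zero_mul]
        · exact (Measurable.ite (measurableSet_lt hAm measurable_const) hDk
            measurable_const).aemeasurable
      have h6 : ∀ s, u s * (C * k s) = C * (u s * k s) := fun s => by ring
      rw [lintegral_congr h6, lintegral_const_mul' _ _ hC, ← h5]
      gcongr
  have hzero : ∀ t ∈ Icc 0 T, ∀ᵐ ω ∂P, D t ω = 0 := by
    intro t ht
    have h1 : ∀ᵐ ω ∂P, ∀ n : ℕ, A t ω < ENNReal.ofReal (n + 1) → D t ω = 0 := by
      refine ae_all_iff.2 fun n => ?_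
      have h2 := (lintegral_eq_zero_iff (Measurable.ite (measurableSet_lt (hAt t) measurable_const)
        ((hDt t).enorm.pow_const 2) measurable_const)).1 (main (n + 1) (by positivity) t ht)
      filter_upwards [h2] with ω hω hlt
      simpa [hlt] using hω
    filter_upwards [h1] with ω hω
    have h3 : A t ω ≠ ⊤ := ne_top_of_le_ne_top (hAfin ω) (hAmono ω ht.2)
    obtain ⟨n, hn⟩ := exists_nat_gt (A t ω).toReal
    refine hω n ?_
    rw [ENNReal.lt_ofReal_iff_toReal_lt h3]
    linarith
  -- The exceptional set depends on the time; countably many times and continuity of paths give one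
  -- for all times.
  have hall : ∀ᵐ ω ∂P, ∀ q : ℚ, D (projIcc 0 T hT q) ω = 0 :=
    ae_all_iff.2 fun q => hzero _ (projIcc 0 T hT q).2
  filter_upwards [hall] with ω hω t ht
  have hc : Continuous fun s : ℝ => D (projIcc 0 T hT s) ω :=
    (hDc ω).comp (continuous_subtype_val.comp continuous_projIcc)
  have := hc.ext_on Rat.denseRange_cast (continuous_const (y := (0 : ℝ)))
    (by rintro _ ⟨q, rfl⟩; exact hω q)
  have h4 := congrFun this t
  simpa [projIcc_of_mem hT ht] using h4

end Uniqueness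

/-! ### The budget inequality -/

section Budget

/-- `∫₀ᵗ exp (-∫₀ᵘ b) df_u` for a continuous function `f` with `f 0 = 0`, written through
integration by parts. -/
def discount (b : ℝ → ℝ) (f : ℝ → ℝ) (t : ℝ) : ℝ :=
  Real.exp (-∫ v in (0 : ℝ)..t, b v) * f t +
    ∫ u in (0 : ℝ)..t, f u * (b u * Real.exp (-∫ v in (0 : ℝ)..u, b v))

variable {T : ℝ} {b : ℝ → ℝ}

lemma continuousOn_discountFactor (hb : IntegrableOn b (Icc 0 T)) :
    ContinuousOn (fun t => Real.exp (-∫ v in (0 : ℝ)..t, b v)) (Icc 0 T) := by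
  rcases le_or_gt 0 T with hT | hT
  · exact Real.continuous_exp.comp_continuousOn
      (intervalIntegral.continuousOn_primitive_interval (a := 0) (b := T)
        (by rwa [uIcc_of_le hT]) |>.mono (by rw [uIcc_of_le hT])).neg
  · simp [Icc_eq_empty (not_le.2 hT)]

lemma integrableOn_discountWeight (hb : IntegrableOn b (Icc 0 T)) :
    IntegrableOn (fun u => b u * Real.exp (-∫ v in (0 : ℝ)..u, b v)) (Icc 0 T) :=
  hb.mul_continuousOn (continuousOn_discountFactor hb) isCompact_Icc

lemma integrableOn_mul_discountWeight (hb : IntegrableOn b (Icc 0 T)) {f : ℝ → ℝ}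
    (hf : ContinuousOn f (Icc 0 T)) :
    IntegrableOn (fun u => f u * (b u * Real.exp (-∫ v in (0 : ℝ)..u, b v))) (Icc 0 T) :=
  (integrableOn_discountWeight hb).continuousOn_mul hf isCompact_Icc

/-- Integration by parts has moved the differential off `f`, so `discount` is Lipschitz for the
uniform norm and commutes with the uniform limits that define Itô integrals. -/
lemma abs_discount_sub_le (hb : IntegrableOn b (Icc 0 T)) :
    ∃ C : ℝ, 0 ≤ C ∧ ∀ f g : ℝ → ℝ, ContinuousOn f (Icc 0 T) → ContinuousOn g (Icc 0 T) → ∀ δ : ℝ,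
      (∀ t ∈ Icc 0 T, |f t - g t| ≤ δ) → ∀ t ∈ Icc 0 T,
        |discount b f t - discount b g t| ≤ C * δ := by
  obtain ⟨C₁, hC₁⟩ := isCompact_Icc.exists_bound_of_continuousOn (continuousOn_discountFactor hb)
  have hw := integrableOn_discountWeight hb
  set w : ℝ → ℝ := fun u => b u * Real.exp (-∫ v in (0 : ℝ)..u, b v)
  refine ⟨|C₁| + ∫ u in Icc 0 T, |w u|, add_nonneg (abs_nonneg _)
    (integral_nonneg fun _ => abs_nonneg _), fun f g hf hg δ h t ht => ?_⟩
  have hT : 0 ≤ T := ht.1.trans ht.2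
  have h0 : (0 : ℝ) ∈ Icc 0 T := ⟨le_rfl, hT⟩
  have hδ : 0 ≤ δ := (abs_nonneg _).trans (h t ht)
  have hfi := intervalIntegrable_of_integrableOn_Icc (integrableOn_mul_discountWeight hb hf) h0 ht
  have hgi := intervalIntegrable_of_integrableOn_Icc (integrableOn_mul_discountWeight hb hg) h0 ht
  have h1 : discount b f t - discount b g t =
      Real.exp (-∫ v in (0 : ℝ)..t, b v) * (f t - g t) + ∫ u in (0 : ℝ)..t, (f u - g u) * w u := by
    have : ∫ u in (0 : ℝ)..t, (f u - g u) * w u =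
        (∫ u in (0 : ℝ)..t, f u * w u) - ∫ u in (0 : ℝ)..t, g u * w u := by
      rw [← intervalIntegral.integral_sub hfi hgi]
      simp_rw [sub_mul]
      rfl
    rw [this]
    unfold discount
    ring
  have h2 : |∫ u in (0 : ℝ)..t, (f u - g u) * w u| ≤ (∫ u in Icc 0 T, |w u|) * δ := by
    rw [intervalIntegral.integral_of_le ht.1, ← integral_Icc_eq_integral_Ioc, ← integral_mul_const]
    refine (abs_integral_le_integral_abs).trans ?_
    have hsub : Icc 0 t ⊆ Icc 0 T := Icc_subset_Icc_right ht.2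
    have hwδ : IntegrableOn (fun u => |w u| * δ) (Icc 0 T) := hw.abs.mul_const δ
    refine (setIntegral_mono_on (g := fun u => |w u| * δ) ?_ (hwδ.mono_set hsub)
      measurableSet_Icc fun u hu => ?_).trans (setIntegral_mono_set hwδ
        (Eventually.of_forall fun u => by positivity) (LE.le.eventuallyLE hsub))
    · exact ((hw.continuousOn_mul (hf.sub hg) isCompact_Icc).mono_set hsub).abs
    · rw [abs_mul, mul_comm]
      gcongr
      exact h u (hsub hu)
  rw [h1, add_mul]
  refine (abs_add_le _ _).trans (add_le_add ?_ h2)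
  rw [abs_mul]
  exact mul_le_mul ((hC₁ t ht).trans (le_abs_self _)) (h t ht) (abs_nonneg _) (abs_nonneg _)

/-- After `ρ` the path is constant and contributes nothing: the integrated weight is the loss of
discount factor on `[ρ, T]`. Stopped stochastic integrals are treated this way. -/
lemma discount_frozen (hb : IntegrableOn b (Icc 0 T)) {f : ℝ → ℝ} (hf : ContinuousOn f (Icc 0 T))
    {ρ : ℝ} (hρ : ρ ∈ Icc 0 T) : discount b (fun t => f (min t ρ)) T = discount b f ρ := by
  have hT : 0 ≤ T := hρ.1.trans hρ.2
  have h0 : (0 : ℝ) ∈ Icc 0 T := ⟨le_rfl, hT⟩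
  have hTT : T ∈ Icc 0 T := ⟨hT, le_rfl⟩
  have hb1 := intervalIntegrable_of_integrableOn_Icc hb h0 hρ
  have hb2 := intervalIntegrable_of_integrableOn_Icc hb hρ hTT
  have hf' : ContinuousOn (fun t => f (min t ρ)) (Icc 0 T) :=
    hf.comp (by fun_prop) fun t ht => ⟨le_min ht.1 hρ.1, min_le_of_left_le ht.2⟩
  have hi := integrableOn_mul_discountWeight hb hf'
  simp only [discount]
  rw [min_eq_right hρ.2, ← intervalIntegral.integral_add_adjacent_intervals
    (intervalIntegrable_of_integrableOn_Icc hi h0 hρ)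
    (intervalIntegrable_of_integrableOn_Icc hi hρ hTT)]
  have h1 : ∫ u in (0 : ℝ)..ρ, f (min u ρ) * (b u * Real.exp (-∫ v in (0 : ℝ)..u, b v)) =
      ∫ u in (0 : ℝ)..ρ, f u * (b u * Real.exp (-∫ v in (0 : ℝ)..u, b v)) := by
    refine intervalIntegral.integral_congr fun u hu => ?_
    rw [uIcc_of_le hρ.1] at hu
    simp only [min_eq_left hu.2]
  have h2 : ∫ u in ρ..T, f (min u ρ) * (b u * Real.exp (-∫ v in (0 : ℝ)..u, b v)) =
      f ρ * (Real.exp (-∫ v in (0 : ℝ)..ρ, b v) - Real.exp (-∫ v in (0 : ℝ)..T, b v)) := by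
    have h3 := integral_exp_mul_primitive (b := fun u => -b u) (g := fun _ => 0) hb2.neg
      intervalIntegrable_const 1
    simp only [intervalIntegral.integral_zero, add_zero, mul_one, mul_zero] at h3
    have h4 : ∀ u ∈ uIcc ρ T, f (min u ρ) * (b u * Real.exp (-∫ v in (0 : ℝ)..u, b v)) =
        -(f ρ * Real.exp (-∫ v in (0 : ℝ)..ρ, b v)) *
          (-b u * Real.exp (∫ v in ρ..u, -b v)) := by
      intro u hu
      rw [uIcc_of_le hρ.2] at hu
      have hu' : u ∈ Icc 0 T := ⟨hρ.1.trans hu.1, hu.2⟩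
      have h5 := intervalIntegral.integral_add_adjacent_intervals hb1
        (intervalIntegrable_of_integrableOn_Icc hb hρ hu')
      rw [min_eq_right hu.1, intervalIntegral.integral_neg, ← h5, neg_add, Real.exp_add]
      ring
    rw [intervalIntegral.integral_congr h4, intervalIntegral.integral_const_mul, h3,
      intervalIntegral.integral_neg, ← intervalIntegral.integral_add_adjacent_intervals hb1 hb2,
      neg_add, Real.exp_add]
    ring
  rw [h1, h2]
  ring

/-- The discounted value of the solution of an affine equation. -/
lemma discount_eq {x : ℝ} {X c : ℝ → ℝ} (hb : IntegrableOn b (Icc 0 T))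
    (hX : ContinuousOn X (Icc 0 T)) (hc : IntegrableOn c (Icc 0 T)) {t : ℝ} (ht : t ∈ Icc 0 T) :
    discount b (fun t => X t - x - ∫ u in (0 : ℝ)..t, (X u * b u - c u)) t =
      Real.exp (-∫ v in (0 : ℝ)..t, b v) * X t - x +
        ∫ u in (0 : ℝ)..t, Real.exp (-∫ v in (0 : ℝ)..u, b v) * c u := by
  have hT : 0 ≤ T := ht.1.trans ht.2
  have h0 : (0 : ℝ) ∈ Icc 0 T := ⟨le_rfl, hT⟩
  have hg : IntegrableOn (fun u => X u * b u - c u) (Icc 0 T) :=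
    (hb.continuousOn_mul hX isCompact_Icc).sub hc
  have hG : ContinuousOn (fun t => ∫ u in (0 : ℝ)..t, (X u * b u - c u)) (Icc 0 T) := by
    have := intervalIntegral.continuousOn_primitive_interval (a := 0) (b := T)
      (f := fun u => X u * b u - c u) (by rwa [uIcc_of_le hT])
    rwa [uIcc_of_le hT] at this
  have h1 := integral_exp_mul_primitive (b := fun u => -b u) (g := fun u => X u * b u - c u)
    (intervalIntegrable_of_integrableOn_Icc hb h0 ht).neg
    (intervalIntegrable_of_integrableOn_Icc hg h0 ht) x
  simp only [intervalIntegral.integral_neg] at h1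
  have hf : ContinuousOn (fun t => X t - x - ∫ u in (0 : ℝ)..t, (X u * b u - c u)) (Icc 0 T) :=
    (hX.sub continuousOn_const).sub hG
  have hβc : IntegrableOn (fun u => Real.exp (-∫ v in (0 : ℝ)..u, b v) * c u) (Icc 0 T) :=
    hc.continuousOn_mul (continuousOn_discountFactor hb) isCompact_Icc
  have hi1 := intervalIntegrable_of_integrableOn_Icc (integrableOn_mul_discountWeight hb hf) h0 ht
  have hi2 := intervalIntegrable_of_integrableOn_Icc hβc h0 ht
  have h2 : ∫ u in (0 : ℝ)..t, (-b u * Real.exp (-∫ v in (0 : ℝ)..u, b v) *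
      (x + ∫ v in (0 : ℝ)..u, (X v * b v - c v)) +
      Real.exp (-∫ v in (0 : ℝ)..u, b v) * (X u * b u - c u)) =
      (∫ u in (0 : ℝ)..t, (X u - x - ∫ v in (0 : ℝ)..u, (X v * b v - c v)) *
        (b u * Real.exp (-∫ v in (0 : ℝ)..u, b v))) -
      ∫ u in (0 : ℝ)..t, Real.exp (-∫ v in (0 : ℝ)..u, b v) * c u := by
    rw [← intervalIntegral.integral_sub hi1 hi2]
    refine intervalIntegral.integral_congr fun u _ => ?_
    ring
  rw [h2] at h1
  unfold discount
  linarith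

variable {F : ℝ → MeasurableSpace Ω} {P : Measure Ω} [IsProbabilityMeasure P]
  {B : ℝ → Ω → EuclideanSpace ℝ (Fin d)}

lemma SimpleIntegrand.qv_mono (S : SimpleIntegrand F T d) (ω : Ω) {s t : ℝ} (hst : s ≤ t) :
    S.qv s ω ≤ S.qv t ω := by
  have h : ENNReal.ofReal (S.qv s ω) ≤ ENNReal.ofReal (S.qv t ω) := by
    rw [← lintegral_eval_sq, ← lintegral_eval_sq]
    exact lintegral_mono_set (Icc_subset_Icc_right hst)
  exact (ENNReal.ofReal_le_ofReal_iff (S.qv_nonneg t ω)).1 h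

/-- `discount` is linear in the path, so Fubini's theorem gives mean zero from mean zero at each
time, and weighted Cauchy-Schwarz bounds the second moment. The constant depends on `b` and `T`
only, not on the integrand or the level `a`. -/
lemma SimpleIntegrand.exists_discount (hB : IsLevy F P T B) (hF : ∀ t, F t ≤ mΩ)
    (hmono : Monotone F) (hBc : ∀ᵐ ω ∂P, ContinuousOn (B · ω) (Icc 0 T)) (hT : 0 ≤ T)
    (hb : IntegrableOn b (Icc 0 T)) :
    ∃ C : ℝ≥0∞, C ≠ ⊤ ∧ ∀ (U : SimpleIntegrand F T d) (a : ℝ), (∀ ω, U.qv T ω ≤ a) →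
      ∃ V : Ω → ℝ, Measurable V ∧ (∀ᵐ ω ∂P, V ω = discount b (U.sint B · ω) T) ∧
        Integrable V P ∧ ∫ ω, V ω ∂P = 0 ∧ ∫⁻ ω, ‖V ω‖ₑ ^ 2 ∂P ≤ C * ENNReal.ofReal a := by
  have hw := integrableOn_discountWeight hb
  set w : ℝ → ℝ := fun u => b u * Real.exp (-∫ v in (0 : ℝ)..u, b v)
  set β := Real.exp (-∫ v in (0 : ℝ)..T, b v)
  set κ := ∫⁻ u in Icc 0 T, ‖w u‖ₑ
  have hκ : κ ≠ ⊤ := hw.2.ne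
  have hTT : T ∈ Icc 0 T := ⟨hT, le_rfl⟩
  refine ⟨2 * ‖β‖ₑ ^ 2 + 2 * (κ * κ), ENNReal.add_ne_top.2 ⟨ENNReal.mul_ne_top (by simp) (by simp),
    ENNReal.mul_ne_top (by simp) (ENNReal.mul_ne_top hκ hκ)⟩, fun U a ha => ?_⟩
  obtain ⟨N, hNm, hNc, hN⟩ := exists_continuous_version (P := P) hT (X := U.sint B)
    (fun t ht => (U.measurable_sint hB hmono ht).mono (hF t) le_rfl)
    (by filter_upwards [hBc] with ω hω using U.continuous_sint hω)
  have hNt : ∀ t, Measurable (N t) := fun t => hNm.comp measurable_prodMk_left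
  have hNeq : ∀ t ∈ Icc 0 T, N t =ᵐ[P] U.sint B t := fun t ht => by
    filter_upwards [hN] with ω hω using hω t ht
  have hN2 : ∀ t ∈ Icc 0 T, MemLp (N t) 2 P := fun t ht =>
    (memLp_congr_ae (hNeq t ht)).2 (U.memLp_sint hB hF ht)
  have hN0 : ∀ t ∈ Icc 0 T, ∫ ω, N t ω ∂P = 0 := fun t ht => by
    rw [integral_congr_ae (hNeq t ht), U.integral_sint hB hF hmono ht]
  have hNsq : ∀ t ∈ Icc 0 T, ∫⁻ ω, ‖N t ω‖ₑ ^ 2 ∂P ≤ ENNReal.ofReal a := by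
    intro t ht
    have h1 : ∫ ω, (N t ω) ^ 2 ∂P ≤ a := by
      have h2 : ∫ ω, (N t ω) ^ 2 ∂P = ∫ ω, (U.sint B t ω) ^ 2 ∂P :=
        integral_congr_ae (by filter_upwards [hNeq t ht] with ω hω; rw [hω])
      rw [h2, U.integral_sint_sq hB hF hmono ht]
      refine (integral_mono_of_nonneg (Eventually.of_forall fun ω => U.qv_nonneg t ω)
        (integrable_const a) (Eventually.of_forall fun ω => (U.qv_mono ω ht.2).trans (ha ω))).trans ?_
      simp
    simp_rw [enorm_sq_eq_ofReal]
    rw [← ofReal_integral_eq_lintegral_ofReal (hN2 t ht).integrable_sq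
      (Eventually.of_forall fun ω => sq_nonneg _)]
    exact ENNReal.ofReal_le_ofReal h1
  have hNabs : ∀ t ∈ Icc 0 T, ∫⁻ ω, ‖N t ω‖ₑ ∂P ≤ 1 + ENNReal.ofReal a := by
    intro t ht
    have h1 : ∀ z : ℝ≥0∞, z ≤ 1 + z ^ 2 := by
      intro z
      rcases le_total z 1 with h | h
      · exact h.trans le_self_add
      · exact (le_self_pow₀ h two_ne_zero).trans le_add_self
    refine (lintegral_mono fun ω => h1 ‖N t ω‖ₑ).trans ?_
    rw [lintegral_add_left measurable_const]
    simpa using hNsq t ht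
  set μ := volume.restrict (Icc (0 : ℝ) T)
  have hprodm : AEStronglyMeasurable (fun p : ℝ × Ω => N p.1 p.2 * w p.1) (μ.prod P) :=
    hNm.aestronglyMeasurable.mul hw.1.comp_fst
  have hprodi : Integrable (fun p : ℝ × Ω => N p.1 p.2 * w p.1) (μ.prod P) := by
    refine ⟨hprodm, ?_⟩
    rw [HasFiniteIntegral, lintegral_prod _ hprodm.enorm]
    have h1 : ∀ᵐ t ∂μ, ∫⁻ ω, ‖N t ω * w t‖ₑ ∂P ≤ (1 + ENNReal.ofReal a) * ‖w t‖ₑ := by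
      filter_upwards [ae_restrict_mem measurableSet_Icc] with t ht
      simp_rw [enorm_mul]
      rw [lintegral_mul_const' _ _ (by simp)]
      gcongr
      exact hNabs t ht
    refine (lintegral_mono_ae h1).trans_lt ?_
    rw [lintegral_const_mul' _ _ (by simp)]
    exact ENNReal.mul_lt_top (by simp) hκ.lt_top
  have hset : ∀ f : ℝ → ℝ, ∫ u in (0 : ℝ)..T, f u = ∫ u, f u ∂μ := fun f => by
    rw [intervalIntegral.integral_of_le hT, ← integral_Icc_eq_integral_Ioc]
  have hIm : StronglyMeasurable fun ω => ∫ u, N u ω * hw.1.mk w u ∂μ := by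
    refine StronglyMeasurable.integral_prod_right' (f := fun p : Ω × ℝ => N p.2 p.1 * hw.1.mk w p.2) ?_
    exact ((hNm.comp measurable_swap).stronglyMeasurable).mul
      (hw.1.stronglyMeasurable_mk.comp_measurable measurable_snd)
  have hIeq : ∀ ω, ∫ u, N u ω * hw.1.mk w u ∂μ = ∫ u, N u ω * w u ∂μ := fun ω =>
    integral_congr_ae (by filter_upwards [hw.1.ae_eq_mk] with u hu; rw [← hu])
  simp_rw [hIeq] at hIm
  refine ⟨fun ω => β * N T ω + ∫ u, N u ω * w u ∂μ, ((hNt T).const_mul β).add hIm.measurable,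
    ?_, ?_, ?_, ?_⟩
  · filter_upwards [hN] with ω hω
    have h1 : ∫ u, N u ω * w u ∂μ = ∫ u, U.sint B u ω * w u ∂μ := ?_
    · simp only [discount]
      rw [hω T hTT, h1, ← hset]
    refine integral_congr_ae ?_
    filter_upwards [ae_restrict_mem measurableSet_Icc] with u hu
    rw [hω u hu]
  · exact (((hN2 T hTT).integrable (by norm_num)).const_mul β).add hprodi.integral_prod_right
  · rw [integral_add (((hN2 T hTT).integrable (by norm_num)).const_mul β)
      hprodi.integral_prod_right, integral_const_mul, hN0 T hTT, mul_zero, zero_add]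
    rw [← integral_integral_swap (f := fun (u : ℝ) (ω : Ω) => N u ω * w u) hprodi]
    refine integral_eq_zero_of_ae ?_
    filter_upwards [ae_restrict_mem measurableSet_Icc] with t ht
    rw [integral_mul_const, hN0 t ht, zero_mul]
    rfl
  · have h1 : ∀ ω, ‖β * N T ω + ∫ u, N u ω * w u ∂μ‖ₑ ^ 2 ≤
        2 * ‖β‖ₑ ^ 2 * ‖N T ω‖ₑ ^ 2 + 2 * κ * ∫⁻ u, ‖N u ω‖ₑ ^ 2 * ‖w u‖ₑ ∂μ := by
      intro ω
      refine (enorm_add_sq_le _ _).trans ?_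
      rw [enorm_mul, mul_pow, ← mul_assoc, mul_assoc 2 κ, ← hset]
      gcongr
      exact enorm_integral_mul_sq_le hT (hNc ω).aestronglyMeasurable hw.1
    refine (lintegral_mono h1).trans ?_
    rw [lintegral_add_left (((hNt T).enorm.pow_const 2).const_mul _),
      lintegral_const_mul' _ _ (ENNReal.mul_ne_top (by simp) (by simp)),
      lintegral_const_mul' _ _ (ENNReal.mul_ne_top (by simp) hκ), add_mul, mul_assoc 2 (κ * κ),
      mul_assoc κ κ, ← mul_assoc 2 κ]
    gcongr
    · exact hNsq T hTT
    · rw [lintegral_lintegral_swap]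
      · have h2 : ∀ᵐ t ∂μ, ∫⁻ ω, ‖N t ω‖ₑ ^ 2 * ‖w t‖ₑ ∂P ≤ ENNReal.ofReal a * ‖w t‖ₑ := by
          filter_upwards [ae_restrict_mem measurableSet_Icc] with t ht
          rw [lintegral_mul_const' _ _ (by simp)]
          gcongr
          exact hNsq t ht
        refine (lintegral_mono_ae h2).trans ?_
        rw [lintegral_const_mul' _ _ (by simp), mul_comm]
      · exact ((hNm.comp measurable_swap).enorm.pow_const 2).aemeasurable.mul hw.1.enorm.comp_snd

/-- Bounded second moments give uniform integrability: `z ≤ min(z, 1/η) + η z²`, where the first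
term converges by domination and the second is small with `η`. -/
lemma tendsto_lintegral_of_sq_bounded {f : ℕ → Ω → ℝ≥0∞} (hf : ∀ n, Measurable (f n))
    (hlim : ∀ᵐ ω ∂P, Tendsto (fun n => f n ω) atTop (𝓝 0)) {K : ℝ≥0∞} (hK : K ≠ ⊤)
    (hsq : ∀ n, ∫⁻ ω, f n ω ^ 2 ∂P ≤ K) : Tendsto (fun n => ∫⁻ ω, f n ω ∂P) atTop (𝓝 0) := by
  have hpt : ∀ (η z : ℝ≥0∞), η ≠ 0 → η ≠ ⊤ → z ≤ min z η⁻¹ + η * z ^ 2 := by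
    intro η z h0 ht
    rcases le_total z η⁻¹ with h | h
    · rw [min_eq_left h]; exact le_self_add
    · have : 1 ≤ η * z := by
        rw [← ENNReal.mul_inv_cancel h0 ht]; gcongr
      calc z = 1 * z := (one_mul z).symm
        _ ≤ η * z * z := by gcongr
        _ = η * z ^ 2 := by ring
        _ ≤ _ := le_add_self
  rw [ENNReal.tendsto_nhds_zero]
  intro ε hε
  by_cases hεt : ε = ⊤
  · simp [hεt]
  have hK1 : K + 1 ≠ ⊤ := by simp [hK]
  set η := ε / 2 / (K + 1)
  have hε2 : ε / 2 ≠ 0 := (ENNReal.half_pos hε.ne').ne'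
  have hη0 : η ≠ 0 := ENNReal.div_ne_zero.2 ⟨hε2, hK1⟩
  have hηt : η ≠ ⊤ := ENNReal.div_ne_top (ENNReal.div_ne_top hεt (by simp)) (by simp)
  have h1 : Tendsto (fun n => ∫⁻ ω, min (f n ω) η⁻¹ ∂P) atTop (𝓝 (∫⁻ _, 0 ∂P)) := by
    refine tendsto_lintegral_of_dominated_convergence (fun _ => η⁻¹)
      (fun n => (hf n).min measurable_const) (fun n => Eventually.of_forall fun ω => min_le_right _ _)
      (by simpa using hη0) ?_
    filter_upwards [hlim] with ω hω
    have := hω.min (tendsto_const_nhds (x := η⁻¹))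
    rwa [min_eq_left zero_le] at this
  rw [lintegral_zero] at h1
  filter_upwards [h1.eventually_le_const (ENNReal.half_pos hε.ne')] with n hn
  calc ∫⁻ ω, f n ω ∂P ≤ ∫⁻ ω, (min (f n ω) η⁻¹ + η * f n ω ^ 2) ∂P :=
        lintegral_mono fun ω => hpt η _ hη0 hηt
    _ = (∫⁻ ω, min (f n ω) η⁻¹ ∂P) + η * ∫⁻ ω, f n ω ^ 2 ∂P := by
        rw [lintegral_add_left ((hf n).min measurable_const), lintegral_const_mul' _ _ hηt]
    _ ≤ ε / 2 + η * (K + 1) := by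
        gcongr
        exact (hsq n).trans le_self_add
    _ = ε := by
        rw [ENNReal.div_mul_cancel (by simp) hK1, ENNReal.add_halves]

/-- A continuous local martingale whose discounted version is bounded below by `-x` is a
supermartingale. -/
theorem lintegral_discount_le (hB : IsLevy F P T B) (hF : ∀ t, F t ≤ mΩ) (hmono : Monotone F)
    (hBc : ∀ᵐ ω ∂P, ContinuousOn (B · ω) (Icc 0 T)) (hT : 0 ≤ T) (hb : IntegrableOn b (Icc 0 T))
    {S : ℕ → SimpleIntegrand F T d} {Y : ℝ → Ω → ℝ} {x : ℝ} (hx : 0 ≤ x)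
    (hS : ∀ᵐ ω ∂P, (∃ l : ℝ≥0∞, l ≠ ⊤ ∧
        Tendsto (fun n => ENNReal.ofReal ((S n).qv T ω)) atTop (𝓝 l)) ∧
      TendstoUniformlyOn (fun n t => (S n).sint B t ω) (fun t => Y t ω) atTop (Icc 0 T))
    (hY : ∀ᵐ ω ∂P, ∀ t ∈ Icc 0 T, -x ≤ discount b (Y · ω) t) :
    ∫⁻ ω, ENNReal.ofReal (x + discount b (Y · ω) T) ∂P ≤ ENNReal.ofReal x := by
  obtain ⟨C, hC, hV⟩ := SimpleIntegrand.exists_discount (b := b) hB hF hmono hBc hT hb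
  have hTT : T ∈ Icc 0 T := ⟨hT, le_rfl⟩
  choose! V hVm hVeq hVi hV0 hVsq using hV
  let U : ℕ → ℕ → SimpleIntegrand F T d := fun a n => (S n).stopped hmono T a
  have hU : ∀ a n ω, (U a n).qv T ω ≤ a := fun a n ω =>
    (S n).qv_stop_le hmono T (Nat.cast_nonneg a) ω
  let v : ℕ → ℕ → Ω → ℝ := fun a n => V (U a n) a
  have hvm : ∀ a n, Measurable (v a n) := fun a n => hVm _ _ (hU a n)
  have hveq : ∀ᵐ ω ∂P, ∀ a n, v a n ω = discount b ((U a n).sint B · ω) T :=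
    ae_all_iff.2 fun a => ae_all_iff.2 fun n => hVeq _ _ (hU a n)
  obtain ⟨C', hC', hdisc⟩ := abs_discount_sub_le hb
  -- The stopped value is the discounted integral at a frozen time `ρ`. There the limit is at least
  -- `-x`, and the approximants are uniformly close, so the negative parts vanish in the limit.
  have hlow : ∀ᵐ ω ∂P, ∀ a, Tendsto (fun n => ENNReal.ofReal (-(x + v a n ω))) atTop (𝓝 0) := by
    filter_upwards [hveq, hS, hY, hBc] with ω h1 h2 h3 h4 a
    have hYc : ContinuousOn (fun t => Y t ω) (Icc 0 T) :=
      h2.2.continuousOn (Eventually.of_forall fun n => (S n).continuous_sint h4).frequently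
    rw [ENNReal.tendsto_nhds_zero]
    intro ε hε
    by_cases hεt : ε = ⊤
    · simp [hεt]
    have hε' : 0 < ε.toReal := ENNReal.toReal_pos hε.ne' hεt
    have h5 := Metric.tendstoUniformlyOn_iff.1 h2.2 (ε.toReal / (C' + 1)) (by positivity)
    filter_upwards [h5] with n hn
    rw [← ENNReal.ofReal_toReal hεt]
    refine ENNReal.ofReal_le_ofReal ?_
    obtain ⟨ρ, hρ, hρ'⟩ := (S n).exists_stop_sint_eq (B := B) hmono T a ω
    have h6 : v a n ω = discount b ((S n).sint B · ω) ρ := by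
      rw [h1]
      simp only [U, hρ']
      exact discount_frozen hb ((S n).continuous_sint h4) hρ
    have h7 := hdisc _ _ ((S n).continuous_sint h4) hYc (ε.toReal / (C' + 1)) (fun t ht => by
      have := hn t ht
      rw [dist_comm, Real.dist_eq] at this
      exact this.le) ρ hρ
    have h8 : C' * (ε.toReal / (C' + 1)) ≤ ε.toReal := by
      rw [mul_div_assoc', div_le_iff₀ (by positivity)]
      nlinarith
    have h9 := h3 ρ hρ
    have h10 := (abs_le.1 (h7.trans h8)).1
    rw [h6]
    linarith
  have hneg : ∀ a, Tendsto (fun n => ∫⁻ ω, ENNReal.ofReal (-(x + v a n ω)) ∂P) atTop (𝓝 0) := by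
    intro a
    refine tendsto_lintegral_of_sq_bounded
      (K := 2 * ‖x‖ₑ ^ 2 + 2 * (C * ENNReal.ofReal a))
      (fun n => (measurable_const.add (hvm a n)).neg.ennreal_ofReal) ?_ ?_ (fun n => ?_)
    · filter_upwards [hlow] with ω hω using hω a
    · exact ENNReal.add_ne_top.2 ⟨ENNReal.mul_ne_top (by simp) (by simp),
        ENNReal.mul_ne_top (by simp) (ENNReal.mul_ne_top hC (by simp))⟩
    · have h1 : ∀ ω, ENNReal.ofReal (-(x + v a n ω)) ^ 2 ≤ 2 * ‖x‖ₑ ^ 2 + 2 * ‖v a n ω‖ₑ ^ 2 := by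
        intro ω
        refine le_trans ?_ (enorm_add_sq_le _ _)
        gcongr
        rw [← enorm_neg, ← ofReal_norm]
        exact ENNReal.ofReal_le_ofReal (Real.le_norm_self _)
      refine (lintegral_mono h1).trans ?_
      rw [lintegral_add_left measurable_const,
        lintegral_const_mul' 2 (fun ω => ‖v a n ω‖ₑ ^ 2) (by simp)]
      simp only [lintegral_const, measure_univ, mul_one]
      gcongr
      exact hVsq _ _ (hU a n)
  -- Each stopped value has mean zero, so the positive part of `x + v` exceeds `x` in mean by
  -- exactly the negative part, which tends to zero.
  have hpos : ∀ a n, ∫⁻ ω, ENNReal.ofReal (x + v a n ω) ∂P =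
      ENNReal.ofReal x + ∫⁻ ω, ENNReal.ofReal (-(x + v a n ω)) ∂P := by
    intro a n
    have hi : Integrable (fun ω => x + v a n ω) P := (integrable_const x).add (hVi _ _ (hU a n))
    have h1 : ∫ ω, (x + v a n ω) ∂P = x := by
      rw [integral_add (integrable_const x) (hVi _ _ (hU a n)), hV0 _ _ (hU a n)]
      simp
    have h2 := integral_eq_lintegral_pos_part_sub_lintegral_neg_part hi
    have h3 : ∫⁻ ω, ENNReal.ofReal (x + v a n ω) ∂P ≠ ⊤ := by
      refine ne_top_of_le_ne_top hi.2.ne (lintegral_mono fun ω => ?_)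
      rw [← ofReal_norm]
      exact ENNReal.ofReal_le_ofReal (Real.le_norm_self _)
    have h4 : ∫⁻ ω, ENNReal.ofReal (-(x + v a n ω)) ∂P ≠ ⊤ := by
      refine ne_top_of_le_ne_top hi.2.ne (lintegral_mono fun ω => ?_)
      rw [← enorm_neg, ← ofReal_norm]
      exact ENNReal.ofReal_le_ofReal (Real.le_norm_self _)
    rw [← ENNReal.ofReal_toReal h3, ← ENNReal.ofReal_toReal h4,
      ← ENNReal.ofReal_add hx ENNReal.toReal_nonneg]
    congr 1
    linarith
  let f : ℕ → Ω → ℝ≥0∞ := fun a ω => liminf (fun n => ENNReal.ofReal (x + v a n ω)) atTop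
  have hfm : ∀ a, Measurable (f a) := fun a =>
    Measurable.liminf fun n => (measurable_const.add (hvm a n)).ennreal_ofReal
  have hfle : ∀ a, ∫⁻ ω, f a ω ∂P ≤ ENNReal.ofReal x := by
    intro a
    have h1 : ∫⁻ ω, f a ω ∂P ≤ liminf (fun n => ∫⁻ ω, ENNReal.ofReal (x + v a n ω) ∂P) atTop :=
      lintegral_liminf_le fun n => (measurable_const.add (hvm a n)).ennreal_ofReal
    refine h1.trans ?_
    simp_rw [hpos]
    have := (tendsto_const_nhds (x := ENNReal.ofReal x)).add (hneg a)
    rw [add_zero] at this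
    exact this.liminf_eq.le
  -- Once `a` exceeds the limiting quadratic variation of the path, the stopping is eventually
  -- inactive; Fatou's lemma in `n` and then in `a` finishes.
  have hfin : ∀ᵐ ω ∂P, ENNReal.ofReal (x + discount b (Y · ω) T) ≤ liminf (fun a => f a ω) atTop := by
    filter_upwards [hveq, hS, hBc] with ω h1 h2 h4
    obtain ⟨⟨l, hl, hlim⟩, hunif⟩ := h2
    have hYc : ContinuousOn (fun t => Y t ω) (Icc 0 T) :=
      hunif.continuousOn (Eventually.of_forall fun n => (S n).continuous_sint h4).frequently
    obtain ⟨a₀, ha₀⟩ := exists_nat_gt l.toReal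
    refine le_liminf_of_le (by isBoundedDefault) ?_
    filter_upwards [eventually_ge_atTop a₀] with a ha
    have hla : l < ENNReal.ofReal a := by
      rw [ENNReal.lt_ofReal_iff_toReal_lt hl]
      exact ha₀.trans_le (by exact_mod_cast ha)
    have hapos : (0 : ℝ) < a := lt_of_le_of_lt ENNReal.toReal_nonneg
      (ha₀.trans_le (by exact_mod_cast ha))
    have hev : ∀ᶠ n in atTop, v a n ω = discount b ((S n).sint B · ω) T := by
      filter_upwards [hlim.eventually_lt_const hla] with n hn
      rw [ENNReal.ofReal_lt_ofReal_iff hapos] at hn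
      rw [h1]
      congr 1
      funext t
      exact (S n).stop_sint_of_le hmono hn.le t
    have hconv : Tendsto (fun n => discount b ((S n).sint B · ω) T) atTop
        (𝓝 (discount b (Y · ω) T)) := by
      rw [Metric.tendsto_atTop']
      intro ε hε
      have h5 := Metric.tendstoUniformlyOn_iff.1 hunif (ε / (C' + 1)) (by positivity)
      obtain ⟨n₀, hn₀⟩ := eventually_atTop.1 h5
      refine ⟨n₀, fun n hn => ?_⟩
      have h7 := hdisc _ _ ((S n).continuous_sint h4) hYc (ε / (C' + 1)) (fun t ht => by
        have := hn₀ n (le_of_lt hn) t ht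
        rw [dist_comm, Real.dist_eq] at this
        exact this.le) T hTT
      rw [Real.dist_eq]
      refine h7.trans_lt ?_
      rw [mul_div_assoc', div_lt_iff₀ (by positivity)]
      nlinarith
    have hconv' : Tendsto (fun n => ENNReal.ofReal (x + v a n ω)) atTop
        (𝓝 (ENNReal.ofReal (x + discount b (Y · ω) T))) :=
      ENNReal.tendsto_ofReal ((hconv.congr' (hev.mono fun n hn => hn.symm)).const_add x)
    exact hconv'.liminf_eq.ge
  refine (lintegral_mono_ae hfin).trans ((lintegral_liminf_le hfm).trans ?_)
  refine (liminf_le_liminf (Eventually.of_forall hfle)).trans ?_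
  simp

end Budget

/-! ### Wealth processes: uniqueness and the budget inequality -/

section WealthTheory

variable {m : Market d} {W : Fin d → ℝ≥0 → Ω → ℝ} {P : Measure Ω} {T x : ℝ}

lemma integrable_inner_of_memLp {α : Type*} [MeasurableSpace α] {μ : Measure α}
    {f g : α → EuclideanSpace ℝ (Fin d)} (hf : MemLp f 2 μ) (hg : MemLp g 2 μ) :
    Integrable (fun a => (inner ℝ (f a) (g a) : ℝ)) μ := by
  have h1 := ((memLp_two_iff_integrable_sq_norm hf.1).1 hf).add
    ((memLp_two_iff_integrable_sq_norm hg.1).1 hg)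
  refine h1.mono' (hf.1.inner hg.1) (Eventually.of_forall fun a => ?_)
  refine (norm_inner_le_norm _ _).trans ?_
  simp only [Pi.add_apply]
  nlinarith [sq_nonneg (‖f a‖ - ‖g a‖), sq_nonneg (‖f a‖), sq_nonneg ‖g a‖]

lemma enorm_integral_inner_sq_le {f g : ℝ → EuclideanSpace ℝ (Fin d)} {t : ℝ} (ht : t ∈ Icc 0 T)
    (hf : AEStronglyMeasurable f (volume.restrict (Icc 0 T)))
    (hg : AEStronglyMeasurable g (volume.restrict (Icc 0 T))) :
    ‖∫ u in (0 : ℝ)..t, (inner ℝ (f u) (g u) : ℝ)‖ₑ ^ 2 ≤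
      (∫⁻ s in Icc 0 T, ‖f s‖ₑ ^ 2) * ∫⁻ s in Icc 0 T, ‖g s‖ₑ ^ 2 := by
  refine le_trans ?_ (lintegral_mul_sq_le hf.enorm hg.enorm)
  gcongr
  rw [intervalIntegral.integral_of_le ht.1, ← integral_Icc_eq_integral_Ioc]
  refine (enorm_integral_le_lintegral_enorm _).trans ?_
  refine (lintegral_mono fun u => ?_).trans (lintegral_mono_set (Icc_subset_Icc_right ht.2))
  rw [← ofReal_norm, ← ofReal_norm, ← ofReal_norm, ← ENNReal.ofReal_mul (norm_nonneg _)]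
  exact ENNReal.ofReal_le_ofReal (norm_inner_le_norm _ _)

lemma SimpleIntegrand.sint_add_drift {F : ℝ → MeasurableSpace Ω} (S : SimpleIntegrand F T d)
    {B : ℝ → Ω → EuclideanSpace ℝ (Fin d)} {φ : ℝ → EuclideanSpace ℝ (Fin d)}
    (hφ : IntegrableOn φ (Icc 0 T)) {t : ℝ} (ht : t ∈ Icc 0 T) (ω : Ω) :
    S.sint (fun t ω => B t ω + ∫ r in (0 : ℝ)..t, φ r) t ω =
      S.sint B t ω + ∫ r in (0 : ℝ)..t, (inner ℝ (S.eval r ω) (φ r) : ℝ) := by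
  have h0 : (0 : ℝ) ∈ Icc 0 T := ⟨le_rfl, ht.1.trans ht.2⟩
  have hmem : ∀ k, min (S.time k) t ∈ Icc 0 T := fun k =>
    ⟨le_min (S.time_mem k).1 ht.1, min_le_of_right_le ht.2⟩
  have hii : ∀ {a b}, a ∈ Icc 0 T → b ∈ Icc 0 T → IntervalIntegrable φ volume a b := fun ha hb =>
    intervalIntegrable_of_integrableOn_Icc hφ ha hb
  have hcell : ∀ k, ∀ r, (inner ℝ ((Ioc (S.time k) (S.time (k + 1))).indicator
      (fun _ => S.coef k ω) r) (φ r) : ℝ) =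
      (Ioc (S.time k) (S.time (k + 1))).indicator (fun r => inner ℝ (S.coef k ω) (φ r)) r := by
    intro k r
    by_cases h : r ∈ Ioc (S.time k) (S.time (k + 1)) <;> simp [h]
  have hint : ∀ k, IntegrableOn (fun r => (inner ℝ (S.coef k ω) (φ r) : ℝ)) (Icc 0 T) := fun k =>
    hφ.const_inner _
  have hsum : ∫ r in (0 : ℝ)..t, (inner ℝ (S.eval r ω) (φ r) : ℝ) =
      ∑ k ∈ Finset.range S.n, inner ℝ (S.coef k ω)
        (∫ r in (min (S.time k) t)..(min (S.time (k + 1)) t), φ r) := by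
    unfold eval
    simp_rw [sum_inner, hcell]
    rw [intervalIntegral.integral_finsetSum fun k _ => by
      refine intervalIntegrable_of_integrableOn_Icc (f := (Ioc (S.time k) (S.time (k + 1))).indicator
        fun r => (inner ℝ (S.coef k ω) (φ r) : ℝ)) ?_ h0 ht
      exact (hint k).indicator measurableSet_Ioc]
    refine Finset.sum_congr rfl fun k _ => ?_
    have h1 : ∫ r in (min (S.time k) t)..(min (S.time (k + 1)) t),
        (inner ℝ (S.coef k ω) (φ r) : ℝ) = inner ℝ (S.coef k ω)
        (∫ r in (min (S.time k) t)..(min (S.time (k + 1)) t), φ r) :=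
      (innerSL ℝ (S.coef k ω)).intervalIntegral_comp_comm (hii (hmem k) (hmem (k + 1)))
    rw [← h1, intervalIntegral.integral_of_le ht.1, setIntegral_indicator measurableSet_Ioc,
      intervalIntegral.integral_of_le (min_le_min_right _ (S.time_mono k.le_succ)), Ioc_inter_Ioc]
    congr 2
    rw [max_eq_right (S.time_mem k).1]
    rcases le_total (S.time k) t with h | h
    · rw [min_eq_left h, min_comm]
    · have h' := h.trans (S.time_mono k.le_succ)
      rw [min_eq_right h, min_eq_right h', Ioc_self, Ioc_eq_empty]
      exact not_lt.2 (min_le_of_left_le h)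
  rw [hsum]
  unfold sint stochSum
  rw [← Finset.sum_add_distrib]
  refine Finset.sum_congr rfl fun k _ => ?_
  rw [← inner_add_right, ← intervalIntegral.integral_interval_sub_left (hii h0 (hmem (k + 1)))
    (hii h0 (hmem k))]
  congr 1
  module

lemma Market.Standing.integrableOn_r (hm : m.Standing T) : IntegrableOn m.r (Icc 0 T) :=
  hm.cadlag_r.integrableOn

lemma Market.Standing.integrableOn_θ (hm : m.Standing T) : IntegrableOn m.θ (Icc 0 T) :=
  hm.θ_sq.integrable (by norm_num)

variable [IsProbabilityMeasure P]

/-- Pathwise uniqueness of the wealth process of a deterministic investment control. -/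
theorem IsWealth.ae_eq (hW : IsBrownianMotion W P) (hT : 0 ≤ T) (hm : m.Standing T)
    {y : ℝ → EuclideanSpace ℝ (Fin d)} (hy : MemLp y 2 (volume.restrict (Icc 0 T)))
    {c X X' : ℝ → Ω → ℝ} (hX : IsWealth m W P T x (fun t _ => y t) c X)
    (hX' : IsWealth m W P T x (fun t _ => y t) c X') :
    ∀ᵐ ω ∂P, ∀ t ∈ Icc 0 T, X' t ω = X t ω := by
  have hF := hW.brownianFiltration_le
  have hmono := brownianFiltration_mono (W := W) (P := P)
  obtain ⟨I, hI, hIeq⟩ := hX.sde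
  obtain ⟨I', hI', hIeq'⟩ := hX'.sde
  obtain ⟨S, hS⟩ := hI.exists_ae_approx
  obtain ⟨S', hS'⟩ := hI'.exists_ae_approx
  obtain ⟨D, hDm, hDc, hD⟩ := exists_continuous_version (P := P) hT
    (X := fun t ω => X' t ω - X t ω)
    (fun t ht => ((hX'.adapted t ht).mono (hF t) le_rfl).sub ((hX.adapted t ht).mono (hF t) le_rfl))
    (by filter_upwards [hX.cont, hX'.cont] with ω h1 h2 using h2.sub h1)
  have hb : IntegrableOn (fun u => m.r u + inner ℝ (y u) (m.θ u)) (Icc 0 T) :=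
    hm.integrableOn_r.add (integrable_inner_of_memLp hy hm.θ_sq)
  -- Both wealths have the same consumption process `c`, which cancels in the difference and leaves
  -- a homogeneous linear equation.
  have key := ae_eq_zero_of_linear (hW.isLevy T) hF hmono hT hDm hDc hy hb
    (S := fun n => (S' n).sub (S n) hmono) ?_
  · filter_upwards [key, hD] with ω h1 h2 t ht
    have := h1 t ht
    rw [h2 t ht] at this
    linarith
  filter_upwards [hS, hS', hD, hX.cont, hX'.cont, hIeq, hIeq', hX.drift_integrable,
    hX'.drift_integrable] with ω h1 h2 h3 h4 h5 h6 h7 h8 h9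
  refine ⟨?_, fun t ht => ?_⟩
  · have hm1 : ∀ {Z : ℝ → Ω → ℝ}, ContinuousOn (fun t => Z t ω) (Icc 0 T) →
        ∀ R : SimpleIntegrand (brownianFiltration W P) T d,
        AEStronglyMeasurable (fun s => R.eval s ω - Z s ω • y s) (volume.restrict (Icc 0 T)) :=
      fun hZ R => ((R.measurable_eval hF).comp measurable_prodMk_right).aestronglyMeasurable.sub
        ((hZ.aestronglyMeasurable measurableSet_Icc).smul hy.1)
    have hle : ∀ n, ∫⁻ s in Icc 0 T, ‖((S' n).sub (S n) hmono).eval s ω - D s ω • y s‖ₑ ^ 2 ≤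
        2 * (∫⁻ s in Icc 0 T, ‖(S' n).eval s ω - X' s ω • y s‖ₑ ^ 2) +
        2 * ∫⁻ s in Icc 0 T, ‖(S n).eval s ω - X s ω • y s‖ₑ ^ 2 := by
      intro n
      have := lintegral_enorm_sub_sq_le (hm1 h5 (S' n)) (hm1 h4 (S n))
        (h := fun _ => 0) aestronglyMeasurable_const
      simp only [sub_zero] at this
      refine le_trans (le_of_eq ?_) this
      refine setLIntegral_congr_fun measurableSet_Icc fun s hs => ?_
      rw [h3 s hs, SimpleIntegrand.sub_eval]
      congr 2
      module
    refine tendsto_of_tendsto_of_tendsto_of_le_of_le tendsto_const_nhds ?_ (fun _ => zero_le) hle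
    have h10 := (ENNReal.Tendsto.const_mul h2.1 (Or.inr (by simp : (2 : ℝ≥0∞) ≠ ⊤))).add
      (ENNReal.Tendsto.const_mul h1.1 (Or.inr (by simp : (2 : ℝ≥0∞) ≠ ⊤)))
    simpa using h10
  · have hlim := (h2.2.tendsto_at ht).sub (h1.2.tendsto_at ht)
    simp_rw [SimpleIntegrand.sub_sint]
    have h0 : (0 : ℝ) ∈ Icc 0 T := ⟨le_rfl, hT⟩
    have hdrift : ∫ u in (0 : ℝ)..t, D u ω * (m.r u + inner ℝ (y u) (m.θ u)) =
        (∫ u in (0 : ℝ)..t, (X' u ω * (m.r u + inner ℝ (y u) (m.θ u)) - c u ω)) -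
        ∫ u in (0 : ℝ)..t, (X u ω * (m.r u + inner ℝ (y u) (m.θ u)) - c u ω) := by
      rw [← intervalIntegral.integral_sub (intervalIntegrable_of_integrableOn_Icc h9 h0 ht)
        (intervalIntegrable_of_integrableOn_Icc h8 h0 ht)]
      refine intervalIntegral.integral_congr fun u hu => ?_
      rw [uIcc_of_le ht.1] at hu
      rw [h3 u ⟨hu.1, hu.2.trans ht.2⟩]
      ring
    rw [hdrift, h3 t ht, h7 t ht, h6 t ht]
    convert hlim using 2
    ring

lemma ae_continuousOn_vecBM_add_drift (hW : IsBrownianMotion W P) {Q : Measure Ω} (hQ : Q ≪ P)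
    (hm : m.Standing T) (hT : 0 ≤ T) :
    ∀ᵐ ω ∂Q, ContinuousOn (fun t => vecBM W t ω + ∫ r in (0 : ℝ)..t, m.θ r) (Icc 0 T) := by
  have h1 : ContinuousOn (fun t => ∫ r in (0 : ℝ)..t, m.θ r) (Icc 0 T) := by
    have := intervalIntegral.continuousOn_primitive_interval (a := 0) (b := T)
      (f := m.θ) (by rw [uIcc_of_le hT]; exact hm.integrableOn_θ)
    rwa [uIcc_of_le hT] at this
  filter_upwards [hQ.ae_le hW.ae_continuous] with ω hω
  exact hω.continuousOn.add h1

/-- The budget inequality: under the risk neutral measure, discounted terminal wealth plus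
discounted consumption costs at most the initial wealth. -/
theorem IsWealth.budget (hW : IsBrownianMotion W P) (hT : 0 ≤ T) (hx : 0 ≤ x) (hm : m.Standing T)
    {y : ℝ → Ω → EuclideanSpace ℝ (Fin d)} {c X : ℝ → Ω → ℝ} (hX : IsWealth m W P T x y c X)
    (hc : ∀ᵐ ω ∂P, ∀ t ∈ Icc 0 T, 0 ≤ c t ω) {M : ℝ → Ω → ℝ}
    (hM : IsWiener (brownianFiltration W P) P T (vecBM W) m.θ M) :
    ∫⁻ ω, ((∫⁻ t in Icc 0 T, ENNReal.ofReal (Real.exp (-m.R t) * c t ω)) +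
      ENNReal.ofReal (Real.exp (-m.R T) * X T ω)) ∂(girsanovMeasure P T m.θ M) ≤
      ENNReal.ofReal x := by
  have hF := hW.brownianFiltration_le
  have hmono := brownianFiltration_mono (W := W) (P := P)
  have hTT : T ∈ Icc 0 T := ⟨hT, le_rfl⟩
  have h0 : (0 : ℝ) ∈ Icc 0 T := ⟨le_rfl, hT⟩
  set Q := girsanovMeasure P T m.θ M
  have hQP : Q ≪ P := withDensity_absolutelyContinuous P _
  have : IsProbabilityMeasure Q := isProbabilityMeasure_girsanovMeasure hT hF hm.θ_sq hM
  have hB := isLevy_girsanovMeasure hT hF hmono hm.θ_sq (hW.isLevy T) hM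
  obtain ⟨I, hI, hIeq⟩ := hX.sde
  obtain ⟨S, hS⟩ := hI.exists_ae_approx
  -- Wealth without its initial value, riskless return and consumption. It should be the stochastic
  -- integral against `W + ∫θ`, and its discounting produces the budget.
  let Y : ℝ → Ω → ℝ := fun t ω => X t ω - x - ∫ u in (0 : ℝ)..t, (X u ω * m.r u - c u ω)
  have hint : ∀ᵐ ω ∂P, IntegrableOn (fun u => X u ω * m.r u) (Icc 0 T) ∧
      IntegrableOn (fun u => inner ℝ (X u ω • y u ω) (m.θ u)) (Icc 0 T) ∧
      IntegrableOn (fun u => c u ω) (Icc 0 T) := by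
    filter_upwards [hX.cont, hX.drift_integrable, hX.diffusion_sq] with ω h1 h2 h3
    have h4 : IntegrableOn (fun u => X u ω * m.r u) (Icc 0 T) :=
      hm.integrableOn_r.continuousOn_mul h1 isCompact_Icc
    have h5 : IntegrableOn (fun u => inner ℝ (X u ω • y u ω) (m.θ u)) (Icc 0 T) :=
      integrable_inner_of_memLp h3 hm.θ_sq
    refine ⟨h4, h5, ((h4.add h5).sub h2).congr (Eventually.of_forall fun u => ?_)⟩
    simp only [Pi.sub_apply, Pi.add_apply, real_inner_smul_left]
    ring
  have hdisc : ∀ᵐ ω ∂P, ∀ t ∈ Icc 0 T, discount m.r (Y · ω) t =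
      Real.exp (-m.R t) * X t ω - x + ∫ u in (0 : ℝ)..t, Real.exp (-m.R u) * c u ω := by
    filter_upwards [hint, hX.cont] with ω h1 h2 t ht
    exact discount_eq hm.integrableOn_r h2 h1.2.2 ht
  have hbudget := lintegral_discount_le (b := m.r) (x := x) (S := S) (Y := Y) hB hF hmono
    (ae_continuousOn_vecBM_add_drift hW hQP hm hT) hT hm.integrableOn_r hx ?_ ?_
  · refine le_trans (lintegral_mono_ae ?_) hbudget
    filter_upwards [hQP.ae_le hdisc, hQP.ae_le hint, hQP.ae_le hc, hQP.ae_le hX.pos]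
      with ω h1 h2 h3 h4
    have h5 : IntegrableOn (fun u => Real.exp (-m.R u) * c u ω) (Icc 0 T) :=
      h2.2.2.continuousOn_mul (continuousOn_discountFactor hm.integrableOn_r) isCompact_Icc
    have h6 : ∫ u in (0 : ℝ)..T, Real.exp (-m.R u) * c u ω =
        ∫ u in Icc 0 T, Real.exp (-m.R u) * c u ω := by
      rw [intervalIntegral.integral_of_le hT, ← integral_Icc_eq_integral_Ioc]
    have h7 : 0 ≤ᵐ[volume.restrict (Icc 0 T)] fun u => Real.exp (-m.R u) * c u ω := by
      filter_upwards [ae_restrict_mem measurableSet_Icc] with u hu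
      exact mul_nonneg (Real.exp_pos _).le (h3 u hu)
    rw [← ofReal_integral_eq_lintegral_ofReal h5 h7, ← ENNReal.ofReal_add
      (integral_nonneg_of_ae h7) (mul_nonneg (Real.exp_pos _).le (h4 T hTT).le), h1 T hTT, h6]
    refine ENNReal.ofReal_le_ofReal (le_of_eq ?_)
    ring
  · refine hQP.ae_le ?_
    filter_upwards [hS, hX.diffusion_sq, hX.cont, hIeq, hint] with ω h1 h2 h3 h4 h5
    refine ⟨⟨_, lintegral_enorm_sq_ne_top h2, tendsto_qv hF h2.1 h1.1 hTT⟩, ?_⟩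
    -- Shifting the Brownian motion adds a Lebesgue integral against `θ`. Cauchy-Schwarz bounds its
    -- error by the `L²` distance of the integrands, so the same simple integrands approximate `Y`
    -- uniformly under the new measure.
    have hYeq : ∀ t ∈ Icc 0 T, Y t ω = I t ω + ∫ u in (0 : ℝ)..t,
        (inner ℝ (X u ω • y u ω) (m.θ u) : ℝ) := by
      intro t ht
      have h6 : ∫ u in (0 : ℝ)..t, (X u ω * (m.r u + inner ℝ (y u ω) (m.θ u)) - c u ω) =
          (∫ u in (0 : ℝ)..t, (X u ω * m.r u - c u ω)) +
          ∫ u in (0 : ℝ)..t, (inner ℝ (X u ω • y u ω) (m.θ u) : ℝ) := by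
        rw [← intervalIntegral.integral_add
          (intervalIntegrable_of_integrableOn_Icc (f := fun u => X u ω * m.r u - c u ω)
            (h5.1.sub h5.2.2) h0 ht)
          (intervalIntegrable_of_integrableOn_Icc h5.2.1 h0 ht)]
        refine intervalIntegral.integral_congr fun u _ => ?_
        simp only [real_inner_smul_left]
        ring
      have h7 := h4 t ht
      rw [h6] at h7
      simp only [Y]
      linarith
    have hev : ∀ n, AEStronglyMeasurable (fun s => (S n).eval s ω - X s ω • y s ω)
        (volume.restrict (Icc 0 T)) := fun n =>
      (((S n).measurable_eval hF).comp measurable_prodMk_right).aestronglyMeasurable.sub h2.1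
    have hsmall : Tendsto (fun n => (∫⁻ s in Icc 0 T, ‖(S n).eval s ω - X s ω • y s ω‖ₑ ^ 2) *
        ∫⁻ s in Icc 0 T, ‖m.θ s‖ₑ ^ 2) atTop (𝓝 0) := by
      have := ENNReal.Tendsto.mul_const h1.1
        (Or.inr (lintegral_enorm_sq_ne_top hm.θ_sq))
      simpa using this
    rw [Metric.tendstoUniformlyOn_iff]
    intro ε hε
    have hε2 : (0 : ℝ≥0∞) < ENNReal.ofReal ((ε / 2) ^ 2) := ENNReal.ofReal_pos.2 (by positivity)
    filter_upwards [Metric.tendstoUniformlyOn_iff.1 h1.2 (ε / 2) (half_pos hε),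
      hsmall.eventually_lt_const hε2] with n hn1 hn2 t ht
    have h8 := (enorm_integral_inner_sq_le ht (hev n) hm.θ_sq.1).trans_lt hn2
    rw [enorm_sq_eq_ofReal, ENNReal.ofReal_lt_ofReal_iff (by positivity), sq_lt_sq,
      abs_of_pos (half_pos hε)] at h8
    have hSi : IntegrableOn (fun u => (inner ℝ ((S n).eval u ω) (m.θ u) : ℝ)) (Icc 0 T) := by
      refine integrable_inner_of_memLp ⟨?_, ?_⟩ hm.θ_sq
      · exact (((S n).measurable_eval hF).comp measurable_prodMk_right).aestronglyMeasurable
      · obtain ⟨C, hC⟩ := (S n).coef_bdd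
        exact (memLp_top_of_bound (C := C)
          (((S n).measurable_eval hF).comp measurable_prodMk_right).aestronglyMeasurable
          (Eventually.of_forall fun s => (S n).norm_eval_le hC s ω)).mono_exponent le_top |>.2
    have h9 : ∫ u in (0 : ℝ)..t, (inner ℝ ((S n).eval u ω - X u ω • y u ω) (m.θ u) : ℝ) =
        (∫ u in (0 : ℝ)..t, (inner ℝ ((S n).eval u ω) (m.θ u) : ℝ)) -
        ∫ u in (0 : ℝ)..t, (inner ℝ (X u ω • y u ω) (m.θ u) : ℝ) := by
      rw [← intervalIntegral.integral_sub (intervalIntegrable_of_integrableOn_Icc hSi h0 ht)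
        (intervalIntegrable_of_integrableOn_Icc h5.2.1 h0 ht)]
      simp_rw [inner_sub_left]
    rw [hYeq t ht, SimpleIntegrand.sint_add_drift (S n) hm.integrableOn_θ ht, dist_comm,
      Real.dist_eq]
    have h10 := hn1 t ht
    rw [dist_comm, Real.dist_eq] at h10
    rw [h9] at h8
    calc _ = |((S n).sint (vecBM W) t ω - I t ω) +
          ((∫ u in (0 : ℝ)..t, (inner ℝ ((S n).eval u ω) (m.θ u) : ℝ)) -
          ∫ u in (0 : ℝ)..t, (inner ℝ (X u ω • y u ω) (m.θ u) : ℝ))| := by congr 1; ring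
      _ ≤ _ := abs_add_le _ _
      _ < ε / 2 + ε / 2 := add_lt_add h10 h8
      _ = ε := add_halves ε
  · refine hQP.ae_le ?_
    filter_upwards [hdisc, hc, hX.pos] with ω h1 h2 h3 t ht
    rw [h1 t ht]
    have h4 : 0 ≤ ∫ u in (0 : ℝ)..t, Real.exp (-m.R u) * c u ω :=
      intervalIntegral.integral_nonneg ht.1 fun u hu =>
        mul_nonneg (Real.exp_pos _).le (h2 u ⟨hu.1, hu.2.trans ht.2⟩)
    have h5 : 0 ≤ Real.exp (-m.R t) * X t ω := mul_nonneg (Real.exp_pos _).le (h3 t ht).le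
    linarith

end WealthTheory

/-! ### The upper bound for the cost -/

section UpperBound

variable {m : Market d} {W : Fin d → ℝ≥0 → Ω → ℝ} {P : Measure Ω} [IsProbabilityMeasure P]
  {T x γ : ℝ} {F : ℝ → MeasurableSpace Ω} {M : ℝ → Ω → ℝ}
  {B : ℝ → Ω → EuclideanSpace ℝ (Fin d)}

lemma aemeasurable_prod_of_continuousOn (hT : 0 ≤ T) {X : ℝ → Ω → ℝ}
    (hX : ∀ t ∈ Icc 0 T, Measurable (X t))
    (hc : ∀ᵐ ω ∂P, ContinuousOn (fun t => X t ω) (Icc 0 T)) :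
    AEMeasurable (fun p : ℝ × Ω => X p.1 p.2) ((volume.restrict (Icc 0 T)).prod P) := by
  obtain ⟨Y, hY, -, hYX⟩ := exists_continuous_version hT hX hc
  refine ⟨_, hY, ?_⟩
  filter_upwards [Measure.quasiMeasurePreserving_snd.ae hYX,
    Measure.quasiMeasurePreserving_fst.ae (ae_restrict_mem measurableSet_Icc)] with p h1 h2
  exact (h1 _ h2).symm

lemma continuousOn_primitive_Icc {E : Type*} [NormedAddCommGroup E] [NormedSpace ℝ E]
    {f : ℝ → E} (hf : IntegrableOn f (Icc 0 T)) :
    ContinuousOn (fun t => ∫ u in (0 : ℝ)..t, f u) (Icc 0 T) := by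
  rcases le_or_gt 0 T with hT | hT
  · have := intervalIntegral.continuousOn_primitive_interval (a := 0) (b := T) (μ := volume)
      (f := f) (by rwa [uIcc_of_le hT])
    rwa [uIcc_of_le hT] at this
  · simp [Icc_eq_empty (not_le.2 hT)]

lemma Market.Standing.continuousOn_R (hm : m.Standing T) : ContinuousOn m.R (Icc 0 T) :=
  continuousOn_primitive_Icc hm.integrableOn_r

lemma Market.Standing.integrableOn_θ_sq (hm : m.Standing T) :
    IntegrableOn (fun t => ‖m.θ t‖ ^ 2) (Icc 0 T) :=
  (memLp_two_iff_integrable_sq_norm hm.θ_sq.1).1 hm.θ_sq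

lemma Market.θnorm_sq (m : Market d) {t : ℝ} (ht : 0 ≤ t) :
    m.θnorm t ^ 2 = ∫ u in (0 : ℝ)..t, ‖m.θ u‖ ^ 2 :=
  Real.sq_sqrt (intervalIntegral.integral_nonneg ht fun _ _ => by positivity)

lemma gTilde_rpow_qexp (m : Market d) (γ : ℝ) {t : ℝ} (ht : 0 ≤ t) :
    gTilde m γ t ^ qexp γ = Real.exp (qexp γ * (γ * m.R t +
      (qexp γ - 1) / 2 * ∫ u in (0 : ℝ)..t, ‖m.θ u‖ ^ 2)) := by
  rw [gTilde, m.θnorm_sq ht, ← Real.exp_mul, mul_comm]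

lemma gTilde_rpow_pos (m : Market d) (γ t : ℝ) : 0 < gTilde m γ t ^ qexp γ :=
  Real.rpow_pos_of_pos (Real.exp_pos _) _

lemma Market.Standing.continuousOn_gTilde_rpow (hm : m.Standing T) (γ : ℝ) :
    ContinuousOn (fun t => gTilde m γ t ^ qexp γ) (Icc 0 T) := by
  refine ContinuousOn.congr ?_ fun t ht => gTilde_rpow_qexp m γ ht.1
  refine Real.continuous_exp.comp_continuousOn (continuousOn_const.mul ?_)
  exact (continuousOn_const.mul hm.continuousOn_R).add
    (continuousOn_const.mul (continuousOn_primitive_Icc hm.integrableOn_θ_sq))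

/-- `g̃(T)^q + ∫_t^T g̃^q`. -/
def remainingWeight (m : Market d) (T γ t : ℝ) : ℝ :=
  gTilde m γ T ^ qexp γ + ∫ s in t..T, gTilde m γ s ^ qexp γ

lemma remainingWeight_pos (m : Market d) (γ : ℝ) {t : ℝ} (ht : t ≤ T) :
    0 < remainingWeight m T γ t :=
  add_pos_of_pos_of_nonneg (gTilde_rpow_pos m γ T)
    (intervalIntegral.integral_nonneg ht fun s _ => (gTilde_rpow_pos m γ s).le)

/-- The state-price density `exp (-R_t) Z_t`. -/
def statePrice (m : Market d) (M : ℝ → Ω → ℝ) (t : ℝ) (ω : Ω) : ℝ :=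
  Real.exp (-m.R t) * densityProc m.θ M t ω

lemma statePrice_pos (t : ℝ) (ω : Ω) : 0 < statePrice m M t ω :=
  mul_pos (Real.exp_pos _) (Real.exp_pos _)

lemma measurable_statePrice (hM : IsWiener F P T B m.θ M) {t : ℝ} (ht : t ∈ Icc 0 T) :
    Measurable[F t] (statePrice m M t) :=
  (measurable_densityProc hM ht).const_mul _

lemma continuousOn_statePrice (hm : m.Standing T) (hM : IsWiener F P T B m.θ M) (ω : Ω) :
    ContinuousOn (fun t => statePrice m M t ω) (Icc 0 T) := by
  refine (Real.continuous_exp.comp_continuousOn hm.continuousOn_R.neg).mul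
    (Real.continuous_exp.comp_continuousOn ?_)
  exact (hM.cont ω).neg.sub ((continuousOn_primitive_Icc hm.integrableOn_θ_sq).div_const 2)

lemma aemeasurable_statePrice (hT : 0 ≤ T) (hF : ∀ t, F t ≤ mΩ) (hm : m.Standing T)
    (hM : IsWiener F P T B m.θ M) :
    AEMeasurable (fun p : ℝ × Ω => statePrice m M p.1 p.2)
      ((volume.restrict (Icc 0 T)).prod P) :=
  aemeasurable_prod_of_continuousOn hT
    (fun _ ht => (measurable_statePrice hM ht).mono (hF _) le_rfl)
    (Eventually.of_forall fun ω => continuousOn_statePrice hm hM ω)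

/-- The state price is lognormal. With `p = γ/(1-γ)` one has `q = p + 1` and `q γ = p`, and the
exponent `p R + p(p+1)/2 ∫|θ|²` is exactly that of `g̃^q`. -/
lemma lintegral_statePrice_rpow (hγ : γ < 1) (hF : ∀ t, F t ≤ mΩ)
    (hM : IsWiener F P T B m.θ M) {t : ℝ} (ht : t ∈ Icc 0 T) :
    ∫⁻ ω, ENNReal.ofReal (statePrice m M t ω ^ (-(γ / (1 - γ)))) ∂P =
      ENNReal.ofReal (gTilde m γ t ^ qexp γ) := by
  set p := γ / (1 - γ) with hp
  have h1γ : (1 - γ) ≠ 0 := by linarith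
  have hq : qexp γ = p + 1 := by rw [qexp, hp]; field_simp; ring
  have hqγ : qexp γ * γ = p := by rw [qexp, hp]; field_simp
  set ν := ∫ u in (0 : ℝ)..t, ‖m.θ u‖ ^ 2 with hν
  have hν0 : 0 ≤ ν := intervalIntegral.integral_nonneg ht.1 fun _ _ => by positivity
  have h1 : ∀ ω, ENNReal.ofReal (statePrice m M t ω ^ (-p)) =
      ENNReal.ofReal (Real.exp (p * m.R t + p * ν / 2)) *
      ENNReal.ofReal (Real.exp (p * (M t ω - M 0 ω))) := by
    intro ω
    rw [← ofReal_exp_add, statePrice, densityProc, ← Real.exp_add, ← Real.exp_mul, hM.zero]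
    congr 2
    ring
  simp_rw [h1]
  rw [(hM.incr_smul le_rfl ht.1 ht.2 p).lintegral_mul_exp hF
    (f := fun _ => ENNReal.ofReal (Real.exp (p * m.R t + p * ν / 2))) (by positivity)
    (@measurable_const _ _ _ (F 0) _), lintegral_const, measure_univ, mul_one, ← ofReal_exp_add,
    gTilde_rpow_qexp m γ ht.1]
  congr 2
  rw [mul_add, ← mul_assoc, hqγ, hq]
  ring

/-- The budget inequality under the original measure. -/
lemma IsWealth.lintegral_statePrice_le (hW : IsBrownianMotion W P) (hT : 0 ≤ T) (hx : 0 ≤ x)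
    (hm : m.Standing T) {y : ℝ → Ω → EuclideanSpace ℝ (Fin d)} {c X : ℝ → Ω → ℝ}
    (hX : IsWealth m W P T x y c X) (hc : ∀ᵐ ω ∂P, ∀ t ∈ Icc 0 T, 0 ≤ c t ω)
    (hM : IsWiener (brownianFiltration W P) P T (vecBM W) m.θ M)
    (hc1 : ∀ t ∈ Icc 0 T, Measurable[brownianFiltration W P t] (c t))
    (hc2 : AEMeasurable (fun p : ℝ × Ω => c p.1 p.2) ((volume.restrict (Icc 0 T)).prod P)) :
    ∫⁻ ω, ((∫⁻ t in Icc 0 T, ENNReal.ofReal (statePrice m M t ω * c t ω)) +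
      ENNReal.ofReal (statePrice m M T ω * X T ω)) ∂P ≤ ENNReal.ofReal x := by
  have hF := hW.brownianFiltration_le
  have hTT : T ∈ Icc 0 T := ⟨hT, le_rfl⟩
  refine le_trans (le_of_eq ?_) (hX.budget hW hT hx hm hc hM)
  have hQP : girsanovMeasure P T m.θ M ≪ P := withDensity_absolutelyContinuous P _
  have : IsProbabilityMeasure (girsanovMeasure P T m.θ M) :=
    isProbabilityMeasure_girsanovMeasure hT hF hm.θ_sq hM
  have hX' : Measurable[brownianFiltration W P T]
      (fun ω => ENNReal.ofReal (Real.exp (-m.R T) * X T ω)) :=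
    ((hX.adapted T hTT).const_mul _).ennreal_ofReal
  have hRm : AEMeasurable (fun t => Real.exp (-m.R t)) (volume.restrict (Icc 0 T)) :=
    (Real.continuous_exp.comp_continuousOn hm.continuousOn_R.neg).aemeasurable measurableSet_Icc
  have hc3 : AEMeasurable (fun p : ℝ × Ω => ENNReal.ofReal (Real.exp (-m.R p.1) * c p.1 p.2))
      ((volume.restrict (Icc 0 T)).prod P) :=
    ((hRm.comp_fst).mul hc2).ennreal_ofReal
  have hc4 : AEMeasurable (fun p : ℝ × Ω => ENNReal.ofReal (Real.exp (-m.R p.1) * c p.1 p.2))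
      ((volume.restrict (Icc 0 T)).prod (girsanovMeasure P T m.θ M)) :=
    hc3.mono_ac (Measure.AbsolutelyContinuous.rfl.prod hQP)
  have hc5 : AEMeasurable (fun p : ℝ × Ω => ENNReal.ofReal (statePrice m M p.1 p.2 * c p.1 p.2))
      ((volume.restrict (Icc 0 T)).prod P) :=
    ((aemeasurable_statePrice hT hF hm hM).mul hc2).ennreal_ofReal
  have hsplit : ∀ t ω (z : ℝ), ENNReal.ofReal (statePrice m M t ω * z) =
      ENNReal.ofReal (densityProc m.θ M t ω) * ENNReal.ofReal (Real.exp (-m.R t) * z) := by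
    intro t ω z
    rw [← ENNReal.ofReal_mul (densityProc_pos t ω).le, statePrice]
    congr 1
    ring
  rw [lintegral_add_right _ (hX'.mono (hF T) le_rfl), lintegral_add_right]
  · congr 1
    · rw [lintegral_lintegral_swap (μ := girsanovMeasure P T m.θ M)
        (f := fun ω t => ENNReal.ofReal (Real.exp (-m.R t) * c t ω)) hc4.prod_swap,
        lintegral_lintegral_swap (μ := P)
        (f := fun ω t => ENNReal.ofReal (statePrice m M t ω * c t ω)) hc5.prod_swap]
      refine setLIntegral_congr_fun measurableSet_Icc fun t ht => ?_
      -- Consumption at time `t` is known at `t`, so the terminal density can be replaced by the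
      -- density at `t`.
      rw [lintegral_girsanovMeasure_of_measurable hF hm.θ_sq hM ht
        (f := fun ω => ENNReal.ofReal (Real.exp (-m.R t) * c t ω))
        ((hc1 t ht).const_mul _).ennreal_ofReal]
      exact lintegral_congr fun ω => hsplit t ω _
    · rw [lintegral_girsanovMeasure_of_measurable hF hm.θ_sq hM hTT hX']
      exact lintegral_congr fun ω => hsplit T ω _
  · exact (((measurable_statePrice hM hTT).mul (hX.adapted T hTT)).mono (hF T) le_rfl).ennreal_ofReal

/-- Young's inequality in dual form. -/
lemma rpow_le_young (hγ : 0 < γ) (hγ' : γ < 1) {c h : ℝ} (hc : 0 ≤ c) (hh : 0 < h) :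
    c ^ γ ≤ γ * (h * c) + (1 - γ) * h ^ (-(γ / (1 - γ))) := by
  have h1 := Real.geom_mean_le_arith_mean2_weighted hγ.le (sub_pos.2 hγ').le
    (mul_nonneg hh.le hc) (Real.rpow_nonneg hh.le (-(γ / (1 - γ)))) (by ring)
  refine le_trans (le_of_eq ?_) h1
  have h1γ : (1 - γ) ≠ 0 := by linarith
  rw [Real.mul_rpow hh.le hc, ← Real.rpow_mul hh.le, mul_right_comm, ← Real.rpow_add hh]
  have : γ + -(γ / (1 - γ)) * (1 - γ) = 0 := by field_simp; ring
  rw [this, Real.rpow_zero, one_mul]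

/-- Apply Young's inequality with the price `l H` to consumption and terminal wealth. The primal
terms are bounded by the budget inequality, and the dual terms have total expectation `G`, whatever
the control. -/
theorem cost_le (hW : IsBrownianMotion W P) (hT : 0 < T) (hx : 0 < x)
    (hm : m.Standing T) (hγ : 0 < γ) (hγ' : γ < 1) (s : Strategy Ω d)
    (hX : IsWealth m W P T x s.y s.c s.X) (hc : ∀ᵐ ω ∂P, ∀ t ∈ Icc 0 T, 0 ≤ s.c t ω)
    (hM : IsWiener (brownianFiltration W P) P T (vecBM W) m.θ M)
    (hc1 : ∀ t ∈ Icc 0 T, Measurable[brownianFiltration W P t] (s.c t))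
    (hc2 : AEMeasurable (fun p : ℝ × Ω => s.c p.1 p.2) ((volume.restrict (Icc 0 T)).prod P)) :
    cost P T γ γ s ≤ ENNReal.ofReal (x ^ γ * remainingWeight m T γ 0 ^ (1 - γ)) := by
  have hF := hW.brownianFiltration_le
  have hTT : T ∈ Icc 0 T := ⟨hT.le, le_rfl⟩
  set G := remainingWeight m T γ 0 with hG
  have hG0 : 0 < G := remainingWeight_pos m γ hT.le
  set p := γ / (1 - γ) with hp
  have h1γ : 0 < 1 - γ := by linarith
  -- The minimiser of `γ l x + (1 - γ) l^{-p} G`: there `l x = l^{-p} G = x^γ G^{1-γ}`.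
  set l : ℝ := (G / x) ^ (1 - γ) with hl
  have hl0 : 0 < l := Real.rpow_pos_of_pos (div_pos hG0 hx) _
  set a := ENNReal.ofReal (γ * l)
  set b := ENNReal.ofReal ((1 - γ) * l ^ (-p))
  have hyoung : ∀ t ω z, 0 ≤ z → ENNReal.ofReal (z ^ γ) ≤
      a * ENNReal.ofReal (statePrice m M t ω * z) +
      b * ENNReal.ofReal (statePrice m M t ω ^ (-p)) := by
    intro t ω z hz
    have hs := statePrice_pos (m := m) (M := M) t ω
    have := rpow_le_young hγ hγ' hz (mul_pos hl0 hs)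
    rw [← ENNReal.ofReal_mul (by positivity), ← ENNReal.ofReal_mul (by positivity),
      ← ENNReal.ofReal_add (by positivity) (by positivity)]
    refine ENNReal.ofReal_le_ofReal (this.trans (le_of_eq ?_))
    rw [Real.mul_rpow hl0.le hs.le]
    ring
  have hsp : AEMeasurable (fun p' : ℝ × Ω => ENNReal.ofReal (statePrice m M p'.1 p'.2 ^ (-p)))
      ((volume.restrict (Icc 0 T)).prod P) :=
    ((aemeasurable_statePrice hT.le hF hm hM).pow_const (-p)).ennreal_ofReal
  have hc5 : AEMeasurable (fun p : ℝ × Ω => ENNReal.ofReal (statePrice m M p.1 p.2 * s.c p.1 p.2))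
      ((volume.restrict (Icc 0 T)).prod P) :=
    ((aemeasurable_statePrice hT.le hF hm hM).mul hc2).ennreal_ofReal
  have hspT : Measurable (fun ω => ENNReal.ofReal (statePrice m M T ω ^ (-p))) :=
    (((measurable_statePrice hM hTT).mono (hF T) le_rfl).pow_const (-p)).ennreal_ofReal
  have hpath : ∀ᵐ ω ∂P, (∫⁻ t in Icc 0 T, ENNReal.ofReal (s.c t ω ^ γ)) +
      ENNReal.ofReal (s.X T ω ^ γ) ≤
      a * ((∫⁻ t in Icc 0 T, ENNReal.ofReal (statePrice m M t ω * s.c t ω)) +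
        ENNReal.ofReal (statePrice m M T ω * s.X T ω)) +
      b * ((∫⁻ t in Icc 0 T, ENNReal.ofReal (statePrice m M t ω ^ (-p))) +
        ENNReal.ofReal (statePrice m M T ω ^ (-p))) := by
    filter_upwards [hc, hX.pos] with ω h1 h2
    have h3 : AEMeasurable (fun t => ENNReal.ofReal (statePrice m M t ω ^ (-p)))
        (volume.restrict (Icc 0 T)) :=
      (((continuousOn_statePrice hm hM ω).aemeasurable measurableSet_Icc).pow_const _).ennreal_ofReal
    have h4 : (∫⁻ t in Icc 0 T, ENNReal.ofReal (s.c t ω ^ γ)) ≤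
        a * (∫⁻ t in Icc 0 T, ENNReal.ofReal (statePrice m M t ω * s.c t ω)) +
        b * ∫⁻ t in Icc 0 T, ENNReal.ofReal (statePrice m M t ω ^ (-p)) := by
      rw [← lintegral_const_mul' _ _ ENNReal.ofReal_ne_top,
        ← lintegral_const_mul' _ _ ENNReal.ofReal_ne_top,
        ← lintegral_add_right' _ (h3.const_mul _)]
      exact setLIntegral_mono' measurableSet_Icc fun t ht => hyoung t ω _ (h1 t ht)
    calc _ ≤ _ := add_le_add h4 (hyoung T ω _ (h2 T hTT).le)
      _ = _ := by ring
  have hgint : ∫⁻ t in Icc 0 T, ENNReal.ofReal (gTilde m γ t ^ qexp γ) =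
      ENNReal.ofReal (∫ t in (0 : ℝ)..T, gTilde m γ t ^ qexp γ) := by
    rw [intervalIntegral.integral_of_le hT.le, ← integral_Icc_eq_integral_Ioc,
      ofReal_integral_eq_lintegral_ofReal
        ((hm.continuousOn_gTilde_rpow γ).integrableOn_compact isCompact_Icc)
        (Eventually.of_forall fun t => (gTilde_rpow_pos m γ t).le)]
  have hdual : ∫⁻ ω, ((∫⁻ t in Icc 0 T, ENNReal.ofReal (statePrice m M t ω ^ (-p))) +
        ENNReal.ofReal (statePrice m M T ω ^ (-p))) ∂P = ENNReal.ofReal G := by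
    rw [lintegral_add_right _ hspT, lintegral_lintegral_swap (μ := P)
        (f := fun ω t => ENNReal.ofReal (statePrice m M t ω ^ (-p))) hsp.prod_swap,
      lintegral_statePrice_rpow hγ' hF hM hTT, setLIntegral_congr_fun measurableSet_Icc
      fun t ht => lintegral_statePrice_rpow hγ' hF hM ht, hgint, ← ENNReal.ofReal_add
      (intervalIntegral.integral_nonneg hT.le fun s _ => (gTilde_rpow_pos m γ s).le)
      (gTilde_rpow_pos m γ T).le, add_comm]
    rfl
  have hmeas : AEMeasurable (fun ω => b * ((∫⁻ t in Icc 0 T,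
      ENNReal.ofReal (statePrice m M t ω ^ (-p))) + ENNReal.ofReal (statePrice m M T ω ^ (-p)))) P :=
    ((hsp.prod_swap.lintegral_prod_right').add hspT.aemeasurable).const_mul _
  calc cost P T γ γ s ≤ _ := lintegral_mono_ae hpath
    _ ≤ a * ENNReal.ofReal x + b * ENNReal.ofReal G := by
      rw [lintegral_add_right' _ hmeas, lintegral_const_mul' _ _ ENNReal.ofReal_ne_top,
        lintegral_const_mul' _ _ ENNReal.ofReal_ne_top, hdual]
      gcongr
      exact hX.lintegral_statePrice_le hW hT.le hx.le hm hc hM hc1 hc2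
    _ = _ := by
      rw [← ENNReal.ofReal_mul (by positivity), ← ENNReal.ofReal_mul (by positivity),
        ← ENNReal.ofReal_add (by positivity) (by positivity)]
      congr 1
      have h1 : l * x = x ^ γ * G ^ (1 - γ) := by
        rw [hl, Real.div_rpow hG0.le hx.le]
        have : x = x ^ γ * x ^ (1 - γ) := by rw [← Real.rpow_add hx]; simp
        have h2 : (x ^ (1 - γ)) ≠ 0 := (Real.rpow_pos_of_pos hx _).ne'
        field_simp
        nth_rw 1 [this]
        ring
      have h2 : l ^ (-p) * G = x ^ γ * G ^ (1 - γ) := by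
        have h3 : (1 - γ) * -p = -γ := by rw [hp]; field_simp
        rw [hl, ← Real.rpow_mul (div_pos hG0 hx).le, h3, Real.rpow_neg (div_pos hG0 hx).le,
          Real.div_rpow hG0.le hx.le, inv_div, Real.rpow_sub hG0, Real.rpow_one]
        ring
      linear_combination γ * h1 + (1 - γ) * h2

end UpperBound

/-! ### The stochastic exponential -/

section StochasticExponential

variable {F : ℝ → MeasurableSpace Ω} {P : Measure Ω} [IsProbabilityMeasure P] {T : ℝ}
  {B : ℝ → Ω → EuclideanSpace ℝ (Fin d)} {φ : ℝ → EuclideanSpace ℝ (Fin d)} {M : ℝ → Ω → ℝ}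

lemma lintegral_densityProc_rpow (hF : ∀ t, F t ≤ mΩ) (hM : IsWiener F P T B φ M) {t : ℝ}
    (ht : t ∈ Icc 0 T) (a : ℝ) :
    ∫⁻ ω, ENNReal.ofReal (densityProc φ M t ω ^ a) ∂P =
      ENNReal.ofReal (Real.exp ((a ^ 2 - a) / 2 * ∫ r in (0 : ℝ)..t, ‖φ r‖ ^ 2)) := by
  set ν := ∫ r in (0 : ℝ)..t, ‖φ r‖ ^ 2
  have hν : 0 ≤ ν := intervalIntegral.integral_nonneg ht.1 fun _ _ => by positivity
  have h1 : ∀ ω, ENNReal.ofReal (densityProc φ M t ω ^ a) =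
      ENNReal.ofReal (Real.exp (-(a * ν / 2))) *
      ENNReal.ofReal (Real.exp (-a * (M t ω - M 0 ω))) := by
    intro ω
    rw [← ofReal_exp_add, densityProc, ← Real.exp_mul, hM.zero]
    congr 2
    ring
  simp_rw [h1]
  rw [(hM.incr_smul le_rfl ht.1 ht.2 (-a)).lintegral_mul_exp hF
    (f := fun _ => ENNReal.ofReal (Real.exp (-(a * ν / 2))))
    (mul_nonneg (sq_nonneg _) hν)
    (@measurable_const _ _ _ (F 0) _), lintegral_const, measure_univ, mul_one, ← ofReal_exp_add]
  congr 2
  ring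

lemma lintegral_densityProc_pow (hF : ∀ t, F t ≤ mΩ) (hM : IsWiener F P T B φ M) {t : ℝ}
    (ht : t ∈ Icc 0 T) (k : ℕ) :
    ∫⁻ ω, ENNReal.ofReal (densityProc φ M t ω ^ k) ∂P =
      ENNReal.ofReal (Real.exp ((k ^ 2 - k) / 2 * ∫ r in (0 : ℝ)..t, ‖φ r‖ ^ 2)) := by
  have h := lintegral_densityProc_rpow hF hM ht k
  simp_rw [Real.rpow_natCast] at h
  exact h

lemma integrable_densityProc_pow (hF : ∀ t, F t ≤ mΩ) (hM : IsWiener F P T B φ M) {t : ℝ}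
    (ht : t ∈ Icc 0 T) (k : ℕ) : Integrable (fun ω => densityProc φ M t ω ^ k) P := by
  have h := (measurable_densityProc hM ht).mono (hF t) le_rfl
  refine ⟨(h.pow_const k).aestronglyMeasurable, ?_⟩
  rw [hasFiniteIntegral_iff_ofReal (Eventually.of_forall fun ω =>
    (pow_pos (densityProc_pos t ω) k).le), lintegral_densityProc_pow hF hM ht]
  exact ENNReal.ofReal_lt_top

lemma integral_densityProc_pow (hF : ∀ t, F t ≤ mΩ) (hM : IsWiener F P T B φ M) {t : ℝ}
    (ht : t ∈ Icc 0 T) (k : ℕ) :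
    ∫ ω, densityProc φ M t ω ^ k ∂P =
      Real.exp ((k ^ 2 - k) / 2 * ∫ r in (0 : ℝ)..t, ‖φ r‖ ^ 2) := by
  have h := integrable_densityProc_pow hF hM ht k
  rw [integral_eq_lintegral_of_nonneg_ae (Eventually.of_forall fun ω =>
    (pow_pos (densityProc_pos t ω) k).le) h.1, lintegral_densityProc_pow hF hM ht,
    ENNReal.toReal_ofReal (Real.exp_pos _).le]

lemma memLp_densityProc (hF : ∀ t, F t ≤ mΩ) (hM : IsWiener F P T B φ M) {t : ℝ}
    (ht : t ∈ Icc 0 T) : MemLp (densityProc φ M t) 2 P :=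
  (memLp_two_iff_integrable_sq
    ((measurable_densityProc hM ht).mono (hF t) le_rfl).aestronglyMeasurable).2
    (integrable_densityProc_pow hF hM ht 2)

lemma integral_densityProc_mul (hF : ∀ t, F t ≤ mΩ) (hφ : MemLp φ 2 (volume.restrict (Icc 0 T)))
    (hM : IsWiener F P T B φ M) {s t : ℝ} (hs : 0 ≤ s) (hst : s ≤ t) (ht : t ≤ T) {f : Ω → ℝ}
    (hf : Measurable[F s] f) :
    ∫ ω, densityProc φ M t ω * f ω ∂P = ∫ ω, densityProc φ M s ω * f ω ∂P := by
  have h0 : (0 : ℝ) ∈ Icc 0 T := ⟨le_rfl, hs.trans (hst.trans ht)⟩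
  have hsm : s ∈ Icc 0 T := ⟨hs, hst.trans ht⟩
  have htm : t ∈ Icc 0 T := ⟨hs.trans hst, ht⟩
  have hadd := intervalIntegral.integral_add_adjacent_intervals
    (intervalIntegrable_norm_sq hφ h0 hsm) (intervalIntegrable_norm_sq hφ hsm htm)
  have h1 : ∀ ω, densityProc φ M t ω * f ω =
      Real.exp (-(∫ r in s..t, ‖φ r‖ ^ 2) / 2) * (densityProc φ M s ω * f ω *
        Real.exp (-1 * (M t ω - M s ω))) := by
    intro ω
    have : densityProc φ M t ω = Real.exp (-(∫ r in s..t, ‖φ r‖ ^ 2) / 2) *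
        (densityProc φ M s ω * Real.exp (-1 * (M t ω - M s ω))) := by
      unfold densityProc
      rw [← Real.exp_add, ← Real.exp_add, ← hadd]
      congr 1
      ring
    rw [this]; ring
  simp_rw [h1]
  rw [integral_const_mul, (hM.incr_smul hs hst ht (-1)).mgf hF
    (mul_nonneg (by norm_num) (intervalIntegral.integral_nonneg hst fun _ _ => by positivity))
    (f := fun ω => densityProc φ M s ω * f ω) ((measurable_densityProc hM hsm).mul hf),
    mul_left_comm, ← Real.exp_add]
  have : -(∫ r in s..t, ‖φ r‖ ^ 2) / 2 + (-1) ^ 2 * (∫ r in s..t, ‖φ r‖ ^ 2) / 2 = 0 := by ring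
  rw [this, Real.exp_zero, mul_one]

lemma SimpleIntegrand.measurable_eval_time (S : SimpleIntegrand F T d) (hmono : Monotone F)
    (t : ℝ) : Measurable[F t] (S.eval t) := by
  unfold eval
  refine Finset.measurable_fun_sum _ fun k _ => ?_
  by_cases h : t ∈ Ioc (S.time k) (S.time (k + 1))
  · simp only [indicator_of_mem h]
    exact (S.coef_meas k).mono (hmono h.1.le) le_rfl
  · simp only [indicator_of_notMem h]
    exact measurable_const

lemma SimpleIntegrand.qv_eq_integral (S : SimpleIntegrand F T d) (hF : ∀ t, F t ≤ mΩ) (ω : Ω) :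
    S.qv T ω = ∫ t in Icc 0 T, ‖S.eval t ω‖ ^ 2 := by
  rw [integral_norm_sq_eq_toReal (g := fun t => S.eval t ω)
    ((S.measurable_eval hF).comp measurable_prodMk_right).aestronglyMeasurable,
    S.lintegral_eval_sq, ENNReal.toReal_ofReal (S.qv_nonneg _ _)]

lemma integral_exp_mul_norm_sq (hT : 0 ≤ T) (hφ : MemLp φ 2 (volume.restrict (Icc 0 T))) :
    ∫ t in Icc 0 T, Real.exp (∫ r in (0 : ℝ)..t, ‖φ r‖ ^ 2) * ‖φ t‖ ^ 2 =
      Real.exp (∫ r in (0 : ℝ)..T, ‖φ r‖ ^ 2) - 1 := by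
  have h := integral_exp_mul_primitive (b := fun t => ‖φ t‖ ^ 2) (g := fun _ => 0)
    (intervalIntegrable_norm_sq hφ ⟨le_rfl, hT⟩ ⟨hT, le_rfl⟩) intervalIntegrable_const 1
  simp only [intervalIntegral.integral_zero, add_zero, mul_one, mul_zero] at h
  rw [← h, intervalIntegral.integral_of_le hT, ← integral_Icc_eq_integral_Ioc]
  exact integral_congr_ae (Eventually.of_forall fun t => mul_comm _ _)

lemma integrable_prod_densityProc (hF : ∀ t, F t ≤ mΩ) (hM : IsWiener F P T B φ M)
    (S : SimpleIntegrand F T d) (hφ : MemLp φ 2 (volume.restrict (Icc 0 T))) (hT : 0 ≤ T) :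
    Integrable (fun p : ℝ × Ω => densityProc φ M T p.2 * inner ℝ (S.eval p.1 p.2) (φ p.1))
      ((volume.restrict (Icc 0 T)).prod P) := by
  obtain ⟨C, hC⟩ := S.coef_bdd
  have hTT : T ∈ Icc 0 T := ⟨hT, le_rfl⟩
  have h1 : Integrable (densityProc φ M T) P := (memLp_densityProc hF hM hTT).integrable (by norm_num)
  have h2 : Integrable φ (volume.restrict (Icc 0 T)) := hφ.integrable (by norm_num)
  have h3 : Integrable (fun p : ℝ × Ω => (C * ‖φ p.1‖) * densityProc φ M T p.2)
      ((volume.restrict (Icc 0 T)).prod P) := (h2.norm.const_mul C).mul_prod h1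
  refine h3.mono' ?_ (Eventually.of_forall fun p => ?_)
  · exact (h1.1.comp_snd).mul ((S.measurable_eval hF).aestronglyMeasurable.inner h2.1.comp_fst)
  · rw [norm_mul, Real.norm_of_nonneg (densityProc_pos _ _).le, mul_comm]
    refine mul_le_mul_of_nonneg_right ?_ (densityProc_pos _ _).le
    exact (norm_inner_le_norm _ _).trans
      (mul_le_mul_of_nonneg_right (S.norm_eval_le hC _ _) (norm_nonneg _))

/-- Girsanov's theorem in place of a product rule: under the tilted measure the integral against `B
+ ∫φ` has mean zero, so weighting `∫ S' dB` by the density gives minus the weighted drift term. -/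
lemma integral_densityProc_mul_sint (hT : 0 ≤ T) (hF : ∀ t, F t ≤ mΩ) (hmono : Monotone F)
    (hB : IsLevy F P T B) (hφ : MemLp φ 2 (volume.restrict (Icc 0 T)))
    (hM : IsWiener F P T B φ M) (S : SimpleIntegrand F T d) :
    ∫ ω, densityProc φ M T ω * S.sint B T ω ∂P =
      -∫ t in Icc 0 T, ∫ ω, densityProc φ M t ω * inner ℝ (S.eval t ω) (φ t) ∂P := by
  have hTT : T ∈ Icc 0 T := ⟨hT, le_rfl⟩
  have : IsProbabilityMeasure (girsanovMeasure P T φ M) :=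
    isProbabilityMeasure_girsanovMeasure hT hF hφ hM
  have hint := integrable_prod_densityProc hF hM S hφ hT
  have h1 := S.integral_sint (isLevy_girsanovMeasure hT hF hmono hφ hB hM) hF hmono hTT
  rw [girsanovMeasure, integral_withDensity_eq_integral_toReal_smul
    (measurable_ofReal_densityProc hF hM hTT)
    (Eventually.of_forall fun _ => ENNReal.ofReal_lt_top)] at h1
  have h2 : ∀ ω, (ENNReal.ofReal (densityProc φ M T ω)).toReal •
      S.sint (fun t ω => B t ω + ∫ r in (0 : ℝ)..t, φ r) T ω =
      densityProc φ M T ω * S.sint B T ω +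
      ∫ t in Icc 0 T, densityProc φ M T ω * inner ℝ (S.eval t ω) (φ t) := by
    intro ω
    rw [ENNReal.toReal_ofReal (densityProc_pos _ _).le,
      S.sint_add_drift (hφ.integrable (by norm_num)) hTT, smul_eq_mul, mul_add,
      integral_const_mul, intervalIntegral.integral_of_le hT, ← integral_Icc_eq_integral_Ioc]
  simp_rw [h2] at h1
  have h3 : Integrable (fun ω => densityProc φ M T ω * S.sint B T ω) P :=
    (memLp_densityProc hF hM hTT).integrable_mul (S.memLp_sint hB hF hTT)
  have h4 : Integrable (fun ω => ∫ t in Icc 0 T, densityProc φ M T ω *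
      inner ℝ (S.eval t ω) (φ t)) P := hint.integral_prod_right
  rw [integral_add h3 h4,
    ← integral_integral_swap (f := fun t ω => densityProc φ M T ω * inner ℝ (S.eval t ω) (φ t))
      hint] at h1
  rw [eq_neg_iff_add_eq_zero]
  refine Eq.trans ?_ h1
  congr 1
  refine setIntegral_congr_fun measurableSet_Icc fun t ht => ?_
  exact (integral_densityProc_mul hF hφ hM ht.1 ht.2 le_rfl
    ((S.measurable_eval_time hmono t).inner_const)).symm

/-- The isometry behind `dE = -E φ' dB` for the density process `E`. -/
theorem integral_densityProc_sub_sint_sq (hT : 0 ≤ T) (hF : ∀ t, F t ≤ mΩ) (hmono : Monotone F)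
    (hB : IsLevy F P T B) (hφ : MemLp φ 2 (volume.restrict (Icc 0 T)))
    (hM : IsWiener F P T B φ M) (S : SimpleIntegrand F T d) :
    ∫ ω, (densityProc φ M T ω - 1 - S.sint B T ω) ^ 2 ∂P =
      ∫ t in Icc 0 T, ∫ ω, ‖S.eval t ω + densityProc φ M t ω • φ t‖ ^ 2 ∂P := by
  have hTT : T ∈ Icc 0 T := ⟨hT, le_rfl⟩
  obtain ⟨C, hC⟩ := S.coef_bdd
  have hE := memLp_densityProc hF hM hTT
  have hJ := S.memLp_sint hB hF hTT
  have hEi : Integrable (densityProc φ M T) P := hE.integrable (by norm_num)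
  have hJi : Integrable (S.sint B T) P := hJ.integrable (by norm_num)
  -- With `ν = ∫₀ᵀ |φ|²` and `E` the density process, both sides equal `e^ν - 1 + 2 ∫ E[E_t ⟨S_t,
  -- φ_t⟩] dt + ∫ E|S_t|² dt`.
  have h1 : ∀ ω, (densityProc φ M T ω - 1 - S.sint B T ω) ^ 2 =
      densityProc φ M T ω ^ 2 + (-2 * densityProc φ M T ω ^ 1 + 1 + 2 * S.sint B T ω) +
      (-2 * (densityProc φ M T ω * S.sint B T ω) + S.sint B T ω ^ 2) := fun ω => by ring
  have hSb : Integrable (fun p : ℝ × Ω => ‖S.eval p.1 p.2‖ ^ 2)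
      ((volume.restrict (Icc 0 T)).prod P) := by
    refine Integrable.of_bound ((S.measurable_eval hF).norm.pow_const 2).aestronglyMeasurable
      (C ^ 2) (Eventually.of_forall fun p => ?_)
    rw [norm_pow, norm_norm]
    exact pow_le_pow_left₀ (norm_nonneg _) (S.norm_eval_le hC _ _) 2
  have hJ2 : ∫ ω, S.sint B T ω ^ 2 ∂P = ∫ t in Icc 0 T, ∫ ω, ‖S.eval t ω‖ ^ 2 ∂P := by
    rw [S.integral_sint_sq hB hF hmono hTT]
    simp_rw [S.qv_eq_integral hF]
    exact integral_integral_swap (f := fun ω t => ‖S.eval t ω‖ ^ 2) hSb.swap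
  have hprod : Integrable (fun t => ∫ ω, densityProc φ M t ω * inner ℝ (S.eval t ω) (φ t) ∂P)
      (volume.restrict (Icc 0 T)) := by
    refine (integrable_prod_densityProc hF hM S hφ hT).integral_prod_left.congr ?_
    filter_upwards [ae_restrict_mem measurableSet_Icc] with t ht
    exact integral_densityProc_mul hF hφ hM ht.1 ht.2 le_rfl
      ((S.measurable_eval_time hmono t).inner_const)
  have hexp : Integrable (fun t => Real.exp (∫ r in (0 : ℝ)..t, ‖φ r‖ ^ 2) * ‖φ t‖ ^ 2)
      (volume.restrict (Icc 0 T)) := by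
    have h2 : IntegrableOn (fun t => ‖φ t‖ ^ 2) (Icc 0 T) :=
      (memLp_two_iff_integrable_sq_norm hφ.1).1 hφ
    exact h2.continuousOn_mul
      (Real.continuous_exp.comp_continuousOn (continuousOn_primitive_Icc h2)) isCompact_Icc
  have hright : ∀ t ∈ Icc 0 T, ∫ ω, ‖S.eval t ω + densityProc φ M t ω • φ t‖ ^ 2 ∂P =
      Real.exp (∫ r in (0 : ℝ)..t, ‖φ r‖ ^ 2) * ‖φ t‖ ^ 2 +
      (2 * (∫ ω, densityProc φ M t ω * inner ℝ (S.eval t ω) (φ t) ∂P) +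
        ∫ ω, ‖S.eval t ω‖ ^ 2 ∂P) := by
    intro t ht
    have h3 : ∀ ω, ‖S.eval t ω + densityProc φ M t ω • φ t‖ ^ 2 =
        densityProc φ M t ω ^ 2 * ‖φ t‖ ^ 2 +
        (2 * (densityProc φ M t ω * inner ℝ (S.eval t ω) (φ t)) + ‖S.eval t ω‖ ^ 2) := by
      intro ω
      rw [norm_add_sq_real, real_inner_smul_right, norm_smul, mul_pow, Real.norm_eq_abs, sq_abs]
      ring
    have hSm : Measurable (S.eval t) := (S.measurable_eval_time hmono t).mono (hF t) le_rfl
    have h4 : Integrable (fun ω => ‖S.eval t ω‖ ^ 2) P := by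
      refine Integrable.of_bound (hSm.norm.pow_const 2).aestronglyMeasurable
        (C ^ 2) (Eventually.of_forall fun ω => ?_)
      rw [norm_pow, norm_norm]
      exact pow_le_pow_left₀ (norm_nonneg _) (S.norm_eval_le hC _ _) 2
    have h5 : Integrable (fun ω => densityProc φ M t ω * inner ℝ (S.eval t ω) (φ t)) P := by
      refine ((memLp_densityProc hF hM ht).integrable (by norm_num)).mul_bdd (c := C * ‖φ t‖)
        hSm.inner_const.aestronglyMeasurable (Eventually.of_forall fun ω => ?_)
      exact (norm_inner_le_norm _ _).trans
        (mul_le_mul_of_nonneg_right (S.norm_eval_le hC _ _) (norm_nonneg _))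
    have h6 := integral_densityProc_pow hF hM ht 2
    norm_num at h6
    simp_rw [h3]
    have h7 : Integrable (fun ω => 2 * (densityProc φ M t ω * inner ℝ (S.eval t ω) (φ t)) +
        ‖S.eval t ω‖ ^ 2) P := (h5.const_mul 2).add h4
    rw [integral_add ((integrable_densityProc_pow hF hM ht 2).mul_const _) h7, integral_add (h5.const_mul 2) h4, integral_mul_const,
      integral_const_mul, h6]
  have hE2 := integral_densityProc_pow hF hM hTT 2
  have hE1 := integral_densityProc_pow hF hM hTT 1
  norm_num at hE2 hE1
  simp_rw [h1]
  have i1 := integrable_densityProc_pow hF hM hTT 2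
  have i2 : Integrable (fun ω => -2 * densityProc φ M T ω ^ 1) P := by
    simpa using hEi.const_mul (-2)
  have i3 : Integrable (fun ω => -2 * (densityProc φ M T ω * S.sint B T ω)) P :=
    (hE.integrable_mul hJ).const_mul _
  have i4 : Integrable (fun ω => -2 * densityProc φ M T ω ^ 1 + 1) P := i2.add (integrable_const 1)
  have i5 : Integrable (fun ω => -2 * densityProc φ M T ω ^ 1 + 1 + 2 * S.sint B T ω) P :=
    i4.add (hJi.const_mul 2)
  have i6 : Integrable (fun ω => densityProc φ M T ω ^ 2 +
      (-2 * densityProc φ M T ω ^ 1 + 1 + 2 * S.sint B T ω)) P := i1.add i5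
  have i7 : Integrable (fun ω => -2 * (densityProc φ M T ω * S.sint B T ω) +
      S.sint B T ω ^ 2) P := i3.add hJ.integrable_sq
  have j1 : Integrable (fun t => 2 * ∫ ω, densityProc φ M t ω * inner ℝ (S.eval t ω) (φ t) ∂P)
      (volume.restrict (Icc 0 T)) := hprod.const_mul 2
  have j2 : Integrable (fun t => ∫ ω, ‖S.eval t ω‖ ^ 2 ∂P) (volume.restrict (Icc 0 T)) :=
    hSb.integral_prod_left
  have j3 : Integrable (fun t => 2 * (∫ ω, densityProc φ M t ω * inner ℝ (S.eval t ω) (φ t) ∂P) +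
      ∫ ω, ‖S.eval t ω‖ ^ 2 ∂P) (volume.restrict (Icc 0 T)) := j1.add j2
  rw [integral_add i6 i7, integral_add i1 i5, integral_add i4 (hJi.const_mul 2),
    integral_add i2 (integrable_const _), integral_add i3 hJ.integrable_sq, integral_const_mul,
    integral_const_mul, integral_const_mul, S.integral_sint hB hF hmono hTT,
    integral_densityProc_mul_sint hT hF hmono hB hφ hM, hJ2,
    setIntegral_congr_fun measurableSet_Icc hright,
    integral_add hexp j3, integral_add j1 j2, integral_const_mul,
    integral_exp_mul_norm_sq hT hφ]
  simp only [pow_one, hE1, hE2, integral_const, probReal_univ, smul_eq_mul]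
  ring

end StochasticExponential

/-! ### Simple approximation of the stochastic exponential -/

section StochasticExponentialApprox

variable {F : ℝ → MeasurableSpace Ω} {P : Measure Ω} [IsProbabilityMeasure P] {T : ℝ}
  {B : ℝ → Ω → EuclideanSpace ℝ (Fin d)} {φ : ℝ → EuclideanSpace ℝ (Fin d)} {M : ℝ → Ω → ℝ}

lemma sq_sub_min_le {e K : ℝ} (he : 0 ≤ e) (hK : 0 < K) : (e - min e K) ^ 2 ≤ e ^ 4 / K ^ 2 := by
  rcases le_total e K with h | h
  · rw [min_eq_left h, sub_self, zero_pow two_ne_zero]; positivity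
  · rw [min_eq_right h, le_div_iff₀ (pow_pos hK 2), ← mul_pow]
    have h1 : (e - K) * K ≤ e ^ 2 := by nlinarith
    calc ((e - K) * K) ^ 2 ≤ (e ^ 2) ^ 2 :=
          pow_le_pow_left₀ (mul_nonneg (sub_nonneg.2 h) hK.le) h1 2
      _ = e ^ 4 := by ring

lemma integral_densityProc_sub_sq (hF : ∀ t, F t ≤ mΩ) (hφ : MemLp φ 2 (volume.restrict (Icc 0 T)))
    (hM : IsWiener F P T B φ M) {s t : ℝ} (hs : 0 ≤ s) (hst : s ≤ t) (ht : t ≤ T) :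
    ∫ ω, (densityProc φ M t ω - densityProc φ M s ω) ^ 2 ∂P =
      Real.exp (∫ r in (0 : ℝ)..t, ‖φ r‖ ^ 2) - Real.exp (∫ r in (0 : ℝ)..s, ‖φ r‖ ^ 2) := by
  have hsm : s ∈ Icc 0 T := ⟨hs, hst.trans ht⟩
  have htm : t ∈ Icc 0 T := ⟨hs.trans hst, ht⟩
  have h1 := integral_densityProc_mul hF hφ hM hs hst ht (measurable_densityProc hM hsm)
  have h2 := integral_densityProc_pow hF hM htm 2
  have h3 := integral_densityProc_pow hF hM hsm 2
  norm_num at h2 h3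
  have i1 := integrable_densityProc_pow hF hM htm 2
  have i2 := integrable_densityProc_pow hF hM hsm 2
  have i3 : Integrable (fun ω => densityProc φ M t ω * densityProc φ M s ω) P :=
    (memLp_densityProc hF hM htm).integrable_mul (memLp_densityProc hF hM hsm)
  have h4 : ∀ ω, (densityProc φ M t ω - densityProc φ M s ω) ^ 2 =
      densityProc φ M t ω ^ 2 + densityProc φ M s ω ^ 2 +
        (-2) * (densityProc φ M t ω * densityProc φ M s ω) := fun ω => by ring
  have i4 : Integrable (fun ω => densityProc φ M t ω ^ 2 + densityProc φ M s ω ^ 2) P := i1.add i2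
  simp_rw [h4]
  rw [integral_add i4 (i3.const_mul _), integral_add i1 i2, integral_const_mul, h1, h2]
  simp_rw [← sq]
  rw [h3]
  ring

/-- The stochastic exponential times its integrand, sampled on a grid and truncated. -/
def expIntegrand (hT : 0 ≤ T) (hM : IsWiener F P T B φ M)
    (G : ℝ → EuclideanSpace ℝ (Fin d)) (hG : ∃ C, ∀ t, ‖G t‖ ≤ C) {K : ℝ} (hK : 0 < K) (N : ℕ) :
    SimpleIntegrand F T d where
  n := N
  time := gridTime T N
  time_mono := gridTime_mono hT
  time_mem := gridTime_mem hT
  -- Coefficients must be bounded, hence the truncation at `K`; the sign is that of `dE = -E φ' dB`.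
  coef k ω := -(min (densityProc φ M (gridTime T N k) ω) K) • G (gridTime T N k)
  coef_meas k := by
    have h := measurable_densityProc hM (gridTime_mem (N := N) hT k)
    have h2 : Measurable fun z : ℝ => -(min z K) • G (gridTime T N k) := by fun_prop
    exact h2.comp h
  coef_bdd := by
    obtain ⟨C, hC⟩ := hG
    refine ⟨K * C, fun k ω => ?_⟩
    rw [norm_smul, norm_neg, Real.norm_of_nonneg (le_min (densityProc_pos _ _).le hK.le)]
    exact mul_le_mul (min_le_right _ _) (hC _) (norm_nonneg _) hK.le

/-- Three errors are balanced: sampling `φ` on the grid, sampling the exponential in time, where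
`E|E_t - E_s|²` is an increment of the continuous function `exp ∫|φ|²`, and truncation, paid for by
fourth moments. -/
lemma exists_expIntegrand (hT : 0 < T) (hF : ∀ t, F t ≤ mΩ)
    (hφ : MemLp φ 2 (volume.restrict (Icc 0 T))) (hM : IsWiener F P T B φ M) {ε : ℝ} (hε : 0 < ε)
    (N₁ : ℕ) :
    ∃ N ≥ N₁, N ≠ 0 ∧ ∃ S : SimpleIntegrand F T d, S.n = N ∧ S.time = gridTime T N ∧
      ∫ t in Icc 0 T, ∫ ω, ‖S.eval t ω + densityProc φ M t ω • φ t‖ ^ 2 ∂P ≤ ε ∧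
      ∫⁻ t in Icc 0 T, ∫⁻ ω, ‖S.eval t ω + densityProc φ M t ω • φ t‖ₑ ^ 2 ∂P ≤
        ENNReal.ofReal ε := by
  set ν : ℝ → ℝ := fun t => ∫ r in (0 : ℝ)..t, ‖φ r‖ ^ 2 with hν
  have hφ2 : IntegrableOn (fun t => ‖φ t‖ ^ 2) (Icc 0 T) :=
    (memLp_two_iff_integrable_sq_norm hφ.1).1 hφ
  have hTT : T ∈ Icc 0 T := ⟨hT.le, le_rfl⟩
  have hνmono : ∀ s t, 0 ≤ s → s ≤ t → t ≤ T → ν s ≤ ν t := by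
    intro s t hs hst ht
    have h := intervalIntegral.integral_add_adjacent_intervals
      (intervalIntegrable_norm_sq hφ ⟨le_rfl, hT.le⟩ ⟨hs, hst.trans ht⟩)
      (intervalIntegrable_norm_sq hφ ⟨hs, hst.trans ht⟩ ⟨hs.trans hst, ht⟩)
    have h2 : 0 ≤ ∫ r in s..t, ‖φ r‖ ^ 2 :=
      intervalIntegral.integral_nonneg hst fun _ _ => by positivity
    simp only [hν]
    linarith
  set A := Real.exp (ν T) with hA
  have hA0 : 0 < A := Real.exp_pos _
  obtain ⟨G, hG, N₀, hN₀⟩ := exists_grid_approx hT hφ (ε := √(ε / (4 * A)))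
    (Real.sqrt_pos.2 (by positivity))
  obtain ⟨C, hC⟩ := hG
  have hC0 : 0 ≤ C := (norm_nonneg _).trans (hC 0)
  -- Chosen so that `8 C² κ T ≤ ε / 2`; the `+ 1` keeps the denominator positive when `C = 0`.
  set κ := ε / (16 * (C ^ 2 + 1) * T) with hκ
  have hκ0 : 0 < κ := by positivity
  have huc : UniformContinuousOn (fun t => Real.exp (ν t)) (Icc 0 T) :=
    isCompact_Icc.uniformContinuousOn_of_continuous
      (Real.continuous_exp.comp_continuousOn (continuousOn_primitive_Icc hφ2))
  obtain ⟨δ, hδ, hδ'⟩ := Metric.uniformContinuousOn_iff.1 huc κ hκ0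
  obtain ⟨N₂, hN₂⟩ := exists_nat_gt (T / δ)
  -- The fourth moment of the density is `exp(6 ν)`, since `(4² - 4)/2 = 6`.
  obtain ⟨K, hK, hKκ⟩ : ∃ K : ℝ, 0 < K ∧ Real.exp (6 * ν T) / K ^ 2 ≤ κ := by
    refine ⟨√(Real.exp (6 * ν T) / κ), Real.sqrt_pos.2 (by positivity), ?_⟩
    rw [Real.sq_sqrt (by positivity), div_div_cancel₀ (Real.exp_pos _).ne']
  set N := max (max N₁ N₀) (max N₂ 1) with hN
  have hN1 : N ≥ N₁ := (le_max_left _ _).trans (le_max_left _ _)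
  have hN0 : N ≥ N₀ := (le_max_right _ _).trans (le_max_left _ _)
  have hN2 : N ≥ N₂ := (le_max_left _ _).trans (le_max_right _ _)
  have hNne : N ≠ 0 := by
    have : 1 ≤ N := (le_max_right _ _).trans (le_max_right _ _)
    omega
  have hmesh : T / N < δ := by
    have : (N₂ : ℝ) ≤ N := by exact_mod_cast hN2
    rw [div_lt_iff₀ (by positivity)]
    rw [div_lt_iff₀ hδ] at hN₂
    nlinarith
  refine ⟨N, hN1, hNne, expIntegrand hT.le hM G ⟨C, hC⟩ hK N, rfl, rfl, ?_⟩
  set S := expIntegrand hT.le hM G ⟨C, hC⟩ hK N with hS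
  have hgm : AEStronglyMeasurable (fun t => gridStep T N G t - φ t) (volume.restrict (Icc 0 T)) :=
    (measurable_gridStep T N G).aestronglyMeasurable.sub hφ.1
  have hgrid : ∫ t in Icc 0 T, ‖gridStep T N G t - φ t‖ ^ 2 ≤ ε / (4 * A) := by
    rw [integral_norm_sq_eq_toReal (g := fun t => gridStep T N G t - φ t) hgm]
    refine ENNReal.toReal_le_of_le_ofReal (by positivity) ?_
    have := hN₀ N hN0
    rwa [Real.sq_sqrt (by positivity)] at this
  have hgi : Integrable (fun t => ‖gridStep T N G t - φ t‖ ^ 2) (volume.restrict (Icc 0 T)) := by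
    refine (memLp_two_iff_integrable_sq_norm hgm).1 (MemLp.sub ?_ hφ)
    refine MemLp.of_bound (measurable_gridStep T N G).aestronglyMeasurable C
      (Eventually.of_forall fun t => ?_)
    exact SimpleIntegrand.norm_eval_le (gridIntegrand F T hT.le G ⟨C, hC⟩ N)
      (fun _ _ => hC _) t (Classical.choice (nonempty_of_isProbabilityMeasure P))
  have hpt : ∀ t ∈ Icc 0 T, t ≠ 0 →
      Integrable (fun ω => ‖S.eval t ω + densityProc φ M t ω • φ t‖ ^ 2) P ∧ ∫ ω, ‖S.eval t ω + densityProc φ M t ω • φ t‖ ^ 2 ∂P ≤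
        2 * A * ‖gridStep T N G t - φ t‖ ^ 2 + 8 * C ^ 2 * κ := by
    intro t ht ht0
    obtain ⟨k, hk, hkt⟩ := exists_mem_gridCell hT.le hNne ⟨lt_of_le_of_ne ht.1 (Ne.symm ht0), ht.2⟩
    set τ := gridTime T N k with hτ
    have hτm : τ ∈ Icc 0 T := gridTime_mem hT.le k
    have hev : ∀ ω, S.eval t ω = -(min (densityProc φ M τ ω) K) • G τ := fun ω =>
      S.eval_of_mem hk hkt ω
    have hgs : gridStep T N G t = G τ := gridStep_of_mem hT.le hk hkt
    have hbd : ∀ ω, ‖S.eval t ω + densityProc φ M t ω • φ t‖ ^ 2 ≤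
        2 * ‖gridStep T N G t - φ t‖ ^ 2 * densityProc φ M t ω ^ 2 +
        (4 * C ^ 2 * (densityProc φ M t ω - densityProc φ M τ ω) ^ 2 +
          4 * C ^ 2 / K ^ 2 * densityProc φ M τ ω ^ 4) := by
      intro ω
      set e := densityProc φ M t ω
      set e' := densityProc φ M τ ω
      set a := min e' K
      -- The first term carries the sampling in time and the truncation of the exponential, the
      -- second the approximation of `φ`.
      have h1 : S.eval t ω + e • φ t = (e - a) • G τ - e • (G τ - φ t) := by
        rw [hev]; module
      have h2 : ‖S.eval t ω + e • φ t‖ ≤ |e - a| * C + |e| * ‖G τ - φ t‖ := by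
        rw [h1]
        refine (norm_sub_le _ _).trans ?_
        rw [norm_smul, norm_smul, Real.norm_eq_abs, Real.norm_eq_abs]
        gcongr
        exact hC _
      have h3 := sq_sub_min_le (e := e') (K := K) (densityProc_pos _ _).le hK
      rw [hgs]
      have h4 : (e - a) ^ 2 ≤ 2 * (e - e') ^ 2 + 2 * (e' ^ 4 / K ^ 2) := by
        nlinarith [sq_nonneg ((e - e') - (e' - a))]
      have h5 : C ^ 2 * (e - a) ^ 2 ≤ C ^ 2 * (2 * (e - e') ^ 2 + 2 * (e' ^ 4 / K ^ 2)) :=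
        mul_le_mul_of_nonneg_left h4 (sq_nonneg C)
      calc ‖S.eval t ω + e • φ t‖ ^ 2 ≤ (|e - a| * C + |e| * ‖G τ - φ t‖) ^ 2 :=
            pow_le_pow_left₀ (norm_nonneg _) h2 2
        _ ≤ 2 * (|e - a| * C) ^ 2 + 2 * (|e| * ‖G τ - φ t‖) ^ 2 := by
            nlinarith [sq_nonneg (|e - a| * C - |e| * ‖G τ - φ t‖)]
        _ = 2 * (C ^ 2 * (e - a) ^ 2) + 2 * (‖G τ - φ t‖ ^ 2 * e ^ 2) := by
            rw [mul_pow, mul_pow, sq_abs, sq_abs]; ring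
        _ ≤ 2 * (C ^ 2 * (2 * (e - e') ^ 2 + 2 * (e' ^ 4 / K ^ 2))) +
            2 * (‖G τ - φ t‖ ^ 2 * e ^ 2) := by linarith
        _ = _ := by ring
    have i1 := (integrable_densityProc_pow hF hM ht 2).const_mul
      (2 * ‖gridStep T N G t - φ t‖ ^ 2)
    have i2 : Integrable (fun ω => 4 * C ^ 2 * (densityProc φ M t ω - densityProc φ M τ ω) ^ 2) P :=
      ((memLp_densityProc hF hM ht).sub (memLp_densityProc hF hM hτm)).integrable_sq.const_mul _
    have i3 := (integrable_densityProc_pow hF hM hτm 4).const_mul (4 * C ^ 2 / K ^ 2)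
    have i4 : Integrable (fun ω => 4 * C ^ 2 * (densityProc φ M t ω - densityProc φ M τ ω) ^ 2 +
          4 * C ^ 2 / K ^ 2 * densityProc φ M τ ω ^ 4) P := i2.add i3
    have hm : Measurable fun ω => S.eval t ω + densityProc φ M t ω • φ t :=
      ((S.measurable_eval hF).comp measurable_prodMk_left).add
        (((measurable_densityProc hM ht).mono (hF t) le_rfl).smul_const (φ t))
    refine ⟨(i1.add i4).mono' (hm.norm.pow_const 2).aestronglyMeasurable
      (Eventually.of_forall fun ω => ?_), ?_⟩
    · rw [Real.norm_of_nonneg (by positivity)]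
      exact hbd ω
    refine (integral_mono_of_nonneg (Eventually.of_forall fun ω => by positivity) (i1.add i4)
      (Eventually.of_forall hbd)).trans ?_
    have m2 := integral_densityProc_pow hF hM ht 2
    have m4 := integral_densityProc_pow hF hM hτm 4
    norm_num at m2 m4
    have hτt : τ ≤ t := hkt.1.le
    simp only [Pi.add_apply]
    rw [integral_add i1 i4, integral_add i2 i3, integral_const_mul, integral_const_mul,
      integral_const_mul, m2, m4, integral_densityProc_sub_sq hF hφ hM hτm.1 hτt ht.2]
    have b1 : Real.exp (ν t) ≤ A := Real.exp_le_exp.2 (hνmono t T ht.1 ht.2 le_rfl)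
    have b2 : Real.exp (ν t) - Real.exp (ν τ) ≤ κ := by
      have hd : dist t τ < δ := by
        rw [Real.dist_eq, abs_of_nonneg (sub_nonneg.2 hτt)]
        have := gridTime_succ_sub_le (N := N) hT.le k
        have := hkt.2
        linarith
      have := hδ' t ht τ hτm hd
      rw [Real.dist_eq] at this
      exact (le_abs_self _).trans this.le
    have b3 : Real.exp (6 * ν τ) / K ^ 2 ≤ κ := by
      refine le_trans ?_ hKκ
      gcongr
      exact hνmono τ T hτm.1 hτm.2 le_rfl
    calc _ = 2 * ‖gridStep T N G t - φ t‖ ^ 2 * Real.exp (ν t) +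
          (4 * C ^ 2 * (Real.exp (ν t) - Real.exp (ν τ)) +
            4 * C ^ 2 * (Real.exp (6 * ν τ) / K ^ 2)) := by ring
      _ ≤ 2 * ‖gridStep T N G t - φ t‖ ^ 2 * A + (4 * C ^ 2 * κ + 4 * C ^ 2 * κ) := by gcongr
      _ = _ := by ring
  have hconst : Integrable (fun _ : ℝ => 8 * C ^ 2 * κ) (volume.restrict (Icc 0 T)) :=
    integrable_const _
  have hne : ∀ᵐ t ∂volume.restrict (Icc 0 T), t ∈ Icc 0 T ∧ t ≠ 0 := by
    filter_upwards [ae_restrict_mem measurableSet_Icc,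
      ae_restrict_of_ae (Measure.ae_ne volume (0 : ℝ))] with t ht ht0 using ⟨ht, ht0⟩
  have hbi : Integrable (fun t => 2 * A * ‖gridStep T N G t - φ t‖ ^ 2 + 8 * C ^ 2 * κ)
      (volume.restrict (Icc 0 T)) := (hgi.const_mul (2 * A)).add hconst
  have hbε : ∫ t in Icc 0 T, (2 * A * ‖gridStep T N G t - φ t‖ ^ 2 + 8 * C ^ 2 * κ) ≤ ε := by
    rw [integral_add (hgi.const_mul _) hconst, integral_const_mul, integral_const]
    have hv : (volume.restrict (Icc 0 T)).real univ = T := by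
      simp [Measure.real, hT.le]
    rw [hv, smul_eq_mul]
    have h1 : 2 * A * ∫ t in Icc 0 T, ‖gridStep T N G t - φ t‖ ^ 2 ≤ ε / 2 := by
      calc _ ≤ 2 * A * (ε / (4 * A)) := by gcongr
        _ = ε / 2 := by field_simp; ring
    have h2 : T * (8 * C ^ 2 * κ) ≤ ε / 2 := by
      rw [hκ]
      have : T * (8 * C ^ 2 * (ε / (16 * (C ^ 2 + 1) * T))) = (C ^ 2 / (C ^ 2 + 1)) * (ε / 2) := by
        field_simp; ring
      rw [this]
      have h3 : C ^ 2 / (C ^ 2 + 1) ≤ 1 := (div_le_one (by positivity)).2 (by linarith)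
      nlinarith
    linarith
  refine ⟨(integral_mono_of_nonneg
    (Eventually.of_forall fun t => integral_nonneg fun ω => by positivity) hbi
    (hne.mono fun t ht => (hpt t ht.1 ht.2).2)).trans hbε, ?_⟩
  refine le_trans (lintegral_mono_ae (g := fun t => ENNReal.ofReal
    (2 * A * ‖gridStep T N G t - φ t‖ ^ 2 + 8 * C ^ 2 * κ)) (hne.mono fun t ht => ?_)) ?_
  · obtain ⟨h1, h2⟩ := hpt t ht.1 ht.2
    refine le_trans (le_of_eq ?_) (ENNReal.ofReal_le_ofReal h2)
    rw [ofReal_integral_eq_lintegral_ofReal h1 (Eventually.of_forall fun ω => by positivity)]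
    refine lintegral_congr fun ω => ?_
    rw [ENNReal.ofReal_pow (norm_nonneg _), ofReal_norm]
  · rw [← ofReal_integral_eq_lintegral_ofReal hbi (Eventually.of_forall fun t => by positivity)]
    exact ENNReal.ofReal_le_ofReal hbε

end StochasticExponentialApprox

/-! ### The wealth equation of the exponential process -/

section PathwiseWeights

variable {T : ℝ} {β : ℝ → ℝ}

lemma discountFactor_sub (hβ : IntegrableOn β (Icc 0 T)) {s t : ℝ} (hs : s ∈ Icc 0 T)
    (ht : t ∈ Icc 0 T) :
    Real.exp (-∫ v in (0 : ℝ)..t, β v) - Real.exp (-∫ v in (0 : ℝ)..s, β v) =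
      -∫ u in s..t, β u * Real.exp (-∫ v in (0 : ℝ)..u, β v) := by
  have h0 : (0 : ℝ) ∈ Icc 0 T := ⟨le_rfl, hs.1.trans hs.2⟩
  have key : ∀ r ∈ Icc 0 T, -∫ u in (0 : ℝ)..r, β u * Real.exp (-∫ v in (0 : ℝ)..u, β v) =
      Real.exp (-∫ v in (0 : ℝ)..r, β v) - 1 := by
    intro r hr
    have h := integral_exp_mul_primitive (b := fun t => -β t) (g := fun _ => 0)
      (intervalIntegrable_of_integrableOn_Icc hβ h0 hr).neg intervalIntegrable_const 1
    simp only [intervalIntegral.integral_zero, add_zero, mul_one, mul_zero,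
      intervalIntegral.integral_neg, neg_mul] at h
    exact h
  have hw := integrableOn_discountWeight hβ
  rw [← intervalIntegral.integral_interval_sub_left
    (intervalIntegrable_of_integrableOn_Icc hw h0 ht)
    (intervalIntegrable_of_integrableOn_Icc hw h0 hs)]
  linarith [key s hs, key t ht]

/-- The error of freezing the discount factor at the left endpoint involves only the oscillation of
`f` on the cell, and is summable against an integrable weight. -/
lemma discount_sub_sub (hβ : IntegrableOn β (Icc 0 T)) {f : ℝ → ℝ} (hf : ContinuousOn f (Icc 0 T))
    {s t : ℝ} (hs : s ∈ Icc 0 T) (ht : t ∈ Icc 0 T) :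
    discount β f t - discount β f s -
      Real.exp (-∫ v in (0 : ℝ)..s, β v) * (f t - f s) =
      ∫ u in s..t, (f u - f t) * (β u * Real.exp (-∫ v in (0 : ℝ)..u, β v)) := by
  have h0 : (0 : ℝ) ∈ Icc 0 T := ⟨le_rfl, hs.1.trans hs.2⟩
  have hw := integrableOn_discountWeight hβ
  have hfw := integrableOn_mul_discountWeight hβ hf
  have h1 := discountFactor_sub hβ hs ht
  have h2 := intervalIntegral.integral_interval_sub_left
    (intervalIntegrable_of_integrableOn_Icc hfw h0 ht)
    (intervalIntegrable_of_integrableOn_Icc hfw h0 hs)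
  simp_rw [sub_mul]
  rw [intervalIntegral.integral_sub (intervalIntegrable_of_integrableOn_Icc hfw hs ht)
    ((intervalIntegrable_of_integrableOn_Icc hw hs ht).const_mul _),
    intervalIntegral.integral_const_mul, ← h2]
  unfold discount
  linear_combination f t * h1

/-- Weighted sums of increments of `f` approximate `discount β f`. -/
lemma abs_weighted_sum_sub_discount_le (hβ : IntegrableOn β (Icc 0 T)) {f : ℝ → ℝ}
    (hf : ContinuousOn f (Icc 0 T)) (hf0 : f 0 = 0) {τ : ℕ → ℝ} (hτ : Monotone τ)
    (hτm : ∀ k, τ k ∈ Icc 0 T) {n : ℕ} (hτ0 : τ 0 = 0) (hτn : τ n = T) {η : ℝ}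
    (hη : ∀ k < n, ∀ u ∈ Icc (τ k) (τ (k + 1)), ∀ v ∈ Icc (τ k) (τ (k + 1)), |f u - f v| ≤ η)
    {t : ℝ} (ht : t ∈ Icc 0 T) :
    |(∑ k ∈ Finset.range n, Real.exp (-∫ v in (0 : ℝ)..(τ k), β v) *
      (f (min (τ (k + 1)) t) - f (min (τ k) t))) - discount β f t| ≤
      η * ∫ u in (0 : ℝ)..T, |β u * Real.exp (-∫ v in (0 : ℝ)..u, β v)| := by
  have hT : 0 ≤ T := ht.1.trans ht.2
  have h0 : (0 : ℝ) ∈ Icc 0 T := ⟨le_rfl, hT⟩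
  have hw : IntegrableOn (fun u => |β u * Real.exp (-∫ v in (0 : ℝ)..u, β v)|) (Icc 0 T) :=
    (integrableOn_discountWeight hβ).abs
  have hmem : ∀ k, min (τ k) t ∈ Icc 0 T := fun k =>
    ⟨le_min (hτm k).1 ht.1, min_le_of_right_le ht.2⟩
  have hmono : ∀ k, min (τ k) t ≤ min (τ (k + 1)) t := fun k => min_le_min_right _ (hτ k.le_succ)
  have hcell : ∀ k ∈ Finset.range n, |Real.exp (-∫ v in (0 : ℝ)..(τ k), β v) *
      (f (min (τ (k + 1)) t) - f (min (τ k) t)) -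
      (discount β f (min (τ (k + 1)) t) - discount β f (min (τ k) t))| ≤
      η * ∫ u in (min (τ k) t)..(min (τ (k + 1)) t),
        |β u * Real.exp (-∫ v in (0 : ℝ)..u, β v)| := by
    intro k hk
    rcases le_total (τ k) t with h | h
    · have h1 := discount_sub_sub hβ hf (hmem k) (hmem (k + 1))
      rw [min_eq_left h] at h1 ⊢
      have hle : τ k ≤ min (τ (k + 1)) t := le_min (hτ k.le_succ) h
      rw [abs_sub_comm, h1, ← intervalIntegral.integral_const_mul]
      refine intervalIntegral.abs_integral_le_integral_abs hle |>.trans ?_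
      refine intervalIntegral.integral_mono_on hle ?_ ?_ fun u hu => ?_
      · have h2 : IntegrableOn (fun u => (f u - f (min (τ (k + 1)) t)) *
            (β u * Real.exp (-∫ v in (0 : ℝ)..u, β v))) (Icc 0 T) :=
          integrableOn_mul_discountWeight hβ (hf.sub continuousOn_const)
        exact (intervalIntegrable_of_integrableOn_Icc h2 (hτm k) (hmem (k + 1))).abs
      · exact (intervalIntegrable_of_integrableOn_Icc hw (hτm k) (hmem (k + 1))).const_mul _
      · rw [abs_mul]
        refine mul_le_mul_of_nonneg_right ?_ (abs_nonneg _)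
        exact hη k (Finset.mem_range.1 hk) u ⟨hu.1, hu.2.trans (min_le_left _ _)⟩ _
          ⟨hle, min_le_left _ _⟩
    · rw [min_eq_right h, min_eq_right (h.trans (hτ k.le_succ))]
      simp
  have htel : discount β f t = ∑ k ∈ Finset.range n,
      (discount β f (min (τ (k + 1)) t) - discount β f (min (τ k) t)) := by
    rw [Finset.sum_range_sub (fun k => discount β f (min (τ k) t)), hτn, hτ0, min_eq_right ht.2,
      min_eq_left ht.1]
    simp [discount, hf0]
  -- With no cells, `hη` is vacuous and `η` may be negative; but then `T = τ 0 = 0` and both sides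
  -- vanish.
  have hη0 : 0 ≤ η ∨ n = 0 := by
    rcases Nat.eq_zero_or_pos n with h | h
    · exact Or.inr h
    · exact Or.inl ((abs_nonneg _).trans (hη 0 h _ ⟨le_rfl, hτ (Nat.le_succ 0)⟩ _
        ⟨le_rfl, hτ (Nat.le_succ 0)⟩))
  rw [htel, ← Finset.sum_sub_distrib]
  refine (Finset.abs_sum_le_sum_abs _ _).trans ((Finset.sum_le_sum hcell).trans ?_)
  rw [← Finset.mul_sum, intervalIntegral.sum_integral_adjacent_intervals (a := fun k => min (τ k) t)
    fun k _ => intervalIntegrable_of_integrableOn_Icc hw (hmem k) (hmem (k + 1)), hτn, hτ0,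
    min_eq_right ht.2, min_eq_left ht.1]
  rcases hη0 with h | h
  · refine mul_le_mul_of_nonneg_left ?_ h
    exact intervalIntegral.integral_mono_interval le_rfl ht.1 ht.2
      (Eventually.of_forall fun u => abs_nonneg _)
      (intervalIntegrable_of_integrableOn_Icc hw h0 ⟨hT, le_rfl⟩)
  · have hT0 : T = 0 := by rw [← hτn, h, hτ0]
    have ht0 : t = 0 := le_antisymm (ht.2.trans hT0.le) ht.1
    rw [hT0, ht0]

end PathwiseWeights

/-! ### Simple integrands with deterministic weights -/

section WeightedIntegrand

variable {F : ℝ → MeasurableSpace Ω} {T : ℝ}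

/-- Multiply the coefficients of a simple integrand by deterministic weights. -/
def SimpleIntegrand.weight (S : SimpleIntegrand F T d) (w : ℝ → ℝ)
    (hw : ∃ C, ∀ t ∈ Icc 0 T, |w t| ≤ C) : SimpleIntegrand F T d where
  n := S.n
  time := S.time
  time_mono := S.time_mono
  time_mem := S.time_mem
  coef k ω := w (S.time k) • S.coef k ω
  coef_meas k := by
    have h : Measurable fun v : EuclideanSpace ℝ (Fin d) => w (S.time k) • v := by fun_prop
    exact h.comp (S.coef_meas k)
  coef_bdd := by
    obtain ⟨C, hC⟩ := hw
    obtain ⟨C', hC'⟩ := S.coef_bdd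
    refine ⟨C * C', fun k ω => ?_⟩
    rw [norm_smul]
    have h1 : ‖w (S.time k)‖ ≤ C := hC _ (S.time_mem k)
    exact mul_le_mul h1 (hC' k ω) (norm_nonneg _) ((norm_nonneg _).trans h1)

lemma SimpleIntegrand.sint_min_sub (S : SimpleIntegrand F T d)
    (B : ℝ → Ω → EuclideanSpace ℝ (Fin d)) {k : ℕ} (hk : k < S.n) (t : ℝ) (ω : Ω) :
    S.sint B (min (S.time (k + 1)) t) ω - S.sint B (min (S.time k) t) ω =
      inner ℝ (S.coef k ω) (B (min (S.time (k + 1)) t) ω - B (min (S.time k) t) ω) := by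
  rcases le_total (S.time k) t with h | h
  · rw [min_eq_left h]
    exact S.sint_sub_of_mem hk le_rfl (le_min (S.time_mono k.le_succ) h) (min_le_left _ _) ω
  · rw [min_eq_right h, min_eq_right (h.trans (S.time_mono k.le_succ))]
    simp

lemma SimpleIntegrand.weight_sint (S : SimpleIntegrand F T d) (w : ℝ → ℝ)
    (hw : ∃ C, ∀ t ∈ Icc 0 T, |w t| ≤ C) (B : ℝ → Ω → EuclideanSpace ℝ (Fin d)) (t : ℝ) (ω : Ω) :
    (S.weight w hw).sint B t ω = ∑ k ∈ Finset.range S.n, w (S.time k) *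
      (S.sint B (min (S.time (k + 1)) t) ω - S.sint B (min (S.time k) t) ω) := by
  change ∑ k ∈ Finset.range S.n, inner ℝ (w (S.time k) • S.coef k ω)
    (B (min (S.time (k + 1)) t) ω - B (min (S.time k) t) ω) = _
  refine Finset.sum_congr rfl fun k hk => ?_
  rw [S.sint_min_sub B (Finset.mem_range.1 hk)]
  exact real_inner_smul_left _ _ _

lemma SimpleIntegrand.weight_eval_of_mem (S : SimpleIntegrand F T d) (w : ℝ → ℝ)
    (hw : ∃ C, ∀ t ∈ Icc 0 T, |w t| ≤ C) {k : ℕ} (hk : k < S.n) {s : ℝ}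
    (hs : s ∈ Ioc (S.time k) (S.time (k + 1))) (ω : Ω) :
    (S.weight w hw).eval s ω = w (S.time k) • S.eval s ω := by
  rw [S.eval_of_mem hk hs]
  exact (S.weight w hw).eval_of_mem (k := k) hk hs ω

end WeightedIntegrand

/-- The event is an uncountable union. Path continuity places it, up to a null set, inside a
countable union over a dense set of times at level `ε / 2`, which is null measurable, and dominated
convergence applies to the indicators. -/
lemma tendsto_measure_exists_le_abs {P : Measure Ω} [IsProbabilityMeasure P] {T : ℝ}
    {Z : ℕ → ℝ → Ω → ℝ} (hZ : ∀ n, ∀ t ∈ Icc 0 T, AEMeasurable (Z n t) P)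
    (hc : ∀ n, ∀ᵐ ω ∂P, ContinuousOn (fun t => Z n t ω) (Icc 0 T))
    (hlim : ∀ᵐ ω ∂P, TendstoUniformlyOn (fun n t => Z n t ω) 0 atTop (Icc 0 T)) {ε : ℝ}
    (hε : 0 < ε) : Tendsto (fun n => P {ω | ∃ t ∈ Icc 0 T, ε ≤ |Z n t ω|}) atTop (𝓝 0) := by
  obtain ⟨D, hDc, hDd⟩ := TopologicalSpace.exists_countable_dense (Icc (0 : ℝ) T)
  let A : ℕ → Set Ω := fun n => ⋃ t ∈ D, {ω | ε / 2 < |Z n t ω|}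
  have hA : ∀ n, NullMeasurableSet (A n) P := fun n =>
    NullMeasurableSet.biUnion hDc fun t _ =>
      nullMeasurableSet_lt aemeasurable_const (hZ n t t.2).abs
  have hle : ∀ n, P {ω | ∃ t ∈ Icc 0 T, ε ≤ |Z n t ω|} ≤ P (A n) := by
    intro n
    refine measure_mono_ae ?_
    filter_upwards [hc n] with ω hω
    rintro ⟨t, ht, hεt⟩
    have hcont : Continuous fun s : Icc (0 : ℝ) T => |Z n s ω| :=
      (continuousOn_iff_continuous_domRestrict.1 hω).abs
    have hopen : IsOpen {s : Icc (0 : ℝ) T | ε / 2 < |Z n s ω|} := isOpen_lt continuous_const hcont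
    obtain ⟨s, hs, hsD⟩ := hDd.inter_open_nonempty _ hopen ⟨⟨t, ht⟩, by
      simp only [Set.mem_ofPred_eq]; linarith⟩
    exact mem_biUnion hsD hs
  refine tendsto_of_tendsto_of_tendsto_of_le_of_le tendsto_const_nhds ?_ (fun _ => zero_le) hle
  have h1 : ∀ n, P (A n) = ∫⁻ ω, (A n).indicator 1 ω ∂P := fun n =>
    (lintegral_indicator_one₀ (hA n)).symm
  simp_rw [h1]
  have := tendsto_lintegral_of_dominated_convergence' (μ := P)
    (F := fun n ω => (A n).indicator (1 : Ω → ℝ≥0∞) ω) (f := fun _ => 0) (bound := fun _ => 1)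
    (fun n => aemeasurable_const.indicator₀ (hA n))
    (fun n => Eventually.of_forall fun ω => indicator_le_self' (fun _ _ => zero_le) ω)
    (by simp) ?_
  · simpa using this
  · filter_upwards [hlim] with ω hω
    refine tendsto_const_nhds.congr' ?_
    filter_upwards [Metric.tendstoUniformlyOn_iff.1 hω (ε / 2) (half_pos hε)] with n hn
    refine (indicator_of_notMem ?_ _).symm
    simp only [A, mem_iUnion, not_exists, Set.mem_ofPred_eq, not_lt]
    intro t _
    have := hn t t.2
    simp only [Pi.zero_apply, dist_zero_left, Real.norm_eq_abs] at this
    exact this.le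

/-! ### The discounted stochastic exponential as an Itô integral -/

section ExponentialItoIntegral

variable {F : ℝ → MeasurableSpace Ω} {P : Measure Ω} [IsProbabilityMeasure P] {T : ℝ}
  {B : ℝ → Ω → EuclideanSpace ℝ (Fin d)} {φ : ℝ → EuclideanSpace ℝ (Fin d)} {M : ℝ → Ω → ℝ}
  {β : ℝ → ℝ}

lemma continuousOn_densityProc (hφ : MemLp φ 2 (volume.restrict (Icc 0 T)))
    (hM : IsWiener F P T B φ M) (ω : Ω) :
    ContinuousOn (fun t => densityProc φ M t ω) (Icc 0 T) :=
  Real.continuous_exp.comp_continuousOn ((hM.cont ω).neg.sub ((continuousOn_primitive_Icc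
    ((memLp_two_iff_integrable_sq_norm hφ.1).1 hφ)).div_const 2))

/-- The difference is a continuous martingale whose terminal second moment is the isometry integral,
at most `δ²`; Doob's inequality uses its first moment. -/
lemma measure_sup_densityProc_sub_sint_le (hT : 0 < T) (hF : ∀ t, F t ≤ mΩ) (hmono : Monotone F)
    (hB : IsLevy F P T B) (hBc : ∀ᵐ ω ∂P, ContinuousOn (B · ω) (Icc 0 T))
    (hφ : MemLp φ 2 (volume.restrict (Icc 0 T))) (hM : IsWiener F P T B φ M)
    (S : SimpleIntegrand F T d) {δ ε : ℝ} (hδ : 0 < δ) (hε : 0 < ε)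
    (hS : ∫ t in Icc 0 T, ∫ ω, ‖S.eval t ω + densityProc φ M t ω • φ t‖ ^ 2 ∂P ≤ δ ^ 2) :
    P {ω | ∃ t ∈ Icc 0 T, ε ≤ |densityProc φ M t ω - 1 - S.sint B t ω|} ≤
      ENNReal.ofReal (2 * δ / ε) := by
  have hTT : T ∈ Icc 0 T := ⟨hT.le, le_rfl⟩
  have hint : ∀ t ∈ Icc 0 T, MemLp (fun ω => densityProc φ M t ω - 1 - S.sint B t ω) 2 P :=
    fun t ht => ((memLp_densityProc hF hM ht).sub (memLp_const 1)).sub (S.memLp_sint hB hF ht)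
  have hle : ∫ ω, |densityProc φ M T ω - 1 - S.sint B T ω| ∂P ≤ δ := by
    refine integral_abs_le_of_sq_le (hint T hTT) hδ ?_
    rw [integral_densityProc_sub_sint_sq hT.le hF hmono hB hφ hM S]
    exact hS
  refine (continuous_maximal hT hF hmono
    (N := fun t ω => densityProc φ M t ω - 1 - S.sint B t ω) (fun t ht => ?_)
    (fun t ht => (hint t ht).integrable (by norm_num)) (fun s t hs hst ht A hA => ?_) ?_ hε).trans ?_
  · exact ((measurable_densityProc hM ht).sub_const 1).sub (S.measurable_sint hB hmono ht)
  · have hsm : s ∈ Icc 0 T := ⟨hs, hst.trans ht⟩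
    have htm : t ∈ Icc 0 T := ⟨hs.trans hst, ht⟩
    have hE : ∀ r ∈ Icc 0 T, Integrable (fun ω => densityProc φ M r ω - 1) P := fun r hr =>
      ((memLp_densityProc hF hM hr).integrable (by norm_num)).sub (integrable_const 1)
    have hJ : ∀ r ∈ Icc 0 T, Integrable (S.sint B r) P := fun r hr =>
      (S.memLp_sint hB hF hr).integrable (by norm_num)
    have hE' : ∀ r ∈ Icc 0 T, Integrable (fun ω => densityProc φ M r ω) P := fun r hr =>
      (memLp_densityProc hF hM hr).integrable (by norm_num)
    have hind : ∀ r, ∫ ω in A, densityProc φ M r ω ∂P =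
        ∫ ω, densityProc φ M r ω * A.indicator 1 ω ∂P := by
      intro r
      rw [← integral_indicator (hF s A hA)]
      congr 1 with ω
      by_cases h : ω ∈ A <;> simp [h]
    have hAm : Measurable[F s] (A.indicator (1 : Ω → ℝ)) := by
      exact (@measurable_const _ _ _ (F s) (1 : ℝ)).indicator hA
    rw [integral_sub (hE t htm).integrableOn (hJ t htm).integrableOn,
      integral_sub (hE s hsm).integrableOn (hJ s hsm).integrableOn,
      integral_sub (hE' t htm).integrableOn integrableOn_const,
      integral_sub (hE' s hsm).integrableOn integrableOn_const,
      S.setIntegral_sint hB hF hmono hs hst ht hA, hind, hind,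
      integral_densityProc_mul hF hφ hM hs hst ht hAm]
  · filter_upwards [hBc] with ω hω
    exact ((continuousOn_densityProc hφ hM ω).sub continuousOn_const).sub (S.continuous_sint hω)
  · gcongr

/-- The density process minus one is approximated by integrals of simple integrands on grids. -/
lemma exists_seq_expIntegrand (hT : 0 < T) (hF : ∀ t, F t ≤ mΩ) (hmono : Monotone F)
    (hB : IsLevy F P T B) (hBc : ∀ᵐ ω ∂P, ContinuousOn (B · ω) (Icc 0 T))
    (hφ : MemLp φ 2 (volume.restrict (Icc 0 T))) (hM : IsWiener F P T B φ M) :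
    ∃ S : ℕ → SimpleIntegrand F T d,
      (∀ n, n ≤ (S n).n ∧ (S n).n ≠ 0 ∧ (S n).time = gridTime T (S n).n) ∧
      (∀ n, ∫⁻ t in Icc 0 T, ∫⁻ ω, ‖(S n).eval t ω + densityProc φ M t ω • φ t‖ₑ ^ 2 ∂P ≤
        ENNReal.ofReal ((1 / 2) ^ n)) ∧
      ∀ᵐ ω ∂P, ∀ᶠ n in atTop, ∀ t ∈ Icc 0 T,
        |densityProc φ M t ω - 1 - (S n).sint B t ω| ≤ (1 / 2) ^ n := by
  -- A root mean square error of `4^{-n}` makes the probability of a deviation of `2^{-n}` at most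
  -- `2·2^{-n}`, which is summable.
  have hex := fun n : ℕ => exists_expIntegrand hT hF hφ hM (ε := ((1 / 4) ^ n) ^ 2)
    (by positivity) n
  choose N hN hN0 S hSn hSt hS1 hS2 using hex
  refine ⟨S, fun n => ⟨(hSn n).symm ▸ hN n, (hSn n).symm ▸ hN0 n, (hSn n).symm ▸ hSt n⟩,
    fun n => (hS2 n).trans (ENNReal.ofReal_le_ofReal ?_), ?_⟩
  · rw [← pow_mul, mul_comm, pow_mul]
    exact pow_le_pow_left₀ (by norm_num) (by norm_num) n
  have hP : ∀ n, P {ω | ∃ t ∈ Icc 0 T, (1 / 2) ^ n ≤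
      |densityProc φ M t ω - 1 - (S n).sint B t ω|} ≤ 2 * (1 / 2) ^ n := by
    intro n
    refine (measure_sup_densityProc_sub_sint_le hT hF hmono hB hBc hφ hM (S n)
      (δ := (1 / 4) ^ n) (by positivity) (by positivity) (hS1 n)).trans (le_of_eq ?_)
    have h1 : 2 * (1 / 4 : ℝ) ^ n / (1 / 2) ^ n = 2 * (1 / 2) ^ n := by
      rw [mul_div_assoc, ← div_pow]; norm_num
    rw [h1, ENNReal.ofReal_mul (by norm_num), ENNReal.ofReal_pow (by norm_num)]
    congr 1
    · simp
    · congr 1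
      rw [ENNReal.ofReal_div_of_pos (by norm_num)]; simp
  have hgeo : ∑' k : ℕ, 2 * ((1 / 2 : ℝ≥0∞)) ^ k ≠ ⊤ := by
    rw [ENNReal.tsum_mul_left, ENNReal.tsum_geometric]
    exact ENNReal.mul_ne_top (by simp) (by simp)
  filter_upwards [ae_eventually_notMem (ne_top_of_le_ne_top hgeo (ENNReal.tsum_le_tsum hP))]
    with ω hω
  filter_upwards [hω] with n hn t ht
  by_contra hcon
  exact hn ⟨t, ht, (not_le.1 hcon).le⟩

lemma exists_bound_discountFactor (hβ : IntegrableOn β (Icc 0 T)) (x : ℝ) :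
    ∃ C, ∀ t ∈ Icc 0 T, |x * Real.exp (-∫ v in (0 : ℝ)..t, β v)| ≤ C :=
  isCompact_Icc.exists_bound_of_continuousOn
    (continuousOn_const.mul (continuousOn_discountFactor hβ))

/-- With left-endpoint discount weights, the integral is a Riemann sum for `x * discount β f`. Fine
grids and the uniform closeness of the unweighted integrals to `f` give uniform convergence. -/
lemma tendstoUniformlyOn_weight_sint (hT : 0 < T) {S : ℕ → SimpleIntegrand F T d}
    (hS : ∀ n, n ≤ (S n).n ∧ (S n).n ≠ 0 ∧ (S n).time = gridTime T (S n).n)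
    (hβ : IntegrableOn β (Icc 0 T)) (x : ℝ) {ω : Ω} {f : ℝ → ℝ} (hf : ContinuousOn f (Icc 0 T))
    (hBc : ContinuousOn (B · ω) (Icc 0 T))
    (hlim : ∀ᶠ n in atTop, ∀ t ∈ Icc 0 T, |f t - (S n).sint B t ω| ≤ (1 / 2) ^ n) :
    TendstoUniformlyOn (fun n t => ((S n).weight (fun t => x * Real.exp (-∫ v in (0 : ℝ)..t, β v))
      (exists_bound_discountFactor hβ x)).sint B t ω) (fun t => x * discount β f t) atTop
      (Icc 0 T) := by
  obtain ⟨C, hC0, hC⟩ := abs_discount_sub_le hβ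
  set K := ∫ u in (0 : ℝ)..T, |β u * Real.exp (-∫ v in (0 : ℝ)..u, β v)| with hK
  have hK0 : 0 ≤ K := intervalIntegral.integral_nonneg hT.le fun _ _ => abs_nonneg _
  have huc := isCompact_Icc.uniformContinuousOn_of_continuous hf
  rw [Metric.tendstoUniformlyOn_iff]
  intro ε hε
  set η := ε / (2 * (|x| + 1) * (3 * K + C + 1)) with hη
  have hη0 : 0 < η := by positivity
  obtain ⟨δ, hδ, hδ'⟩ := Metric.uniformContinuousOn_iff.1 huc η hη0
  obtain ⟨N₂, hN₂⟩ := exists_nat_gt (T / δ)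
  have hz : Tendsto (fun k : ℕ => (1 / 2 : ℝ) ^ k) atTop (𝓝 0) :=
    tendsto_pow_atTop_nhds_zero_of_lt_one (by norm_num) (by norm_num)
  filter_upwards [hlim, eventually_ge_atTop N₂, hz.eventually_lt_const hη0] with n hn hnN hnη t ht
  obtain ⟨h1, h2, h3⟩ := hS n
  have hmesh : T / (S n).n < δ := by
    have h4 : (N₂ : ℝ) ≤ (S n).n := by exact_mod_cast hnN.trans h1
    have h5 : (0 : ℝ) < (S n).n := by positivity
    rw [div_lt_iff₀ h5]
    rw [div_lt_iff₀ hδ] at hN₂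
    nlinarith
  set J : ℝ → ℝ := fun t => (S n).sint B t ω with hJ
  have hJc : ContinuousOn J (Icc 0 T) := (S n).continuous_sint hBc
  have hfJ : ∀ s ∈ Icc 0 T, |f s - J s| ≤ η := fun s hs => (hn s hs).trans hnη.le
  have hτ0 : (S n).time 0 = 0 := by rw [h3]; exact gridTime_zero hT.le
  have hτn : (S n).time (S n).n = T := by rw [h3]; exact gridTime_last h2
  have hJ0 : J 0 = 0 := by simp only [hJ, SimpleIntegrand.sint_zero]
  -- The oscillation bound `3 * η` is one `η` for `f` on a cell and two for its distance to `J`.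
  have h6 := abs_weighted_sum_sub_discount_le hβ hJc hJ0
    (S n).time_mono (S n).time_mem hτ0 hτn (η := 3 * η) (fun k _ u hu v hv => ?_) ht
  · have h7 := hC f J hf hJc η hfJ t ht
    rw [dist_comm, Real.dist_eq, SimpleIntegrand.weight_sint]
    have h8 : ∑ k ∈ Finset.range (S n).n, x * Real.exp (-∫ v in (0 : ℝ)..((S n).time k), β v) *
        ((S n).sint B (min ((S n).time (k + 1)) t) ω - (S n).sint B (min ((S n).time k) t) ω) -
        x * discount β f t =
        x * ((∑ k ∈ Finset.range (S n).n, Real.exp (-∫ v in (0 : ℝ)..((S n).time k), β v) *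
        (J (min ((S n).time (k + 1)) t) - J (min ((S n).time k) t)) - discount β J t) -
        (discount β f t - discount β J t)) := by
      simp_rw [mul_assoc]
      rw [← Finset.mul_sum]
      ring
    rw [h8, abs_mul]
    calc _ ≤ |x| * (3 * η * K + C * η) :=
          mul_le_mul_of_nonneg_left ((abs_sub _ _).trans (add_le_add h6 h7)) (abs_nonneg x)
      _ ≤ (|x| + 1) * ((3 * K + C + 1) * η) := by
          refine mul_le_mul (by linarith) ?_ (by positivity) (by positivity)
          nlinarith
      _ = ε / 2 := by rw [hη]; field_simp
      _ < ε := half_lt_self hε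
  · have hum : u ∈ Icc 0 T := ⟨((S n).time_mem k).1.trans hu.1, hu.2.trans ((S n).time_mem _).2⟩
    have hvm : v ∈ Icc 0 T := ⟨((S n).time_mem k).1.trans hv.1, hv.2.trans ((S n).time_mem _).2⟩
    have hd : dist u v < δ := by
      refine lt_of_le_of_lt ?_ hmesh
      refine (Real.dist_le_of_mem_Icc hu hv).trans ?_
      rw [h3]
      exact gridTime_succ_sub_le hT.le k
    have h9 := hδ' u hum v hvm hd
    rw [Real.dist_eq] at h9
    have h10 := abs_le.1 (hfJ u hum)
    have h11 := abs_le.1 (hfJ v hvm)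
    have h12 := abs_lt.1 h9
    exact abs_le.2 ⟨by linarith, by linarith⟩

/-- Besides the bounded weight times the known error, freezing `w` at the left endpoint costs its
modulus of continuity times the finite energy `Φ` of the limiting integrand. -/
lemma tendsto_lintegral_weight_eval (hT : 0 < T) (hF : ∀ t, F t ≤ mΩ)
    (hφ : MemLp φ 2 (volume.restrict (Icc 0 T)))
    (hM : IsWiener F P T B φ M) {S : ℕ → SimpleIntegrand F T d}
    (hS : ∀ n, n ≤ (S n).n ∧ (S n).n ≠ 0 ∧ (S n).time = gridTime T (S n).n)
    {w : ℝ → ℝ} (hwc : ContinuousOn w (Icc 0 T)) (hw : ∃ C, ∀ t ∈ Icc 0 T, |w t| ≤ C)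
    (hlim : ∀ n, ∫⁻ t in Icc 0 T, ∫⁻ ω, ‖(S n).eval t ω + densityProc φ M t ω • φ t‖ₑ ^ 2 ∂P ≤
        ENNReal.ofReal ((1 / 2) ^ n)) :
    Tendsto (fun n => ∫⁻ t in Icc 0 T, ∫⁻ ω, ‖((S n).weight w hw).eval t ω -
      (w t * densityProc φ M t ω) • (-φ t)‖ₑ ^ 2 ∂P) atTop (𝓝 0) := by
  obtain ⟨C, hC⟩ := id hw
  have hC0 : 0 ≤ C := (abs_nonneg _).trans (hC 0 ⟨le_rfl, hT.le⟩)
  have hTT : T ∈ Icc 0 T := ⟨hT.le, le_rfl⟩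
  have hφ2 : IntegrableOn (fun t => ‖φ t‖ ^ 2) (Icc 0 T) :=
    (memLp_two_iff_integrable_sq_norm hφ.1).1 hφ
  set Φ : ℝ≥0∞ := ∫⁻ t in Icc 0 T, ENNReal.ofReal
    (Real.exp (∫ r in (0 : ℝ)..t, ‖φ r‖ ^ 2) * ‖φ t‖ ^ 2) with hΦ
  have hΦt : Φ ≠ ⊤ := by
    have h1 : IntegrableOn (fun t => Real.exp (∫ r in (0 : ℝ)..t, ‖φ r‖ ^ 2) * ‖φ t‖ ^ 2)
        (Icc 0 T) := hφ2.continuousOn_mul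
      (Real.continuous_exp.comp_continuousOn (continuousOn_primitive_Icc hφ2)) isCompact_Icc
    rw [hΦ, ← ofReal_integral_eq_lintegral_ofReal h1 (Eventually.of_forall fun t => by positivity)]
    exact ENNReal.ofReal_ne_top
  have huc := isCompact_Icc.uniformContinuousOn_of_continuous hwc
  have hbound : ∀ (δ : ℝ), 0 < δ → ∀ᶠ n in atTop, ∫⁻ t in Icc 0 T, ∫⁻ ω,
      ‖((S n).weight w hw).eval t ω - (w t * densityProc φ M t ω) • (-φ t)‖ₑ ^ 2 ∂P ≤
      ENNReal.ofReal (2 * C ^ 2) * ENNReal.ofReal ((1 / 2) ^ n) +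
        ENNReal.ofReal (2 * δ ^ 2) * Φ := by
    intro δ hδ
    obtain ⟨ρ, hρ, hρ'⟩ := Metric.uniformContinuousOn_iff.1 huc δ hδ
    obtain ⟨N₂, hN₂⟩ := exists_nat_gt (T / ρ)
    filter_upwards [eventually_ge_atTop N₂] with n hnN
    obtain ⟨h1, h2, h3⟩ := hS n
    have hmesh : T / (S n).n < ρ := by
      have h4 : (N₂ : ℝ) ≤ (S n).n := by exact_mod_cast hnN.trans h1
      have h5 : (0 : ℝ) < (S n).n := by positivity
      rw [div_lt_iff₀ h5]
      rw [div_lt_iff₀ hρ] at hN₂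
      nlinarith
    have hpt : ∀ t ∈ Icc 0 T, t ≠ 0 → ∫⁻ ω, ‖((S n).weight w hw).eval t ω -
        (w t * densityProc φ M t ω) • (-φ t)‖ₑ ^ 2 ∂P ≤
        ENNReal.ofReal (2 * C ^ 2) *
          (∫⁻ ω, ‖(S n).eval t ω + densityProc φ M t ω • φ t‖ₑ ^ 2 ∂P) +
        ENNReal.ofReal (2 * δ ^ 2) * ENNReal.ofReal
          (Real.exp (∫ r in (0 : ℝ)..t, ‖φ r‖ ^ 2) * ‖φ t‖ ^ 2) := by
      intro t ht ht0
      obtain ⟨k, hk, hkt⟩ := exists_mem_gridCell hT.le h2 ⟨lt_of_le_of_ne ht.1 (Ne.symm ht0), ht.2⟩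
      rw [← h3] at hkt
      have hτm := (S n).time_mem k
      have hwd : |w ((S n).time k) - w t| ≤ δ := by
        rw [← Real.dist_eq]
        refine (hρ' _ hτm t ht (lt_of_le_of_lt ?_ hmesh)).le
        refine (Real.dist_le_of_mem_Icc ⟨le_rfl, hkt.1.le.trans hkt.2⟩
          ⟨hkt.1.le, hkt.2⟩).trans ?_
        rw [h3]
        exact gridTime_succ_sub_le hT.le k
      have hm2 := lintegral_densityProc_pow hF hM ht 2
      norm_num at hm2
      rw [ENNReal.ofReal_mul (Real.exp_pos _).le, ← hm2,
        ← lintegral_mul_const' _ _ ENNReal.ofReal_ne_top,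
        ← lintegral_const_mul' _ _ ENNReal.ofReal_ne_top,
        ← lintegral_const_mul' _ _ ENNReal.ofReal_ne_top, ← lintegral_add_right]
      swap
      · exact ((((measurable_densityProc hM ht).mono (hF t) le_rfl).pow_const
          2).ennreal_ofReal.mul_const _).const_mul _
      refine lintegral_mono fun ω => ?_
      set e := densityProc φ M t ω
      rw [(S n).weight_eval_of_mem w hw hk hkt]
      have h6 : w ((S n).time k) • (S n).eval t ω - (w t * e) • (-φ t) =
          w ((S n).time k) • ((S n).eval t ω + e • φ t) -
            ((w ((S n).time k) - w t) * e) • φ t := by module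
      rw [h6, ← ofReal_norm, ← ofReal_norm, ← ENNReal.ofReal_pow (norm_nonneg _),
        ← ENNReal.ofReal_pow (norm_nonneg _), ← ENNReal.ofReal_mul (by positivity),
        ← ENNReal.ofReal_mul (by positivity), ← ENNReal.ofReal_mul (by positivity),
        ← ENNReal.ofReal_add (by positivity) (by positivity)]
      refine ENNReal.ofReal_le_ofReal ?_
      have h7 : ‖w ((S n).time k) • ((S n).eval t ω + e • φ t) -
          ((w ((S n).time k) - w t) * e) • φ t‖ ≤
          C * ‖(S n).eval t ω + e • φ t‖ + δ * (|e| * ‖φ t‖) := by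
        refine (norm_sub_le _ _).trans ?_
        rw [norm_smul, norm_smul, norm_mul, mul_assoc]
        simp only [Real.norm_eq_abs]
        gcongr
        exact hC _ hτm
      calc _ ≤ (C * ‖(S n).eval t ω + e • φ t‖ + δ * (|e| * ‖φ t‖)) ^ 2 :=
            pow_le_pow_left₀ (norm_nonneg _) h7 2
        _ ≤ 2 * (C * ‖(S n).eval t ω + e • φ t‖) ^ 2 + 2 * (δ * (|e| * ‖φ t‖)) ^ 2 := by
            nlinarith [sq_nonneg (C * ‖(S n).eval t ω + e • φ t‖ - δ * (|e| * ‖φ t‖))]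
        _ = _ := by rw [mul_pow, mul_pow, mul_pow, sq_abs]; ring
    have hne : ∀ᵐ t ∂volume.restrict (Icc 0 T), t ∈ Icc 0 T ∧ t ≠ 0 := by
      filter_upwards [ae_restrict_mem measurableSet_Icc,
        ae_restrict_of_ae (Measure.ae_ne volume (0 : ℝ))] with t ht ht0 using ⟨ht, ht0⟩
    refine (lintegral_mono_ae (hne.mono fun t ht => hpt t ht.1 ht.2)).trans ?_
    rw [lintegral_add_right', lintegral_const_mul' _ _ ENNReal.ofReal_ne_top,
      lintegral_const_mul' _ _ ENNReal.ofReal_ne_top]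
    · gcongr
      exact hlim n
    · refine AEMeasurable.const_mul (AEMeasurable.ennreal_ofReal ?_) _
      exact ((Real.continuous_exp.comp_continuousOn (continuousOn_primitive_Icc hφ2)).aemeasurable
        measurableSet_Icc).mul hφ2.1.aemeasurable
  rw [ENNReal.tendsto_nhds_zero]
  intro ε hε
  have hδlim : Tendsto (fun δ : ℝ => ENNReal.ofReal (2 * δ ^ 2) * Φ) (𝓝[>] 0) (𝓝 0) := by
    have h1 : Tendsto (fun δ : ℝ => ENNReal.ofReal (2 * δ ^ 2)) (𝓝[>] 0) (𝓝 0) := by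
      have h2 : Continuous fun δ : ℝ => ENNReal.ofReal (2 * δ ^ 2) :=
        ENNReal.continuous_ofReal.comp (by fun_prop)
      have := (h2.tendsto 0).mono_left (nhdsWithin_le_nhds (s := Ioi 0))
      simpa using this
    simpa using ENNReal.Tendsto.mul_const h1 (Or.inr hΦt)
  have hε2 : 0 < ε / 2 := ENNReal.half_pos hε.ne'
  obtain ⟨δ, hδε, hδ0⟩ := ((hδlim.eventually_lt_const hε2).and self_mem_nhdsWithin).exists
  have hnlim : Tendsto (fun n : ℕ => ENNReal.ofReal (2 * C ^ 2) * ENNReal.ofReal ((1 / 2) ^ n))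
      atTop (𝓝 0) := by
    have hz : Tendsto (fun k : ℕ => (1 / 2 : ℝ) ^ k) atTop (𝓝 0) :=
      tendsto_pow_atTop_nhds_zero_of_lt_one (by norm_num) (by norm_num)
    have := ENNReal.Tendsto.const_mul (a := ENNReal.ofReal (2 * C ^ 2)) (ENNReal.tendsto_ofReal hz)
      (Or.inr ENNReal.ofReal_ne_top)
    simpa using this
  filter_upwards [hbound δ hδ0, hnlim.eventually_lt_const hε2] with n h1 h2
  exact h1.trans ((add_le_add h2.le hδε.le).trans (ENNReal.add_halves ε).le)

/-- Markov's inequality turns mean square convergence of the integrands into convergence in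
probability; the integrals converge uniformly a.s., hence in probability. -/
lemma IsItoIntegral.of_ae_approx {W : Fin d → ℝ≥0 → Ω → ℝ} (hW : IsBrownianMotion W P)
    {H : ℝ → Ω → EuclideanSpace ℝ (Fin d)} {I : ℝ → Ω → ℝ}
    {S : ℕ → SimpleIntegrand (brownianFiltration W P) T d}
    (hH : AEStronglyMeasurable (fun p : ℝ × Ω => H p.1 p.2) ((volume.restrict (Icc 0 T)).prod P))
    (h1 : Tendsto (fun n => ∫⁻ t in Icc 0 T, ∫⁻ ω, ‖(S n).eval t ω - H t ω‖ₑ ^ 2 ∂P) atTop (𝓝 0))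
    (h2 : ∀ᵐ ω ∂P, TendstoUniformlyOn (fun n t => (S n).sint (vecBM W) t ω) (fun t => I t ω) atTop
      (Icc 0 T)) : IsItoIntegral W P T H I := by
  have hF := hW.brownianFiltration_le
  have hmono := brownianFiltration_mono (W := W) (P := P)
  refine ⟨S, fun ε hε => ?_, fun ε hε => ?_⟩
  · have hm : ∀ n, AEMeasurable (fun p : ℝ × Ω => ‖(S n).eval p.1 p.2 - H p.1 p.2‖ₑ ^ 2)
        ((volume.restrict (Icc 0 T)).prod P) := fun n =>
      (((S n).measurable_eval hF).aestronglyMeasurable.sub hH).enorm.pow_const 2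
    -- Markov's inequality needs a finite level. At level `⊤` the event is null as soon as the mean
    -- is finite.
    rcases eq_or_ne ε ⊤ with rfl | hεt
    · have h3 : ∀ᶠ n in atTop, P {ω | ⊤ ≤ ∫⁻ s in Icc 0 T, ‖(S n).eval s ω - H s ω‖ₑ ^ 2} = 0 := by
        filter_upwards [h1.eventually_lt_const ENNReal.zero_lt_top] with n hn
        rw [lintegral_lintegral_swap (hm n)] at hn
        have := ae_lt_top' (hm n).prod_swap.lintegral_prod_right' hn.ne
        rw [ae_iff] at this
        refine measure_mono_null (fun ω hω => ?_) this
        exact not_lt.2 hω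
      exact tendsto_const_nhds.congr' (h3.mono fun n hn => hn.symm)
    · have h3 : ∀ n, P {ω | ε ≤ ∫⁻ s in Icc 0 T, ‖(S n).eval s ω - H s ω‖ₑ ^ 2} ≤
          (∫⁻ t in Icc 0 T, ∫⁻ ω, ‖(S n).eval t ω - H t ω‖ₑ ^ 2 ∂P) / ε := by
        intro n
        rw [lintegral_lintegral_swap (hm n)]
        exact meas_ge_le_lintegral_div (hm n).prod_swap.lintegral_prod_right' hε.ne' hεt
      refine tendsto_of_tendsto_of_tendsto_of_le_of_le tendsto_const_nhds ?_ (fun _ => zero_le) h3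
      have := ENNReal.Tendsto.div_const h1 (Or.inr hε.ne')
      simpa using this
  · simp_rw [SimpleIntegrand.integral_eq_sint]
    have hsm : ∀ n, ∀ t ∈ Icc 0 T, Measurable ((S n).sint (vecBM W) t) := fun n t ht =>
      ((S n).measurable_sint (hW.isLevy T) hmono ht).mono (hF t) le_rfl
    have hsc : ∀ᵐ ω ∂P, ∀ n, ContinuousOn (fun t => (S n).sint (vecBM W) t ω) (Icc 0 T) := by
      filter_upwards [hW.ae_continuous] with ω hω n
      exact (S n).continuous_sint hω.continuousOn
    refine tendsto_measure_exists_le_abs (Z := fun n t ω => (S n).sint (vecBM W) t ω - I t ω)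
      (fun n t ht => ?_) (fun n => ?_) ?_ hε
    · exact (hsm n t ht).aemeasurable.sub (aemeasurable_of_tendsto_metrizable_ae atTop
        (fun n => (hsm n t ht).aemeasurable) (h2.mono fun ω hω => hω.tendsto_at ht))
    · filter_upwards [hsc, h2] with ω h3 h4
      exact (h3 n).sub (h4.continuousOn (Frequently.of_forall fun n => h3 n))
    · filter_upwards [h2] with ω hω
      rw [Metric.tendstoUniformlyOn_iff] at hω ⊢
      intro ε hε
      filter_upwards [hω ε hε] with n hn t ht
      have := hn t ht
      rw [Real.dist_eq] at this
      simpa [Real.dist_eq] using this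

/-- Itô's formula for the product of a stochastic exponential and a discount factor. -/
theorem isItoIntegral_exponential {W : Fin d → ℝ≥0 → Ω → ℝ} (hW : IsBrownianMotion W P)
    (hT : 0 < T) (hφ : MemLp φ 2 (volume.restrict (Icc 0 T)))
    (hM : IsWiener (brownianFiltration W P) P T (vecBM W) φ M) (hβ : IntegrableOn β (Icc 0 T))
    (x : ℝ) :
    IsItoIntegral W P T
      (fun t ω => (x * Real.exp (-∫ v in (0 : ℝ)..t, β v) * densityProc φ M t ω) • (-φ t))
      (fun t ω => x * discount β (fun s => densityProc φ M s ω - 1) t) := by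
  have hF := hW.brownianFiltration_le
  have hmono := brownianFiltration_mono (W := W) (P := P)
  have hBc : ∀ᵐ ω ∂P, ContinuousOn (vecBM W · ω) (Icc 0 T) :=
    hW.ae_continuous.mono fun ω hω => hω.continuousOn
  obtain ⟨S, hS1, hS2, hS3⟩ := exists_seq_expIntegrand hT hF hmono (hW.isLevy T) hBc hφ hM
  have hwc : ContinuousOn (fun t => x * Real.exp (-∫ v in (0 : ℝ)..t, β v)) (Icc 0 T) :=
    continuousOn_const.mul (continuousOn_discountFactor hβ)
  refine IsItoIntegral.of_ae_approx hW (S := fun n => (S n).weight _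
    (exists_bound_discountFactor hβ x)) ?_
    (tendsto_lintegral_weight_eval hT hF hφ hM hS1 hwc _ hS2) ?_
  · have h1 : AEMeasurable (fun p : ℝ × Ω => x * Real.exp (-∫ v in (0 : ℝ)..p.1, β v) *
        densityProc φ M p.1 p.2) ((volume.restrict (Icc 0 T)).prod P) :=
      aemeasurable_prod_of_continuousOn hT.le
        (X := fun t ω => x * Real.exp (-∫ v in (0 : ℝ)..t, β v) * densityProc φ M t ω)
        (fun t ht => ((measurable_densityProc hM ht).mono (hF t) le_rfl).const_mul _)
        (Eventually.of_forall fun ω => hwc.mul (continuousOn_densityProc hφ hM ω))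
    exact h1.aestronglyMeasurable.smul hφ.1.neg.comp_fst
  · filter_upwards [hBc, hS3] with ω h1 h2
    exact tendstoUniformlyOn_weight_sint hT hS1 hβ x
      ((continuousOn_densityProc hφ hM ω).sub continuousOn_const) h1 h2

end ExponentialItoIntegral

/-! ### Wealth processes of deterministic strategies -/

section ExponentialWealth

variable {m : Market d} {W : Fin d → ℝ≥0 → Ω → ℝ} {P : Measure Ω} [IsProbabilityMeasure P]
  {T x γ α : ℝ} {y : ℝ → EuclideanSpace ℝ (Fin d)} {v : ℝ → ℝ} {M : ℝ → Ω → ℝ}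
  {F : ℝ → MeasurableSpace Ω} {B : ℝ → Ω → EuclideanSpace ℝ (Fin d)}

/-- The rate `v - r - y'θ`. -/
def netRate (m : Market d) (y : ℝ → EuclideanSpace ℝ (Fin d)) (v : ℝ → ℝ) (u : ℝ) : ℝ :=
  -(m.r u + inner ℝ (y u) (m.θ u) - v u)

/-- The process `x exp (∫ (r + y'θ - v)) E`, with `E` the stochastic exponential of `∫ y' dW`;
here `M` is the Wiener integral of `-y`. -/
def expWealth (m : Market d) (y : ℝ → EuclideanSpace ℝ (Fin d)) (v : ℝ → ℝ) (M : ℝ → Ω → ℝ)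
    (x t : ℝ) (ω : Ω) : ℝ :=
  x * Real.exp (-∫ u in (0 : ℝ)..t, netRate m y v u) * densityProc (fun t => -y t) M t ω

lemma Market.Standing.integrableOn_netRate (hm : m.Standing T)
    (hy : MemLp y 2 (volume.restrict (Icc 0 T))) (hv : IntegrableOn v (Icc 0 T)) :
    IntegrableOn (netRate m y v) (Icc 0 T) :=
  ((hm.integrableOn_r.add (integrable_inner_of_memLp hy hm.θ_sq)).sub hv).neg

lemma expWealth_pos (hx : 0 < x) (t : ℝ) (ω : Ω) : 0 < expWealth m y v M x t ω :=
  mul_pos (mul_pos hx (Real.exp_pos _)) (densityProc_pos t ω)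

lemma measurable_expWealth (hM : IsWiener F P T B (fun t => -y t) M) {t : ℝ} (ht : t ∈ Icc 0 T) :
    Measurable[F t] (expWealth m y v M x t) :=
  (measurable_densityProc hM ht).const_mul _

lemma continuousOn_expWealth (hm : m.Standing T) (hy : MemLp y 2 (volume.restrict (Icc 0 T)))
    (hv : IntegrableOn v (Icc 0 T)) (hM : IsWiener F P T B (fun t => -y t) M) (ω : Ω) :
    ContinuousOn (fun t => expWealth m y v M x t ω) (Icc 0 T) :=
  (continuousOn_const.mul (continuousOn_discountFactor (hm.integrableOn_netRate hy hv))).mul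
    (continuousOn_densityProc hy.neg hM ω)

lemma IsItoIntegral.congr_integrand {H H' : ℝ → Ω → EuclideanSpace ℝ (Fin d)} {I : ℝ → Ω → ℝ}
    (h : IsItoIntegral W P T H I) (hH : ∀ t ω, H t ω = H' t ω) : IsItoIntegral W P T H' I := by
  obtain rfl : H = H' := funext fun t => funext fun ω => hH t ω
  exact h

/-- Here `netRate` is minus the drift rate and `M` integrates `-y`, so the stochastic exponential
satisfies `dE = E y' dW`. The Itô part is `x * discount` of `E - 1`, and undoing the integration by
parts recovers the wealth equation pathwise. -/
theorem isWealth_expWealth (hW : IsBrownianMotion W P) (hT : 0 < T) (hx : 0 < x)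
    (hm : m.Standing T) (hy : MemLp y 2 (volume.restrict (Icc 0 T)))
    (hv : IntegrableOn v (Icc 0 T))
    (hM : IsWiener (brownianFiltration W P) P T (vecBM W) (fun t => -y t) M) :
    IsWealth m W P T x (fun t _ => y t) (fun t ω => v t * expWealth m y v M x t ω)
      (expWealth m y v M x) := by
  have hβ := hm.integrableOn_netRate hy hv
  have hy' : MemLp (fun t => -y t) 2 (volume.restrict (Icc 0 T)) := hy.neg
  have hc := continuousOn_expWealth (x := x) hm hy hv hM
  have hdrift : ∀ u ω, expWealth m y v M x u ω * (m.r u + inner ℝ (y u) (m.θ u)) -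
      v u * expWealth m y v M x u ω = -(expWealth m y v M x u ω * netRate m y v u) := by
    intro u ω
    rw [netRate]; ring
  have hXβ : ∀ ω, IntegrableOn (fun u => expWealth m y v M x u ω * netRate m y v u) (Icc 0 T) :=
    fun ω => hβ.continuousOn_mul (hc ω) isCompact_Icc
  refine ⟨fun t ht => measurable_expWealth hM ht, Eventually.of_forall hc,
    Eventually.of_forall fun ω t _ => expWealth_pos hx t ω, Eventually.of_forall fun ω => ?_,
    Eventually.of_forall fun ω => ?_, _,
    (isItoIntegral_exponential hW hT hy' hM hβ x).congr_integrand fun t ω => ?_,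
    Eventually.of_forall fun ω t ht => ?_⟩
  · simp_rw [hdrift]
    exact (hXβ ω).neg
  · have h1 : AEStronglyMeasurable (fun u => expWealth m y v M x u ω • y u)
        (volume.restrict (Icc 0 T)) := ((hc ω).aestronglyMeasurable measurableSet_Icc).smul hy.1
    refine (memLp_two_iff_integrable_sq_norm h1).2 ?_
    have h2 : IntegrableOn (fun t => ‖y t‖ ^ 2) (Icc 0 T) :=
      (memLp_two_iff_integrable_sq_norm hy.1).1 hy
    refine (h2.continuousOn_mul ((hc ω).pow 2) isCompact_Icc).congr
      (Eventually.of_forall fun u => ?_)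
    simp only [Pi.pow_apply]
    rw [norm_smul, mul_pow, Real.norm_eq_abs, sq_abs]
  · simp only [neg_neg]
    rfl
  · have h0 : (0 : ℝ) ∈ Icc 0 T := ⟨le_rfl, hT.le⟩
    simp_rw [hdrift]
    have h1 := discountFactor_sub hβ h0 ht
    have h2 : ∫ u in (0 : ℝ)..t, (densityProc (fun t => -y t) M u ω - 1) *
        (netRate m y v u * Real.exp (-∫ s in (0 : ℝ)..u, netRate m y v s)) =
        (∫ u in (0 : ℝ)..t, densityProc (fun t => -y t) M u ω *
          (netRate m y v u * Real.exp (-∫ s in (0 : ℝ)..u, netRate m y v s))) -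
        ∫ u in (0 : ℝ)..t, netRate m y v u * Real.exp (-∫ s in (0 : ℝ)..u, netRate m y v s) := by
      rw [← intervalIntegral.integral_sub (intervalIntegrable_of_integrableOn_Icc
        (integrableOn_mul_discountWeight hβ (continuousOn_densityProc hy' hM ω)) h0 ht)
        (intervalIntegrable_of_integrableOn_Icc (integrableOn_discountWeight hβ) h0 ht)]
      simp_rw [sub_mul, one_mul]
    have h3 : ∫ u in (0 : ℝ)..t, -(expWealth m y v M x u ω * netRate m y v u) =
        -(x * ∫ u in (0 : ℝ)..t, densityProc (fun t => -y t) M u ω *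
          (netRate m y v u * Real.exp (-∫ s in (0 : ℝ)..u, netRate m y v s))) := by
      rw [intervalIntegral.integral_neg, ← intervalIntegral.integral_const_mul]
      congr 1
      refine intervalIntegral.integral_congr fun u _ => ?_
      simp only [expWealth]
      ring
    rw [h3, discount, h2]
    simp only [intervalIntegral.integral_same, neg_zero, Real.exp_zero] at h1
    unfold expWealth
    linear_combination x * h1

lemma measurable_uncurry_of_continuousOn (hmono : Monotone F) {X : ℝ → Ω → ℝ} {t : ℝ}
    (hX : ∀ s ∈ Icc 0 t, Measurable[F s] (X s))
    (hc : ∀ ω, ContinuousOn (fun s => X s ω) (Icc 0 t)) :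
    Measurable[Subtype.instMeasurableSpace.prod (F t)] fun p : Icc (0 : ℝ) t × Ω => X p.1 p.2 :=
  @measurable_uncurry_of_continuous_of_measurable Ω ℝ (Icc (0 : ℝ) t) _ _ _ _ _ _ _ _ _ (F t)
    (fun s ω => X s ω) (fun ω => continuousOn_iff_continuous_domRestrict.1 (hc ω))
    fun s => (hX s s.2).mono (hmono s.2.2) le_rfl

lemma IsProgressiveOn.measurable {u : ℝ → Ω → ℝ} (hu : IsProgressiveOn F T u) {t : ℝ}
    (ht : t ∈ Icc 0 T) : Measurable[F t] (u t) := by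
  have h := hu t ht
  have h2 : @Measurable Ω (Icc (0 : ℝ) t × Ω) (F t) (Subtype.instMeasurableSpace.prod (F t))
      fun ω => (⟨t, ⟨ht.1, le_rfl⟩⟩, ω) :=
    @Measurable.prodMk Ω (F t) (Icc (0 : ℝ) t) Ω _ (F t) (fun _ => ⟨t, ⟨ht.1, le_rfl⟩⟩) id
      (@measurable_const _ _ _ (F t) _) (@measurable_id _ (F t))
  exact h.comp h2

lemma IsProgressiveOn.aemeasurable (hF : ∀ t, F t ≤ mΩ) (hT : 0 ≤ T) {u : ℝ → Ω → ℝ}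
    (hu : IsProgressiveOn F T u) :
    AEMeasurable (fun p : ℝ × Ω => u p.1 p.2) ((volume.restrict (Icc 0 T)).prod P) := by
  have h1 : Measurable fun p : Icc (0 : ℝ) T × Ω => u p.1 p.2 := by
    refine (hu T ⟨hT, le_rfl⟩).mono ?_ le_rfl
    exact sup_le_sup le_rfl (MeasurableSpace.comap_mono (hF T))
  have h2 : Measurable fun p : ℝ × Ω => u (projIcc 0 T hT p.1) p.2 :=
    h1.comp ((((continuous_projIcc (h := hT)).measurable).comp measurable_fst).prodMk measurable_snd)
  refine ⟨_, h2, ?_⟩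
  filter_upwards [Measure.quasiMeasurePreserving_fst.ae
    (ae_restrict_mem (measurableSet_Icc (a := (0 : ℝ)) (b := T)))] with p hp
  rw [projIcc_of_mem hT hp]

/-- The inverse matrix is the adjugate over the determinant, so its entries are polynomials times a
measurable reciprocal; at singular times the convention `0⁻¹ = 0` keeps this valid. -/
lemma Market.Standing.measurable_θ (hm : m.Standing T) :
    Measurable fun t : Icc (0 : ℝ) T => m.θ t := by
  have hσ : ∀ i j, Measurable fun t : Icc (0 : ℝ) T => m.σ t i j := fun i j =>
    (hm.cadlag_σ.comp (g := fun A : Matrix (Fin d) (Fin d) ℝ => A i j)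
      (by fun_prop)).measurable
  have hμ : ∀ i, Measurable fun t : Icc (0 : ℝ) T => m.μ t i := fun i =>
    (hm.cadlag_μ.comp (g := fun A : EuclideanSpace ℝ (Fin d) => A i) (by fun_prop)).measurable
  have hr : Measurable fun t : Icc (0 : ℝ) T => m.r t := hm.cadlag_r.measurable
  have hdet : ∀ A : Icc (0 : ℝ) T → Matrix (Fin d) (Fin d) ℝ,
      (∀ i j, Measurable fun t => A t i j) → Measurable fun t => (A t).det := by
    intro A hA
    simp_rw [Matrix.det_apply]
    exact Finset.measurable_fun_sum _ fun τ _ => (Finset.measurable_fun_prod _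
      fun i _ => hA _ _).const_smul _
  refine (MeasurableEquiv.toLp 2 (Fin d → ℝ)).measurable.comp (measurable_pi_lambda _ fun i => ?_)
  simp only [Matrix.mulVec, dotProduct, Market.excess, Matrix.inv_def, Matrix.smul_apply,
    Ring.inverse_eq_inv', Matrix.adjugate_apply, smul_eq_mul]
  refine Finset.measurable_fun_sum _ fun j _ => ?_
  refine ((hdet _ hσ).inv.mul (hdet _ fun a b => ?_)).mul ((hμ j).sub hr)
  simp only [Matrix.updateRow_apply]
  split_ifs
  · exact measurable_const
  · exact hσ a b

end ExponentialWealth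

/-! ### The candidate optimal strategy -/

section Candidate

variable {m : Market d} {P : Measure Ω} [IsProbabilityMeasure P]
  {T x γ α ζ : ℝ} {M : ℝ → Ω → ℝ}
  {F : ℝ → MeasurableSpace Ω} {B : ℝ → Ω → EuclideanSpace ℝ (Fin d)}

lemma mul_qexp (hγ : γ < 1) : γ * qexp γ = qexp γ - 1 := by
  have : 1 - γ ≠ 0 := by linarith
  rw [qexp]; field_simp; ring

lemma qexp_pos (hγ : γ < 1) : 0 < qexp γ := one_div_pos.2 (sub_pos.2 hγ)

lemma Market.Standing.remainingWeight_eq (hm : m.Standing T) (γ : ℝ) {t : ℝ} (ht : t ∈ Icc 0 T) :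
    remainingWeight m T γ t =
      remainingWeight m T γ 0 + ∫ s in (0 : ℝ)..t, -(gTilde m γ s ^ qexp γ) := by
  have hT : 0 ≤ T := ht.1.trans ht.2
  have h := (hm.continuousOn_gTilde_rpow γ).integrableOn_compact isCompact_Icc (μ := volume)
  have hadd := intervalIntegral.integral_add_adjacent_intervals
    (intervalIntegrable_of_integrableOn_Icc h ⟨le_rfl, hT⟩ ht)
    (intervalIntegrable_of_integrableOn_Icc h ht ⟨hT, le_rfl⟩)
  rw [remainingWeight, remainingWeight, intervalIntegral.integral_neg]
  linarith

lemma remainingWeight_self (m : Market d) (T γ : ℝ) :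
    remainingWeight m T γ T = gTilde m γ T ^ qexp γ := by
  simp [remainingWeight]

lemma Market.Standing.continuousOn_remainingWeight (hm : m.Standing T) (γ : ℝ) :
    ContinuousOn (remainingWeight m T γ) (Icc 0 T) := by
  have h := (hm.continuousOn_gTilde_rpow γ).integrableOn_compact isCompact_Icc (μ := volume)
  exact (continuousOn_const.add (continuousOn_primitive_Icc h.neg)).congr
    fun t ht => hm.remainingWeight_eq γ ht

lemma Market.Standing.continuousOn_vStar (hm : m.Standing T) (γ : ℝ) :
    ContinuousOn (vStar m T γ) (Icc 0 T) :=
  (hm.continuousOn_gTilde_rpow γ).div (hm.continuousOn_remainingWeight γ)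
    fun _ ht => (remainingWeight_pos m γ ht.2).ne'

lemma vStar_nonneg (m : Market d) (γ : ℝ) {t : ℝ} (ht : t ≤ T) : 0 ≤ vStar m T γ t :=
  div_nonneg (gTilde_rpow_pos m γ t).le (remainingWeight_pos m γ ht).le

lemma Market.Standing.integrableOn_vStar (hm : m.Standing T) (γ : ℝ) :
    IntegrableOn (vStar m T γ) (Icc 0 T) :=
  (hm.continuousOn_vStar γ).integrableOn_compact isCompact_Icc

/-- `v*` is minus the logarithmic derivative of `remainingWeight`, so this product is constant in
time; its integrand in the product rule vanishes identically. -/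
lemma Market.Standing.exp_integral_vStar (hm : m.Standing T) (γ : ℝ) {t : ℝ} (ht : t ∈ Icc 0 T) :
    Real.exp (∫ s in (0 : ℝ)..t, vStar m T γ s) * remainingWeight m T γ t =
      remainingWeight m T γ 0 := by
  have hT : 0 ≤ T := ht.1.trans ht.2
  have h0 : (0 : ℝ) ∈ Icc 0 T := ⟨le_rfl, hT⟩
  have h := (hm.continuousOn_gTilde_rpow γ).integrableOn_compact isCompact_Icc (μ := volume)
  have h1 := integral_exp_mul_primitive
    (intervalIntegrable_of_integrableOn_Icc (hm.integrableOn_vStar γ) h0 ht)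
    (intervalIntegrable_of_integrableOn_Icc h.neg h0 ht) (remainingWeight m T γ 0)
  simp only [Pi.neg_apply] at h1
  rw [← hm.remainingWeight_eq γ ht] at h1
  rw [intervalIntegral.integral_congr (g := fun _ => 0), intervalIntegral.integral_zero] at h1
  · linarith
  · intro u hu
    rw [uIcc_of_le ht.1] at hu
    have huT : u ∈ Icc 0 T := ⟨hu.1, hu.2.trans ht.2⟩
    simp only
    rw [← hm.remainingWeight_eq γ huT]
    have h2 : vStar m T γ u * remainingWeight m T γ u = gTilde m γ u ^ qexp γ :=
      div_mul_cancel₀ _ (remainingWeight_pos m γ huT.2).ne'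
    linear_combination Real.exp (∫ v in (0 : ℝ)..u, vStar m T γ v) * h2

lemma Market.Standing.memLp_yStar (hm : m.Standing T) (γ : ℝ) :
    MemLp (yStar m γ) 2 (volume.restrict (Icc 0 T)) := hm.θ_sq.const_smul (qexp γ)

lemma yStar_eq (m : Market d) (γ t : ℝ) : yStar m γ t = qexp γ • m.θ t := rfl

lemma Market.Standing.integral_netRate_star (hm : m.Standing T) (γ : ℝ) {t : ℝ}
    (ht : t ∈ Icc 0 T) :
    ∫ u in (0 : ℝ)..t, netRate m (yStar m γ) (vStar m T γ) u =
      -(m.R t + qexp γ * (∫ u in (0 : ℝ)..t, ‖m.θ u‖ ^ 2) - ∫ u in (0 : ℝ)..t, vStar m T γ u) := by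
  have h0 : (0 : ℝ) ∈ Icc 0 T := ⟨le_rfl, ht.1.trans ht.2⟩
  have hr := intervalIntegrable_of_integrableOn_Icc hm.integrableOn_r h0 ht
  have hθ := intervalIntegrable_of_integrableOn_Icc hm.integrableOn_θ_sq h0 ht
  have hv := intervalIntegrable_of_integrableOn_Icc (hm.integrableOn_vStar γ) h0 ht
  have h1 : ∀ u, netRate m (yStar m γ) (vStar m T γ) u =
      -(m.r u + qexp γ * ‖m.θ u‖ ^ 2 - vStar m T γ u) := by
    intro u
    rw [netRate, yStar_eq, real_inner_smul_left, real_inner_self_eq_norm_sq]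
  simp_rw [h1]
  rw [intervalIntegral.integral_neg, intervalIntegral.integral_sub (hr.add (hθ.const_mul _)) hv,
    intervalIntegral.integral_add hr (hθ.const_mul _), intervalIntegral.integral_const_mul]
  rfl

lemma integral_norm_neg_yStar_sq (m : Market d) (γ t : ℝ) :
    ∫ u in (0 : ℝ)..t, ‖-yStar m γ u‖ ^ 2 = qexp γ ^ 2 * ∫ u in (0 : ℝ)..t, ‖m.θ u‖ ^ 2 := by
  rw [← intervalIntegral.integral_const_mul]
  congr 1 with u
  rw [norm_neg, yStar_eq, norm_smul, mul_pow, Real.norm_eq_abs, sq_abs]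

/-- The candidate optimal wealth process. -/
def wealthStar (m : Market d) (T γ : ℝ) (M : ℝ → Ω → ℝ) (x t : ℝ) (ω : Ω) : ℝ :=
  expWealth m (yStar m γ) (vStar m T γ) M x t ω

lemma Market.Standing.wealthStar_eq_exp (hm : m.Standing T) {t : ℝ} (ht : t ∈ Icc 0 T) (ω : Ω) :
    wealthStar m T γ M x t ω = x * Real.exp (m.R t + qexp γ * (∫ u in (0 : ℝ)..t, ‖m.θ u‖ ^ 2) -
      (∫ u in (0 : ℝ)..t, vStar m T γ u) -
      qexp γ ^ 2 * (∫ u in (0 : ℝ)..t, ‖m.θ u‖ ^ 2) / 2 - M t ω) := by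
  rw [wealthStar, expWealth, densityProc, hm.integral_netRate_star γ ht,
    integral_norm_neg_yStar_sq, mul_assoc, ← Real.exp_add]
  congr 2
  ring

/-- Consumption scales wealth by `exp(-∫v*)`, the ratio of remaining weights. What is left is a
lognormal moment whose exponent collapses to that of `g̃` by `γ q = q - 1`. -/
lemma lintegral_wealthStar_rpow (hx : 0 < x) (hγ : γ < 1) (hF : ∀ t, F t ≤ mΩ)
    (hm : m.Standing T) (hM : IsWiener F P T B (fun t => -yStar m γ t) M) {t : ℝ}
    (ht : t ∈ Icc 0 T) :
    ∫⁻ ω, ENNReal.ofReal (wealthStar m T γ M x t ω ^ γ) ∂P =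
      ENNReal.ofReal (x ^ γ * (remainingWeight m T γ t / remainingWeight m T γ 0) ^ γ *
        gTilde m γ t) := by
  have hG := remainingWeight_pos m γ ht.2
  have hG0 : 0 < remainingWeight m T γ 0 := remainingWeight_pos m γ (ht.1.trans ht.2)
  have hE := hm.exp_integral_vStar γ ht
  set V := ∫ u in (0 : ℝ)..t, vStar m T γ u
  set ν := ∫ u in (0 : ℝ)..t, ‖m.θ u‖ ^ 2 with hν
  have hratio : Real.exp (-V) = remainingWeight m T γ t / remainingWeight m T γ 0 := by
    rw [eq_div_iff hG0.ne', ← hE, ← mul_assoc, ← Real.exp_add]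
    simp
  have h1 : ∀ ω, ENNReal.ofReal (wealthStar m T γ M x t ω ^ γ) =
      ENNReal.ofReal (x ^ γ * (Real.exp (-V) ^ γ * Real.exp (γ * (m.R t + qexp γ * ν)))) *
      ENNReal.ofReal (densityProc (fun t => -yStar m γ t) M t ω ^ γ) := by
    intro ω
    have hd := densityProc_pos (ψ := fun t => -yStar m γ t) (M := M) t ω
    rw [← ENNReal.ofReal_mul (by positivity), wealthStar, expWealth,
      Real.mul_rpow (by positivity) hd.le, Real.mul_rpow hx.le (Real.exp_pos _).le,
      hm.integral_netRate_star γ ht, ← Real.exp_mul, ← Real.exp_mul, ← Real.exp_add]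
    congr 4
    ring
  simp_rw [h1]
  rw [lintegral_const_mul' _ _ ENNReal.ofReal_ne_top, lintegral_densityProc_rpow hF hM ht,
    ← ENNReal.ofReal_mul (by positivity), integral_norm_neg_yStar_sq, hratio, gTilde,
    m.θnorm_sq ht.1]
  congr 1
  rw [mul_assoc (x ^ γ), mul_assoc (x ^ γ), mul_assoc (_ ^ γ), ← Real.exp_add]
  congr 3
  have hq := mul_qexp hγ
  -- The Gaussian moment contributes `(γ² - γ) q² ν / 2 = -(q - 1) ν / 2` and the drift `γ q ν = (q
  -- - 1) ν`, in total `(q - 1) ν / 2`.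
  have hq2 : (γ ^ 2 - γ) * qexp γ ^ 2 = -(qexp γ - 1) := by
    linear_combination (γ * qexp γ + (qexp γ - 1) - qexp γ) * hq
  linear_combination ν * hq + ν / 2 * hq2

/-- The remaining weight at `t` cancels between `v*` and the wealth moment. Expected utility of
consumption is proportional to `g̃^q`, so the running and terminal costs add up to a multiple of
`remainingWeight` at `0`. -/
lemma lintegral_consumption_rpow (hx : 0 < x) (hγ : γ < 1) (hF : ∀ t, F t ≤ mΩ)
    (hm : m.Standing T) (hM : IsWiener F P T B (fun t => -yStar m γ t) M) {t : ℝ}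
    (ht : t ∈ Icc 0 T) :
    ∫⁻ ω, ENNReal.ofReal ((vStar m T γ t * wealthStar m T γ M x t ω) ^ γ) ∂P =
      ENNReal.ofReal (x ^ γ * remainingWeight m T γ 0 ^ (-γ) * gTilde m γ t ^ qexp γ) := by
  have hG := remainingWeight_pos m γ ht.2
  have hG0 : 0 < remainingWeight m T γ 0 := remainingWeight_pos m γ (ht.1.trans ht.2)
  have hg : 0 < gTilde m γ t := Real.exp_pos _
  have hv := vStar_nonneg m γ ht.2
  have h1 : ∀ ω, ENNReal.ofReal ((vStar m T γ t * wealthStar m T γ M x t ω) ^ γ) =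
      ENNReal.ofReal (vStar m T γ t ^ γ) * ENNReal.ofReal (wealthStar m T γ M x t ω ^ γ) := by
    intro ω
    have hX : 0 < wealthStar m T γ M x t ω := expWealth_pos hx t ω
    rw [← ENNReal.ofReal_mul (by positivity), Real.mul_rpow hv hX.le]
  simp_rw [h1]
  rw [lintegral_const_mul' _ _ ENNReal.ofReal_ne_top, lintegral_wealthStar_rpow hx hγ hF hm hM ht,
    ← ENNReal.ofReal_mul (by positivity)]
  congr 1
  have h2 : gTilde m γ t ^ qexp γ = (gTilde m γ t ^ qexp γ) ^ γ * gTilde m γ t := by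
    rw [← Real.rpow_mul hg.le, mul_comm (qexp γ), mul_qexp hγ, Real.rpow_sub hg, Real.rpow_one]
    field_simp
  have h3 : vStar m T γ t ^ γ =
      (gTilde m γ t ^ qexp γ) ^ γ / remainingWeight m T γ t ^ γ :=
    Real.div_rpow (gTilde_rpow_pos m γ t).le hG.le γ
  have h4 : remainingWeight m T γ t ^ γ ≠ 0 := (Real.rpow_pos_of_pos hG _).ne'
  rw [h3, Real.div_rpow hG.le hG0.le, Real.rpow_neg hG0.le]
  conv_rhs => rw [h2]
  generalize remainingWeight m T γ t ^ γ = a at h4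
  field_simp

theorem cost_wealthStar (hT : 0 < T) (hx : 0 < x) (hγ : γ < 1) (hF : ∀ t, F t ≤ mΩ)
    (hm : m.Standing T) (hM : IsWiener F P T B (fun t => -yStar m γ t) M) :
    cost P T γ γ ⟨fun t _ => yStar m γ t, fun t ω => vStar m T γ t * wealthStar m T γ M x t ω,
      wealthStar m T γ M x⟩ = ENNReal.ofReal (x ^ γ * remainingWeight m T γ 0 ^ (1 - γ)) := by
  have hTT : T ∈ Icc 0 T := ⟨hT.le, le_rfl⟩
  have hG0 : 0 < remainingWeight m T γ 0 := remainingWeight_pos m γ hT.le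
  have hGT : remainingWeight m T γ T = gTilde m γ T ^ qexp γ := remainingWeight_self m T γ
  have hg : 0 < gTilde m γ T := Real.exp_pos _
  have hX : ∀ t ∈ Icc 0 T, Measurable (wealthStar m T γ M x t) := fun t ht =>
    (measurable_expWealth hM ht).mono (hF t) le_rfl
  have hXc : ∀ ω, ContinuousOn (fun t => wealthStar m T γ M x t ω) (Icc 0 T) := fun ω =>
    continuousOn_expWealth hm (hm.memLp_yStar γ) (hm.integrableOn_vStar γ) hM ω
  have hjoint : AEMeasurable (fun p : ℝ × Ω =>
      ENNReal.ofReal ((vStar m T γ p.1 * wealthStar m T γ M x p.1 p.2) ^ γ))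
      ((volume.restrict (Icc 0 T)).prod P) :=
    ((((hm.integrableOn_vStar γ).1.aemeasurable.comp_fst).mul
      (aemeasurable_prod_of_continuousOn hT.le hX (Eventually.of_forall hXc))).pow_const
      γ).ennreal_ofReal
  have hterm : ∫⁻ ω, ENNReal.ofReal (wealthStar m T γ M x T ω ^ γ) ∂P =
      ENNReal.ofReal (x ^ γ * remainingWeight m T γ 0 ^ (-γ) * gTilde m γ T ^ qexp γ) := by
    rw [lintegral_wealthStar_rpow hx hγ hF hm hM hTT, hGT,
      Real.div_rpow (gTilde_rpow_pos m γ T).le hG0.le, ← Real.rpow_mul hg.le, mul_comm (qexp γ),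
      mul_qexp hγ, Real.rpow_neg hG0.le, Real.rpow_sub hg, Real.rpow_one]
    congr 1
    field_simp
  have hgi : ∫⁻ t in Icc 0 T, ENNReal.ofReal
      (x ^ γ * remainingWeight m T γ 0 ^ (-γ) * gTilde m γ t ^ qexp γ) =
      ENNReal.ofReal (x ^ γ * remainingWeight m T γ 0 ^ (-γ) *
        ∫ t in (0 : ℝ)..T, gTilde m γ t ^ qexp γ) := by
    rw [← intervalIntegral.integral_const_mul, intervalIntegral.integral_of_le hT.le,
      ← integral_Icc_eq_integral_Ioc, ofReal_integral_eq_lintegral_ofReal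
        (((hm.continuousOn_gTilde_rpow γ).integrableOn_compact isCompact_Icc).const_mul _)]
    exact Eventually.of_forall fun t => mul_nonneg (by positivity) (gTilde_rpow_pos m γ t).le
  have hint0 : 0 ≤ ∫ t in (0 : ℝ)..T, gTilde m γ t ^ qexp γ :=
    intervalIntegral.integral_nonneg hT.le fun s _ => (gTilde_rpow_pos m γ s).le
  unfold cost
  simp only
  rw [lintegral_add_right _ ((hX T hTT).pow_const γ).ennreal_ofReal, hterm,
    lintegral_lintegral_swap (μ := P) (f := fun ω t =>
      ENNReal.ofReal ((vStar m T γ t * wealthStar m T γ M x t ω) ^ γ)) hjoint.prod_swap,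
    setLIntegral_congr_fun measurableSet_Icc fun t ht =>
      lintegral_consumption_rpow hx hγ hF hm hM ht, hgi,
    ← ENNReal.ofReal_add (by positivity) (by positivity)]
  congr 1
  have h5 : remainingWeight m T γ 0 ^ (1 - γ) =
      remainingWeight m T γ 0 ^ (-γ) * remainingWeight m T γ 0 := by
    rw [sub_eq_neg_add, Real.rpow_add hG0, Real.rpow_one]
  rw [h5]
  nth_rw 4 [remainingWeight]
  ring

end Candidate

/-! ### Value-at-Risk of the candidate -/

section GaussianQuantile

/-- By symmetry the open positive half-line weighs no more than its reflection. This makes the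
quantile nonpositive for `α ≤ 1/2`. -/
lemma half_le_gaussianReal_Iic_zero : (1 / 2 : ℝ) ≤ (gaussianReal 0 1).real (Iic 0) := by
  have h1 : (gaussianReal 0 1).real (Ioi 0) ≤ (gaussianReal 0 1).real (Iic 0) := by
    have h2 : (gaussianReal 0 1).map (fun x : ℝ => -x) = gaussianReal 0 1 := by
      rw [gaussianReal_map_neg, neg_zero]
    conv_rhs => rw [← h2]
    rw [map_measureReal_apply measurable_neg measurableSet_Iic]
    exact measureReal_mono fun x (hx : 0 < x) => by simpa using hx.le
  have h3 := probReal_compl_eq_one_sub (μ := gaussianReal 0 1) (measurableSet_Iic (a := (0 : ℝ)))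
  rw [compl_Iic] at h3
  linarith

variable {α : ℝ}

lemma bddBelow_normalQuantile_set (hα : 0 < α) :
    BddBelow {z : ℝ | α ≤ cdf (gaussianReal 0 1) z} := by
  obtain ⟨z₀, hz₀⟩ := ((tendsto_cdf_atBot (gaussianReal 0 1)).eventually_lt_const hα).exists
  refine ⟨z₀, fun z hz => ?_⟩
  by_contra h
  exact absurd (hz.trans (monotone_cdf _ (not_le.1 h).le)) (not_le.2 hz₀)

lemma normalQuantile_nonpos (hα : 0 < α) (hα' : α ≤ 1 / 2) : normalQuantile α ≤ 0 := by
  refine csInf_le (bddBelow_normalQuantile_set hα) ?_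
  simp only [Set.mem_ofPred_eq]
  rw [cdf_eq_real]
  exact hα'.trans half_le_gaussianReal_Iic_zero

/-- Scaling by `√v` reduces to the standard normal and the definition of its quantile as an infimum.
When `v = 0` the law is the Dirac mass at `0`, and `c < 0`. -/
lemma gaussianReal_Iic_lt (hα : 0 < α) {v c : ℝ} (hv : 0 ≤ v) (hc : c < √v * normalQuantile α) :
    (gaussianReal 0 v.toNNReal).real (Iic c) < α := by
  rcases hv.eq_or_lt with rfl | hv
  · simp only [Real.sqrt_zero, zero_mul] at hc
    simpa [measureReal_def, gaussianReal_zero_var, hc] using hα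
  · have hs : 0 < √v := Real.sqrt_pos.2 hv
    have h1 : gaussianReal 0 v.toNNReal = (gaussianReal 0 1).map (√v * ·) := by
      rw [gaussianReal_map_const_mul, mul_zero, mul_one]
      congr 1
      ext
      simp [Real.sq_sqrt hv.le, hv.le]
    rw [h1, map_measureReal_apply (measurable_const_mul _) measurableSet_Iic]
    have h2 : (√v * ·) ⁻¹' Iic c = Iic (c / √v) := by
      ext z
      simp only [mem_preimage, mem_Iic]
      rw [le_div_iff₀ hs, mul_comm]
    rw [h2, ← cdf_eq_real]
    by_contra h
    have h3 : normalQuantile α ≤ c / √v :=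
      csInf_le (bddBelow_normalQuantile_set hα) (not_lt.1 h)
    rw [le_div_iff₀ hs, mul_comm] at h3
    exact absurd hc (not_lt.2 h3)

end GaussianQuantile

/-! ### Feasibility of the candidate for the risk constraint -/

section ValueAtRisk

variable {m : Market d} {P : Measure Ω} [IsProbabilityMeasure P]
  {T x γ α ζ : ℝ} {M : ℝ → Ω → ℝ}
  {F : ℝ → MeasurableSpace Ω} {B : ℝ → Ω → EuclideanSpace ℝ (Fin d)}

lemma qNorm_gTilde_rpow (m : Market d) (T : ℝ) (hT : 0 ≤ T) (hγ : γ < 1) :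
    qNorm (qexp γ) T (gTilde m γ) ^ qexp γ = ∫ t in (0 : ℝ)..T, gTilde m γ t ^ qexp γ := by
  have h1 : ∀ t, |gTilde m γ t| = gTilde m γ t := fun t => abs_of_pos (Real.exp_pos _)
  unfold qNorm
  simp_rw [h1]
  rw [← Real.rpow_mul (intervalIntegral.integral_nonneg hT fun s _ => (gTilde_rpow_pos m γ s).le),
    one_div_mul_cancel (qexp_pos hγ).ne', Real.rpow_one]

lemma qNorm_gTilde_rpow_add (m : Market d) (T : ℝ) (hT : 0 ≤ T) (hγ : γ < 1) :
    qNorm (qexp γ) T (gTilde m γ) ^ qexp γ + gTilde m γ T ^ qexp γ = remainingWeight m T γ 0 := by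
  rw [qNorm_gTilde_rpow m T hT hγ, add_comm]
  rfl

/-- `1 - κ̃` is the ratio of the remaining weights at `T` and at `0`, which is `exp(-∫₀ᵀ v*)`. -/
lemma Market.Standing.log_one_sub_kappaTilde (hm : m.Standing T) (hT : 0 ≤ T) (hγ : γ < 1) :
    Real.log (1 - kappaTilde m T γ) = -∫ t in (0 : ℝ)..T, vStar m T γ t := by
  have hG0 : 0 < remainingWeight m T γ 0 := remainingWeight_pos m γ hT
  have hE := hm.exp_integral_vStar γ (t := T) ⟨hT, le_rfl⟩
  rw [remainingWeight_self] at hE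
  have h1 : 1 - kappaTilde m T γ = Real.exp (-∫ t in (0 : ℝ)..T, vStar m T γ t) := by
    rw [kappaTilde, qNorm_gTilde_rpow_add m T hT hγ, Real.exp_neg, one_sub_div hG0.ne',
      ← qNorm_gTilde_rpow_add m T hT hγ, add_sub_cancel_left, qNorm_gTilde_rpow_add m T hT hγ, ← hE]
    have := (gTilde_rpow_pos m γ T).ne'
    have := (Real.exp_pos (∫ t in (0 : ℝ)..T, vStar m T γ t)).ne'
    field_simp
  rw [h1, Real.log_exp]

lemma Market.Standing.integral_vStar_pos (hm : m.Standing T) (hT : 0 < T) (γ : ℝ) :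
    0 < ∫ t in (0 : ℝ)..T, vStar m T γ t := by
  refine intervalIntegral.intervalIntegral_pos_of_pos_on
    (intervalIntegrable_of_integrableOn_Icc (hm.integrableOn_vStar γ) ⟨le_rfl, hT.le⟩
      ⟨hT.le, le_rfl⟩) (fun t ht => ?_) hT
  exact div_pos (gTilde_rpow_pos m γ t) (remainingWeight_pos m γ ht.2.le)

lemma Market.Standing.integral_mono_upper {f : ℝ → ℝ} (hf : IntegrableOn f (Icc 0 T))
    (hf0 : ∀ t ∈ Icc 0 T, 0 ≤ f t) {t : ℝ} (ht : t ∈ Icc 0 T) :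
    ∫ u in (0 : ℝ)..t, f u ≤ ∫ u in (0 : ℝ)..T, f u := by
  have hT : 0 ≤ T := ht.1.trans ht.2
  have hadd := intervalIntegral.integral_add_adjacent_intervals
    (intervalIntegrable_of_integrableOn_Icc hf ⟨le_rfl, hT⟩ ht)
    (intervalIntegrable_of_integrableOn_Icc hf ht ⟨hT, le_rfl⟩)
  have : 0 ≤ ∫ u in t..T, f u :=
    intervalIntegral.integral_nonneg ht.2 fun u hu => hf0 u ⟨ht.1.trans hu.1, hu.2⟩
  linarith

/-- Strict negativity comes from consumption, whose rate `v*` is positive on the interior. It forces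
`ζ > 0`, so the quotient in the risk constraint can be cleared. -/
lemma lStar_neg (hm : m.Standing T) (hT : 0 < T) (hγ : γ < 1) : lStar m T α γ < 0 := by
  have hq := qexp_pos hγ
  have hV := hm.integral_vStar_pos hT γ
  have h1 : 0 ≤ qexp γ * m.θnorm T * |normalQuantile α| := by
    have : 0 ≤ m.θnorm T := Real.sqrt_nonneg _
    positivity
  unfold lStar
  rw [hm.log_one_sub_kappaTilde hT.le hγ]
  split_ifs with h
  · linarith
  · have h2 : 2 ≤ qexp γ := by
      rw [qexp, le_div_iff₀ (by linarith)]
      linarith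
    have h3 : 0 ≤ qexp γ * (qexp γ - 2) / 2 * m.θnorm T ^ 2 := by
      have := mul_nonneg hq.le (sub_nonneg.2 h2)
      positivity
    linarith

/-- Worst case over `t`. Both `∫₀ᵗ v*` and `‖θ‖_t` increase, and `z_α ≤ 0`, so these terms are worst
at `T`. The correction `-q(q-2)/2 ‖θ‖_t²` helps when `q ≤ 2`, that is `γ ≤ 1/2`, and is dropped; for
`q ≥ 2` it too is worst at `T`. -/
lemma Market.Standing.lStar_sub_le (hm : m.Standing T) (hγ : γ < 1) (hα : 0 < α)
    (hα' : α ≤ 1 / 2) {t : ℝ} (ht : t ∈ Icc 0 T) :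
    lStar m T α γ + (∫ u in (0 : ℝ)..t, vStar m T γ u) +
      qexp γ * (qexp γ - 2) / 2 * (∫ u in (0 : ℝ)..t, ‖m.θ u‖ ^ 2) ≤
      √(qexp γ ^ 2 * ∫ u in (0 : ℝ)..t, ‖m.θ u‖ ^ 2) * normalQuantile α := by
  have hT : 0 ≤ T := ht.1.trans ht.2
  have hq := qexp_pos hγ
  have hz := normalQuantile_nonpos hα hα'
  have hV : ∫ u in (0 : ℝ)..t, vStar m T γ u ≤ ∫ u in (0 : ℝ)..T, vStar m T γ u :=
    integral_mono_upper (hm.integrableOn_vStar γ) (fun u hu => vStar_nonneg m γ hu.2) ht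
  have hν : ∫ u in (0 : ℝ)..t, ‖m.θ u‖ ^ 2 ≤ ∫ u in (0 : ℝ)..T, ‖m.θ u‖ ^ 2 :=
    integral_mono_upper hm.integrableOn_θ_sq (fun u _ => by positivity) ht
  have hν0 : 0 ≤ ∫ u in (0 : ℝ)..t, ‖m.θ u‖ ^ 2 :=
    intervalIntegral.integral_nonneg ht.1 fun _ _ => by positivity
  have hs : √(qexp γ ^ 2 * ∫ u in (0 : ℝ)..t, ‖m.θ u‖ ^ 2) ≤ qexp γ * m.θnorm T := by
    rw [Real.sqrt_mul (sq_nonneg _), Real.sqrt_sq hq.le]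
    exact mul_le_mul_of_nonneg_left (Real.sqrt_le_sqrt hν) hq.le
  have h1 : qexp γ * m.θnorm T * normalQuantile α ≤
      √(qexp γ ^ 2 * ∫ u in (0 : ℝ)..t, ‖m.θ u‖ ^ 2) * normalQuantile α :=
    mul_le_mul_of_nonpos_right hs hz
  refine le_trans ?_ h1
  unfold lStar
  rw [hm.log_one_sub_kappaTilde hT hγ, abs_of_nonpos hz]
  split_ifs with h
  · have h2 : qexp γ ≤ 2 := by
      rw [qexp, div_le_iff₀ (by linarith)]
      linarith
    have h3 : qexp γ * (qexp γ - 2) / 2 * (∫ u in (0 : ℝ)..t, ‖m.θ u‖ ^ 2) ≤ 0 := by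
      refine mul_nonpos_of_nonpos_of_nonneg ?_ hν0
      have := mul_nonneg hq.le (sub_nonneg.2 h2)
      linarith
    linarith
  · have h2 : 2 ≤ qexp γ := by
      rw [qexp, le_div_iff₀ (by linarith)]
      linarith
    have h3 : qexp γ * (qexp γ - 2) / 2 * (∫ u in (0 : ℝ)..t, ‖m.θ u‖ ^ 2) ≤
        qexp γ * (qexp γ - 2) / 2 * m.θnorm T ^ 2 := by
      rw [m.θnorm_sq hT]
      refine mul_le_mul_of_nonneg_left hν ?_
      have := mul_nonneg hq.le (sub_nonneg.2 h2)
      positivity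
    linarith

lemma le_quantile_wealthStar (hx : 0 < x) (hγ : γ < 1) (hα : 0 < α) (hα' : α ≤ 1 / 2)
    (hF : ∀ t, F t ≤ mΩ) (hm : m.Standing T)
    (hM : IsWiener F P T B (fun t => -yStar m γ t) M) {t : ℝ} (ht : t ∈ Icc 0 T) :
    x * Real.exp (m.R t) * Real.exp (lStar m T α γ) ≤
      quantile P (wealthStar m T γ M x t) α := by
  have hXm : Measurable (wealthStar m T γ M x t) := (measurable_expWealth hM ht).mono (hF t) le_rfl
  set ν := ∫ u in (0 : ℝ)..t, ‖m.θ u‖ ^ 2 with hν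
  have hν0 : 0 ≤ ν := intervalIntegral.integral_nonneg ht.1 fun _ _ => by positivity
  have hgauss := hM.incr_smul le_rfl ht.1 ht.2 (-1)
  rw [integral_norm_neg_yStar_sq, neg_one_sq, one_mul] at hgauss
  -- Nonemptiness matters: the infimum of the empty set would be `0`.
  refine le_csInf ?_ fun l hl => ?_
  · have h1 : Tendsto (fun l : ℝ => (P.map (wealthStar m T γ M x t)) (Iic l)) atTop (𝓝 1) := by
      have : IsProbabilityMeasure (P.map (wealthStar m T γ M x t)) :=
        Measure.isProbabilityMeasure_map hXm.aemeasurable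
      have h2 := tendsto_measure_Iic_atTop (P.map (wealthStar m T γ M x t))
      rwa [measure_univ] at h2
    have hα1 : ENNReal.ofReal α < 1 := by
      rw [← ENNReal.ofReal_one, ENNReal.ofReal_lt_ofReal_iff one_pos]
      linarith
    obtain ⟨l, hl, hl0⟩ := ((h1.eventually_const_lt hα1).and (eventually_ge_atTop 0)).exists
    refine ⟨l, hl0, ?_⟩
    rw [Measure.map_apply hXm measurableSet_Iic] at hl
    exact (ENNReal.ofReal_le_iff_le_toReal (measure_ne_top _ _)).1 hl.le
  · by_contra hlt
    rw [not_le] at hlt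
    obtain ⟨hl0, hlα⟩ := hl
    rcases hl0.eq_or_lt with rfl | hl0
    · have : {ω | wealthStar m T γ M x t ω ≤ 0} = ∅ := by
        ext ω
        simp only [Set.mem_ofPred_eq, mem_empty_iff_false, iff_false, not_le]
        exact expWealth_pos hx t ω
      rw [this, measureReal_empty] at hlα
      linarith
    -- `A` is the mean of `log (X*_t / x)`, whose fluctuation `-M t` is centred Gaussian with
    -- variance `q² ν`. The case `l = 0` was treated apart because of the logarithm.
    · set A := m.R t + qexp γ * ν - (∫ u in (0 : ℝ)..t, vStar m T γ u) - qexp γ ^ 2 * ν / 2 with hA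
      have hset : {ω | wealthStar m T γ M x t ω ≤ l} =
          (fun ω => -1 * (M t ω - M 0 ω)) ⁻¹' Iic (Real.log (l / x) - A) := by
        ext ω
        simp only [Set.mem_ofPred_eq, mem_preimage, mem_Iic]
        rw [hm.wealthStar_eq_exp ht, ← le_div_iff₀' hx, ← Real.le_log_iff_exp_le (div_pos hl0 hx),
          hM.zero]
        constructor <;> intro h <;> linarith
      have hlog : Real.log (l / x) < m.R t + lStar m T α γ := by
        rw [Real.log_lt_iff_lt_exp (div_pos hl0 hx), div_lt_iff₀ hx, Real.exp_add]
        linarith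
      have hc : Real.log (l / x) - A < √(qexp γ ^ 2 * ν) * normalQuantile α := by
        refine lt_of_lt_of_le ?_ (hm.lStar_sub_le hγ hα hα' ht)
        rw [← hν, hA]
        linarith
      have h3 := gaussianReal_Iic_lt hα (mul_nonneg (sq_nonneg _) hν0) hc
      rw [hset, ← map_measureReal_apply (hgauss.measurable hF) measurableSet_Iic,
        hgauss.law] at hlα
      exact absurd hlα (not_le.2 h3)

theorem vaRBounded_wealthStar (hT : 0 < T) (hx : 0 < x) (hγ : γ < 1) (hα : 0 < α)
    (hα' : α ≤ 1 / 2) (hF : ∀ t, F t ≤ mΩ) (hm : m.Standing T)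
    (hM : IsWiener F P T B (fun t => -yStar m γ t) M)
    (hζ : 1 - Real.exp (lStar m T α γ) ≤ ζ) {s : Strategy Ω d}
    (hs : s.X = wealthStar m T γ M x) : VaRBounded m P T x α ζ s := by
  intro t ht
  have hl : Real.exp (lStar m T α γ) < 1 := Real.exp_lt_one_iff.2 (lStar_neg hm hT hγ)
  have hζ0 : 0 < ζ := by linarith
  have hq := le_quantile_wealthStar hx hγ hα hα' hF hm hM ht
  have hxR : 0 < x * Real.exp (m.R t) := mul_pos hx (Real.exp_pos _)
  rw [div_le_one (by positivity), VaR, hs]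
  -- The quantile is at least `x e^{R_t} e^{l_*}`, hence at least `(1 - ζ) x e^{R_t}`.
  nlinarith

end ValueAtRisk

/-! ### Admissibility of the candidate and the dual bound on both control classes -/

section Strategies

variable {m : Market d} {W : Fin d → ℝ≥0 → Ω → ℝ} {P : Measure Ω} [IsProbabilityMeasure P]
  {T x γ α : ℝ} {M : ℝ → Ω → ℝ}

lemma transpose_mulVec_piStar (m : Market d) (γ : ℝ) {t : ℝ} (ht : IsUnit (m.σ t).det) :
    (m.σ t)ᵀ *ᵥ piStar m γ t = (yStar m γ t).ofLp := by
  have h1 : IsUnit (m.σ t)ᵀ.det := by rwa [Matrix.det_transpose]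
  rw [piStar, Matrix.mul_inv_rev, Matrix.mulVec_smul, Matrix.mulVec_mulVec, ← Matrix.mul_assoc,
    Matrix.mul_nonsing_inv _ h1, Matrix.one_mul]
  rfl

lemma isProgressiveOn_yStar (hm : m.Standing T) (F : ℝ → MeasurableSpace Ω) :
    IsProgressiveOn F T (fun t (_ : Ω) => yStar m γ t) := by
  intro t ht
  have h1 : Measurable fun s : Icc (0 : ℝ) t => yStar m γ s :=
    (hm.measurable_θ.comp (measurable_inclusion (Icc_subset_Icc_right ht.2))).const_smul (qexp γ)
  exact h1.comp (@measurable_fst _ _ _ (F t))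

lemma isProgressiveOn_consumption (hm : m.Standing T) {F : ℝ → MeasurableSpace Ω}
    (hmono : Monotone F) {B : ℝ → Ω → EuclideanSpace ℝ (Fin d)}
    (hM : IsWiener F P T B (fun t => -yStar m γ t) M) :
    IsProgressiveOn F T (fun t ω => vStar m T γ t * wealthStar m T γ M x t ω) := by
  intro t ht
  have hsub : Icc 0 t ⊆ Icc 0 T := Icc_subset_Icc_right ht.2
  refine measurable_uncurry_of_continuousOn hmono
    (X := fun t ω => vStar m T γ t * wealthStar m T γ M x t ω)
    (fun s hs => (measurable_expWealth hM (hsub hs)).const_mul _) fun ω => ?_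
  exact ((hm.continuousOn_vStar γ).mul (continuousOn_expWealth hm (hm.memLp_yStar γ)
    (hm.integrableOn_vStar γ) hM ω)).mono hsub

lemma cost_le_of_mem_classV (hW : IsBrownianMotion W P) (hT : 0 < T) (hx : 0 < x)
    (hm : m.Standing T) (hγ : 0 < γ) (hγ' : γ < 1) {s : Strategy Ω d}
    (hs : s ∈ classV m W P T x)
    (hM : IsWiener (brownianFiltration W P) P T (vecBM W) m.θ M) :
    cost P T γ γ s ≤ ENNReal.ofReal (x ^ γ * remainingWeight m T γ 0 ^ (1 - γ)) := by
  obtain ⟨-, hc, hc0, hX, -⟩ := hs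
  exact cost_le hW hT hx hm hγ hγ' s hX hc0 hM (fun t ht => hc.measurable ht)
    (hc.aemeasurable hW.brownianFiltration_le hT.le)

/-- The dual bound is applied directly rather than through `classV`: `y` and `v` are only a.e.
measurable, so progressive measurability is not at hand. Adaptedness at each time and joint a.e.
measurability of the consumption suffice. -/
lemma cost_le_of_mem_classU (hW : IsBrownianMotion W P) (hT : 0 < T) (hx : 0 < x)
    (hm : m.Standing T) (hγ : 0 < γ) (hγ' : γ < 1) {s : Strategy Ω d}
    (hs : s ∈ classU m W P T x)
    (hM : IsWiener (brownianFiltration W P) P T (vecBM W) m.θ M) :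
    cost P T γ γ s ≤ ENNReal.ofReal (x ^ γ * remainingWeight m T γ 0 ^ (1 - γ)) := by
  obtain ⟨y, v, -, hv0, hv, -, hc, hX⟩ := hs
  refine cost_le hW hT hx hm hγ hγ' s hX ?_ hM (fun t ht => ?_) ?_
  · filter_upwards [hX.pos] with ω h t ht
    rw [hc]
    exact mul_nonneg (hv0 t ht) (h t ht).le
  · rw [hc]
    exact (hX.adapted t ht).const_mul _
  · rw [hc]
    exact hv.1.aemeasurable.comp_fst.mul (aemeasurable_prod_of_continuousOn hT.le
      (fun t ht => (hX.adapted t ht).mono (hW.brownianFiltration_le t) le_rfl) hX.cont)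

lemma IsBrownianMotion.exists_isWiener (hW : IsBrownianMotion W P) (hT : 0 < T)
    {ψ : ℝ → EuclideanSpace ℝ (Fin d)} (hψ : MemLp ψ 2 (volume.restrict (Icc 0 T))) :
    ∃ M, IsWiener (brownianFiltration W P) P T (vecBM W) ψ M :=
  VaRConsumption.exists_isWiener hT hW.brownianFiltration_le brownianFiltration_mono
    (fun _ hA h0 t => measurableSet_brownianFiltration_of_full hA h0 t) (hW.isLevy T)
    (hW.ae_continuous.mono fun _ hω => hω.continuousOn) hψ

end Strategies

end VaRConsumption

end

/-! ### Optimality of the candidate in both problems -/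

theorem theorem3p9 {Ω : Type*} [MeasurableSpace Ω] (P : Measure Ω) [IsProbabilityMeasure P]
    {d : ℕ} (W : Fin d → ℝ≥0 → Ω → ℝ) (hW : VaRConsumption.IsBrownianMotion W P)
    (m : VaRConsumption.Market d) (T x α γ ζ : ℝ) (hT : 0 < T) (hx : 0 < x)
    (hm : m.Standing T) (hα : 0 < α) (hα' : α ≤ 1 / 2) (hγ : 0 < γ) (hγ' : γ < 1)
    (hr : ∀ t ∈ Icc 0 T, 0 ≤ m.r t)
    (hζ : 1 - Real.exp (VaRConsumption.lStar m T α γ) ≤ ζ) (hζ' : ζ < 1) :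
    -- the portfolio process `π*` corresponds to the control `y*`
    (∀ᵐ t ∂volume.restrict (Icc 0 T),
      (m.σ t)ᵀ *ᵥ VaRConsumption.piStar m γ t = (VaRConsumption.yStar m γ t).ofLp) ∧
    ∃ s : VaRConsumption.Strategy Ω d,
      -- `s` is the strategy `(y*, v* X*)` with its wealth process `X*`
      s.y = (fun t _ => VaRConsumption.yStar m γ t) ∧
      s.c = (fun t ω => VaRConsumption.vStar m T γ t * s.X t ω) ∧
      s ∈ VaRConsumption.classU m W P T x ∧
      -- it solves the problem over `𝒰` under the Value-at-Risk constraint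
      VaRConsumption.VaRBounded m P T x α ζ s ∧
      IsMaxOn (VaRConsumption.cost P T γ γ)
        {s' ∈ VaRConsumption.classU m W P T x | VaRConsumption.VaRBounded m P T x α ζ s'} s ∧
      -- it solves the unconstrained problem over `𝒱`
      s ∈ VaRConsumption.classV m W P T x ∧
      IsMaxOn (VaRConsumption.cost P T γ γ) (VaRConsumption.classV m W P T x) s ∧
      -- the common optimal value
      VaRConsumption.cost P T γ γ s = ENNReal.ofReal (x ^ γ *
        (VaRConsumption.qNorm (VaRConsumption.qexp γ) T (VaRConsumption.gTilde m γ) ^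
            VaRConsumption.qexp γ +
          VaRConsumption.gTilde m γ T ^ VaRConsumption.qexp γ) ^ (1 / VaRConsumption.qexp γ)) := by
  refine ⟨hm.nonsing.mono fun t ht => VaRConsumption.transpose_mulVec_piStar m γ ht, ?_⟩
  have hy := hm.memLp_yStar γ
  have hv := hm.integrableOn_vStar γ
  have hF := hW.brownianFiltration_le
  have hmono := VaRConsumption.brownianFiltration_mono (W := W) (P := P)
  -- Two Wiener integrals: that of `θ` drives the state price density in the upper bound, and that
  -- of `-y*` drives the candidate wealth.
  obtain ⟨N, hN⟩ := hW.exists_isWiener hT hm.θ_sq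
  obtain ⟨M, hM⟩ := hW.exists_isWiener hT hy.neg
  have hX := VaRConsumption.isWealth_expWealth hW hT hx hm hy hv hM
  have hcost := VaRConsumption.cost_wealthStar hT hx hγ' hF hm hM
  refine ⟨⟨fun t _ => VaRConsumption.yStar m γ t,
    fun t ω => VaRConsumption.vStar m T γ t * VaRConsumption.wealthStar m T γ M x t ω,
    VaRConsumption.wealthStar m T γ M x⟩, rfl, rfl,
    ⟨_, _, hy, fun t ht => VaRConsumption.vStar_nonneg m γ ht.2, hv, rfl, rfl, hX⟩,
    VaRConsumption.vaRBounded_wealthStar hT hx hγ' hα hα' hF hm hM hζ rfl, fun s hs => ?_,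
    ⟨VaRConsumption.isProgressiveOn_yStar hm _,
      VaRConsumption.isProgressiveOn_consumption hm hmono hM,
      ae_of_all _ fun ω t ht => mul_nonneg (VaRConsumption.vStar_nonneg m γ ht.2)
        (VaRConsumption.expWealth_pos hx t ω).le, hX,
      fun X' hX' => hX.ae_eq hW hT.le hm hy hX'⟩, fun s hs => ?_, ?_⟩
  -- The bound holds on all of `classU`; a competitor's risk constraint gives it no advantage, so
  -- only membership in the class is passed on.
  · exact (VaRConsumption.cost_le_of_mem_classU hW hT hx hm hγ hγ' hs.1 hN).trans hcost.ge
  · exact (VaRConsumption.cost_le_of_mem_classV hW hT hx hm hγ hγ' hs hN).trans hcost.ge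
  · rw [hcost, VaRConsumption.qNorm_gTilde_rpow_add m T hT.le hγ', VaRConsumption.qexp,
      one_div_one_div]
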